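/- **Setting.** Fix an integer $K\ge 2$ and constants $\beta\ge 1$, $\alpha>\beta$, $\kappa_1,\kappa_2>0$. For $b\geq 1$ call $Z\in[K]^n$ $b$-balanced if $\frac{n}{bK}\le |\{i:Z_i=k\}|\le\frac{bn}{K}$ for all $k\in[K]$, and let $S_\alpha$ be the set of $\alpha$-balanced $Z\in[K]^n$. Let $0\le q_n<p_n\le 1$ with $p_n,q_n\to0$ and $p_n\asymp q_n$. The network $A$ on $n$ nodes is drawn from the homogeneous stochastic block model with a $\beta$-balanced true assignment $Z^*$: the edges $A_{ij}$, $i<j$, are independent Bernoulli variables with mean $p_n$ if $Z^*_i=Z^*_j$ and $q_n$ otherwise. Put $I=-2\log\big(\sqrt{p_nq_n}+\sqrt{(1-p_n)(1-q_n)}\big)$, and $\bar n=n/2$ if $K=2$, $\bar n=n/(K\beta)$ if $K\ge3$. Let $\Pi(\cdot\mid A)$ be the posterior distribution of $Z$ for the likelihood $\prod_{i<j}B_{Z_iZ_j}^{A_{ij}}(1-B_{Z_iZ_j})^{1-A_{ij}}$ ($B$ symmetric), the uniform prior of $Z$ on $S_\alpha$, and independent $\mathrm{Beta}(\kappa_1,\kappa_2)$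 priors of $B_{ab}$, $a\le b$. **The chain.** Let $\Gamma(Z)=\{\sigma\circ Z:\sigma\text{ a permutation of }[K]\}$, $\check S_\alpha=\{\Gamma(Z):Z\in S_\alpha\}$, $\check H(\Gamma,\Gamma')=\min_{Z\in\Gamma,Z'\in\Gamma'}|\{i:Z_i\ne Z_i'\}|$, $\ell(Z,Z^*)=\frac1n\check H(\Gamma(Z),\Gamma(Z^*))$ and $\Pi(\Gamma|A)=\sum_{Z\in\Gamma}\Pi(Z|A)$. For an inverse temperature $\xi=\xi_n\ge1$, the single-flip Metropolis–Hastings chain on $\check S_\alpha$ has the transition matrix $\check P$ with $\check P(\Gamma,\Gamma')=\frac1{n(K-1)}\min\{1,[\Pi(\Gamma'|A)/\Pi(\Gamma|A)]^{\xi}\}$ if $\check H(\Gamma,\Gamma')=1$, $\check P(\Gamma,\Gamma')=0$ if $\check H(\Gamma,\Gamma')>1$, and $\check P(\Gamma,\Gamma)=1-\sum_{\Gamma'\ne\Gamma}\check P(\Gamma,\Gamma')$. Its target is $\check\Pi(\Gamma|A)=\sum_{Z\in\Gamma}\Pi(Z|A)^\xi\big/\sum_{Z\in[K]^n}\Pi(Z|A)^\xi$.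 For $Z_0\in S_\alpha$, let $\tau_\varepsilon(Z_0)$ be the $\varepsilon$-mixing time of the lazy chain $(\check P+\mathrm{Id})/2$ started at $\Gamma(Z_0)$: the least $t\in\mathbb N$ such that for all $t'\ge t$ the total variation distance between the law at time $t'$ and $\check\Pi(\cdot|A)$ is at most $\varepsilon$. **Conditions.** Let $\gamma_0=\gamma_0(n)>0$, and suppose that $\limsup_{n\to\infty}\frac{\log n}{\bar nI}=1-\varepsilon_0$ with $\varepsilon_0>0$. Suppose that (a) and (b) hold, or that (c) holds: (a) either $K=2$, $K\beta\gamma_0<1$ for all large $n$, $(1-K\gamma_0)^4nI\to\infty$ and $(1-K\gamma_0)(1-K\beta\gamma_0)n\to\infty$; or $K\ge3$ and $\gamma_0\to0$; (b) either $K=2$ and $\xi>(1-\varepsilon_0)\max\big\{\frac1{2\varepsilon_0},\frac{\alpha^2}{(1-K\gamma_0)^4}\big\}$ for all large $n$; or $K\ge3$ and $\xi>\frac{1-\varepsilon_0}{2\varepsilon_0}$ for all large $n$; (c) $\gamma_0\to0$, and $\xi\ge\frac{1-\varepsilon_0}{2\varepsilon_0}$ for all large $n$. **Theorem (Rapid mixing).**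 For every sufficiently small constant $\tau>0$ there is a constant $C_2>0$, and for every constant $\varepsilon\in(0,1)$ a constant $C_1>0$, such that the following holds for every $n\ge1$, every $\beta$-balanced $Z^*$, and every initial assignment $Z_0$ with values in $S_\alpha$ (which may depend on $A$ and on further randomness): if $\mathbb P\{\ell(Z_0,Z^*)\le\gamma_0\}\ge1-\eta$, then with probability at least $1-C_1n^{-C_2}-\eta$, $$\tau_\varepsilon(Z_0)\le 4Kn^2\max\{\gamma_0,n^{-\tau}\}\cdot\big(\xi\log(\Pi(Z_0|A)^{-1})+\log(\varepsilon^{-1})\big).$$ -/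

import Mathlib

open Filter Topology MeasureTheory

namespace SBM

noncomputable section

/-! ### Label assignments, clusterings, and the loss -/

/-- Label assignments of `n` nodes to `K` communities. -/
abbrev Labels (n K : ℕ) : Type := Fin n → Fin K

/-- All community sizes of `Z` lie in `[n / (b K), b n / K]`. With `b = β` this is the assumption on
the true assignment, with `b = α` it describes the feasible set `S_α`. -/
def IsBalanced {n K : ℕ} (b : ℝ) (Z : Labels n K) : Prop :=
  ∀ k : Fin K,
    (n : ℝ) / (b * K) ≤ ((Finset.univ.filter fun i => Z i = k).card : ℝ) ∧
      ((Finset.univ.filter fun i => Z i = k).card : ℝ) ≤ b * n / K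

/-- The feasible set `S_α`, as a type. -/
abbrev Feasible (n K : ℕ) (α : ℝ) : Type := {Z : Labels n K // IsBalanced α Z}

/-- `Γ(Z)`: all assignments obtained from `Z` by a permutation of the labels. -/
def cluster {n K : ℕ} (Z : Labels n K) : Finset (Labels n K) :=
  Finset.univ.image fun σ : Equiv.Perm (Fin K) => (fun i => σ (Z i) : Labels n K)

/-- Distance of two clusterings: the minimal Hamming distance of representatives. -/
def clusterDist {n K : ℕ} (Γ Γ' : Finset (Labels n K)) : ℕ :=
  sInf {d : ℕ | ∃ Z ∈ Γ, ∃ Z' ∈ Γ', d = hammingDist Z Z'}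

/-- The misclassification proportion `ℓ(Z, Z*)`. -/
def loss {n K : ℕ} (Z Zstar : Labels n K) : ℝ :=
  (clusterDist (cluster Z) (cluster Zstar) : ℝ) / n

/-- The clustering space `{Γ(Z) : Z ∈ S_α}`. -/
abbrev ClusterSpace (n K : ℕ) (α : ℝ) : Type :=
  {Γ : Finset (Labels n K) // ∃ Z : Labels n K, IsBalanced α Z ∧ cluster Z = Γ}

instance (n K : ℕ) (α : ℝ) : Fintype (ClusterSpace n K α) := Fintype.ofFinite _

/-- The clustering of a feasible assignment, as a state of the chain. -/
def Feasible.toCluster {n K : ℕ} {α : ℝ} (Z : Feasible n K α) : ClusterSpace n K α :=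
  ⟨cluster Z.1, Z.1, Z.2, rfl⟩

/-! ### The stochastic block model -/

/-- Likelihood `p(A | Z, B) = ∏_{i<j} B_{Z_i Z_j}^{A_ij} (1 - B_{Z_i Z_j})^{1 - A_ij}` of the network
`A`. The symmetric matrix `B` is a function on unordered pairs of labels. -/
def likelihood {n K : ℕ} (A : SimpleGraph (Fin n)) (Z : Labels n K) (B : Sym2 (Fin K) → ℝ) : ℝ :=
  open Classical in
  ∏ i : Fin n, ∏ j ∈ Finset.Ioi i, if A.Adj i j then B s(Z i, Z j) else 1 - B s(Z i, Z j)

/-- The homogeneous connectivity matrix: `p` on the diagonal, `q` off the diagonal. -/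
def connectivity (K : ℕ) (p q : ℝ) : Sym2 (Fin K) → ℝ :=
  fun e => if e.IsDiag then p else q

/-- Under `μ`, the random network `A` follows the stochastic block model with true assignment
`Zstar` and connectivity probabilities `p` (within) and `q` (between). -/
def IsSample {Ω : Type*} [MeasurableSpace Ω] {n K : ℕ} (μ : Measure Ω) (p q : ℝ)
    (Zstar : Labels n K) (A : Ω → SimpleGraph (Fin n)) : Prop :=
  ∀ G : SimpleGraph (Fin n), MeasurableSet (A ⁻¹' {G}) ∧
    μ (A ⁻¹' {G}) = ENNReal.ofReal (likelihood G Zstar (connectivity K p q))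

/-- `I`, the Rényi divergence of order `1/2` between Bernoulli(`p`) and Bernoulli(`q`). -/
def renyi (p q : ℝ) : ℝ :=
  -2 * Real.log (√(p * q) + √((1 - p) * (1 - q)))

/-- The effective sample size. -/
def effSize (K : ℕ) (β : ℝ) (n : ℕ) : ℝ :=
  if K = 2 then (n : ℝ) / 2 else (n : ℝ) / (K * β)

/-! ### The posterior distribution -/

/-- The prior of the connectivity matrix: independent Beta(`κ₁`, `κ₂`) entries `B_ab`, `a ≤ b`. -/
def prior (K : ℕ) (κ₁ κ₂ : ℝ) : Measure (Sym2 (Fin K) → ℝ) :=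
  Measure.pi fun _ => ProbabilityTheory.betaMeasure κ₁ κ₂

/-- The likelihood of `Z` with the connectivity matrix integrated out. -/
def marginal {n K : ℕ} (κ₁ κ₂ : ℝ) (A : SimpleGraph (Fin n)) (Z : Labels n K) : ℝ :=
  ∫ B, likelihood A Z B ∂(prior K κ₁ κ₂)

/-- The marginal likelihood times the indicator of `S_α`. -/
def weight {n K : ℕ} (α κ₁ κ₂ : ℝ) (A : SimpleGraph (Fin n)) (Z : Labels n K) : ℝ :=
  open Classical in
  if IsBalanced α Z then marginal κ₁ κ₂ A Z else 0

/-- The posterior `Π(Z | A)` for the uniform prior on `S_α`. -/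
def posterior {n K : ℕ} (α κ₁ κ₂ : ℝ) (A : SimpleGraph (Fin n)) (Z : Labels n K) : ℝ :=
  weight α κ₁ κ₂ A Z / ∑ W : Labels n K, weight α κ₁ κ₂ A W

/-- The posterior mass `Π(Γ | A)` of a clustering. -/
def clusterPosterior {n K : ℕ} (α κ₁ κ₂ : ℝ) (A : SimpleGraph (Fin n))
    (Γ : Finset (Labels n K)) : ℝ :=
  ∑ Z ∈ Γ, posterior α κ₁ κ₂ A Z

/-- The tempered posterior, proportional to `Π(Z | A) ^ ξ`. -/
def tempered {n K : ℕ} (α κ₁ κ₂ ξ : ℝ) (A : SimpleGraph (Fin n)) (Z : Labels n K) : ℝ :=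
  posterior α κ₁ κ₂ A Z ^ ξ / ∑ W : Labels n K, posterior α κ₁ κ₂ A W ^ ξ

/-- The target distribution on the clustering space. -/
def target {n K : ℕ} (α κ₁ κ₂ ξ : ℝ) (A : SimpleGraph (Fin n)) (Γ : ClusterSpace n K α) : ℝ :=
  ∑ Z ∈ Γ.1, tempered α κ₁ κ₂ ξ A Z

/-! ### The Metropolis–Hastings chain on the clustering space -/

/-- Probability of moving from `Γ` to a different clustering `Γ'`. -/
def moveProb {n K : ℕ} (α κ₁ κ₂ ξ : ℝ) (A : SimpleGraph (Fin n)) (Γ Γ' : ClusterSpace n K α) : ℝ :=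
  if clusterDist Γ.1 Γ'.1 = 1 then
    1 / (n * ((K : ℝ) - 1)) *
      min 1 ((clusterPosterior α κ₁ κ₂ A Γ'.1 / clusterPosterior α κ₁ κ₂ A Γ.1) ^ ξ)
  else 0

/-- The single-flip Metropolis–Hastings transition matrix. -/
def transition {n K : ℕ} (α κ₁ κ₂ ξ : ℝ) (A : SimpleGraph (Fin n)) :
    Matrix (ClusterSpace n K α) (ClusterSpace n K α) ℝ :=
  Matrix.of fun Γ Γ' =>
    if Γ' = Γ then 1 - ∑ Γ'' ∈ Finset.univ.erase Γ, moveProb α κ₁ κ₂ ξ A Γ Γ''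
    else moveProb α κ₁ κ₂ ξ A Γ Γ'

/-- The lazy version of the chain. -/
def lazyTransition {n K : ℕ} (α κ₁ κ₂ ξ : ℝ) (A : SimpleGraph (Fin n)) :
    Matrix (ClusterSpace n K α) (ClusterSpace n K α) ℝ :=
  (1 / 2 : ℝ) • (transition α κ₁ κ₂ ξ A + 1)

/-- Total variation distance between the law of the lazy chain after `t` steps from `Γ(Z₀)` and the
target distribution. -/
def tvToTarget {n K : ℕ} {α : ℝ} (κ₁ κ₂ ξ : ℝ) (A : SimpleGraph (Fin n)) (Z₀ : Feasible n K α)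
    (t : ℕ) : ℝ :=
  1 / 2 * ∑ Γ : ClusterSpace n K α,
    |(lazyTransition α κ₁ κ₂ ξ A ^ t) Z₀.toCluster Γ - target α κ₁ κ₂ ξ A Γ|

/-- The `ε`-mixing time `min {t : Δ(t') ≤ ε for all t' ≥ t}`, which is `⊤` if there is no such
`t`. -/
def mixingTime {n K : ℕ} {α : ℝ} (κ₁ κ₂ ξ : ℝ) (A : SimpleGraph (Fin n)) (Z₀ : Feasible n K α)
    (ε : ℝ) : ℕ∞ :=
  sInf ((fun t : ℕ => (t : ℕ∞)) '' {t : ℕ | ∀ t' ≥ t, tvToTarget κ₁ κ₂ ξ A Z₀ t' ≤ ε})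

/-! ### The conditions on the signal, the initialization and the inverse temperature -/

/-- `limsup log n / (n̄ I) = 1 - ε₀`, the upper limit being taken in the extended reals. -/
def SignalCondition (K : ℕ) (β : ℝ) (p q : ℕ → ℝ) (ε₀ : ℝ) : Prop :=
  limsup (fun n : ℕ => ((Real.log n / (effSize K β n * renyi (p n) (q n)) : ℝ) : EReal)) atTop
    = ((1 - ε₀ : ℝ) : EReal)

/-- The condition on the initial misclassification proportion. For two communities, the two factors
`1 - K γ₀` and `1 - K β γ₀` are (eventually) positive: the number of misclassified nodes stays below
the minimal community size. -/
def InitCondition (K : ℕ) (β : ℝ) (p q γ₀ : ℕ → ℝ) : Prop :=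
  (K = 2 ∧ (∀ᶠ n in atTop, K * β * γ₀ n < 1) ∧
      Tendsto (fun n : ℕ => (1 - K * γ₀ n) ^ 4 * (n * renyi (p n) (q n))) atTop atTop ∧
      Tendsto (fun n : ℕ => (1 - K * γ₀ n) * (1 - K * β * γ₀ n) * n) atTop atTop) ∨
    (3 ≤ K ∧ Tendsto γ₀ atTop (𝓝 0))

/-- The condition on the inverse temperature that goes with `InitCondition`. -/
def TemperatureCondition (K : ℕ) (α ε₀ : ℝ) (γ₀ ξ : ℕ → ℝ) : Prop :=
  (K = 2 ∧ ∀ᶠ n in atTop,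
      (1 - ε₀) * max (1 / (2 * ε₀)) (α ^ 2 / (1 - K * γ₀ n) ^ 4) < ξ n) ∨
    (3 ≤ K ∧ ∀ᶠ n in atTop, (1 - ε₀) / (2 * ε₀) < ξ n)

/-- The alternative condition on initialization and inverse temperature. -/
def ConsistentInitCondition (ε₀ : ℝ) (γ₀ ξ : ℕ → ℝ) : Prop :=
  Tendsto γ₀ atTop (𝓝 0) ∧ ∀ᶠ n in atTop, (1 - ε₀) / (2 * ε₀) ≤ ξ n

end

end SBM

namespace SBM

/-! ### Reversible chains with a dominating state -/

section Chain

variable {V : Type*} [Fintype V] [DecidableEq V]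

lemma reversible_pow {Q : Matrix V V ℝ} {π : V → ℝ}
    (hrev : ∀ x y, π x * Q x y = π y * Q y x) (t : ℕ) (x y : V) :
    π x * (Q ^ t) x y = π y * (Q ^ t) y x := by
  induction t generalizing x y with
  | zero =>
    by_cases h : x = y
    · subst h; rfl
    · simp [Matrix.one_apply_ne h, Matrix.one_apply_ne (Ne.symm h)]
  | succ t ih =>
    rw [pow_succ, Matrix.mul_apply, ← pow_succ, pow_succ', Matrix.mul_apply, Finset.mul_sum,
      Finset.mul_sum]
    refine Finset.sum_congr rfl fun z _ => ?_
    rw [← mul_assoc, ih x z, ← mul_assoc, ← hrev z y]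
    ring

lemma row_sum_pow {Q : Matrix V V ℝ} (h1 : ∀ x, ∑ y, Q x y = 1) (t : ℕ) (x : V) :
    ∑ y, (Q ^ t) x y = 1 := by
  induction t generalizing x with
  | zero => simp [Matrix.one_apply]
  | succ t ih =>
    simp_rw [pow_succ', Matrix.mul_apply]
    rw [Finset.sum_comm]
    simp_rw [← Finset.mul_sum, ih, mul_one, h1]

lemma pow_nonneg_entry {Q : Matrix V V ℝ} (h0 : ∀ x y, 0 ≤ Q x y) (t : ℕ) (x y : V) :
    0 ≤ (Q ^ t) x y := by
  induction t generalizing x with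
  | zero => rw [pow_zero, Matrix.one_apply]; split_ifs <;> norm_num
  | succ t ih =>
    rw [pow_succ', Matrix.mul_apply]
    exact Finset.sum_nonneg fun z _ => mul_nonneg (h0 x z) (ih z)

/-- If `R` is stochastic, reversible and positive semidefinite in `L²(π)`, then
`Q ^ s * R * Q ^ s` returns to any state with at least its stationary probability. -/
lemma le_diag_pow_mul_mul_pow {Q R : Matrix V V ℝ} {π : V → ℝ} (hπ : ∀ x, 0 < π x)
    (hπ1 : ∑ x, π x = 1)
    (hQ1 : ∀ x, ∑ y, Q x y = 1) (hQ : ∀ x y, π x * Q x y = π y * Q y x)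
    (hR1 : ∀ x, ∑ y, R x y = 1) (hR : ∀ x y, π x * R x y = π y * R y x)
    (hpsd : ∀ g : V → ℝ, 0 ≤ ∑ y, ∑ z, π y * R y z * g y * g z) (s : ℕ) (x : V) :
    π x ≤ (Q ^ s * R * Q ^ s) x x := by
  set f : V → ℝ := fun y => (Q ^ s) y x with hf
  have hrev := reversible_pow hQ s
  have hsumf : ∑ y, π y * f y = π x := by
    simp_rw [hf, ← hrev x, ← Finset.mul_sum, row_sum_pow hQ1, mul_one]
  have hL : ∀ g : V → ℝ, ∑ y, ∑ z, π y * R y z * g y = ∑ y, π y * g y := fun g =>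
    Finset.sum_congr rfl fun y _ => by
      calc ∑ z, π y * R y z * g y = π y * g y * ∑ z, R y z := by
            rw [Finset.mul_sum]; exact Finset.sum_congr rfl fun z _ => by ring
        _ = _ := by rw [hR1, mul_one]
  have hRr : ∀ g : V → ℝ, ∑ y, ∑ z, π y * R y z * g z = ∑ y, π y * g y := fun g => by
    rw [Finset.sum_comm, ← hL g]
    refine Finset.sum_congr rfl fun y _ => Finset.sum_congr rfl fun z _ => ?_
    rw [hR z y]
  -- `π x` is the `π`-mean of `f`. Semidefiniteness at the centred function gives `⟨f, R f⟩ ≥ (π x)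
  -- ^ 2`, and by reversibility `⟨f, R f⟩` is `π x` times the diagonal entry.
  have key := hpsd (fun y => f y - π x)
  have expand : ∑ y, ∑ z, π y * R y z * (f y - π x) * (f z - π x)
      = (∑ y, ∑ z, π y * R y z * f y * f z) - π x * (∑ y, ∑ z, π y * R y z * f y)
        - π x * (∑ y, ∑ z, π y * R y z * f z) + π x ^ 2 * ∑ y, ∑ z, π y * R y z * 1 := by
    simp_rw [Finset.mul_sum, ← Finset.sum_sub_distrib, ← Finset.sum_add_distrib]
    exact Finset.sum_congr rfl fun y _ => Finset.sum_congr rfl fun z _ => by ring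
  rw [expand, hL f, hRr f, hL (fun _ => 1)] at key
  simp only [mul_one, hπ1, hsumf] at key
  have hval : π x * (Q ^ s * R * Q ^ s) x x = ∑ y, ∑ z, π y * R y z * f y * f z := by
    simp_rw [Matrix.mul_apply, Finset.sum_mul, Finset.mul_sum]
    rw [Finset.sum_comm]
    refine Finset.sum_congr rfl fun y _ => Finset.sum_congr rfl fun z _ => ?_
    rw [← mul_assoc, ← mul_assoc, hrev x y]
    ring
  have h2 : π x * π x ≤ π x * (Q ^ s * R * Q ^ s) x x := by rw [hval]; nlinarith
  exact le_of_mul_le_mul_left h2 (hπ x)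

/-- The lazy kernel is positive semidefinite, so its powers have no negative spectrum and the return
probability cannot fall below its limit. Even powers split around the identity, odd powers around
one more lazy step. -/
lemma le_diag_lazy_pow {P : Matrix V V ℝ} {π : V → ℝ} (hP0 : ∀ x y, 0 ≤ P x y)
    (hP1 : ∀ x, ∑ y, P x y = 1) (hπ : ∀ x, 0 < π x) (hπ1 : ∑ x, π x = 1)
    (hrev : ∀ x y, π x * P x y = π y * P y x) (t : ℕ) (x : V) :
    π x ≤ (((1 / 2 : ℝ) • (P + 1)) ^ t) x x := by
  set Q : Matrix V V ℝ := (1 / 2 : ℝ) • (P + 1) with hQdef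
  have hQa : ∀ x y, Q x y = 1 / 2 * (P x y + (1 : Matrix V V ℝ) x y) := fun x y => by
    simp [hQdef]; ring
  have h11 : ∀ x, ∑ y, (1 : Matrix V V ℝ) x y = 1 := fun x => by simp [Matrix.one_apply]
  have h1r : ∀ x y, π x * (1 : Matrix V V ℝ) x y = π y * (1 : Matrix V V ℝ) y x :=
    fun x y => by simpa using reversible_pow hrev 0 x y
  have hQ1 : ∀ x, ∑ y, Q x y = 1 := fun x => by
    simp_rw [hQa, ← Finset.mul_sum, Finset.sum_add_distrib, hP1, h11]; norm_num
  have hQr : ∀ x y, π x * Q x y = π y * Q y x := fun x y => by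
    rw [hQa, hQa]; linear_combination (1 / 2) * hrev x y + (1 / 2) * h1r x y
  have hone : ∀ g : V → ℝ, ∑ y, ∑ z, π y * (1 : Matrix V V ℝ) y z * g y * g z
      = ∑ y, π y * g y ^ 2 := fun g => Finset.sum_congr rfl fun y _ => by
    rw [Finset.sum_eq_single y]
    · simp; ring
    · intro z _ hz; simp [Matrix.one_apply_ne (Ne.symm hz)]
    · simp
  rcases Nat.even_or_odd' t with ⟨s, rfl | rfl⟩
  · have := le_diag_pow_mul_mul_pow hπ hπ1 hQ1 hQr h11 h1r (fun g => by
      rw [hone]; exact Finset.sum_nonneg fun y _ => mul_nonneg (hπ y).le (sq_nonneg _)) s x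
    rwa [Matrix.mul_one, ← pow_add, ← two_mul] at this
  -- The form of `P + 1` is a sum of squares of `g y + g z`: this is where laziness enters.
  · have hsq : ∀ g : V → ℝ, ∑ y, ∑ z, π y * Q y z * g y * g z
        = 1 / 4 * ∑ y, ∑ z, π y * P y z * (g y + g z) ^ 2 := fun g => by
      have e1 : ∑ y, ∑ z, π y * P y z * g y ^ 2 = ∑ y, π y * g y ^ 2 :=
        Finset.sum_congr rfl fun y _ => by
          calc ∑ z, π y * P y z * g y ^ 2 = π y * g y ^ 2 * ∑ z, P y z := by
                rw [Finset.mul_sum]; exact Finset.sum_congr rfl fun z _ => by ring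
            _ = _ := by rw [hP1, mul_one]
      have e2 : ∑ y, ∑ z, π y * P y z * g z ^ 2 = ∑ y, π y * g y ^ 2 := by
        rw [Finset.sum_comm, ← e1]
        exact Finset.sum_congr rfl fun y _ => Finset.sum_congr rfl fun z _ => by rw [hrev z y]
      have e3 : ∑ y, ∑ z, π y * Q y z * g y * g z
          = 1 / 2 * (∑ y, ∑ z, π y * P y z * g y * g z)
            + 1 / 2 * ∑ y, ∑ z, π y * (1 : Matrix V V ℝ) y z * g y * g z := by
        simp_rw [Finset.mul_sum, ← Finset.sum_add_distrib]
        refine Finset.sum_congr rfl fun y _ => Finset.sum_congr rfl fun z _ => ?_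
        rw [hQa]; ring
      have e4 : ∑ y, ∑ z, π y * P y z * (g y + g z) ^ 2
          = (∑ y, ∑ z, π y * P y z * g y ^ 2) + (∑ y, ∑ z, π y * P y z * g z ^ 2)
            + 2 * ∑ y, ∑ z, π y * P y z * g y * g z := by
        simp_rw [Finset.mul_sum, ← Finset.sum_add_distrib]
        exact Finset.sum_congr rfl fun y _ => Finset.sum_congr rfl fun z _ => by ring
      rw [e3, e4, e1, e2, hone]; ring
    have := le_diag_pow_mul_mul_pow hπ hπ1 hQ1 hQr hQ1 hQr (fun g => by
      rw [hsq]
      refine mul_nonneg (by norm_num) (Finset.sum_nonneg fun y _ => Finset.sum_nonneg fun z _ => ?_)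
      exact mul_nonneg (mul_nonneg (hπ y).le (hP0 y z)) (sq_nonneg _)) s x
    have e : Q ^ s * Q * Q ^ s = Q ^ (2 * s + 1) := by
      rw [← pow_succ, ← pow_add]; congr 1; ring
    rwa [e] at this

/-- Mixing of a lazy reversible chain with one dominating state `x₀`, from a drift of the distance
`D` towards `x₀` up to the level `m`. -/
theorem tv_le_of_drift {P : Matrix V V ℝ} {π : V → ℝ} (hP0 : ∀ x y, 0 ≤ P x y)
    (hP1 : ∀ x, ∑ y, P x y = 1) (hπ : ∀ x, 0 < π x) (hπ1 : ∑ x, π x = 1)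
    (hrev : ∀ x y, π x * P x y = π y * P y x) (x₀ : V) (D : V → ℕ) (hD : ∀ x, D x = 0 → x = x₀)
    (m : ℕ) (c : ℝ) (hc1 : c ≤ 1)
    (hdrift : ∀ x, D x ≠ 0 → D x < m → ∑ y, P x y * D y ≤ (1 - c) * D x)
    (hexp : ∀ x, D x ≠ 0 → D x < m → ∑ y, P x y * (2 : ℝ) ^ D y ≤ 2 ^ D x)
    (t : ℕ) (x : V) :
    1 / 2 * ∑ y, |(((1 / 2 : ℝ) • (P + 1)) ^ t) x y - π y|
      ≤ 1 - π x₀ + ((1 - c / 2) ^ t * D x + 2 ^ D x / 2 ^ m) := by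
  set Q : Matrix V V ℝ := (1 / 2 : ℝ) • (P + 1) with hQdef
  have hQa : ∀ x y, Q x y = 1 / 2 * (P x y + (1 : Matrix V V ℝ) x y) := fun x y => by
    simp [hQdef]; ring
  have h10 : ∀ x y, 0 ≤ (1 : Matrix V V ℝ) x y := fun x y => by
    rw [Matrix.one_apply]; split_ifs <;> norm_num
  have hQ0 : ∀ x y, 0 ≤ Q x y := fun x y => by
    rw [hQa]; have := hP0 x y; have := h10 x y; positivity
  have hQ1 : ∀ x, ∑ y, Q x y = 1 := fun x => by
    simp_rw [hQa, ← Finset.mul_sum, Finset.sum_add_distrib, hP1]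
    simp [Matrix.one_apply]; norm_num
  have hQf : ∀ (f : V → ℝ) x, ∑ y, Q x y * f y = 1 / 2 * (∑ y, P x y * f y) + 1 / 2 * f x := by
    intro f x
    simp_rw [hQa, mul_assoc, add_mul, ← Finset.mul_sum, Finset.sum_add_distrib, mul_add]
    simp [Matrix.one_apply]
  have hr0 : 0 ≤ 1 - c / 2 := by linarith
  -- The two terms play the roles of the probability of not having reached `x₀` and of having
  -- climbed to the level `m`.
  set F : ℕ → V → ℝ := fun t x => (1 - c / 2) ^ t * D x + 2 ^ D x / 2 ^ m with hF
  have hF0 : ∀ t x, 0 ≤ F t x := fun t x => by positivity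
  have hπle : ∀ y, π y ≤ 1 := fun y => by
    rw [← hπ1]; exact Finset.single_le_sum (fun z _ => (hπ z).le) (Finset.mem_univ y)
  have hu : ∀ t x, π x₀ ≤ (Q ^ t) x x₀ + F t x := by
    intro t
    induction t with
    | zero =>
      intro x
      by_cases hx : D x = 0
      · rw [hD x hx]
        have := hF0 0 x₀
        simp only [pow_zero, Matrix.one_apply_eq]
        linarith [hπle x₀]
      · have h1 : (1 : ℝ) ≤ D x := by exact_mod_cast Nat.one_le_iff_ne_zero.mpr hx
        have h2 : (0 : ℝ) ≤ 2 ^ D x / 2 ^ m := by positivity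
        have h3 := pow_nonneg_entry hQ0 0 x x₀
        simp only [hF, pow_zero, one_mul] at *
        linarith [hπle x₀]
    | succ t ih =>
      intro x
      have hpos := pow_nonneg_entry hQ0 (t + 1) x x₀
      by_cases hx : D x = 0
      · rw [hD x hx]
        -- At `x₀` no one-step estimate is needed: the return probability already suffices at all
        -- times. Below level `m` the function `F` decreases in one step.
        have := le_diag_lazy_pow hP0 hP1 hπ hπ1 hrev (t + 1) x₀
        rw [← hQdef] at this
        linarith [hF0 (t + 1) x₀]
      · by_cases hm : D x < m
        · have hsum : (Q ^ (t + 1)) x x₀ + ∑ y, Q x y * F t y ≥ π x₀ := by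
            rw [pow_succ', Matrix.mul_apply, ← Finset.sum_add_distrib]
            calc π x₀ = ∑ y, Q x y * π x₀ := by rw [← Finset.sum_mul, hQ1, one_mul]
              _ ≤ _ := Finset.sum_le_sum fun y _ => by
                rw [← mul_add]; exact mul_le_mul_of_nonneg_left (ih y) (hQ0 x y)
          have hFs : ∑ y, Q x y * F t y ≤ F (t + 1) x := by
            have e : ∑ y, Q x y * F t y = (1 - c / 2) ^ t * (∑ y, Q x y * D y)
                + (∑ y, Q x y * 2 ^ D y) / 2 ^ m := by
              rw [Finset.mul_sum, Finset.sum_div, ← Finset.sum_add_distrib]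
              exact Finset.sum_congr rfl fun y _ => by simp only [hF]; ring
            rw [e, hQf, hQf]
            have a1 : 1 / 2 * (∑ y, P x y * D y) + 1 / 2 * (D x : ℝ) ≤ (1 - c / 2) * D x := by
              linarith [hdrift x hx hm]
            have a2 : 1 / 2 * (∑ y, P x y * 2 ^ D y) + 1 / 2 * (2 : ℝ) ^ D x ≤ 2 ^ D x := by
              linarith [hexp x hx hm]
            simp only [hF]
            have a3 := mul_le_mul_of_nonneg_left a1 (pow_nonneg hr0 t)
            rw [pow_succ, mul_assoc]
            gcongr
          linarith
        -- Beyond the level `m` the drift is unknown, but the escape term already exceeds one.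
        · have h2 : (1 : ℝ) ≤ 2 ^ D x / 2 ^ m := by
            rw [le_div_iff₀ (by positivity), one_mul]
            exact pow_le_pow_right₀ (by norm_num) (not_lt.mp hm)
          have h3 : (0 : ℝ) ≤ (1 - c / 2) ^ (t + 1) * D x := by positivity
          simp only [hF]
          linarith [hπle x₀]
  have hrow := row_sum_pow hQ1 t x
  -- The differences sum to zero, so the total variation distance is the sum of the positive parts
  -- of `π - Q ^ t`. At `x₀` this part is at most `F`; elsewhere it is at most `π y`, with total `1
  -- - π x₀`.
  have habs : ∀ y, |(Q ^ t) x y - π y| = ((Q ^ t) x y - π y) + 2 * max (π y - (Q ^ t) x y) 0 := by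
    intro y
    rcases le_total (π y) ((Q ^ t) x y) with h | h
    · rw [abs_of_nonneg (by linarith), max_eq_right (by linarith)]; ring
    · rw [abs_of_nonpos (by linarith), max_eq_left (by linarith)]; ring
  have htv : 1 / 2 * ∑ y, |(Q ^ t) x y - π y| = ∑ y, max (π y - (Q ^ t) x y) 0 := by
    simp_rw [habs]
    rw [Finset.sum_add_distrib, Finset.sum_sub_distrib, hrow, hπ1, ← Finset.mul_sum]; ring
  rw [htv, ← Finset.add_sum_erase _ _ (Finset.mem_univ x₀)]
  have hA : max (π x₀ - (Q ^ t) x x₀) 0 ≤ F t x :=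
    max_le (by linarith [hu t x]) (hF0 t x)
  have hB : ∑ y ∈ Finset.univ.erase x₀, max (π y - (Q ^ t) x y) 0 ≤ 1 - π x₀ := by
    calc _ ≤ ∑ y ∈ Finset.univ.erase x₀, π y := Finset.sum_le_sum fun y _ =>
          max_le (by linarith [pow_nonneg_entry hQ0 t x y]) (hπ y).le
      _ = 1 - π x₀ := by
        rw [← hπ1, ← Finset.add_sum_erase _ _ (Finset.mem_univ x₀)]; ring
  linarith

end Chain

end SBM

namespace SBM

noncomputable section

/-! ### The marginal likelihood as a product over blocks -/

/-- The integral of `x ^ a * (1 - x) ^ b` against the Beta prior of one block. -/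
def blockWeight (κ₁ κ₂ : ℝ) (a b : ℕ) : ℝ :=
  ProbabilityTheory.beta (κ₁ + a) (κ₂ + b) / ProbabilityTheory.beta κ₁ κ₂

lemma blockWeight_pos {κ₁ κ₂ : ℝ} (h₁ : 0 < κ₁) (h₂ : 0 < κ₂) (a b : ℕ) :
    0 < blockWeight κ₁ κ₂ a b :=
  div_pos (ProbabilityTheory.beta_pos (by positivity) (by positivity))
    (ProbabilityTheory.beta_pos h₁ h₂)

lemma integral_betaPDFReal {κ₁ κ₂ : ℝ} (h₁ : 0 < κ₁) (h₂ : 0 < κ₂) :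
    ∫ x, ProbabilityTheory.betaPDFReal κ₁ κ₂ x = 1 := by
  rw [integral_eq_lintegral_of_nonneg_ae]
  · have := ProbabilityTheory.lintegral_betaPDF_eq_one h₁ h₂
    simp only [ProbabilityTheory.betaPDF] at this
    rw [this]; rfl
  · refine Eventually.of_forall fun x => ?_
    by_cases hx : 0 < x ∧ x < 1
    · exact (ProbabilityTheory.betaPDFReal_pos hx.1 hx.2 h₁ h₂).le
    · simp [ProbabilityTheory.betaPDFReal, hx]
  · exact (ProbabilityTheory.measurable_betaPDFReal κ₁ κ₂).aestronglyMeasurable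

lemma betaPDFReal_nonneg {κ₁ κ₂ : ℝ} (h₁ : 0 < κ₁) (h₂ : 0 < κ₂) (x : ℝ) :
    0 ≤ ProbabilityTheory.betaPDFReal κ₁ κ₂ x := by
  by_cases hx : 0 < x ∧ x < 1
  · exact (ProbabilityTheory.betaPDFReal_pos hx.1 hx.2 h₁ h₂).le
  · simp [ProbabilityTheory.betaPDFReal, hx]

/-- Conjugacy of the Beta prior; the normalising constant that appears is the block weight. -/
lemma pow_mul_betaPDFReal {κ₁ κ₂ : ℝ} (h₁ : 0 < κ₁) (h₂ : 0 < κ₂) (a b : ℕ) (x : ℝ) :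
    ProbabilityTheory.betaPDFReal κ₁ κ₂ x * (x ^ a * (1 - x) ^ b)
      = blockWeight κ₁ κ₂ a b * ProbabilityTheory.betaPDFReal (κ₁ + a) (κ₂ + b) x := by
  unfold ProbabilityTheory.betaPDFReal blockWeight
  split_ifs with hx
  · have e1 : x ^ (κ₁ + a - 1) = x ^ (κ₁ - 1) * x ^ a := by
      rw [← Real.rpow_natCast x a, ← Real.rpow_add hx.1]; congr 1; ring
    have e2 : (1 - x) ^ (κ₂ + b - 1) = (1 - x) ^ (κ₂ - 1) * (1 - x) ^ b := by
      rw [← Real.rpow_natCast (1 - x) b, ← Real.rpow_add (by linarith [hx.2])]; congr 1; ring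
    have p1 := ProbabilityTheory.beta_pos h₁ h₂
    have p2 : 0 < ProbabilityTheory.beta (κ₁ + a) (κ₂ + b) :=
      ProbabilityTheory.beta_pos (by positivity) (by positivity)
    rw [e1, e2]
    field_simp
  · simp

lemma integral_betaMeasure {κ₁ κ₂ : ℝ} (h₁ : 0 < κ₁) (h₂ : 0 < κ₂) (f : ℝ → ℝ) :
    ∫ x, f x ∂(ProbabilityTheory.betaMeasure κ₁ κ₂)
      = ∫ x, ProbabilityTheory.betaPDFReal κ₁ κ₂ x * f x := by
  unfold ProbabilityTheory.betaMeasure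
  rw [integral_withDensity_eq_integral_toReal_smul]
  · refine integral_congr_ae (Eventually.of_forall fun x => ?_)
    simp only [ProbabilityTheory.betaPDF, smul_eq_mul]
    rw [ENNReal.toReal_ofReal (betaPDFReal_nonneg h₁ h₂ x)]
  · exact (ProbabilityTheory.measurable_betaPDFReal κ₁ κ₂).ennreal_ofReal
  · exact Eventually.of_forall fun x => by simp [ProbabilityTheory.betaPDF]

lemma integral_pow_betaMeasure {κ₁ κ₂ : ℝ} (h₁ : 0 < κ₁) (h₂ : 0 < κ₂) (a b : ℕ) :
    ∫ x, x ^ a * (1 - x) ^ b ∂(ProbabilityTheory.betaMeasure κ₁ κ₂) = blockWeight κ₁ κ₂ a b := by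
  rw [integral_betaMeasure h₁ h₂]
  simp_rw [pow_mul_betaPDFReal h₁ h₂]
  rw [integral_const_mul, integral_betaPDFReal (by positivity) (by positivity), mul_one]

/-- A block weight is an average of `x ^ a * (1 - x) ^ b` over a probability density. Used with the
maximum of the block likelihood as `C`. -/
lemma blockWeight_le_of_forall {κ₁ κ₂ : ℝ} (h₁ : 0 < κ₁) (h₂ : 0 < κ₂) (a b : ℕ) (C : ℝ)
    (hC : ∀ x : ℝ, 0 < x → x < 1 → x ^ a * (1 - x) ^ b ≤ C) : blockWeight κ₁ κ₂ a b ≤ C := by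
  have hint : ∀ {c d : ℝ}, 0 < c → 0 < d → Integrable (ProbabilityTheory.betaPDFReal c d) :=
    fun hc hd => by
      by_contra h
      have := integral_betaPDFReal hc hd
      rw [integral_undef h] at this
      exact zero_ne_one this
  calc blockWeight κ₁ κ₂ a b = ∫ x, blockWeight κ₁ κ₂ a b *
        ProbabilityTheory.betaPDFReal (κ₁ + a) (κ₂ + b) x := by
        rw [integral_const_mul, integral_betaPDFReal (by positivity) (by positivity), mul_one]
    _ ≤ ∫ x, C * ProbabilityTheory.betaPDFReal κ₁ κ₂ x := by
        refine integral_mono ((hint (by positivity) (by positivity)).const_mul _)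
          ((hint h₁ h₂).const_mul _) fun x => ?_
        simp only
        rw [← pow_mul_betaPDFReal h₁ h₂, mul_comm C]
        by_cases hx : 0 < x ∧ x < 1
        · exact mul_le_mul_of_nonneg_left (hC x hx.1 hx.2) (betaPDFReal_nonneg h₁ h₂ x)
        · simp [ProbabilityTheory.betaPDFReal, hx]
    _ = C := by rw [integral_const_mul, integral_betaPDFReal h₁ h₂, mul_one]

/-- The functional equation of the Gamma function: the new factor is the predictive probability of
an edge in a Pólya urn. -/
lemma blockWeight_succ_left {κ₁ κ₂ : ℝ} (h₁ : 0 < κ₁) (h₂ : 0 < κ₂) (a b : ℕ) :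
    blockWeight κ₁ κ₂ (a + 1) b
      = blockWeight κ₁ κ₂ a b * ((κ₁ + a) / (κ₁ + κ₂ + a + b)) := by
  unfold blockWeight ProbabilityTheory.beta
  have e1 : κ₁ + ((a + 1 : ℕ) : ℝ) = κ₁ + a + 1 := by push_cast; ring
  have e2 : κ₁ + a + 1 + (κ₂ + b) = κ₁ + κ₂ + a + b + 1 := by ring
  have e3 : κ₁ + a + (κ₂ + b) = κ₁ + κ₂ + a + b := by ring
  have p : ∀ x : ℝ, 0 < x → Real.Gamma x ≠ 0 := fun x hx => (Real.Gamma_pos_of_pos hx).ne'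
  have q1 : 0 < κ₁ + κ₂ + a + b := by positivity
  have q2 : 0 < κ₁ + a := by positivity
  rw [e1, e2, e3, Real.Gamma_add_one q2.ne', Real.Gamma_add_one q1.ne']
  have := p _ q1
  have := p _ (add_pos h₁ h₂)
  have := p _ h₁
  have := p _ h₂
  field_simp

lemma blockWeight_comm (κ₁ κ₂ : ℝ) (a b : ℕ) :
    blockWeight κ₁ κ₂ a b = blockWeight κ₂ κ₁ b a := by
  unfold blockWeight ProbabilityTheory.beta
  rw [add_comm κ₁ κ₂, add_comm (κ₁ + (a : ℝ)), mul_comm (Real.Gamma κ₁),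
    mul_comm (Real.Gamma (κ₁ + a))]

lemma blockWeight_succ_right {κ₁ κ₂ : ℝ} (h₁ : 0 < κ₁) (h₂ : 0 < κ₂) (a b : ℕ) :
    blockWeight κ₁ κ₂ a (b + 1)
      = blockWeight κ₁ κ₂ a b * ((κ₂ + b) / (κ₁ + κ₂ + a + b)) := by
  rw [blockWeight_comm, blockWeight_succ_left h₂ h₁, blockWeight_comm κ₂ κ₁]
  congr 2; ring

lemma blockWeight_zero {κ₁ κ₂ : ℝ} (h₁ : 0 < κ₁) (h₂ : 0 < κ₂) : blockWeight κ₁ κ₂ 0 0 = 1 := by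
  unfold blockWeight
  simpa using div_self (ProbabilityTheory.beta_pos h₁ h₂).ne'

/-- The posterior predictive weight of `d` edges and `m` non-edges, from above and from below. -/
lemma log_blockWeight_add_le {κ₁ κ₂ : ℝ} (h₁ : 0 < κ₁) (h₂ : 0 < κ₂) (a b d m : ℕ) :
    Real.log (blockWeight κ₁ κ₂ (a + d) (b + m)) - Real.log (blockWeight κ₁ κ₂ a b)
      ≤ d * Real.log ((κ₁ + a) / (κ₁ + κ₂ + a + b)) + m * Real.log ((κ₂ + b) / (κ₁ + κ₂ + a + b))
        + ((d : ℝ) ^ 2 / (κ₁ + a) + (m : ℝ) ^ 2 / (κ₂ + b)) := by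
  have hx : 0 < κ₁ + a := by positivity
  have hy : 0 < κ₂ + b := by positivity
  have hs : 0 < κ₁ + κ₂ + a + b := by positivity
  have pos := blockWeight_pos h₁ h₂
  have stepL : ∀ i j : ℕ, i < d → Real.log (blockWeight κ₁ κ₂ (a + (i + 1)) (b + j))
      ≤ Real.log (blockWeight κ₁ κ₂ (a + i) (b + j))
        + (Real.log ((κ₁ + a) / (κ₁ + κ₂ + a + b)) + d / (κ₁ + a)) := by
    intro i j hi
    have hid : (i : ℝ) ≤ d := by exact_mod_cast hi.le
    rw [← add_assoc, blockWeight_succ_left h₁ h₂, Real.log_mul (pos _ _).ne' (by positivity)]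
    -- Observations are added one at a time. The numerator has grown by at most `d` and the growth
    -- of the denominator is dropped, so each step costs at most `log (1 + d / (κ₁ + a))`.
    have e : (κ₁ + ((a + i : ℕ) : ℝ)) / (κ₁ + κ₂ + ((a + i : ℕ) : ℝ) + ((b + j : ℕ) : ℝ))
        ≤ (κ₁ + a) / (κ₁ + κ₂ + a + b) * (1 + d / (κ₁ + a)) := by
      have : (κ₁ + a) / (κ₁ + κ₂ + a + b) * (1 + d / (κ₁ + a))
          = (κ₁ + a + d) / (κ₁ + κ₂ + a + b) := by field_simp
      rw [this]; push_cast
      gcongr ?_ / ?_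
      · linarith
      · have : (0 : ℝ) ≤ i := by positivity
        have : (0 : ℝ) ≤ j := by positivity
        linarith
    have h3 := Real.log_le_log (by positivity) e
    rw [Real.log_mul (by positivity) (by positivity)] at h3
    have h4 : Real.log (1 + d / (κ₁ + a)) ≤ d / (κ₁ + a) := by
      have := Real.log_le_sub_one_of_pos (show 0 < 1 + d / (κ₁ + a) by positivity); linarith
    linarith
  have stepR : ∀ i j : ℕ, j < m → Real.log (blockWeight κ₁ κ₂ (a + i) (b + (j + 1)))
      ≤ Real.log (blockWeight κ₁ κ₂ (a + i) (b + j))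
        + (Real.log ((κ₂ + b) / (κ₁ + κ₂ + a + b)) + m / (κ₂ + b)) := by
    intro i j hj
    have hjm : (j : ℝ) ≤ m := by exact_mod_cast hj.le
    rw [← add_assoc, blockWeight_succ_right h₁ h₂, Real.log_mul (pos _ _).ne' (by positivity)]
    have e : (κ₂ + ((b + j : ℕ) : ℝ)) / (κ₁ + κ₂ + ((a + i : ℕ) : ℝ) + ((b + j : ℕ) : ℝ))
        ≤ (κ₂ + b) / (κ₁ + κ₂ + a + b) * (1 + m / (κ₂ + b)) := by
      have : (κ₂ + b) / (κ₁ + κ₂ + a + b) * (1 + m / (κ₂ + b))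
          = (κ₂ + b + m) / (κ₁ + κ₂ + a + b) := by field_simp
      rw [this]; push_cast
      gcongr ?_ / ?_
      · linarith
      · have : (0 : ℝ) ≤ i := by positivity
        have : (0 : ℝ) ≤ j := by positivity
        linarith
    have h3 := Real.log_le_log (by positivity) e
    rw [Real.log_mul (by positivity) (by positivity)] at h3
    have h4 : Real.log (1 + m / (κ₂ + b)) ≤ m / (κ₂ + b) := by
      have := Real.log_le_sub_one_of_pos (show 0 < 1 + m / (κ₂ + b) by positivity); linarith
    linarith
  have hL : ∀ i : ℕ, i ≤ d → Real.log (blockWeight κ₁ κ₂ (a + i) (b + 0))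
      ≤ Real.log (blockWeight κ₁ κ₂ a b)
        + i * (Real.log ((κ₁ + a) / (κ₁ + κ₂ + a + b)) + d / (κ₁ + a)) := by
    intro i hi
    induction i with
    | zero => simp
    | succ i ih =>
      have := stepL i 0 hi
      have := ih (by omega)
      push_cast; linarith
  have hR : ∀ j : ℕ, j ≤ m → Real.log (blockWeight κ₁ κ₂ (a + d) (b + j))
      ≤ Real.log (blockWeight κ₁ κ₂ (a + d) (b + 0))
        + j * (Real.log ((κ₂ + b) / (κ₁ + κ₂ + a + b)) + m / (κ₂ + b)) := by
    intro j hj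
    induction j with
    | zero => simp
    | succ j ih =>
      have := stepR d j hj
      have := ih (by omega)
      push_cast; linarith
  have r1 := hL d le_rfl
  have r2 := hR m le_rfl
  have e1 : (d : ℝ) ^ 2 / (κ₁ + a) = d * (d / (κ₁ + a)) := by ring
  have e2 : (m : ℝ) ^ 2 / (κ₂ + b) = m * (m / (κ₂ + b)) := by ring
  rw [e1, e2]
  linarith

/-- The opposite one-sided estimate: numerators only grow, and the common denominator grows by at
most `N = d + m`. Each of the `N` steps therefore loses at most `N / (κ₁ + κ₂ + a + b)`. -/
lemma le_log_blockWeight_add {κ₁ κ₂ : ℝ} (h₁ : 0 < κ₁) (h₂ : 0 < κ₂) (a b d m : ℕ) :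
    d * Real.log ((κ₁ + a) / (κ₁ + κ₂ + a + b)) + m * Real.log ((κ₂ + b) / (κ₁ + κ₂ + a + b))
        - ((d : ℝ) + m) ^ 2 / (κ₁ + κ₂ + a + b)
      ≤ Real.log (blockWeight κ₁ κ₂ (a + d) (b + m)) - Real.log (blockWeight κ₁ κ₂ a b) := by
  have hx : 0 < κ₁ + a := by positivity
  have hy : 0 < κ₂ + b := by positivity
  have hs : 0 < κ₁ + κ₂ + a + b := by positivity
  have pos := blockWeight_pos h₁ h₂
  set N : ℝ := (d : ℝ) + m with hN
  have hN0 : 0 ≤ N := by positivity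
  have hlog : Real.log (1 + N / (κ₁ + κ₂ + a + b)) ≤ N / (κ₁ + κ₂ + a + b) := by
    have := Real.log_le_sub_one_of_pos (show 0 < 1 + N / (κ₁ + κ₂ + a + b) by positivity)
    linarith
  have gen : ∀ x x' s' : ℝ, 0 < x → x ≤ x' → 0 < s' → s' ≤ κ₁ + κ₂ + a + b + N →
      Real.log (x / (κ₁ + κ₂ + a + b)) - N / (κ₁ + κ₂ + a + b) ≤ Real.log (x' / s') := by
    intro x x' s' hx hxx hs' hss
    have e : x / (κ₁ + κ₂ + a + b) ≤ x' / s' * (1 + N / (κ₁ + κ₂ + a + b)) := by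
      have : x' / s' * (1 + N / (κ₁ + κ₂ + a + b))
          = x' * ((κ₁ + κ₂ + a + b + N) / s') / (κ₁ + κ₂ + a + b) := by field_simp
      rw [this]
      gcongr
      calc x ≤ x' * 1 := by linarith
        _ ≤ _ := by
          apply mul_le_mul_of_nonneg_left _ (by linarith)
          rwa [le_div_iff₀ hs', one_mul]
    have h3 := Real.log_le_log (by positivity) e
    have hx' : 0 < x' := lt_of_lt_of_le hx hxx
    rw [Real.log_mul (by positivity) (by positivity)] at h3
    linarith
  have hL : ∀ i : ℕ, i ≤ d → Real.log (blockWeight κ₁ κ₂ a b)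
        + i * (Real.log ((κ₁ + a) / (κ₁ + κ₂ + a + b)) - N / (κ₁ + κ₂ + a + b))
      ≤ Real.log (blockWeight κ₁ κ₂ (a + i) (b + 0)) := by
    intro i hi
    induction i with
    | zero => simp
    | succ i ih =>
      have ih := ih (by omega)
      rw [← add_assoc a i 1, blockWeight_succ_left h₁ h₂, Real.log_mul (pos _ _).ne' (by positivity)]
      have hid : (i : ℝ) ≤ d := by exact_mod_cast (by omega : i ≤ d)
      have := gen (κ₁ + a) (κ₁ + ((a + i : ℕ) : ℝ))
        (κ₁ + κ₂ + ((a + i : ℕ) : ℝ) + ((b + 0 : ℕ) : ℝ)) hx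
        (by push_cast; linarith [show (0 : ℝ) ≤ i by positivity]) (by positivity)
        (by push_cast; linarith [show (0 : ℝ) ≤ m by positivity])
      push_cast at *; linarith
  have hR : ∀ j : ℕ, j ≤ m → Real.log (blockWeight κ₁ κ₂ (a + d) (b + 0))
        + j * (Real.log ((κ₂ + b) / (κ₁ + κ₂ + a + b)) - N / (κ₁ + κ₂ + a + b))
      ≤ Real.log (blockWeight κ₁ κ₂ (a + d) (b + j)) := by
    intro j hj
    induction j with
    | zero => simp
    | succ j ih =>
      have ih := ih (by omega)
      rw [← add_assoc b j 1, blockWeight_succ_right h₁ h₂,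
        Real.log_mul (pos _ _).ne' (by positivity)]
      have hid : (j : ℝ) ≤ m := by exact_mod_cast (by omega : j ≤ m)
      have := gen (κ₂ + b) (κ₂ + ((b + j : ℕ) : ℝ))
        (κ₁ + κ₂ + ((a + d : ℕ) : ℝ) + ((b + j : ℕ) : ℝ)) hy
        (by push_cast; linarith [show (0 : ℝ) ≤ j by positivity]) (by positivity)
        (by push_cast; linarith)
      push_cast at *; linarith
  have r1 := hL d le_rfl
  have r2 := hR m le_rfl
  have e1 : N ^ 2 / (κ₁ + κ₂ + a + b)
      = d * (N / (κ₁ + κ₂ + a + b)) + m * (N / (κ₁ + κ₂ + a + b)) := by rw [hN]; ring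
  rw [e1]
  linarith

/-! The marginal weight of a block dominates, up to a polynomial factor, the likelihood of the block
at any parameter. -/

/-- All factors but the initial `κ` dominate those of a factorial one index lower; the factor `a +
1` makes up for the shift, and the minimum with `1` covers the empty product. -/
lemma le_prod_range_add {κ : ℝ} (h : 0 < κ) (a : ℕ) :
    min κ 1 * (a.factorial : ℝ) ≤ (a + 1) * ∏ j ∈ Finset.range a, (κ + j) := by
  rcases a with _ | a
  · simp
  have key : κ * (a.factorial : ℝ) ≤ ∏ j ∈ Finset.range (a + 1), (κ + j) := by
    induction a with
    | zero => simp
    | succ a ih =>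
      rw [Finset.prod_range_succ, Nat.factorial_succ]
      push_cast
      have : κ * ((a + 1) * (a.factorial : ℝ)) ≤ (κ * a.factorial) * (κ + (a + 1)) := by
        have : (0 : ℝ) ≤ κ * a.factorial * κ := by positivity
        nlinarith
      exact this.trans (mul_le_mul_of_nonneg_right ih (by positivity))
  have h2 : min κ 1 * ((a + 1).factorial : ℝ) ≤ (a + 1) * (κ * a.factorial) := by
    rw [Nat.factorial_succ]; push_cast
    have : min κ 1 ≤ κ := min_le_left _ _
    have h3 : (0 : ℝ) ≤ (a + 1) * a.factorial := by positivity
    nlinarith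
  have h4 : (0 : ℝ) ≤ ∏ j ∈ Finset.range (a + 1), (κ + j) :=
    Finset.prod_nonneg fun j _ => by positivity
  push_cast
  nlinarith [mul_le_mul_of_nonneg_left key (show (0 : ℝ) ≤ a + 1 by positivity)]

/-- Bernoulli's inequality shows that the polynomial factor grows fast enough to absorb `(κ + N) /
(N + 1)` at every step. -/
lemma prod_range_add_le {κ : ℝ} (h : 0 < κ) (N : ℕ) :
    ∏ j ∈ Finset.range N, (κ + j) ≤ (N.factorial : ℝ) * (N + 1) ^ ⌈κ⌉₊ := by
  induction N with
  | zero => simp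
  | succ N ih =>
    rw [Finset.prod_range_succ, Nat.factorial_succ]
    push_cast
    have hN : (0 : ℝ) < N + 1 := by positivity
    have hb : κ + N ≤ (N + 1) * (1 + 1 / ((N : ℝ) + 1)) ^ ⌈κ⌉₊ := by
      have h1 := one_add_mul_le_pow (a := 1 / ((N : ℝ) + 1))
        (by have : (0 : ℝ) ≤ 1 / ((N : ℝ) + 1) := by positivity
            linarith) ⌈κ⌉₊
      have h2 := Nat.le_ceil κ
      have h3 : ((N : ℝ) + 1) * (1 + ⌈κ⌉₊ * (1 / ((N : ℝ) + 1))) = N + 1 + ⌈κ⌉₊ := by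
        field_simp
      have h4 := mul_le_mul_of_nonneg_left h1 hN.le
      linarith
    calc (∏ j ∈ Finset.range N, (κ + j)) * (κ + N)
        ≤ ((N.factorial : ℝ) * (N + 1) ^ ⌈κ⌉₊) * ((N + 1) * (1 + 1 / ((N : ℝ) + 1)) ^ ⌈κ⌉₊) := by
          gcongr
      _ = (N + 1) * N.factorial * (((N : ℝ) + 1) * (1 + 1 / ((N : ℝ) + 1))) ^ ⌈κ⌉₊ := by
          rw [mul_pow]; ring
      _ = _ := by congr 2; field_simp

lemma blockWeight_eq_prod {κ₁ κ₂ : ℝ} (h₁ : 0 < κ₁) (h₂ : 0 < κ₂) (a b : ℕ) :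
    blockWeight κ₁ κ₂ a b * ∏ j ∈ Finset.range (a + b), (κ₁ + κ₂ + j)
      = (∏ j ∈ Finset.range a, (κ₁ + j)) * ∏ j ∈ Finset.range b, (κ₂ + j) := by
  induction b with
  | zero =>
    induction a with
    | zero => simp [blockWeight_zero h₁ h₂]
    | succ a ih =>
      simp only [add_zero, Finset.range_zero, Finset.prod_empty, mul_one] at ih ⊢
      rw [blockWeight_succ_left h₁ h₂, Finset.prod_range_succ, Finset.prod_range_succ, ← ih]
      have : κ₁ + κ₂ + a ≠ 0 := by positivity
      push_cast
      simp only [add_zero]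
      field_simp
  | succ b ih =>
    rw [blockWeight_succ_right h₁ h₂, ← add_assoc, Finset.prod_range_succ, Finset.prod_range_succ,
      ← mul_assoc (∏ j ∈ Finset.range a, (κ₁ + j)), ← ih]
    have : κ₁ + κ₂ + a + b ≠ 0 := by positivity
    push_cast
    field_simp
    ring

/-- A binomial probability is at most one, so the left side is controlled by `a! b! / (a + b)!`. The
block weight is the same expression with rising factorials, which differ from factorials by
polynomial factors. -/
lemma pow_mul_pow_le_blockWeight {κ₁ κ₂ : ℝ} (h₁ : 0 < κ₁) (h₂ : 0 < κ₂) (a b : ℕ) {x : ℝ}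
    (hx0 : 0 ≤ x) (hx1 : x ≤ 1) :
    min κ₁ 1 * min κ₂ 1 * (x ^ a * (1 - x) ^ b)
      ≤ blockWeight κ₁ κ₂ a b * ((a : ℝ) + b + 1) ^ (⌈κ₁ + κ₂⌉₊ + 2) := by
  have hbin : (a + b).choose a * (x ^ a * (1 - x) ^ b) ≤ 1 := by
    have hs := add_pow x (1 - x) (a + b)
    rw [add_sub_cancel, one_pow] at hs
    refine le_trans (le_of_eq ?_) (le_trans (Finset.single_le_sum (f := fun m =>
      x ^ m * (1 - x) ^ (a + b - m) * ((a + b).choose m : ℝ)) (fun m _ => by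
        have : 0 ≤ 1 - x := by linarith
        positivity) (Finset.mem_range.mpr (by omega : a < a + b + 1)))
        hs.symm.le)
    rw [Nat.add_sub_cancel_left]; ring
  have hch : ((a + b).choose a : ℝ) * a.factorial * b.factorial = (a + b).factorial := by
    have := Nat.add_choose_mul_factorial_mul_factorial a b
    rw [← Nat.choose_symm_add] at this
    exact_mod_cast this
  have hprod := blockWeight_eq_prod h₁ h₂ a b
  have hA := le_prod_range_add h₁ a
  have hB := le_prod_range_add h₂ b
  have hC := prod_range_add_le (add_pos h₁ h₂) (a + b)
  set A := ∏ j ∈ Finset.range a, (κ₁ + j)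
  set B := ∏ j ∈ Finset.range b, (κ₂ + j)
  have hw := blockWeight_pos h₁ h₂ a b
  have hy : 0 ≤ x ^ a * (1 - x) ^ b := by
    have : 0 ≤ 1 - x := by linarith
    positivity
  have hk1 : 0 < min κ₁ 1 := lt_min h₁ one_pos
  have hk2 : 0 < min κ₂ 1 := lt_min h₂ one_pos
  have hAB : min κ₁ 1 * a.factorial * (min κ₂ 1 * b.factorial) ≤ ((a + 1) * A) * ((b + 1) * B) :=
    mul_le_mul hA hB (by positivity) (le_trans (by positivity) hA)
  set c : ℝ := ((a + b).choose a : ℝ)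
  set y : ℝ := x ^ a * (1 - x) ^ b
  have hfab : (0 : ℝ) < a.factorial * b.factorial := by positivity
  have hw2 : A * B ≤ blockWeight κ₁ κ₂ a b * ((a + b).factorial * ((a : ℝ) + b + 1) ^ ⌈κ₁ + κ₂⌉₊) := by
    rw [← hprod]; gcongr; push_cast at hC; exact hC
  have hchain : min κ₁ 1 * min κ₂ 1 * y * (a.factorial * b.factorial)
      ≤ blockWeight κ₁ κ₂ a b * ((a : ℝ) + b + 1) ^ (⌈κ₁ + κ₂⌉₊ + 2) * (a.factorial * b.factorial) := by
    calc min κ₁ 1 * min κ₂ 1 * y * (a.factorial * b.factorial)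
        = y * (min κ₁ 1 * a.factorial * (min κ₂ 1 * b.factorial)) := by ring
      _ ≤ y * (((a + 1) * A) * ((b + 1) * B)) := mul_le_mul_of_nonneg_left hAB hy
      _ = y * ((a + 1) * (b + 1)) * (A * B) := by ring
      _ ≤ y * ((a + 1) * (b + 1)) *
          (blockWeight κ₁ κ₂ a b * ((a + b).factorial * ((a : ℝ) + b + 1) ^ ⌈κ₁ + κ₂⌉₊)) := by
          gcongr
      _ = (c * y) * (((a + 1) * (b + 1)) *
          (blockWeight κ₁ κ₂ a b * ((a : ℝ) + b + 1) ^ ⌈κ₁ + κ₂⌉₊) * (a.factorial * b.factorial)) := by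
          rw [← hch]; ring
      _ ≤ 1 * (((a + b + 1) * (a + b + 1)) *
          (blockWeight κ₁ κ₂ a b * ((a : ℝ) + b + 1) ^ ⌈κ₁ + κ₂⌉₊) * (a.factorial * b.factorial)) := by
          have ha : (0 : ℝ) ≤ a := by positivity
          have hb : (0 : ℝ) ≤ b := by positivity
          gcongr <;> linarith
      _ = _ := by ring
  exact le_of_mul_le_mul_right hchain hfab

end

end SBM

namespace SBM

noncomputable section

/-! ### Sums over unordered pairs of nodes -/

/-- The pairs `i < j` of nodes. -/
def pairs (n : ℕ) : Finset (Fin n × Fin n) := Finset.univ.filter fun x => x.1 < x.2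

/-- The nodes with label `k`. -/
def labelClass {n K : ℕ} (Z : Labels n K) (k : Fin K) : Finset (Fin n) :=
  Finset.univ.filter fun i => Z i = k

@[simp] lemma mem_labelClass {n K : ℕ} {Z : Labels n K} {k : Fin K} {i : Fin n} :
    i ∈ labelClass Z k ↔ Z i = k := by simp [labelClass]

lemma prod_Ioi_eq_prod_pairs {M : Type*} [CommMonoid M] {n : ℕ} (f : Fin n → Fin n → M) :
    ∏ i, ∏ j ∈ Finset.Ioi i, f i j = ∏ x ∈ pairs n, f x.1 x.2 := by
  rw [pairs, Finset.prod_filter, ← Finset.univ_product_univ, Finset.prod_product]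
  refine Finset.prod_congr rfl fun i _ => ?_
  rw [← Finset.prod_filter]
  refine Finset.prod_congr ?_ fun _ _ => rfl
  ext j; simp

lemma two_mul_sum_pairs {n : ℕ} (f : Fin n → Fin n → ℝ) (hs : ∀ i j, f i j = f j i)
    (h0 : ∀ i, f i i = 0) : 2 * ∑ x ∈ pairs n, f x.1 x.2 = ∑ i, ∑ j, f i j := by
  have h1 : ∀ g : Fin n → Fin n → ℝ, ∑ x ∈ pairs n, g x.1 x.2
      = ∑ i, ∑ j, if i < j then g i j else 0 := fun g => by
    rw [pairs, Finset.sum_filter, ← Finset.univ_product_univ, Finset.sum_product]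
  have h2 : ∑ x ∈ pairs n, f x.1 x.2 = ∑ i, ∑ j, if j < i then f i j else 0 := by
    rw [h1, Finset.sum_comm]
    refine Finset.sum_congr rfl fun i _ => Finset.sum_congr rfl fun j _ => ?_
    rw [hs j i]
  rw [two_mul]
  nth_rewrite 1 [h1]
  rw [h2, ← Finset.sum_add_distrib]
  refine Finset.sum_congr rfl fun i _ => ?_
  rw [← Finset.sum_add_distrib]
  refine Finset.sum_congr rfl fun j _ => ?_
  rcases lt_trichotomy i j with h | h | h
  · simp [h, h.not_gt]
  · subst h; simp [h0]
  · simp [h, h.not_gt]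

/-- `2` on diagonal blocks, which the ordered pairs of nodes cover twice, and `1` elsewhere. -/
def mult {K : ℕ} (a c : Fin K) : ℝ := if a = c then 2 else 1

lemma mult_pos {K : ℕ} (a c : Fin K) : 0 < mult a c := by unfold mult; split_ifs <;> norm_num

lemma mult_le {K : ℕ} (a c : Fin K) : mult a c ≤ 2 := by unfold mult; split_ifs <;> norm_num

lemma one_le_mult {K : ℕ} (a c : Fin K) : 1 ≤ mult a c := by unfold mult; split_ifs <;> norm_num

/-- Turns a sum over one block of unordered pairs into a sum over a rectangle of ordered pairs, the
form in which the noise is controlled. -/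
lemma mult_mul_sum_pairs {n K : ℕ} (Z : Labels n K) (a c : Fin K) (f : Fin n → Fin n → ℝ)
    (hs : ∀ i j, f i j = f j i) (h0 : ∀ i, f i i = 0) :
    mult a c * (∑ x ∈ pairs n, if s(Z x.1, Z x.2) = s(a, c) then f x.1 x.2 else 0)
      = ∑ i ∈ labelClass Z a, ∑ j ∈ labelClass Z c, f i j := by
  have h2 := two_mul_sum_pairs (fun i j => if s(Z i, Z j) = s(a, c) then f i j else 0)
    (fun i j => by simp only [Sym2.eq_swap (a := Z i), hs i j]) (fun i => by simp [h0])
  have hR : ∀ a c : Fin K, ∑ i ∈ labelClass Z a, ∑ j ∈ labelClass Z c, f i j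
      = ∑ i, ∑ j, if Z i = a ∧ Z j = c then f i j else 0 := fun a c => by
    rw [labelClass, Finset.sum_filter]
    refine Finset.sum_congr rfl fun i _ => ?_
    rw [labelClass, Finset.sum_filter]
    split_ifs with h <;> simp [h]
  by_cases hac : a = c
  · subst hac
    rw [mult, if_pos rfl, h2, hR]
    refine Finset.sum_congr rfl fun i _ => Finset.sum_congr rfl fun j _ => ?_
    simp
  · rw [mult, if_neg hac, one_mul]
    have hsw : ∑ i, ∑ j, (if Z i = c ∧ Z j = a then f i j else 0)
        = ∑ i, ∑ j, if Z i = a ∧ Z j = c then f i j else 0 := by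
      rw [Finset.sum_comm]
      refine Finset.sum_congr rfl fun i _ => Finset.sum_congr rfl fun j _ => ?_
      rw [hs j i]; simp only [and_comm]
    have hsum : ∑ i, ∑ j, (if s(Z i, Z j) = s(a, c) then f i j else 0)
        = (∑ i, ∑ j, if Z i = a ∧ Z j = c then f i j else 0)
          + ∑ i, ∑ j, if Z i = c ∧ Z j = a then f i j else 0 := by
      simp_rw [← Finset.sum_add_distrib]
      refine Finset.sum_congr rfl fun i _ => Finset.sum_congr rfl fun j _ => ?_
      by_cases h1 : Z i = a ∧ Z j = c
      · simp [h1, hac]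
      · simp [h1]
    rw [hsum, hsw] at h2
    rw [hR]; linarith

/-! ### Block counts -/

open Classical in
/-- Number of pairs `i < j` in the relation `r`. -/
def pairCount {n : ℕ} (r : Fin n → Fin n → Prop) : ℕ :=
  ((pairs n).filter fun x => r x.1 x.2).card

open Classical in
lemma pairCount_eq_sum {n : ℕ} (r : Fin n → Fin n → Prop) :
    (pairCount r : ℝ) = ∑ x ∈ pairs n, if r x.1 x.2 then 1 else 0 := by
  rw [pairCount, Finset.card_filter]; push_cast; rfl

/-- The edges of `G` in the block `e` of `Z`. -/
def edgeRel {n K : ℕ} (G : SimpleGraph (Fin n)) (Z : Labels n K) (e : Sym2 (Fin K))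
    (i j : Fin n) : Prop := s(Z i, Z j) = e ∧ G.Adj i j

/-- The non-edges of `G` in the block `e` of `Z`. -/
def nonEdgeRel {n K : ℕ} (G : SimpleGraph (Fin n)) (Z : Labels n K) (e : Sym2 (Fin K))
    (i j : Fin n) : Prop := s(Z i, Z j) = e ∧ ¬ G.Adj i j

/-- The restriction of a relation to the nodes different from `v`. -/
def offNode {n : ℕ} (v : Fin n) (r : Fin n → Fin n → Prop) (i j : Fin n) : Prop :=
  i ≠ v ∧ j ≠ v ∧ r i j

lemma likelihood_eq_prod_pairs {n K : ℕ} (G : SimpleGraph (Fin n)) (Z : Labels n K)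
    (B : Sym2 (Fin K) → ℝ) : likelihood G Z B = open Classical in
      ∏ x ∈ pairs n, if G.Adj x.1 x.2 then B s(Z x.1, Z x.2) else 1 - B s(Z x.1, Z x.2) := by
  classical
  unfold likelihood
  rw [← prod_Ioi_eq_prod_pairs (fun i j =>
    if G.Adj i j then B s(Z i, Z j) else 1 - B s(Z i, Z j))]

lemma likelihood_eq_prod_blocks {n K : ℕ} (G : SimpleGraph (Fin n)) (Z : Labels n K)
    (B : Sym2 (Fin K) → ℝ) : likelihood G Z B
      = ∏ e, B e ^ pairCount (edgeRel G Z e) * (1 - B e) ^ pairCount (nonEdgeRel G Z e) := by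
  classical
  rw [likelihood_eq_prod_pairs, ← Finset.prod_fiberwise (pairs n) (fun x => s(Z x.1, Z x.2))]
  refine Finset.prod_congr rfl fun e _ => ?_
  have : ∏ x ∈ pairs n with s(Z x.1, Z x.2) = e,
      (if G.Adj x.1 x.2 then B s(Z x.1, Z x.2) else 1 - B s(Z x.1, Z x.2))
      = ∏ x ∈ pairs n with s(Z x.1, Z x.2) = e, (if G.Adj x.1 x.2 then B e else 1 - B e) :=
    Finset.prod_congr rfl fun x hx => by rw [(Finset.mem_filter.mp hx).2]
  rw [this, Finset.prod_ite, Finset.prod_const, Finset.prod_const, Finset.filter_filter,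
    Finset.filter_filter]
  unfold pairCount edgeRel nonEdgeRel
  congr!

lemma marginal_eq_prod {n K : ℕ} {κ₁ κ₂ : ℝ} (h₁ : 0 < κ₁) (h₂ : 0 < κ₂)
    (G : SimpleGraph (Fin n)) (Z : Labels n K) :
    marginal κ₁ κ₂ G Z = ∏ e, blockWeight κ₁ κ₂ (pairCount (edgeRel G Z e))
      (pairCount (nonEdgeRel G Z e)) := by
  have : IsProbabilityMeasure (ProbabilityTheory.betaMeasure κ₁ κ₂) :=
    ProbabilityTheory.isProbabilityMeasureBeta h₁ h₂
  unfold marginal prior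
  simp_rw [likelihood_eq_prod_blocks]
  rw [integral_fintype_prod_eq_prod (fun e (x : ℝ) => x ^ pairCount (edgeRel G Z e)
    * (1 - x) ^ pairCount (nonEdgeRel G Z e))]
  simp_rw [integral_pow_betaMeasure h₁ h₂]

lemma marginal_pos {n K : ℕ} {κ₁ κ₂ : ℝ} (h₁ : 0 < κ₁) (h₂ : 0 < κ₂)
    (G : SimpleGraph (Fin n)) (Z : Labels n K) : 0 < marginal κ₁ κ₂ G Z := by
  rw [marginal_eq_prod h₁ h₂]
  exact Finset.prod_pos fun e _ => blockWeight_pos h₁ h₂ _ _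

/-- The prior is the same for all blocks, so a permutation of the labels merely permutes the
factors. -/
lemma marginal_relabel {n K : ℕ} {κ₁ κ₂ : ℝ} (h₁ : 0 < κ₁) (h₂ : 0 < κ₂)
    (G : SimpleGraph (Fin n)) (Z : Labels n K) (σ : Equiv.Perm (Fin K)) :
    marginal κ₁ κ₂ G (fun i => σ (Z i)) = marginal κ₁ κ₂ G Z := by
  rw [marginal_eq_prod h₁ h₂, marginal_eq_prod h₁ h₂]
  symm
  have hinj : Function.Injective (Sym2.map σ) := Sym2.map.injective σ.injective
  refine Fintype.prod_bijective (Sym2.map σ) (Finite.injective_iff_bijective.mp hinj) _ _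
    fun e => ?_
  have hrel : ∀ i j, s(σ (Z i), σ (Z j)) = Sym2.map σ e ↔ s(Z i, Z j) = e := fun i j => by
    rw [← Sym2.map_mk, hinj.eq_iff]
  unfold edgeRel nonEdgeRel
  simp_rw [hrel]

open Classical in
/-- Splitting off the pairs that contain the node `v`. -/
lemma pairCount_split {n : ℕ} (r : Fin n → Fin n → Prop) (hs : ∀ i j, r i j ↔ r j i)
    (v : Fin n) :
    pairCount r = pairCount (offNode v r) + (Finset.univ.filter fun j => j ≠ v ∧ r v j).card := by
  have two : ∀ r : Fin n → Fin n → Prop, (∀ i j, r i j ↔ r j i) →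
      2 * (pairCount r : ℝ) = ∑ i, ∑ j, if i ≠ j ∧ r i j then (1 : ℝ) else 0 := by
    intro r hs
    rw [← two_mul_sum_pairs _ (fun i j => by simp only [ne_comm, hs i j]) (fun i => by simp),
      pairCount_eq_sum]
    congr 1
    refine Finset.sum_congr rfl fun x hx => ?_
    have : x.1 ≠ x.2 := ne_of_lt (by simpa [pairs] using hx)
    simp [this]
  have hoff : ∀ i j, offNode v r i j ↔ offNode v r j i := fun i j => by
    unfold offNode; rw [hs i j]; tauto
  have key : 2 * (pairCount r : ℝ) = 2 * (pairCount (offNode v r) : ℝ)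
      + 2 * ((Finset.univ.filter fun j => j ≠ v ∧ r v j).card : ℝ) := by
    rw [two r hs, two _ hoff, Finset.card_filter]
    push_cast
    have e1 : ∑ i, ∑ j, (if i ≠ j ∧ r i j then (1 : ℝ) else 0)
        = ∑ i, ∑ j, ((if i ≠ j ∧ offNode v r i j then (1 : ℝ) else 0)
          + (if i = v then (if j ≠ v ∧ r v j then 1 else 0) else 0)
          + (if j = v then (if i ≠ v ∧ r v i then 1 else 0) else 0)) := by
      refine Finset.sum_congr rfl fun i _ => Finset.sum_congr rfl fun j _ => ?_
      unfold offNode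
      by_cases hi : i = v
      · subst hi
        by_cases hj : j = i
        · subst hj; simp
        · simp [hj, Ne.symm hj]
      · by_cases hj : j = v
        · subst hj; simp [hi, hs i j]
        · simp [hi, hj]
    rw [e1]
    simp_rw [Finset.sum_add_distrib]
    have e2 : ∑ i, ∑ j, (if i = v then (if j ≠ v ∧ r v j then (1 : ℝ) else 0) else 0)
        = ∑ j, if j ≠ v ∧ r v j then (1 : ℝ) else 0 := by
      rw [Finset.sum_comm]; simp
    have e3 : ∑ i, ∑ j, (if j = v then (if i ≠ v ∧ r v i then (1 : ℝ) else 0) else 0)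
        = ∑ j, if j ≠ v ∧ r v j then (1 : ℝ) else 0 := by
      simp
    rw [e2, e3]; ring
  have : (pairCount r : ℝ) = ((pairCount (offNode v r) +
      (Finset.univ.filter fun j => j ≠ v ∧ r v j).card : ℕ) : ℝ) := by push_cast; linarith
  exact_mod_cast this

lemma edgeRel_symm {n K : ℕ} (G : SimpleGraph (Fin n)) (Z : Labels n K) (e : Sym2 (Fin K))
    (i j : Fin n) : edgeRel G Z e i j ↔ edgeRel G Z e j i := by
  unfold edgeRel; rw [Sym2.eq_swap, G.adj_comm]

lemma nonEdgeRel_symm {n K : ℕ} (G : SimpleGraph (Fin n)) (Z : Labels n K) (e : Sym2 (Fin K))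
    (i j : Fin n) : nonEdgeRel G Z e i j ↔ nonEdgeRel G Z e j i := by
  unfold nonEdgeRel; rw [Sym2.eq_swap, G.adj_comm]

/-- Edges of `G` in the block `e`, not counting those at the node `v`. -/
def offEdges {n K : ℕ} (G : SimpleGraph (Fin n)) (Z : Labels n K) (v : Fin n)
    (e : Sym2 (Fin K)) : ℕ := pairCount (offNode v (edgeRel G Z e))

/-- Non-edges of `G` in the block `e`, not counting those at the node `v`. -/
def offNonEdges {n K : ℕ} (G : SimpleGraph (Fin n)) (Z : Labels n K) (v : Fin n)
    (e : Sym2 (Fin K)) : ℕ := pairCount (offNode v (nonEdgeRel G Z e))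

open Classical in
/-- Number of neighbours of `v` with label `c`. -/
def degTo {n K : ℕ} (G : SimpleGraph (Fin n)) (Z : Labels n K) (v : Fin n) (c : Fin K) : ℕ :=
  (Finset.univ.filter fun j => j ≠ v ∧ Z j = c ∧ G.Adj v j).card

open Classical in
/-- Number of non-neighbours of `v`, other than `v`, with label `c`. -/
def nonDegTo {n K : ℕ} (G : SimpleGraph (Fin n)) (Z : Labels n K) (v : Fin n) (c : Fin K) : ℕ :=
  (Finset.univ.filter fun j => j ≠ v ∧ Z j = c ∧ ¬ G.Adj v j).card

lemma offNode_update {n K : ℕ} (Z : Labels n K) (v : Fin n) (a : Fin K) (e : Sym2 (Fin K))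
    (R : Fin n → Fin n → Prop) :
    offNode v (fun i j => s(Function.update Z v a i, Function.update Z v a j) = e ∧ R i j)
      = offNode v (fun i j => s(Z i, Z j) = e ∧ R i j) := by
  funext i j
  unfold offNode
  by_cases hi : i = v
  · simp [hi]
  · by_cases hj : j = v
    · simp [hj]
    · simp [hi, hj]

-- Counts away from `v` do not see the label of `v`, and the edges at `v` enter exactly the `K`
-- blocks that contain the new label. The sum over all blocks is independent of `a` and cancels when
-- two labels of `v` are compared.
open Classical in
lemma log_marginal_update {n K : ℕ} {κ₁ κ₂ : ℝ} (h₁ : 0 < κ₁) (h₂ : 0 < κ₂)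
    (G : SimpleGraph (Fin n)) (Z : Labels n K) (v : Fin n) (a : Fin K) :
    Real.log (marginal κ₁ κ₂ G (Function.update Z v a))
      = (∑ e, Real.log (blockWeight κ₁ κ₂ (offEdges G Z v e) (offNonEdges G Z v e)))
        + ∑ c, (Real.log (blockWeight κ₁ κ₂ (offEdges G Z v s(a, c) + degTo G Z v c)
            (offNonEdges G Z v s(a, c) + nonDegTo G Z v c))
          - Real.log (blockWeight κ₁ κ₂ (offEdges G Z v s(a, c)) (offNonEdges G Z v s(a, c)))) := by
  have pos := blockWeight_pos h₁ h₂
  rw [marginal_eq_prod h₁ h₂, Real.log_prod fun e _ => (pos _ _).ne']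
  set Z' := Function.update Z v a with hZ'
  have hE : ∀ e, pairCount (edgeRel G Z' e) = offEdges G Z v e
      + (Finset.univ.filter fun j => j ≠ v ∧ s(a, Z j) = e ∧ G.Adj v j).card := by
    intro e
    rw [pairCount_split _ (edgeRel_symm G Z' e) v, offEdges]
    congr 1
    · exact congrArg pairCount (offNode_update Z v a e G.Adj)
    · congr 1; ext j
      by_cases hj : j = v <;> simp [hZ', hj, edgeRel]
  have hN : ∀ e, pairCount (nonEdgeRel G Z' e) = offNonEdges G Z v e
      + (Finset.univ.filter fun j => j ≠ v ∧ s(a, Z j) = e ∧ ¬ G.Adj v j).card := by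
    intro e
    rw [pairCount_split _ (nonEdgeRel_symm G Z' e) v, offNonEdges]
    congr 1
    · exact congrArg pairCount (offNode_update Z v a e (fun i j => ¬ G.Adj i j))
    · congr 1; ext j
      by_cases hj : j = v <;> simp [hZ', hj, nonEdgeRel]
  have hinj : Function.Injective fun c : Fin K => s(a, c) := fun c c' h => Sym2.congr_right.mp h
  rw [← sub_eq_iff_eq_add', ← Finset.sum_sub_distrib]
  rw [← Finset.sum_subset (Finset.subset_univ (Finset.univ.image fun c : Fin K => s(a, c)))]
  · rw [Finset.sum_image fun c _ c' _ h => hinj h]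
    refine Finset.sum_congr rfl fun c _ => ?_
    rw [hE, hN]
    have f1 : (Finset.univ.filter fun j => j ≠ v ∧ s(a, Z j) = s(a, c) ∧ G.Adj v j)
        = Finset.univ.filter fun j => j ≠ v ∧ Z j = c ∧ G.Adj v j := by
      ext j; simp [hinj.eq_iff]
    have f2 : (Finset.univ.filter fun j => j ≠ v ∧ s(a, Z j) = s(a, c) ∧ ¬ G.Adj v j)
        = Finset.univ.filter fun j => j ≠ v ∧ Z j = c ∧ ¬ G.Adj v j := by
      ext j; simp [hinj.eq_iff]
    rw [f1, f2]; rfl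
  · intro e _ he
    have f1 : (Finset.univ.filter fun j => j ≠ v ∧ s(a, Z j) = e ∧ G.Adj v j) = ∅ := by
      rw [Finset.filter_eq_empty_iff]; rintro j - ⟨-, h, -⟩
      exact he (Finset.mem_image.mpr ⟨Z j, Finset.mem_univ _, h⟩)
    have f2 : (Finset.univ.filter fun j => j ≠ v ∧ s(a, Z j) = e ∧ ¬ G.Adj v j) = ∅ := by
      rw [Finset.filter_eq_empty_iff]; rintro j - ⟨-, h, -⟩
      exact he (Finset.mem_image.mpr ⟨Z j, Finset.mem_univ _, h⟩)
    rw [hE, hN, f1, f2]; simp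

end

end SBM

namespace SBM

noncomputable section

/-! ### Clusterings and their distance -/

section Clusters

variable {n K : ℕ}

lemma mem_cluster {Z W : Labels n K} :
    W ∈ cluster Z ↔ ∃ σ : Equiv.Perm (Fin K), (fun i => σ (Z i)) = W := by
  simp [cluster]

lemma self_mem_cluster (Z : Labels n K) : Z ∈ cluster Z := mem_cluster.mpr ⟨1, rfl⟩

lemma cluster_relabel (Z : Labels n K) (σ : Equiv.Perm (Fin K)) :
    cluster (fun i => σ (Z i)) = cluster Z := by
  ext W
  rw [mem_cluster, mem_cluster]
  constructor
  · rintro ⟨ρ, rfl⟩; exact ⟨ρ * σ, rfl⟩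
  · rintro ⟨ρ, rfl⟩; exact ⟨ρ * σ⁻¹, by funext i; simp⟩

lemma cluster_eq_of_mem {Z W : Labels n K} (h : W ∈ cluster Z) : cluster W = cluster Z := by
  obtain ⟨σ, rfl⟩ := mem_cluster.mp h
  exact cluster_relabel Z σ

lemma hammingDist_relabel (Z W : Labels n K) (σ : Equiv.Perm (Fin K)) :
    hammingDist (fun i => σ (Z i)) (fun i => σ (W i)) = hammingDist Z W :=
  hammingDist_comp (fun _ => σ) fun _ => σ.injective

lemma clusterDist_le {Γ Γ' : Finset (Labels n K)} {Z W : Labels n K} (hZ : Z ∈ Γ) (hW : W ∈ Γ') :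
    clusterDist Γ Γ' ≤ hammingDist Z W :=
  Nat.sInf_le ⟨Z, hZ, W, hW, rfl⟩

/-- The distance to the clustering of `W` is attained at any given representative of the first
clustering. -/
lemma exists_mem_clusterDist (Z W : Labels n K) :
    ∃ W' ∈ cluster W, hammingDist Z W' = clusterDist (cluster Z) (cluster W) := by
  have hne : {d : ℕ | ∃ X ∈ cluster Z, ∃ Y ∈ cluster W, d = hammingDist X Y}.Nonempty :=
    ⟨_, Z, self_mem_cluster Z, W, self_mem_cluster W, rfl⟩
  obtain ⟨X, hX, Y, hY, h⟩ := Nat.sInf_mem hne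
  obtain ⟨σ, rfl⟩ := mem_cluster.mp hX
  refine ⟨fun i => σ⁻¹ (Y i), ?_, ?_⟩
  · rw [← cluster_eq_of_mem hY, mem_cluster]; exact ⟨σ⁻¹, rfl⟩
  · have := hammingDist_relabel Z (fun i => σ⁻¹ (Y i)) σ
    simp only [Equiv.Perm.coe_inv, Equiv.apply_symm_apply] at this
    simp only [Equiv.Perm.coe_inv]
    rw [← this, ← h]; rfl

lemma clusterDist_comm (Z W : Labels n K) :
    clusterDist (cluster Z) (cluster W) = clusterDist (cluster W) (cluster Z) := by
  apply le_antisymm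
  · obtain ⟨X, hX, h⟩ := exists_mem_clusterDist W Z
    rw [← h, hammingDist_comm]; exact clusterDist_le hX (self_mem_cluster W)
  · obtain ⟨X, hX, h⟩ := exists_mem_clusterDist Z W
    rw [← h, hammingDist_comm]; exact clusterDist_le hX (self_mem_cluster Z)

lemma exists_aligned (Z W : Labels n K) :
    ∃ Z' ∈ cluster Z, hammingDist Z' W = clusterDist (cluster Z) (cluster W) := by
  obtain ⟨X, hX, h⟩ := exists_mem_clusterDist W Z
  exact ⟨X, hX, by rw [hammingDist_comm, h, clusterDist_comm]⟩

lemma isBalanced_relabel {b : ℝ} {Z : Labels n K} (h : IsBalanced b Z)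
    (σ : Equiv.Perm (Fin K)) : IsBalanced b (fun i => σ (Z i)) := by
  intro k
  have : (Finset.univ.filter fun i => σ (Z i) = k) = Finset.univ.filter fun i => Z i = σ⁻¹ k := by
    ext i; simp [Equiv.eq_symm_apply]
  rw [this]; exact h _

lemma isBalanced_of_mem {b : ℝ} {Z W : Labels n K} (h : IsBalanced b Z) (hW : W ∈ cluster Z) :
    IsBalanced b W := by
  obtain ⟨σ, rfl⟩ := mem_cluster.mp hW
  exact isBalanced_relabel h σ

lemma hammingDist_update_le (Z : Labels n K) (v : Fin n) (b : Fin K) :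
    hammingDist Z (Function.update Z v b) ≤ 1 := by
  unfold hammingDist
  calc _ ≤ ({v} : Finset (Fin n)).card := Finset.card_le_card fun i hi => by
        by_contra h
        simp only [Finset.mem_singleton] at h
        simp [Function.update_of_ne h] at hi
    _ = 1 := by simp

lemma exists_update_of_hammingDist_eq_one {Z W : Labels n K} (h : hammingDist Z W = 1) :
    ∃ v b, b ≠ Z v ∧ W = Function.update Z v b := by
  obtain ⟨v, hv⟩ := Finset.card_eq_one.mp h
  have hv' : ∀ i, Z i ≠ W i ↔ i = v := fun i => by
    have : i ∈ Finset.univ.filter (fun i => Z i ≠ W i) ↔ i = v := by rw [hv]; simp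
    simpa using this
  refine ⟨v, W v, ((hv' v).mpr rfl).symm, ?_⟩
  funext i
  by_cases hi : i = v
  · subst hi; simp
  · rw [Function.update_of_ne hi]
    by_contra hne
    exact hi ((hv' i).mp (Ne.symm hne))

lemma hammingDist_update_of_eq {Z W : Labels n K} {v : Fin n} {b : Fin K} (hv : Z v ≠ W v)
    (hb : b = W v) : hammingDist (Function.update Z v b) W + 1 = hammingDist Z W := by
  subst hb
  unfold hammingDist
  have : Finset.univ.filter (fun i => Z i ≠ W i)
      = insert v (Finset.univ.filter fun i => Function.update Z v (W v) i ≠ W i) := by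
    ext i
    by_cases hi : i = v
    · subst hi; simp [hv]
    · simp [hi]
  rw [this, Finset.card_insert_of_notMem (by simp)]

lemma hammingDist_update_le_of_ne {Z W : Labels n K} {v : Fin n} (hv : Z v ≠ W v) (b : Fin K) :
    hammingDist (Function.update Z v b) W ≤ hammingDist Z W := by
  unfold hammingDist
  refine Finset.card_le_card fun i hi => ?_
  by_cases h : i = v
  · subst h; simpa using hv
  · simpa [h] using hi

lemma IsBalanced.card_pos {b : ℝ} {Z : Labels n K} (h : IsBalanced b Z) (hb : 0 < b) (hn : 0 < n)
    (k : Fin K) : ∃ i, Z i = k := by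
  have hK : 0 < K := Fin.pos k
  have : (0 : ℝ) < ((Finset.univ.filter fun i => Z i = k).card : ℝ) :=
    lt_of_lt_of_le (by positivity) (h k).1
  have := Finset.card_pos.mp (by exact_mod_cast this)
  obtain ⟨i, hi⟩ := this
  exact ⟨i, by simpa using hi⟩

/-- A balanced assignment uses every label, so the permutations of the labels act freely on it. -/
lemma card_cluster {b : ℝ} {Z : Labels n K} (h : IsBalanced b Z) (hb : 0 < b) (hn : 0 < n) :
    (cluster Z).card = K.factorial := by
  unfold cluster
  rw [Finset.card_image_of_injective, Finset.card_univ, Fintype.card_perm, Fintype.card_fin]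
  intro σ ρ hσ
  ext k
  obtain ⟨i, rfl⟩ := h.card_pos hb hn k
  exact congrArg Fin.val (congrFun hσ i)

/-- Relabelings of a balanced assignment are far apart. -/
lemma eq_of_mem_cluster_of_hammingDist_le {b : ℝ} {Z W : Labels n K} (h : IsBalanced b Z)
    (hW : W ∈ cluster Z) (hn : (2 : ℝ) < n / (b * K)) (hd : hammingDist Z W ≤ 2) : Z = W := by
  obtain ⟨σ, rfl⟩ := mem_cluster.mp hW
  have hσ : ∀ k, σ k = k := by
    intro k
    by_contra hk
    have h1 := (h k).1
    -- If the label `k` is moved, its whole community contributes to the Hamming distance.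
    have h2 : (Finset.univ.filter fun i => Z i = k).card ≤ hammingDist Z (fun i => σ (Z i)) := by
      unfold hammingDist
      refine Finset.card_le_card fun i hi => ?_
      have : Z i = k := by simpa using hi
      simp only [Finset.mem_filter, Finset.mem_univ, true_and]
      rw [this]; exact Ne.symm hk
    have h3 : ((Finset.univ.filter fun i => Z i = k).card : ℝ) ≤ 2 := by
      exact_mod_cast h2.trans hd
    linarith
  funext i; exact (hσ _).symm

end Clusters

/-! ### The posterior and the target in terms of the marginal likelihood -/

section Posterior

variable {n K : ℕ} {α κ₁ κ₂ ξ : ℝ} {G : SimpleGraph (Fin n)}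

lemma weight_nonneg (h₁ : 0 < κ₁) (h₂ : 0 < κ₂) (Z : Labels n K) : 0 ≤ weight α κ₁ κ₂ G Z := by
  unfold weight; split_ifs
  · exact (marginal_pos h₁ h₂ G Z).le
  · exact le_rfl

lemma weight_of_balanced {Z : Labels n K} (hZ : IsBalanced α Z) :
    weight α κ₁ κ₂ G Z = marginal κ₁ κ₂ G Z := by
  unfold weight; rw [if_pos hZ]

lemma sum_weight_pos (h₁ : 0 < κ₁) (h₂ : 0 < κ₂) {Z : Labels n K} (hZ : IsBalanced α Z) :
    0 < ∑ W : Labels n K, weight α κ₁ κ₂ G W :=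
  Finset.sum_pos' (fun W _ => weight_nonneg h₁ h₂ W) ⟨Z, Finset.mem_univ _, by
    rw [weight_of_balanced hZ]; exact marginal_pos h₁ h₂ G Z⟩

lemma posterior_of_mem_cluster (h₁ : 0 < κ₁) (h₂ : 0 < κ₂) {Z W : Labels n K}
    (hZ : IsBalanced α Z) (hW : W ∈ cluster Z) :
    posterior α κ₁ κ₂ G W = posterior α κ₁ κ₂ G Z := by
  unfold posterior
  rw [weight_of_balanced hZ, weight_of_balanced (isBalanced_of_mem hZ hW)]
  obtain ⟨σ, rfl⟩ := mem_cluster.mp hW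
  rw [marginal_relabel h₁ h₂]

lemma posterior_pos (h₁ : 0 < κ₁) (h₂ : 0 < κ₂) {Z : Labels n K} (hZ : IsBalanced α Z) :
    0 < posterior α κ₁ κ₂ G Z := by
  unfold posterior
  rw [weight_of_balanced hZ]
  exact div_pos (marginal_pos h₁ h₂ G Z) (sum_weight_pos h₁ h₂ hZ)

lemma posterior_div (h₁ : 0 < κ₁) (h₂ : 0 < κ₂) {Z W : Labels n K} (hZ : IsBalanced α Z)
    (hW : IsBalanced α W) : posterior α κ₁ κ₂ G W / posterior α κ₁ κ₂ G Z
      = marginal κ₁ κ₂ G W / marginal κ₁ κ₂ G Z := by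
  unfold posterior
  rw [weight_of_balanced hZ, weight_of_balanced hW]
  have := (sum_weight_pos (G := G) h₁ h₂ hZ).ne'
  have := (marginal_pos h₁ h₂ G Z).ne'
  field_simp

lemma posterior_of_not_balanced {Z : Labels n K} (hZ : ¬ IsBalanced α Z) :
    posterior α κ₁ κ₂ G Z = 0 := by
  unfold posterior weight; rw [if_neg hZ, zero_div]

lemma clusterPosterior_cluster (h₁ : 0 < κ₁) (h₂ : 0 < κ₂) (hα : 0 < α) (hn : 0 < n)
    {Z : Labels n K} (hZ : IsBalanced α Z) : clusterPosterior α κ₁ κ₂ G (cluster Z)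
      = K.factorial * posterior α κ₁ κ₂ G Z := by
  unfold clusterPosterior
  rw [Finset.sum_congr rfl fun W hW => posterior_of_mem_cluster h₁ h₂ hZ hW, Finset.sum_const,
    card_cluster hZ hα hn, nsmul_eq_mul]

lemma clusterPosterior_div (h₁ : 0 < κ₁) (h₂ : 0 < κ₂) (hα : 0 < α) (hn : 0 < n)
    {Z W : Labels n K} (hZ : IsBalanced α Z) (hW : IsBalanced α W) :
    clusterPosterior α κ₁ κ₂ G (cluster W) / clusterPosterior α κ₁ κ₂ G (cluster Z)
      = marginal κ₁ κ₂ G W / marginal κ₁ κ₂ G Z := by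
  rw [clusterPosterior_cluster h₁ h₂ hα hn hZ, clusterPosterior_cluster h₁ h₂ hα hn hW,
    ← posterior_div h₁ h₂ hZ hW]
  have : (K.factorial : ℝ) ≠ 0 := by positivity
  field_simp

lemma sum_posterior_rpow_pos (h₁ : 0 < κ₁) (h₂ : 0 < κ₂) {Z : Labels n K} (hZ : IsBalanced α Z) :
    0 < ∑ W : Labels n K, posterior α κ₁ κ₂ G W ^ ξ :=
  Finset.sum_pos' (fun W _ => Real.rpow_nonneg
    (div_nonneg (weight_nonneg h₁ h₂ W) (sum_weight_pos h₁ h₂ hZ).le) _)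
    ⟨Z, Finset.mem_univ _, Real.rpow_pos_of_pos (posterior_pos h₁ h₂ hZ) _⟩

lemma target_cluster (h₁ : 0 < κ₁) (h₂ : 0 < κ₂) (hα : 0 < α) (hn : 0 < n)
    (Γ : ClusterSpace n K α) {Z : Labels n K} (hZ : IsBalanced α Z) (hΓ : cluster Z = Γ.1) :
    target α κ₁ κ₂ ξ G Γ = K.factorial * (posterior α κ₁ κ₂ G Z ^ ξ
      / ∑ W : Labels n K, posterior α κ₁ κ₂ G W ^ ξ) := by
  unfold target tempered
  rw [← hΓ, Finset.sum_congr rfl fun W hW => by rw [posterior_of_mem_cluster h₁ h₂ hZ hW],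
    Finset.sum_const, card_cluster hZ hα hn, nsmul_eq_mul]

lemma target_pos (h₁ : 0 < κ₁) (h₂ : 0 < κ₂) (hα : 0 < α) (hn : 0 < n) (Γ : ClusterSpace n K α) :
    0 < target α κ₁ κ₂ ξ G Γ := by
  obtain ⟨Z, hZ, hΓ⟩ := Γ.2
  rw [target_cluster h₁ h₂ hα hn Γ hZ hΓ]
  exact mul_pos (Nat.cast_pos.mpr K.factorial_pos)
    (div_pos (Real.rpow_pos_of_pos (posterior_pos h₁ h₂ hZ) ξ) (sum_posterior_rpow_pos h₁ h₂ hZ))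

/-- The clusterings partition the feasible assignments. The normalising sum also runs over
infeasible assignments, which contribute `0 ^ ξ = 0` because `ξ` is nonzero. -/
lemma sum_target (h₁ : 0 < κ₁) (h₂ : 0 < κ₂) (hξ : 1 ≤ ξ) (Γ₀ : ClusterSpace n K α) :
    ∑ Γ : ClusterSpace n K α, target α κ₁ κ₂ ξ G Γ = 1 := by
  classical
  obtain ⟨Z₀, hZ₀, -⟩ := Γ₀.2
  have hsum : ∑ W : Labels n K, tempered α κ₁ κ₂ ξ G W = 1 := by
    unfold tempered
    rw [← Finset.sum_div]
    exact div_self (sum_posterior_rpow_pos h₁ h₂ hZ₀).ne'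
  have h0 : ∀ W : Labels n K, ¬ IsBalanced α W → tempered α κ₁ κ₂ ξ G W = 0 := fun W hW => by
    unfold tempered
    rw [posterior_of_not_balanced hW, Real.zero_rpow (by linarith), zero_div]
  unfold target
  generalize tempered α κ₁ κ₂ ξ G = f at hsum h0
  have e : ∀ Γ : ClusterSpace n K α, ∑ Z ∈ Γ.1, f Z = ∑ Z, if Z ∈ Γ.1 then f Z else 0 :=
    fun Γ => by rw [← Finset.sum_filter]; congr 1; ext; simp
  simp_rw [e]
  rw [Finset.sum_comm, ← hsum]
  refine Finset.sum_congr rfl fun W _ => ?_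
  by_cases hW : IsBalanced α W
  · rw [Finset.sum_eq_single (⟨cluster W, W, hW, rfl⟩ : ClusterSpace n K α)]
    · simp [self_mem_cluster]
    · rintro ⟨Γ, Z, hZ, rfl⟩ - hne
      refine if_neg fun hmem => hne (Subtype.ext ?_)
      exact (cluster_eq_of_mem hmem).symm
    · exact fun h => absurd (Finset.mem_univ _) h
  · rw [h0 W hW]; simp

/-- The `K!` representatives of a clustering share its mass equally. This keeps `log (Π⁻¹)` in the
time bound at least `log 2`. -/
lemma posterior_le_half (h₁ : 0 < κ₁) (h₂ : 0 < κ₂) (hα : 0 < α) (hn : 0 < n) (hK : 2 ≤ K)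
    {Z : Labels n K} (hZ : IsBalanced α Z) : posterior α κ₁ κ₂ G Z ≤ 1 / 2 := by
  have hsum : ∑ W : Labels n K, posterior α κ₁ κ₂ G W = 1 := by
    unfold posterior; rw [← Finset.sum_div]; exact div_self (sum_weight_pos h₁ h₂ hZ).ne'
  have h3 : clusterPosterior α κ₁ κ₂ G (cluster Z) ≤ 1 := by
    unfold clusterPosterior
    rw [← hsum]
    exact Finset.sum_le_sum_of_subset_of_nonneg (Finset.subset_univ _) fun W _ _ =>
      div_nonneg (weight_nonneg h₁ h₂ W) (sum_weight_pos h₁ h₂ hZ).le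
  rw [clusterPosterior_cluster h₁ h₂ hα hn hZ] at h3
  have h4 : (2 : ℝ) ≤ K.factorial := by
    exact_mod_cast hK.trans (Nat.self_le_factorial K)
  have h5 := posterior_pos (G := G) h₁ h₂ hZ
  nlinarith

end Posterior

end

end SBM

namespace SBM

noncomputable section

/-! ### Drift of the Metropolis–Hastings chain towards a reference clustering -/

section Drift

variable {n K : ℕ} {α κ₁ κ₂ ξ : ℝ} {G : SimpleGraph (Fin n)}

/-- Total acceptance probability, at temperature one, of the flips that create an error with respect
to `Zs`. -/
def outwardRate (κ₁ κ₂ : ℝ) (G : SimpleGraph (Fin n)) (Z Zs : Labels n K) : ℝ :=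
  ∑ x : Fin n × Fin K, if Z x.1 = Zs x.1 ∧ x.2 ≠ Z x.1 then
    min 1 (marginal κ₁ κ₂ G (Function.update Z x.1 x.2) / marginal κ₁ κ₂ G Z) else 0

/-- One fixed representative is enough to see all neighbours of a clustering; moves can then be
counted as flips of `Z`. -/
lemma exists_flip_of_clusterDist_eq_one {Z : Labels n K} {Γ Γ' : ClusterSpace n K α}
    (hΓ : cluster Z = Γ.1) (h : clusterDist Γ.1 Γ'.1 = 1) :
    ∃ x : Fin n × Fin K, x.2 ≠ Z x.1 ∧ cluster (Function.update Z x.1 x.2) = Γ'.1 := by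
  obtain ⟨Z', -, hΓ'⟩ := Γ'.2
  rw [← hΓ, ← hΓ'] at h
  obtain ⟨W, hW, hd⟩ := exists_mem_clusterDist Z Z'
  rw [h] at hd
  obtain ⟨v, b, hb, rfl⟩ := exists_update_of_hammingDist_eq_one hd
  exact ⟨(v, b), hb, by rw [← hΓ', cluster_eq_of_mem hW]⟩

lemma one_div_nonneg_of_two_le (hK : 2 ≤ K) : 0 ≤ 1 / (n * ((K : ℝ) - 1)) := by
  have : (2 : ℝ) ≤ K := by exact_mod_cast hK
  have : 0 ≤ (K : ℝ) - 1 := by linarith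
  positivity

lemma clusterPosterior_nonneg (h₁ : 0 < κ₁) (h₂ : 0 < κ₂) (hα : 0 < α) (hn : 0 < n)
    (Γ : ClusterSpace n K α) : 0 < clusterPosterior α κ₁ κ₂ G Γ.1 := by
  obtain ⟨Z, hZ, hΓ⟩ := Γ.2
  rw [← hΓ, clusterPosterior_cluster h₁ h₂ hα hn hZ]
  exact mul_pos (Nat.cast_pos.mpr K.factorial_pos) (posterior_pos h₁ h₂ hZ)

lemma moveProb_nonneg (h₁ : 0 < κ₁) (h₂ : 0 < κ₂) (hα : 0 < α) (hn : 0 < n) (hK : 2 ≤ K)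
    (Γ Γ' : ClusterSpace n K α) : 0 ≤ moveProb α κ₁ κ₂ ξ G Γ Γ' := by
  unfold moveProb
  split_ifs
  · refine mul_nonneg (one_div_nonneg_of_two_le hK) (le_min zero_le_one (Real.rpow_nonneg ?_ _))
    exact div_nonneg (clusterPosterior_nonneg h₁ h₂ hα hn Γ').le
      (clusterPosterior_nonneg h₁ h₂ hα hn Γ).le
  · exact le_rfl

lemma moveProb_le (hK : 2 ≤ K) (Γ Γ' : ClusterSpace n K α) :
    moveProb α κ₁ κ₂ ξ G Γ Γ'
      ≤ if clusterDist Γ.1 Γ'.1 = 1 then 1 / (n * ((K : ℝ) - 1)) else 0 := by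
  unfold moveProb
  split_ifs
  · exact mul_le_of_le_one_right (one_div_nonneg_of_two_le hK) (min_le_left _ _)
  · exact le_rfl

open Classical in
lemma card_flips (Z : Labels n K) :
    (Finset.univ.filter fun x : Fin n × Fin K => x.2 ≠ Z x.1).card = n * (K - 1) := by
  rw [Finset.card_filter, ← Finset.univ_product_univ, Finset.sum_product]
  have : ∀ i : Fin n, ∑ b : Fin K, (if b ≠ Z i then 1 else 0) = K - 1 := fun i => by
    rw [← Finset.card_filter, Finset.filter_ne', Finset.card_erase_of_mem (Finset.mem_univ _),
      Finset.card_univ, Fintype.card_fin]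
  rw [Finset.sum_congr rfl fun i _ => this i]; simp

/-- Distinct neighbours come from distinct flips of a fixed representative, and there are `n * (K -
1)` flips. -/
lemma sum_moveProb_le_one (hn : 0 < n) (hK : 2 ≤ K) (Γ : ClusterSpace n K α)
    (s : Finset (ClusterSpace n K α)) : ∑ Γ' ∈ s, moveProb α κ₁ κ₂ ξ G Γ Γ' ≤ 1 := by
  classical
  obtain ⟨Z, hZ, hΓ⟩ := Γ.2
  have hK' : (1 : ℝ) < K := by exact_mod_cast (by omega : 1 < K)
  have hN : (0 : ℝ) < n * ((K : ℝ) - 1) := mul_pos (by exact_mod_cast hn) (by linarith)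
  have hcard : (s.filter fun Γ' => clusterDist Γ.1 Γ'.1 = 1).card ≤ n * (K - 1) := by
    rw [← card_flips Z]
    have : Nonempty (Fin n × Fin K) := ⟨⟨0, hn⟩, ⟨0, by omega⟩⟩
    choose! f hf using fun (Γ' : ClusterSpace n K α) (h : clusterDist Γ.1 Γ'.1 = 1) =>
      exists_flip_of_clusterDist_eq_one hΓ h
    refine Finset.card_le_card_of_injOn f (fun Γ' h => ?_) fun Γ' h Γ'' h' he => ?_
    · have h := (Finset.mem_filter.mp h).2
      simpa using (hf Γ' h).1
    · have h := (Finset.mem_filter.mp h).2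
      have h' := (Finset.mem_filter.mp h').2
      exact Subtype.ext (by rw [← (hf Γ' h).2, ← (hf Γ'' h').2, he])
  calc ∑ Γ' ∈ s, moveProb α κ₁ κ₂ ξ G Γ Γ'
      ≤ ∑ Γ' ∈ s, if clusterDist Γ.1 Γ'.1 = 1 then 1 / (n * ((K : ℝ) - 1)) else 0 :=
        Finset.sum_le_sum fun Γ' _ => moveProb_le hK Γ Γ'
    _ = (s.filter fun Γ' => clusterDist Γ.1 Γ'.1 = 1).card * (1 / (n * ((K : ℝ) - 1))) := by
        rw [← Finset.sum_filter, Finset.sum_const, nsmul_eq_mul]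
    _ ≤ ((n * (K - 1) : ℕ) : ℝ) * (1 / (n * ((K : ℝ) - 1))) := by
        gcongr
    _ = 1 := by
        rw [Nat.cast_mul, Nat.cast_sub (by omega)]
        push_cast
        rw [mul_one_div, div_self hN.ne']

lemma transition_nonneg (h₁ : 0 < κ₁) (h₂ : 0 < κ₂) (hα : 0 < α) (hn : 0 < n) (hK : 2 ≤ K)
    (Γ Γ' : ClusterSpace n K α) : 0 ≤ transition α κ₁ κ₂ ξ G Γ Γ' := by
  unfold transition
  rw [Matrix.of_apply]
  split_ifs
  · linarith [sum_moveProb_le_one (G := G) (κ₁ := κ₁) (κ₂ := κ₂) (ξ := ξ) hn hK Γ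
      (Finset.univ.erase Γ)]
  · exact moveProb_nonneg h₁ h₂ hα hn hK Γ Γ'

lemma sum_transition_mul (Γ : ClusterSpace n K α) (f : ClusterSpace n K α → ℝ) :
    ∑ Γ', transition α κ₁ κ₂ ξ G Γ Γ' * f Γ'
      = f Γ + ∑ Γ' ∈ Finset.univ.erase Γ, moveProb α κ₁ κ₂ ξ G Γ Γ' * (f Γ' - f Γ) := by
  rw [← Finset.add_sum_erase _ _ (Finset.mem_univ Γ)]
  have e1 : transition α κ₁ κ₂ ξ G Γ Γ
      = 1 - ∑ Γ'' ∈ Finset.univ.erase Γ, moveProb α κ₁ κ₂ ξ G Γ Γ'' := by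
    unfold transition; rw [Matrix.of_apply, if_pos rfl]
  have e2 : ∀ Γ' ∈ Finset.univ.erase Γ, transition α κ₁ κ₂ ξ G Γ Γ' * f Γ'
      = moveProb α κ₁ κ₂ ξ G Γ Γ' * f Γ' := fun Γ' h => by
    unfold transition; rw [Matrix.of_apply, if_neg (Finset.ne_of_mem_erase h)]
  rw [e1, Finset.sum_congr rfl e2]
  simp_rw [mul_sub]
  rw [Finset.sum_sub_distrib, ← Finset.sum_mul]
  ring

lemma target_mul_moveProb (h₁ : 0 < κ₁) (h₂ : 0 < κ₂) (hα : 0 < α) (hn : 0 < n)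
    (Γ Γ' : ClusterSpace n K α) :
    target α κ₁ κ₂ ξ G Γ * moveProb α κ₁ κ₂ ξ G Γ Γ'
      = target α κ₁ κ₂ ξ G Γ' * moveProb α κ₁ κ₂ ξ G Γ' Γ := by
  obtain ⟨Z, hZ, hΓ⟩ := Γ.2
  obtain ⟨W, hW, hΓ'⟩ := Γ'.2
  have hcomm : clusterDist Γ.1 Γ'.1 = clusterDist Γ'.1 Γ.1 := by
    rw [← hΓ, ← hΓ', clusterDist_comm]
  unfold moveProb
  rw [hcomm]
  split_ifs with h
  · rw [target_cluster h₁ h₂ hα hn Γ hZ hΓ, target_cluster h₁ h₂ hα hn Γ' hW hΓ', ← hΓ, ← hΓ',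
      clusterPosterior_cluster h₁ h₂ hα hn hZ, clusterPosterior_cluster h₁ h₂ hα hn hW]
    have hx := posterior_pos (G := G) h₁ h₂ hZ
    have hy := posterior_pos (G := G) h₁ h₂ hW
    have hf : (0 : ℝ) < K.factorial := Nat.cast_pos.mpr K.factorial_pos
    generalize posterior α κ₁ κ₂ G Z = x at *
    generalize posterior α κ₁ κ₂ G W = y at *
    -- Detailed balance: the flow between two neighbours is the symmetric expression `min (x ^ ξ) (y
    -- ^ ξ)`, up to a common factor.
    have key : ∀ x y : ℝ, 0 < x → 0 < y → x ^ ξ * min 1 ((K.factorial * y / (K.factorial * x)) ^ ξ)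
        = min (x ^ ξ) (y ^ ξ) := fun x y hx hy => by
      have hxp := Real.rpow_pos_of_pos hx ξ
      rw [mul_div_mul_left _ _ hf.ne', Real.div_rpow hy.le hx.le, mul_min_of_nonneg _ _ hxp.le,
        mul_one, mul_div_cancel₀ _ hxp.ne']
    have k1 := key x y hx hy
    have k2 := key y x hy hx
    rw [min_comm (y ^ ξ)] at k2
    have k3 := k1.trans k2.symm
    generalize ∑ W : Labels n K, posterior α κ₁ κ₂ G W ^ ξ = T
    linear_combination (K.factorial / T * (1 / (n * ((K : ℝ) - 1)))) * k3
  · simp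

lemma transition_reversible (h₁ : 0 < κ₁) (h₂ : 0 < κ₂) (hα : 0 < α) (hn : 0 < n)
    (Γ Γ' : ClusterSpace n K α) :
    target α κ₁ κ₂ ξ G Γ * transition α κ₁ κ₂ ξ G Γ Γ'
      = target α κ₁ κ₂ ξ G Γ' * transition α κ₁ κ₂ ξ G Γ' Γ := by
  by_cases h : Γ' = Γ
  · rw [h]
  · unfold transition
    rw [Matrix.of_apply, Matrix.of_apply, if_neg h, if_neg (Ne.symm h)]
    exact target_mul_moveProb h₁ h₂ hα hn Γ Γ'

/-- Distance to the clustering of `Zs`. -/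
def distTo (Zs : Labels n K) (Γ : ClusterSpace n K α) : ℕ := clusterDist Γ.1 (cluster Zs)

lemma exists_aligned_rep (Zs : Labels n K) (Γ : ClusterSpace n K α) :
    ∃ Z, IsBalanced α Z ∧ cluster Z = Γ.1 ∧ hammingDist Z Zs = distTo Zs Γ := by
  obtain ⟨Z, hZ, hΓ⟩ := Γ.2
  obtain ⟨W, hW, h⟩ := exists_aligned Z Zs
  exact ⟨W, isBalanced_of_mem hZ hW, by rw [cluster_eq_of_mem hW, hΓ], by rw [h, hΓ, distTo]⟩

lemma distTo_le_succ (Zs : Labels n K) {Γ Γ' : ClusterSpace n K α}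
    (h : clusterDist Γ.1 Γ'.1 = 1) : distTo Zs Γ' ≤ distTo Zs Γ + 1 := by
  obtain ⟨Z, -, hΓ, hd⟩ := exists_aligned_rep Zs Γ
  obtain ⟨x, -, hx⟩ := exists_flip_of_clusterDist_eq_one hΓ h
  calc distTo Zs Γ' ≤ hammingDist (Function.update Z x.1 x.2) Zs := by
        unfold distTo; rw [← hx]; exact clusterDist_le (self_mem_cluster _) (self_mem_cluster _)
    _ ≤ hammingDist (Function.update Z x.1 x.2) Z + hammingDist Z Zs := hammingDist_triangle _ _ _
    _ ≤ _ := by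
      rw [hd, hammingDist_comm]
      have := hammingDist_update_le Z x.1 x.2
      omega

lemma le_distTo_succ (Zs : Labels n K) {Γ Γ' : ClusterSpace n K α}
    (h : clusterDist Γ.1 Γ'.1 = 1) : distTo Zs Γ ≤ distTo Zs Γ' + 1 := by
  refine distTo_le_succ Zs ?_
  obtain ⟨Z, -, hΓ⟩ := Γ.2
  obtain ⟨W, -, hΓ'⟩ := Γ'.2
  rw [← hΓ, ← hΓ', clusterDist_comm, hΓ, hΓ', h]

lemma distTo_eq_zero {Zs : Labels n K} {Γ : ClusterSpace n K α} (h : distTo Zs Γ = 0) :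
    Γ.1 = cluster Zs := by
  obtain ⟨Z, -, hΓ, hd⟩ := exists_aligned_rep Zs Γ
  rw [h] at hd
  rw [← hΓ, hammingDist_eq_zero.mp hd]

/-- For a ratio below one, raising it to the power `ξ ≥ 1` only lowers the acceptance probability,
so bounds at temperature one apply to every `ξ`. -/
lemma moveProb_le_of_flip (h₁ : 0 < κ₁) (h₂ : 0 < κ₂) (hα : 0 < α) (hn : 0 < n) (hK : 2 ≤ K)
    (hξ : 1 ≤ ξ) {Γ Γ' : ClusterSpace n K α} {Z W : Labels n K} (hZ : IsBalanced α Z)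
    (hΓ : cluster Z = Γ.1) (hΓ' : cluster W = Γ'.1) :
    moveProb α κ₁ κ₂ ξ G Γ Γ'
      ≤ 1 / (n * ((K : ℝ) - 1)) * min 1 (marginal κ₁ κ₂ G W / marginal κ₁ κ₂ G Z) := by
  have hr : 0 < marginal κ₁ κ₂ G W / marginal κ₁ κ₂ G Z :=
    div_pos (marginal_pos h₁ h₂ G W) (marginal_pos h₁ h₂ G Z)
  have hW : IsBalanced α W := by
    obtain ⟨W', hW', hc⟩ := Γ'.2
    exact isBalanced_of_mem hW' (by rw [hc, ← hΓ']; exact self_mem_cluster W)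
  unfold moveProb
  split_ifs
  · rw [← hΓ, ← hΓ', clusterPosterior_div h₁ h₂ hα hn hZ hW]
    refine mul_le_mul_of_nonneg_left ?_ (one_div_nonneg_of_two_le hK)
    refine le_min (min_le_left _ _) ?_
    rcases le_total (marginal κ₁ κ₂ G W / marginal κ₁ κ₂ G Z) 1 with h | h
    · refine (min_le_right _ _).trans ?_
      calc _ ≤ (marginal κ₁ κ₂ G W / marginal κ₁ κ₂ G Z) ^ (1 : ℝ) :=
            Real.rpow_le_rpow_of_exponent_ge hr h hξ
        _ = _ := Real.rpow_one _
    · exact (min_le_left _ _).trans h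
  · exact mul_nonneg (one_div_nonneg_of_two_le hK) (le_min zero_le_one hr.le)

/-- Moves away from `Zs` and towards `Zs`, bounded in terms of flips of an aligned
representative. -/
lemma outward_moves_le (h₁ : 0 < κ₁) (h₂ : 0 < κ₂) (hα : 0 < α) (hn : 0 < n) (hK : 2 ≤ K)
    (hξ : 1 ≤ ξ) {Zs Z : Labels n K} {Γ : ClusterSpace n K α} (hZ : IsBalanced α Z)
    (hΓ : cluster Z = Γ.1) (hd : hammingDist Z Zs = distTo Zs Γ) :
    ∑ Γ' ∈ Finset.univ.erase Γ with distTo Zs Γ' = distTo Zs Γ + 1, moveProb α κ₁ κ₂ ξ G Γ Γ'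
      ≤ 1 / (n * ((K : ℝ) - 1)) * outwardRate κ₁ κ₂ G Z Zs := by
  classical
  set s := (Finset.univ.erase Γ).filter fun Γ' => distTo Zs Γ' = distTo Zs Γ + 1 with hs
  have hsub : ∑ Γ' ∈ s, moveProb α κ₁ κ₂ ξ G Γ Γ'
      = ∑ Γ' ∈ s.filter (fun Γ' => clusterDist Γ.1 Γ'.1 = 1), moveProb α κ₁ κ₂ ξ G Γ Γ' := by
    symm
    refine Finset.sum_subset (Finset.filter_subset _ _) fun Γ' hs' h => ?_
    unfold moveProb
    rw [if_neg fun h' => h (Finset.mem_filter.mpr ⟨hs', h'⟩)]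
  set s' := s.filter (fun Γ' => clusterDist Γ.1 Γ'.1 = 1) with hs'
  have : Nonempty (Fin n × Fin K) := ⟨⟨0, hn⟩, ⟨0, by omega⟩⟩
  choose! f hf using fun (Γ' : ClusterSpace n K α) (h : clusterDist Γ.1 Γ'.1 = 1) =>
    exists_flip_of_clusterDist_eq_one hΓ h
  set F : Fin n × Fin K → ℝ := fun x => if Z x.1 = Zs x.1 ∧ x.2 ≠ Z x.1 then
    min 1 (marginal κ₁ κ₂ G (Function.update Z x.1 x.2) / marginal κ₁ κ₂ G Z) else 0 with hF
  have hF0 : ∀ x, 0 ≤ F x := fun x => by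
    simp only [hF]; split_ifs
    · exact le_min zero_le_one
        (div_pos (marginal_pos h₁ h₂ G _) (marginal_pos h₁ h₂ G Z)).le
    · exact le_rfl
  have hmem : ∀ Γ' ∈ s', distTo Zs Γ' = distTo Zs Γ + 1 ∧ clusterDist Γ.1 Γ'.1 = 1 := by
    intro Γ' h
    have h' := Finset.mem_filter.mp h
    exact ⟨(Finset.mem_filter.mp h'.1).2, h'.2⟩
  have hinj : Set.InjOn f s' := fun Γ' h Γ'' h' he => Subtype.ext (by
    rw [← (hf Γ' (hmem _ h).2).2, ← (hf Γ'' (hmem _ h').2).2, he])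
  have hle : ∀ Γ' ∈ s', moveProb α κ₁ κ₂ ξ G Γ Γ' ≤ 1 / (n * ((K : ℝ) - 1)) * F (f Γ') := by
    intro Γ' h
    obtain ⟨hD, h1⟩ := hmem Γ' h
    obtain ⟨hb, hc⟩ := hf Γ' h1
    -- Flipping a misclassified node of an aligned representative never increases the distance, so a
    -- move away must flip a correctly labelled node.
    have hcorr : Z (f Γ').1 = Zs (f Γ').1 := by
      by_contra hne
      have e1 := hammingDist_update_le_of_ne hne (f Γ').2
      have e2 : distTo Zs Γ' ≤ hammingDist (Function.update Z (f Γ').1 (f Γ').2) Zs := by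
        unfold distTo; rw [← hc]
        exact clusterDist_le (self_mem_cluster _) (self_mem_cluster _)
      omega
    have := moveProb_le_of_flip (G := G) h₁ h₂ hα hn hK hξ hZ hΓ hc
    simp only [hF]
    rwa [if_pos ⟨hcorr, hb⟩]
  rw [hsub]
  calc ∑ Γ' ∈ s', moveProb α κ₁ κ₂ ξ G Γ Γ'
      ≤ ∑ Γ' ∈ s', 1 / (n * ((K : ℝ) - 1)) * F (f Γ') := Finset.sum_le_sum hle
    _ = 1 / (n * ((K : ℝ) - 1)) * ∑ x ∈ s'.image f, F x := by
        rw [← Finset.mul_sum, Finset.sum_image hinj]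
    _ ≤ 1 / (n * ((K : ℝ) - 1)) * ∑ x, F x :=
        mul_le_mul_of_nonneg_left (Finset.sum_le_sum_of_subset_of_nonneg (Finset.subset_univ _)
          fun x _ _ => hF0 x) (one_div_nonneg_of_two_le hK)

/-- Each correction in `S` does not decrease the likelihood and is accepted surely. Different nodes
lead to different clusterings, so the proposal probabilities add up. -/
lemma le_inward_moves (h₁ : 0 < κ₁) (h₂ : 0 < κ₂) (hα : 0 < α) (hn : 0 < n) (hK : 2 ≤ K)
    (hξ : 1 ≤ ξ) (hsize : (2 : ℝ) < n / (α * K))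
    {Zs Z : Labels n K} {Γ : ClusterSpace n K α} (hZ : IsBalanced α Z)
    (hΓ : cluster Z = Γ.1) (hd : hammingDist Z Zs = distTo Zs Γ) (S : Finset (Fin n))
    (hS : ∀ i ∈ S, Z i ≠ Zs i ∧ IsBalanced α (Function.update Z i (Zs i)) ∧
      marginal κ₁ κ₂ G Z ≤ marginal κ₁ κ₂ G (Function.update Z i (Zs i))) :
    1 / (n * ((K : ℝ) - 1)) * S.card
      ≤ ∑ Γ' ∈ Finset.univ.erase Γ with distTo Zs Γ' + 1 = distTo Zs Γ,
        moveProb α κ₁ κ₂ ξ G Γ Γ' := by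
  classical
  set s := (Finset.univ.erase Γ).filter fun Γ' => distTo Zs Γ' + 1 = distTo Zs Γ with hs
  set f : S → ClusterSpace n K α := fun i =>
    ⟨cluster (Function.update Z i (Zs i)), _, (hS i i.2).2.1, rfl⟩ with hf
  have hinj : Function.Injective f := by
    intro i j hij
    have hc : cluster (Function.update Z i (Zs i)) = cluster (Function.update Z j (Zs j)) :=
      congrArg Subtype.val hij
    have hclose : hammingDist (Function.update Z (i : Fin n) (Zs i))
        (Function.update Z (j : Fin n) (Zs j)) ≤ 2 := by
      have := hammingDist_triangle (Function.update Z (i : Fin n) (Zs i)) Z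
        (Function.update Z (j : Fin n) (Zs j))
      have a1 := hammingDist_update_le Z (i : Fin n) (Zs i)
      have a2 := hammingDist_update_le Z (j : Fin n) (Zs j)
      rw [hammingDist_comm] at a1
      omega
    -- Two corrected assignments differ in at most two nodes; large communities rule out that they
    -- are distinct relabelings of each other.
    have heq := eq_of_mem_cluster_of_hammingDist_le (hS i i.2).2.1
      (by rw [hc]; exact self_mem_cluster _) hsize hclose
    by_contra hne
    have hne' : (i : Fin n) ≠ j := fun h => hne (Subtype.ext h)
    have := congrFun heq i
    rw [Function.update_self, Function.update_of_ne hne'] at this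
    exact (hS i i.2).1 this.symm
  have hdist : ∀ i, distTo Zs (f i) + 1 = distTo Zs Γ ∧ clusterDist Γ.1 (f i).1 = 1 := by
    intro i
    have h1 := hammingDist_update_of_eq (hS i i.2).1 rfl
    have h2 : distTo Zs (f i) ≤ hammingDist (Function.update Z (i : Fin n) (Zs i)) Zs := by
      unfold distTo; exact clusterDist_le (self_mem_cluster _) (self_mem_cluster _)
    have h3 : clusterDist Γ.1 (f i).1 ≤ 1 := by
      rw [← hΓ]
      exact (clusterDist_le (self_mem_cluster _) (self_mem_cluster _)).trans
        (hammingDist_update_le Z (i : Fin n) (Zs i))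
    have h4 : clusterDist Γ.1 (f i).1 ≠ 0 := by
      intro h0
      rw [← hΓ] at h0
      have : distTo (Function.update Z (i : Fin n) (Zs i)) (⟨cluster Z, Z, hZ, rfl⟩ :
        ClusterSpace n K α) = 0 := h0
      have := distTo_eq_zero this
      have hfi : (f i).1 = Γ.1 := by rw [← hΓ]; exact this.symm
      have : distTo Zs (f i) = distTo Zs Γ := by unfold distTo; rw [hfi]
      omega
    have h5 : clusterDist Γ.1 (f i).1 = 1 := by omega
    have h6 := le_distTo_succ Zs h5
    exact ⟨by omega, h5⟩
  have hmove : ∀ i, moveProb α κ₁ κ₂ ξ G Γ (f i) = 1 / (n * ((K : ℝ) - 1)) := by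
    intro i
    unfold moveProb
    rw [if_pos (hdist i).2, ← hΓ, clusterPosterior_div h₁ h₂ hα hn hZ (hS i i.2).2.1, min_eq_left,
      mul_one]
    refine Real.one_le_rpow ?_ (by linarith)
    rw [one_le_div (marginal_pos h₁ h₂ G Z)]
    exact (hS i i.2).2.2
  calc 1 / (n * ((K : ℝ) - 1)) * S.card = ∑ i : S, moveProb α κ₁ κ₂ ξ G Γ (f i) := by
        simp_rw [hmove]; simp; ring
    _ = ∑ Γ' ∈ Finset.univ.image f, moveProb α κ₁ κ₂ ξ G Γ Γ' := by
        rw [Finset.sum_image fun i _ j _ h => hinj h]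
    _ ≤ _ := by
      refine Finset.sum_le_sum_of_subset_of_nonneg (fun Γ' h => ?_)
        fun Γ' _ _ => moveProb_nonneg h₁ h₂ hα hn hK Γ Γ'
      obtain ⟨i, -, rfl⟩ := Finset.mem_image.mp h
      refine Finset.mem_filter.mpr ⟨Finset.mem_erase.mpr ⟨fun h => ?_, Finset.mem_univ _⟩,
        (hdist i).1⟩
      have := (hdist i).1
      rw [h] at this
      omega

/-- The expected change of a function of the distance to `Zs` in one step. -/
lemma sum_transition_distTo (Zs : Labels n K) (Γ : ClusterSpace n K α) (f : ℕ → ℝ) :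
    ∑ Γ', transition α κ₁ κ₂ ξ G Γ Γ' * f (distTo Zs Γ')
      = f (distTo Zs Γ)
        + (∑ Γ' ∈ Finset.univ.erase Γ with distTo Zs Γ' = distTo Zs Γ + 1,
          moveProb α κ₁ κ₂ ξ G Γ Γ') * (f (distTo Zs Γ + 1) - f (distTo Zs Γ))
        + (∑ Γ' ∈ Finset.univ.erase Γ with distTo Zs Γ' + 1 = distTo Zs Γ,
          moveProb α κ₁ κ₂ ξ G Γ Γ') * (f (distTo Zs Γ - 1) - f (distTo Zs Γ)) := by
  rw [sum_transition_mul, add_assoc, Finset.sum_filter, Finset.sum_filter, Finset.sum_mul,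
    Finset.sum_mul, ← Finset.sum_add_distrib]
  congr 1
  refine Finset.sum_congr rfl fun Γ' _ => ?_
  by_cases h1 : clusterDist Γ.1 Γ'.1 = 1
  · have a := distTo_le_succ Zs h1
    have b := le_distTo_succ Zs h1
    rcases (by omega : distTo Zs Γ' = distTo Zs Γ + 1 ∨ distTo Zs Γ' = distTo Zs Γ ∨
      distTo Zs Γ' + 1 = distTo Zs Γ) with h | h | h
    · rw [if_pos h, if_neg (by omega), h]; ring
    · rw [if_neg (by omega), if_neg (by omega), h]; ring
    · rw [if_neg (by omega), if_pos h, show distTo Zs Γ - 1 = distTo Zs Γ' by omega]; ring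
  · have : moveProb α κ₁ κ₂ ξ G Γ Γ' = 0 := by unfold moveProb; rw [if_neg h1]
    rw [this]; simp

/-- Each clustering is counted once, through an aligned representative. The sum `s ≤ 1` bounds every
single likelihood ratio by one, so the tempered ratios are no larger than the untempered ones. -/
lemma one_sub_target_le (h₁ : 0 < κ₁) (h₂ : 0 < κ₂) (hα : 0 < α) (hn : 0 < n) (hξ : 1 ≤ ξ)
    {Zs : Labels n K} (hZs : IsBalanced α Zs) {s : ℝ} (hs1 : s ≤ 1)
    (hs : open Classical in ∑ Z : Labels n K with IsBalanced α Z ∧ Z ≠ Zs ∧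
      hammingDist Z Zs = clusterDist (cluster Z) (cluster Zs),
        marginal κ₁ κ₂ G Z / marginal κ₁ κ₂ G Zs ≤ s) :
    1 - target α κ₁ κ₂ ξ G ⟨cluster Zs, Zs, hZs, rfl⟩ ≤ s := by
  classical
  set Γ₀ : ClusterSpace n K α := ⟨cluster Zs, Zs, hZs, rfl⟩ with hΓ₀
  set R := Finset.univ.filter (fun Z : Labels n K => IsBalanced α Z ∧ Z ≠ Zs ∧
    hammingDist Z Zs = clusterDist (cluster Z) (cluster Zs)) with hR
  have hpos : ∀ Z : Labels n K, 0 < marginal κ₁ κ₂ G Z / marginal κ₁ κ₂ G Zs := fun Z =>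
    div_pos (marginal_pos h₁ h₂ G Z) (marginal_pos h₁ h₂ G Zs)
  choose f hf using fun Γ : ClusterSpace n K α => exists_aligned_rep Zs Γ
  have hinj : Function.Injective f := fun Γ Γ' h =>
    Subtype.ext (by rw [← (hf Γ).2.1, ← (hf Γ').2.1, h])
  have hmem : ∀ Γ ∈ Finset.univ.erase Γ₀, f Γ ∈ R := fun Γ h => by
    refine Finset.mem_filter.mpr ⟨Finset.mem_univ _, (hf Γ).1, fun h' => ?_, ?_⟩
    · exact Finset.ne_of_mem_erase h (Subtype.ext (by rw [← (hf Γ).2.1, h']))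
    · rw [(hf Γ).2.2, distTo, (hf Γ).2.1]
  have h0le : target α κ₁ κ₂ ξ G Γ₀ ≤ 1 := by
    rw [← sum_target (G := G) h₁ h₂ hξ Γ₀]
    exact Finset.single_le_sum (fun Γ _ => (target_pos h₁ h₂ hα hn Γ).le) (Finset.mem_univ Γ₀)
  have hterm : ∀ Γ ∈ Finset.univ.erase Γ₀, target α κ₁ κ₂ ξ G Γ
      ≤ marginal κ₁ κ₂ G (f Γ) / marginal κ₁ κ₂ G Zs := by
    intro Γ h
    have hle1 : marginal κ₁ κ₂ G (f Γ) / marginal κ₁ κ₂ G Zs ≤ 1 :=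
      (Finset.single_le_sum (f := fun Z => marginal κ₁ κ₂ G Z / marginal κ₁ κ₂ G Zs)
        (fun Z _ => (hpos Z).le) (hmem Γ h)).trans (hs.trans hs1)
    have e : target α κ₁ κ₂ ξ G Γ = target α κ₁ κ₂ ξ G Γ₀ *
        (marginal κ₁ κ₂ G (f Γ) / marginal κ₁ κ₂ G Zs) ^ ξ := by
      rw [target_cluster h₁ h₂ hα hn Γ (hf Γ).1 (hf Γ).2.1,
        target_cluster h₁ h₂ hα hn Γ₀ hZs rfl, ← posterior_div h₁ h₂ hZs (hf Γ).1,
        Real.div_rpow (posterior_pos h₁ h₂ (hf Γ).1).le (posterior_pos h₁ h₂ hZs).le]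
      have := (Real.rpow_pos_of_pos (posterior_pos (G := G) h₁ h₂ hZs) ξ).ne'
      generalize posterior α κ₁ κ₂ G Zs ^ ξ = x at *
      generalize ∑ W : Labels n K, posterior α κ₁ κ₂ G W ^ ξ = T
      field_simp
    rw [e]
    calc _ ≤ 1 * (marginal κ₁ κ₂ G (f Γ) / marginal κ₁ κ₂ G Zs) ^ (1 : ℝ) := by
          refine mul_le_mul h0le (Real.rpow_le_rpow_of_exponent_ge (hpos _) hle1 hξ)
            (Real.rpow_nonneg (hpos _).le _) zero_le_one
      _ = _ := by rw [Real.rpow_one, one_mul]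
  have hsum := sum_target (G := G) h₁ h₂ hξ Γ₀
  rw [← Finset.add_sum_erase _ _ (Finset.mem_univ Γ₀)] at hsum
  calc 1 - target α κ₁ κ₂ ξ G Γ₀ = ∑ Γ ∈ Finset.univ.erase Γ₀, target α κ₁ κ₂ ξ G Γ := by linarith
    _ ≤ ∑ Γ ∈ Finset.univ.erase Γ₀, marginal κ₁ κ₂ G (f Γ) / marginal κ₁ κ₂ G Zs :=
        Finset.sum_le_sum hterm
    _ = ∑ Z ∈ (Finset.univ.erase Γ₀).image f, marginal κ₁ κ₂ G Z / marginal κ₁ κ₂ G Zs := by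
        rw [Finset.sum_image fun i _ j _ h => hinj h]
    _ ≤ ∑ Z ∈ R, marginal κ₁ κ₂ G Z / marginal κ₁ κ₂ G Zs :=
        Finset.sum_le_sum_of_subset_of_nonneg (fun Z h => by
          obtain ⟨Γ, hΓ, rfl⟩ := Finset.mem_image.mp h; exact hmem Γ hΓ) fun Z _ _ => (hpos Z).le
    _ ≤ s := hs

/-- Mixing of the chain from a drift towards `Zs` below the distance `m` and concentration of the
posterior at `Zs`. -/
theorem tvToTarget_le (h₁ : 0 < κ₁) (h₂ : 0 < κ₂) (hα : 0 < α) (hn : 0 < n) (hK : 2 ≤ K)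
    (hξ : 1 ≤ ξ) (hsize : (2 : ℝ) < n / (α * K)) {Zs : Labels n K} (hZs : IsBalanced α Zs)
    (m : ℕ) {c : ℝ} (hc : c ≤ 1)
    (hdrift : ∀ Z : Labels n K, IsBalanced α Z →
      hammingDist Z Zs = clusterDist (cluster Z) (cluster Zs) → hammingDist Z Zs ≠ 0 →
      hammingDist Z Zs < m → ∃ S : Finset (Fin n),
        (∀ i ∈ S, Z i ≠ Zs i ∧ IsBalanced α (Function.update Z i (Zs i)) ∧
          marginal κ₁ κ₂ G Z ≤ marginal κ₁ κ₂ G (Function.update Z i (Zs i))) ∧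
        c * hammingDist Z Zs ≤ S.card ∧ outwardRate κ₁ κ₂ G Z Zs ≤ S.card / 2)
    {s : ℝ} (hs1 : s ≤ 1)
    (hs : open Classical in ∑ Z : Labels n K with IsBalanced α Z ∧ Z ≠ Zs ∧
      hammingDist Z Zs = clusterDist (cluster Z) (cluster Zs),
        marginal κ₁ κ₂ G Z / marginal κ₁ κ₂ G Zs ≤ s)
    (Z₀ : Feasible n K α) (t : ℕ) :
    tvToTarget κ₁ κ₂ ξ G Z₀ t ≤ s + ((1 - c / (4 * (n * ((K : ℝ) - 1)))) ^ t
        * clusterDist (cluster Z₀.1) (cluster Zs)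
      + 2 ^ clusterDist (cluster Z₀.1) (cluster Zs) / 2 ^ m) := by
  classical
  have hK' : (2 : ℝ) ≤ K := by exact_mod_cast hK
  have hn' : (1 : ℝ) ≤ n := by exact_mod_cast hn
  have hN : (1 : ℝ) ≤ n * ((K : ℝ) - 1) := by nlinarith
  set N : ℝ := n * ((K : ℝ) - 1) with hNdef
  set Γ₀ : ClusterSpace n K α := ⟨cluster Zs, Zs, hZs, rfl⟩ with hΓ₀
  have hboth : ∀ Γ : ClusterSpace n K α, distTo Zs Γ ≠ 0 → distTo Zs Γ < m →
      ∃ x : ℝ, c * distTo Zs Γ ≤ x ∧ 0 ≤ x ∧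
        (∑ Γ' ∈ Finset.univ.erase Γ with distTo Zs Γ' = distTo Zs Γ + 1,
          moveProb α κ₁ κ₂ ξ G Γ Γ') ≤ 1 / N * (x / 2) ∧
        1 / N * x ≤ ∑ Γ' ∈ Finset.univ.erase Γ with distTo Zs Γ' + 1 = distTo Zs Γ,
          moveProb α κ₁ κ₂ ξ G Γ Γ' := by
    intro Γ h0 hm
    obtain ⟨Z, hZ, hΓ, hd⟩ := exists_aligned_rep Zs Γ
    obtain ⟨S, hS1, hS2, hS3⟩ := hdrift Z hZ (by rw [hd, distTo, hΓ]) (by rwa [hd]) (by rwa [hd])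
    refine ⟨S.card, by rwa [hd] at hS2, by positivity, ?_, ?_⟩
    · refine (outward_moves_le h₁ h₂ hα hn hK hξ hZ hΓ hd).trans ?_
      exact mul_le_mul_of_nonneg_left hS3 (by positivity)
    · exact le_inward_moves h₁ h₂ hα hn hK hξ hsize hZ hΓ hd S hS1
  -- Correcting moves have probability at least `x / N` and erring moves at most half of that, so
  -- the distance drops at rate at least `x / (2 * N)`, hence `c / (2 * N)` relative to itself.
  have main := tv_le_of_drift (P := transition α κ₁ κ₂ ξ G) (π := target α κ₁ κ₂ ξ G)
    (transition_nonneg h₁ h₂ hα hn hK)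
    (fun Γ => by simpa using sum_transition_mul (G := G) Γ (fun _ => (1 : ℝ)))
    (target_pos h₁ h₂ hα hn) (sum_target h₁ h₂ hξ Γ₀) (transition_reversible h₁ h₂ hα hn) Γ₀
    (distTo Zs) (fun Γ h => Subtype.ext (distTo_eq_zero h)) m (c / (2 * N))
    (by rw [div_le_one (by positivity)]; linarith)
    (fun Γ h0 hm => by
      obtain ⟨x, hx1, hx0, hU, hL⟩ := hboth Γ h0 hm
      rw [sum_transition_distTo Zs Γ (fun d => (d : ℝ))]
      have h1 : 1 ≤ distTo Zs Γ := Nat.one_le_iff_ne_zero.mpr h0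
      push_cast [Nat.cast_sub h1]
      have e : c / (2 * N) * distTo Zs Γ ≤ 1 / N * (x / 2) := by
        have : c / (2 * N) * distTo Zs Γ = 1 / N * (c * distTo Zs Γ / 2) := by field_simp
        rw [this]; gcongr
      have : 1 / N * (x / 2) = 1 / N * x / 2 := by ring
      linarith)
    (fun Γ h0 hm => by
      obtain ⟨x, hx1, hx0, hU, hL⟩ := hboth Γ h0 hm
      -- An erring move adds `2 ^ d` to `2 ^ d` and a correcting move removes `2 ^ (d - 1)`: the
      -- ratio `1 / 2` of the rates is exactly what makes base two non-increasing in mean.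
      rw [sum_transition_distTo Zs Γ (fun d => (2 : ℝ) ^ d)]
      obtain ⟨d, hd⟩ := Nat.exists_eq_succ_of_ne_zero h0
      rw [hd] at hU hL ⊢
      simp only [Nat.succ_eq_add_one, Nat.add_sub_cancel, pow_succ] at *
      have hp : (0 : ℝ) < 2 ^ d := by positivity
      have : 1 / N * (x / 2) = 1 / N * x / 2 := by ring
      nlinarith) t Z₀.toCluster
  unfold tvToTarget
  have hT := one_sub_target_le h₁ h₂ hα hn hξ hZs hs1 hs
  have e : 1 - c / (2 * N) / 2 = 1 - c / (4 * N) := by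
    rw [div_div]; congr 2; ring
  rw [e] at main
  refine main.trans ?_
  have hdd : distTo Zs Z₀.toCluster = clusterDist (cluster Z₀.1) (cluster Zs) := rfl
  rw [hdd]
  linarith

end Drift

end

end SBM

namespace SBM

noncomputable section

/-! ### Exponential moments of the network -/

section GraphSums

variable {n K : ℕ}

open Classical in
/-- The random graph with independent edges: generating function. -/
lemma sum_graph_prod_pairs (f g : Fin n × Fin n → ℝ) :
    ∑ G : SimpleGraph (Fin n), ∏ x ∈ pairs n, (if G.Adj x.1 x.2 then f x else g x)
      = ∏ x ∈ pairs n, (f x + g x) := by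
  rw [Finset.prod_add]
  refine Finset.sum_bij' (fun G _ => (pairs n).filter fun x => G.Adj x.1 x.2)
    (fun t _ => SimpleGraph.fromRel fun i j => (i, j) ∈ t) ?_ ?_ ?_ ?_ ?_
  · intro G _; simp
  · intro t _; simp
  · intro G _
    ext i j
    rw [SimpleGraph.fromRel_adj]
    constructor
    · rintro ⟨-, h | h⟩
      · exact (Finset.mem_filter.mp h).2
      · exact (Finset.mem_filter.mp h).2.symm
    · intro h
      refine ⟨h.ne, ?_⟩
      rcases lt_or_gt_of_ne h.ne with hlt | hlt
      · exact Or.inl (Finset.mem_filter.mpr ⟨by simpa [pairs] using hlt, h⟩)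
      · exact Or.inr (Finset.mem_filter.mpr ⟨by simpa [pairs] using hlt, h.symm⟩)
  · intro t ht
    have hsub : ∀ x ∈ t, x.1 < x.2 := fun x hx => by
      simpa [pairs] using Finset.mem_powerset.mp ht hx
    ext ⟨i, j⟩
    simp only [pairs, Finset.mem_filter, Finset.mem_univ, true_and, SimpleGraph.fromRel_adj]
    constructor
    · rintro ⟨hlt, -, h | h⟩
      · exact h
      · exact absurd (hsub _ h) (not_lt.mpr hlt.le)
    · intro h
      exact ⟨hsub _ h, (hsub _ h).ne, Or.inl h⟩
  · intro G _
    rw [Finset.prod_ite]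
    congr 1
    refine Finset.prod_congr ?_ fun _ _ => rfl
    ext x; simp only [Finset.mem_filter, Finset.mem_sdiff]; tauto

/-- The connection probability of two labels. -/
def labelMean (p q : ℝ) (a c : Fin K) : ℝ := if a = c then p else q

lemma labelMean_comm (p q : ℝ) (a c : Fin K) : labelMean p q a c = labelMean p q c a := by
  unfold labelMean; simp only [eq_comm]

lemma connectivity_eq (p q : ℝ) (a c : Fin K) : connectivity K p q s(a, c) = labelMean p q a c := by
  unfold connectivity labelMean; simp

/-- The likelihood of a network under the true parameters. -/
abbrev graphLik (p q : ℝ) (Zs : Labels n K) (G : SimpleGraph (Fin n)) : ℝ :=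
  likelihood G Zs (connectivity K p q)

-- Independence of the edges: the Laplace transform of a sum over pairs factorises. All exponential
-- moments below are instances.
open Classical in
lemma sum_graphLik_mul_exp (p q : ℝ) (Zs : Labels n K) (f g : Fin n × Fin n → ℝ) :
    ∑ G, graphLik p q Zs G * Real.exp (∑ x ∈ pairs n, if G.Adj x.1 x.2 then f x else g x)
      = ∏ x ∈ pairs n, (labelMean p q (Zs x.1) (Zs x.2) * Real.exp (f x)
        + (1 - labelMean p q (Zs x.1) (Zs x.2)) * Real.exp (g x)) := by
  rw [← sum_graph_prod_pairs]
  refine Finset.sum_congr rfl fun G _ => ?_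
  rw [graphLik, likelihood_eq_prod_pairs, Real.exp_sum, ← Finset.prod_mul_distrib]
  refine Finset.prod_congr rfl fun x _ => ?_
  rw [connectivity_eq]
  split_ifs <;> rfl

lemma labelMean_mem {p q : ℝ} (hq : 0 ≤ q) (hqp : q ≤ p) (a c : Fin K) :
    q ≤ labelMean p q a c ∧ labelMean p q a c ≤ p ∧ 0 ≤ labelMean p q a c := by
  unfold labelMean; split_ifs
  · exact ⟨hqp, le_rfl, hq.trans hqp⟩
  · exact ⟨le_rfl, hqp, hq⟩

lemma graphLik_nonneg {p q : ℝ} (hq : 0 ≤ q) (hqp : q ≤ p) (hp : p ≤ 1) (Zs : Labels n K)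
    (G : SimpleGraph (Fin n)) : 0 ≤ graphLik p q Zs G := by
  classical
  rw [graphLik, likelihood_eq_prod_pairs]
  refine Finset.prod_nonneg fun x _ => ?_
  rw [connectivity_eq]
  have := labelMean_mem hq hqp (Zs x.1) (Zs x.2)
  split_ifs <;> linarith

open Classical in
/-- Probability of an event of networks. -/
def graphProb (p q : ℝ) (Zs : Labels n K) (E : SimpleGraph (Fin n) → Prop) : ℝ :=
  ∑ G, if E G then graphLik p q Zs G else 0

/-- Markov's inequality, with `h` dominating the indicator of the event. -/
lemma graphProb_le_sum {p q : ℝ} (hq : 0 ≤ q) (hqp : q ≤ p) (hp : p ≤ 1) (Zs : Labels n K)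
    (E : SimpleGraph (Fin n) → Prop) (h : SimpleGraph (Fin n) → ℝ) (h0 : ∀ G, 0 ≤ h G)
    (h1 : ∀ G, E G → 1 ≤ h G) : graphProb p q Zs E ≤ ∑ G, graphLik p q Zs G * h G := by
  unfold graphProb
  refine Finset.sum_le_sum fun G _ => ?_
  have := graphLik_nonneg hq hqp hp Zs G
  split_ifs with hE
  · exact le_mul_of_one_le_right this (h1 G hE)
  · exact mul_nonneg this (h0 G)

lemma graphProb_le_sum_of_exists {p q : ℝ} (hq : 0 ≤ q) (hqp : q ≤ p) (hp : p ≤ 1)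
    (Zs : Labels n K) {ι : Type*} (s : Finset ι) (E : SimpleGraph (Fin n) → Prop)
    (F : ι → SimpleGraph (Fin n) → Prop) (hE : ∀ G, E G → ∃ i ∈ s, F i G) :
    graphProb p q Zs E ≤ ∑ i ∈ s, graphProb p q Zs (F i) := by
  classical
  unfold graphProb
  rw [Finset.sum_comm]
  refine Finset.sum_le_sum fun G _ => ?_
  have h0 := graphLik_nonneg hq hqp hp Zs G
  have hnn : ∀ i ∈ s, 0 ≤ if F i G then graphLik p q Zs G else 0 := fun i _ => by
    split_ifs <;> [exact h0; exact le_rfl]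
  split_ifs with h
  · obtain ⟨i, hi, hF⟩ := hE G h
    exact le_trans (by rw [if_pos hF]) (Finset.single_le_sum hnn hi)
  · exact Finset.sum_nonneg hnn

lemma graphProb_mono {p q : ℝ} (hq : 0 ≤ q) (hqp : q ≤ p) (hp : p ≤ 1)
    (Zs : Labels n K) {E F : SimpleGraph (Fin n) → Prop} (h : ∀ G, E G → F G) :
    graphProb p q Zs E ≤ graphProb p q Zs F := by
  have := graphProb_le_sum_of_exists hq hqp hp Zs {()} E (fun _ => F) (fun G hG => ⟨(), by simp, h G hG⟩)
  simpa using this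

lemma graphProb_or_le {p q : ℝ} (hq : 0 ≤ q) (hqp : q ≤ p) (hp : p ≤ 1)
    (Zs : Labels n K) (E F : SimpleGraph (Fin n) → Prop) :
    graphProb p q Zs (fun G => E G ∨ F G) ≤ graphProb p q Zs E + graphProb p q Zs F := by
  have := graphProb_le_sum_of_exists hq hqp hp Zs Finset.univ (fun G => E G ∨ F G)
    (fun b : Bool => if b then E else F) (fun G h => h.elim (fun h => ⟨true, by simp, by simpa⟩)
      (fun h => ⟨false, by simp, by simpa⟩))
  simpa using this

/-! ### The centred network -/

open Classical in
/-- Adjacency indicator. -/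
def adj (G : SimpleGraph (Fin n)) (i j : Fin n) : ℝ := if G.Adj i j then 1 else 0

/-- Mean of the adjacency indicator, zero on the diagonal. -/
def pairMean (p q : ℝ) (Zs : Labels n K) (i j : Fin n) : ℝ :=
  if i = j then 0 else labelMean p q (Zs i) (Zs j)

/-- The centred adjacency indicator. -/
def noise (p q : ℝ) (Zs : Labels n K) (G : SimpleGraph (Fin n)) (i j : Fin n) : ℝ :=
  adj G i j - pairMean p q Zs i j

/-- Sum of the centred adjacency indicators over the ordered pairs in `S × T`. -/
def noiseSum (p q : ℝ) (Zs : Labels n K) (G : SimpleGraph (Fin n)) (S T : Finset (Fin n)) : ℝ :=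
  ∑ i ∈ S, ∑ j ∈ T, noise p q Zs G i j

lemma adj_comm' (G : SimpleGraph (Fin n)) (i j : Fin n) : adj G i j = adj G j i := by
  unfold adj; congr 1; exact propext (G.adj_comm i j)

lemma adj_self (G : SimpleGraph (Fin n)) (i : Fin n) : adj G i i = 0 := by simp [adj]

lemma pairMean_comm (p q : ℝ) (Zs : Labels n K) (i j : Fin n) :
    pairMean p q Zs i j = pairMean p q Zs j i := by
  unfold pairMean; rw [labelMean_comm]; simp only [eq_comm]

lemma noise_comm (p q : ℝ) (Zs : Labels n K) (G : SimpleGraph (Fin n)) (i j : Fin n) :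
    noise p q Zs G i j = noise p q Zs G j i := by
  unfold noise; rw [adj_comm', pairMean_comm]

lemma noise_self (p q : ℝ) (Zs : Labels n K) (G : SimpleGraph (Fin n)) (i : Fin n) :
    noise p q Zs G i i = 0 := by simp [noise, adj_self, pairMean]

lemma exp_sub_one_sub_le (u : ℝ) : Real.exp u - 1 - u ≤ u ^ 2 * Real.exp |u| := by
  have h1 : Real.exp u - 1 ≤ u * Real.exp u := by
    have := Real.add_one_le_exp (-u)
    have h2 : Real.exp u * Real.exp (-u) = 1 := by rw [← Real.exp_add]; simp
    nlinarith [Real.exp_pos u]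
  rcases le_total 0 u with hu | hu
  · rw [abs_of_nonneg hu]
    nlinarith
  · rw [abs_of_nonpos hu]
    have h2 := Real.add_one_le_exp u
    have h3 : 1 ≤ Real.exp (-u) := Real.one_le_exp (by linarith)
    nlinarith [sq_nonneg u]

/-- Poisson-type bound for a centred Bernoulli variable: the variance proxy is proportional to `P`,
which is essential for sparse networks. -/
lemma mean_mul_exp_le {P : ℝ} (u : ℝ) (h0 : 0 ≤ P) :
    P * Real.exp (u * (1 - P)) + (1 - P) * Real.exp (-(u * P))
      ≤ Real.exp (P * (u ^ 2 * Real.exp |u|)) := by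
  have e1 : Real.exp (u * (1 - P)) = Real.exp u * Real.exp (-(u * P)) := by
    rw [← Real.exp_add]; congr 1; ring
  have e2 : P * (Real.exp u * Real.exp (-(u * P))) + (1 - P) * Real.exp (-(u * P))
      = Real.exp (-(u * P)) * (P * (Real.exp u - 1) + 1) := by ring
  rw [e1, e2]
  calc _ ≤ Real.exp (-(u * P)) * Real.exp (P * (Real.exp u - 1)) := by
        gcongr; exact Real.add_one_le_exp _
    _ = Real.exp (P * (Real.exp u - 1 - u)) := by rw [← Real.exp_add]; congr 1; ring
    _ ≤ _ := by gcongr; exact exp_sub_one_sub_le u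

open Classical in
/-- Exponential moments of the noise on a rectangle. -/
lemma sum_graphLik_mul_exp_noiseSum_le {p q : ℝ} (hq : 0 ≤ q) (hqp : q ≤ p) (hp : p ≤ 1)
    (Zs : Labels n K) (S T : Finset (Fin n)) (θ : ℝ) :
    ∑ G, graphLik p q Zs G * Real.exp (θ * noiseSum p q Zs G S T)
      ≤ Real.exp (2 * p * θ ^ 2 * Real.exp (2 * |θ|) * (S.card * T.card)) := by
  -- A pair is counted once or twice, according to whether one or both of its orientations lie in `S
  -- × T`. Hence the weight at most two, and the `2 * |θ|` in the exponent.
  set w : Fin n → Fin n → ℝ := fun i j =>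
    (if i ∈ S ∧ j ∈ T then 1 else 0) + (if j ∈ S ∧ i ∈ T then 1 else 0) with hw
  have hws : ∀ i j, w i j = w j i := fun i j => by simp only [hw]; ring
  have hw0 : ∀ i j, 0 ≤ w i j := fun i j => by
    simp only [hw]; split_ifs <;> norm_num
  have hw2 : ∀ i j, w i j ≤ 2 := fun i j => by
    simp only [hw]; split_ifs <;> norm_num
  have hST : ∀ f : Fin n → Fin n → ℝ, ∑ i, ∑ j, (if i ∈ S ∧ j ∈ T then f i j else 0)
      = ∑ i ∈ S, ∑ j ∈ T, f i j := fun f => by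
    have : ∀ i, ∑ j, (if i ∈ S ∧ j ∈ T then f i j else 0)
        = if i ∈ S then ∑ j ∈ T, f i j else 0 := fun i => by
      by_cases hi : i ∈ S <;> simp [hi]
    simp_rw [this]; simp
  have hdouble : ∀ f : Fin n → Fin n → ℝ, (∀ i j, f i j = f j i) →
      ∑ i, ∑ j, w i j * f i j = 2 * ∑ i ∈ S, ∑ j ∈ T, f i j := fun f hf => by
    have e1 : ∑ i, ∑ j, w i j * f i j = (∑ i, ∑ j, if i ∈ S ∧ j ∈ T then f i j else 0)
        + ∑ i, ∑ j, if j ∈ S ∧ i ∈ T then f i j else 0 := by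
      simp_rw [← Finset.sum_add_distrib]
      refine Finset.sum_congr rfl fun i _ => Finset.sum_congr rfl fun j _ => ?_
      simp only [hw]; split_ifs <;> ring
    have e2 : ∑ i, ∑ j, (if j ∈ S ∧ i ∈ T then f i j else 0) = ∑ i ∈ S, ∑ j ∈ T, f i j := by
      rw [Finset.sum_comm, ← hST f]
      refine Finset.sum_congr rfl fun i _ => Finset.sum_congr rfl fun j _ => ?_
      rw [hf j i]
    rw [e1, e2, hST]; ring
  have hsum : ∀ G, θ * noiseSum p q Zs G S T = ∑ x ∈ pairs n,
      if G.Adj x.1 x.2 then θ * w x.1 x.2 * (1 - labelMean p q (Zs x.1) (Zs x.2))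
        else -(θ * w x.1 x.2 * labelMean p q (Zs x.1) (Zs x.2)) := by
    intro G
    have e := two_mul_sum_pairs (fun i j => w i j * noise p q Zs G i j)
      (fun i j => by rw [hws, noise_comm]) (fun i => by rw [noise_self, mul_zero])
    rw [hdouble _ (noise_comm p q Zs G)] at e
    have e' : noiseSum p q Zs G S T = ∑ x ∈ pairs n, w x.1 x.2 * noise p q Zs G x.1 x.2 := by
      unfold noiseSum; linarith
    rw [e', Finset.mul_sum]
    refine Finset.sum_congr rfl fun x hx => ?_
    have hne : x.1 ≠ x.2 := ne_of_lt (by simpa [pairs] using hx)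
    simp only [noise, adj, pairMean, if_neg hne]
    split_ifs <;> ring
  simp_rw [hsum]
  rw [sum_graphLik_mul_exp]
  have hwsum : ∑ x ∈ pairs n, w x.1 x.2 ≤ S.card * T.card := by
    have e := two_mul_sum_pairs (fun i j => w i j * (if i = j then 0 else 1))
      (fun i j => by rw [hws]; simp only [eq_comm]) (fun i => by simp)
    rw [hdouble _ (fun i j => by simp only [eq_comm])] at e
    have e1 : ∑ x ∈ pairs n, w x.1 x.2 = ∑ x ∈ pairs n, w x.1 x.2 * (if x.1 = x.2 then 0 else 1) :=
      Finset.sum_congr rfl fun x hx => by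
        have hne : x.1 ≠ x.2 := ne_of_lt (by simpa [pairs] using hx)
        rw [if_neg hne, mul_one]
    have e2 : ∑ i ∈ S, ∑ j ∈ T, (if i = j then (0 : ℝ) else 1) ≤ S.card * T.card := by
      calc _ ≤ ∑ i ∈ S, ∑ j ∈ T, (1 : ℝ) := Finset.sum_le_sum fun i _ =>
            Finset.sum_le_sum fun j _ => by split_ifs <;> norm_num
        _ = _ := by simp
    rw [e1]; linarith
  calc _ ≤ ∏ x ∈ pairs n, Real.exp (2 * p * θ ^ 2 * Real.exp (2 * |θ|) * w x.1 x.2) := by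
        refine Finset.prod_le_prod (fun x _ => ?_) fun x _ => ?_
        · have := labelMean_mem hq hqp (Zs x.1) (Zs x.2)
          have h1 : 0 ≤ 1 - labelMean p q (Zs x.1) (Zs x.2) := by linarith
          have h2 := this.2.2
          positivity
        · have hm := labelMean_mem hq hqp (Zs x.1) (Zs x.2)
          refine (mean_mul_exp_le (θ * w x.1 x.2) hm.2.2).trans (Real.exp_le_exp.mpr ?_)
          have a0 := hw0 x.1 x.2
          have a2 := hw2 x.1 x.2
          have hexp : Real.exp |θ * w x.1 x.2| ≤ Real.exp (2 * |θ|) := by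
            rw [Real.exp_le_exp, abs_mul, abs_of_nonneg a0, mul_comm]
            exact mul_le_mul_of_nonneg_right a2 (abs_nonneg _)
          calc labelMean p q (Zs x.1) (Zs x.2) * ((θ * w x.1 x.2) ^ 2 * Real.exp |θ * w x.1 x.2|)
              ≤ p * ((θ * w x.1 x.2) ^ 2 * Real.exp (2 * |θ|)) := by
                gcongr
                · exact hm.2.2.trans hm.2.1
                · exact hm.2.1
            _ = p * θ ^ 2 * Real.exp (2 * |θ|) * (w x.1 x.2 * w x.1 x.2) := by ring
            _ ≤ p * θ ^ 2 * Real.exp (2 * |θ|) * (2 * w x.1 x.2) := by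
                have : 0 ≤ p := hq.trans hqp
                gcongr
            _ = _ := by ring
    _ = Real.exp (2 * p * θ ^ 2 * Real.exp (2 * |θ|) * ∑ x ∈ pairs n, w x.1 x.2) := by
        rw [← Real.exp_sum, Finset.mul_sum]
    _ ≤ _ := by
        have : 0 ≤ p := hq.trans hqp
        gcongr

/-- Tail bound for the noise on a rectangle. -/
lemma graphProb_noiseSum_le {p q : ℝ} (hq : 0 ≤ q) (hqp : q ≤ p) (hp : p ≤ 1)
    (Zs : Labels n K) (S T : Finset (Fin n)) {θ : ℝ} (hθ : 0 ≤ θ) (t : ℝ) :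
    graphProb p q Zs (fun G => t ≤ |noiseSum p q Zs G S T|)
      ≤ 2 * Real.exp (2 * p * θ ^ 2 * Real.exp (2 * θ) * (S.card * T.card) - θ * t) := by
  have one : ∀ ε : ℝ, |ε| = 1 → graphProb p q Zs (fun G => t ≤ ε * noiseSum p q Zs G S T)
      ≤ Real.exp (2 * p * θ ^ 2 * Real.exp (2 * θ) * (S.card * T.card) - θ * t) := by
    intro ε hε
    have hsq : ε ^ 2 = 1 := by rw [← sq_abs, hε, one_pow]
    calc _ ≤ ∑ G, graphLik p q Zs G *
          (Real.exp (-(θ * t)) * Real.exp ((θ * ε) * noiseSum p q Zs G S T)) := by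
          refine graphProb_le_sum hq hqp hp Zs _ _ (fun G => by positivity) fun G hG => ?_
          rw [← Real.exp_add]
          refine Real.one_le_exp ?_
          nlinarith [mul_le_mul_of_nonneg_left hG hθ]
      _ = Real.exp (-(θ * t)) * ∑ G, graphLik p q Zs G *
          Real.exp ((θ * ε) * noiseSum p q Zs G S T) := by
          rw [Finset.mul_sum]; exact Finset.sum_congr rfl fun G _ => by ring
      _ ≤ Real.exp (-(θ * t)) *
          Real.exp (2 * p * (θ * ε) ^ 2 * Real.exp (2 * |θ * ε|) * (S.card * T.card)) := by
          gcongr; exact sum_graphLik_mul_exp_noiseSum_le hq hqp hp Zs S T _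
      _ = _ := by
          rw [← Real.exp_add, abs_mul, hε, mul_one, abs_of_nonneg hθ, mul_pow, hsq, mul_one]
          congr 1; ring
  calc _ ≤ graphProb p q Zs (fun G => t ≤ 1 * noiseSum p q Zs G S T ∨
        t ≤ -1 * noiseSum p q Zs G S T) := by
        refine graphProb_mono hq hqp hp Zs fun G hG => ?_
        rcases le_abs.mp hG with h | h
        · left; linarith
        · right; linarith
    _ ≤ _ := graphProb_or_le hq hqp hp Zs _ _
    _ ≤ _ := by
        have a := one 1 (by simp)
        have b := one (-1) (by simp)
        linarith

end GraphSums

/-- Transfer to a random network on a probability space. -/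
lemma IsSample.measureReal_le {Ω : Type*} [MeasurableSpace Ω] {n K : ℕ} {μ : Measure Ω}
    [IsProbabilityMeasure μ] {p q : ℝ} (hq : 0 ≤ q) (hqp : q ≤ p) (hp : p ≤ 1) {Zs : Labels n K}
    {A : Ω → SimpleGraph (Fin n)} (hA : IsSample μ p q Zs A) (E : SimpleGraph (Fin n) → Prop) :
    MeasurableSet {ω | E (A ω)} ∧ μ.real {ω | E (A ω)} = graphProb p q Zs E := by
  classical
  have hset : {ω | E (A ω)} = ⋃ G ∈ Finset.univ.filter E, A ⁻¹' {G} := by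
    ext ω; simp
  constructor
  · rw [hset]
    exact Finset.measurableSet_biUnion _ fun G _ => (hA G).1
  · rw [hset, measureReal_biUnion_finset]
    · unfold graphProb
      rw [Finset.sum_filter]
      refine Finset.sum_congr rfl fun G _ => ?_
      rw [Measure.real, (hA G).2, ENNReal.toReal_ofReal (graphLik_nonneg hq hqp hp Zs G)]
    · intro G _ G' _ hne
      exact Disjoint.preimage _ (by simpa using hne)
    · exact fun G _ => (hA G).1

end

end SBM

namespace SBM

noncomputable section

/-! ### The Bernoulli log-likelihood -/

/-- The (cross-entropy) log-likelihood of the parameter `B` at the observation `t`. -/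
def bernLog (t B : ℝ) : ℝ := t * Real.log B + (1 - t) * Real.log (1 - B)

/-- The log-odds. -/
def logOdds (B : ℝ) : ℝ := Real.log B - Real.log (1 - B)

/-- The log-likelihood is affine in the observation. This splits every gain into a part at the mean
and a part linear in the noise. -/
lemma bernLog_eq (t m B : ℝ) : bernLog t B = bernLog m B + (t - m) * logOdds B := by
  unfold bernLog logOdds; ring

lemma log_sub_log_le {x y : ℝ} (hx : 0 < x) (hy : 0 < y) :
    Real.log x - Real.log y ≤ (x - y) / y := by
  rw [← Real.log_div hx.ne' hy.ne']
  have := Real.log_le_sub_one_of_pos (div_pos hx hy)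
  have e : (x - y) / y = x / y - 1 := by field_simp
  linarith

/-- Concavity: both logarithms lie below their tangents at `y`. At `y = m` the bound vanishes, which
is Gibbs' inequality. -/
lemma bernLog_sub_le {m x y : ℝ} (hm0 : 0 ≤ m) (hm1 : m ≤ 1) (hx0 : 0 < x) (hx1 : x < 1)
    (hy0 : 0 < y) (hy1 : y < 1) :
    bernLog m x - bernLog m y ≤ (x - y) * (m - y) / (y * (1 - y)) := by
  have h1 := log_sub_log_le hx0 hy0
  have h2 := log_sub_log_le (sub_pos.mpr hx1) (sub_pos.mpr hy1)
  have h3 : (x - y) * (m - y) / (y * (1 - y))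
      = m * ((x - y) / y) + (1 - m) * ((1 - x - (1 - y)) / (1 - y)) := by
    have := sub_pos.mpr hy1
    field_simp; ring
  rw [h3]
  unfold bernLog
  nlinarith [mul_le_mul_of_nonneg_left h1 hm0,
    mul_le_mul_of_nonneg_left h2 (sub_nonneg.mpr hm1)]

/-- Lipschitz bound for the log-likelihood with parameters of order `l`. -/
lemma abs_bernLog_sub_le {m x y l : ℝ} (hm0 : 0 ≤ m) (hm1 : m ≤ 1) (hl : 0 < l) (hx0 : l ≤ x)
    (hx1 : x ≤ 3 / 4) (hy0 : l ≤ y) (hy1 : y ≤ 3 / 4) :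
    |bernLog m x - bernLog m y| ≤ 4 / l * |x - y| * (|m - x| + |m - y|) := by
  have key : ∀ x y : ℝ, l ≤ x → x ≤ 3 / 4 → l ≤ y → y ≤ 3 / 4 →
      bernLog m x - bernLog m y ≤ 4 / l * |x - y| * |m - y| := by
    intro x y hx0 hx1 hy0 hy1
    refine (bernLog_sub_le hm0 hm1 (by linarith) (by linarith) (by linarith)
      (by linarith)).trans ?_
    have h1 : l / 4 ≤ y * (1 - y) := by nlinarith
    calc (x - y) * (m - y) / (y * (1 - y)) ≤ |x - y| * |m - y| / (y * (1 - y)) := by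
          refine div_le_div_of_nonneg_right ?_ (by linarith)
          rw [← abs_mul]; exact le_abs_self _
      _ ≤ |x - y| * |m - y| / (l / 4) := by gcongr
      _ = _ := by field_simp
  rw [abs_le]
  have a := key x y hx0 hx1 hy0 hy1
  have b := key y x hy0 hy1 hx0 hx1
  rw [abs_sub_comm y x] at b
  have c1 : 0 ≤ 4 / l * |x - y| * |m - x| := by positivity
  have c2 : 0 ≤ 4 / l * |x - y| * |m - y| := by positivity
  constructor <;> linarith

lemma abs_logOdds_sub_le {x y l : ℝ} (hl : 0 < l) (hx0 : l ≤ x)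
    (hx1 : x ≤ 3 / 4) (hy0 : l ≤ y) (hy1 : y ≤ 3 / 4) :
    |logOdds x - logOdds y| ≤ 4 / l * |x - y| := by
  have key : ∀ x y : ℝ, l ≤ x → x ≤ 3 / 4 → l ≤ y → y ≤ 3 / 4 →
      logOdds x - logOdds y ≤ 4 / l * |x - y| := by
    intro x y hx0 hx1 hy0 hy1
    have h1 := log_sub_log_le (x := x) (y := y) (by linarith) (by linarith)
    have h2 := log_sub_log_le (x := 1 - y) (y := 1 - x) (by linarith) (by linarith)
    have e : (1 - y - (1 - x)) / (1 - x) = (x - y) / (1 - x) := by congr 1; ring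
    rw [e] at h2
    unfold logOdds
    rcases le_total x y with h | h
    · have a1 : (x - y) / y ≤ 0 := div_nonpos_of_nonpos_of_nonneg (by linarith) (by linarith)
      have a2 : (x - y) / (1 - x) ≤ 0 := div_nonpos_of_nonpos_of_nonneg (by linarith) (by linarith)
      have a3 : 0 ≤ 4 / l * |x - y| := by positivity
      linarith
    · have hxy : 0 ≤ x - y := by linarith
      rw [abs_of_nonneg hxy]
      have a1 : (x - y) / y ≤ (x - y) / l := by gcongr
      have a2 : (x - y) / (1 - x) ≤ (x - y) / (l / 3) := by
        gcongr
        · nlinarith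
      have a3 : (x - y) / l + (x - y) / (l / 3) = 4 / l * (x - y) := by field_simp; ring
      linarith
  rw [abs_le]
  have a := key x y hx0 hx1 hy0 hy1
  have b := key y x hy0 hy1 hx0 hx1
  rw [abs_sub_comm y x] at b
  constructor <;> linarith

/-- If `x` lies between `y` and `m`, the parameter `x` fits the observation `m` better than `y`. -/
lemma le_bernLog_sub {m x y u : ℝ} (hm0 : 0 < m) (hm1 : m ≤ 3 / 4) (hx0 : 0 < x) (hx1 : x ≤ 3 / 4)
    (hy0 : 0 < y) (hy1 : y ≤ 3 / 4) (hxu : x ≤ u) (hyu : y ≤ u) (hmxy : 0 ≤ (m - x) * (x - y)) :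
    (x - y) * (2 * m - x - y) / (4 * u) ≤ bernLog m x - bernLog m y := by
  -- The tangent at `x` would give nothing when `x = m`. Passing through the midpoint keeps a
  -- quadratic gain on the half from `y` to `z`, while the half from `z` to `x` is not a loss.
  set z := (x + y) / 2 with hz
  have hz0 : 0 < z := by rw [hz]; linarith
  have hz1 : z ≤ 3 / 4 := by rw [hz]; linarith
  have hzu : z ≤ u := by rw [hz]; linarith
  have h1 := bernLog_sub_le hm0.le (by linarith) hz0 (by linarith) hx0 (by linarith)
  have h2 := bernLog_sub_le hm0.le (by linarith) hy0 (by linarith) hz0 (by linarith)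
  have h3 : (z - x) * (m - x) / (x * (1 - x)) ≤ 0 := by
    refine div_nonpos_of_nonpos_of_nonneg ?_ (by nlinarith)
    rw [hz]; nlinarith
  have h4 : (y - z) * (m - z) / (z * (1 - z)) ≤ (y - z) * (m - z) / u := by
    have hneg : (y - z) * (m - z) ≤ 0 := by rw [hz]; nlinarith [sq_nonneg (x - y)]
    have hzz : z * (1 - z) ≤ u := by nlinarith
    have hpos : 0 < z * (1 - z) := by nlinarith
    rw [div_le_div_iff₀ hpos (by linarith)]
    nlinarith
  have e : (y - z) * (m - z) / u = -((x - y) * (2 * m - x - y) / (4 * u)) := by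
    have : u ≠ 0 := by linarith
    rw [hz]; field_simp; ring
  linarith

/-! ### Ideal gains of correcting one label -/

section Ideal

variable {n K : ℕ}

/-- Log-likelihood ratio of the true label of `v` against the label `b`, when all other labels and
the connectivity are known. -/
def idealGain (p q : ℝ) (Zs : Labels n K) (G : SimpleGraph (Fin n)) (v : Fin n) (b : Fin K) : ℝ :=
  ∑ j ∈ Finset.univ.erase v, (bernLog (adj G v j) (labelMean p q (Zs v) (Zs j))
    - bernLog (adj G v j) (labelMean p q b (Zs j)))

/-- The exponent `1 / 2` turns `x * exp (-log (x / y) / 2)` into the geometric mean, so the mean of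
the square root of the likelihood ratio is the Hellinger affinity. -/
lemma half_affinity {x y : ℝ} (hx0 : 0 < x) (hx1 : x < 1) (hy0 : 0 < y) (hy1 : y < 1) :
    x * Real.exp (-((bernLog 1 x - bernLog 1 y) / 2))
      + (1 - x) * Real.exp (-((bernLog 0 x - bernLog 0 y) / 2))
      = √(x * y) + √((1 - x) * (1 - y)) := by
  have key : ∀ x y : ℝ, 0 < x → 0 < y →
      x * Real.exp (-((Real.log x - Real.log y) / 2)) = √(x * y) := by
    intro x y hx hy
    rw [Real.sqrt_eq_rpow, Real.rpow_def_of_pos (mul_pos hx hy), Real.log_mul hx.ne' hy.ne']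
    nth_rewrite 1 [← Real.exp_log hx]
    rw [← Real.exp_add]; congr 1; ring
  have h1 := key x y hx0 hy0
  have h2 := key (1 - x) (1 - y) (by linarith) (by linarith)
  have e1 : bernLog 1 x - bernLog 1 y = Real.log x - Real.log y := by unfold bernLog; ring
  have e0 : bernLog 0 x - bernLog 0 y = Real.log (1 - x) - Real.log (1 - y) := by
    unfold bernLog; ring
  rw [e1, e0, h1, h2]

lemma affinity_pos {p q : ℝ} (hq : 0 < q) (hp : 0 < p) :
    0 < √(p * q) + √((1 - p) * (1 - q)) := by
  have : 0 < √(p * q) := Real.sqrt_pos.mpr (mul_pos hp hq)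
  have := Real.sqrt_nonneg ((1 - p) * (1 - q))
  linarith

lemma exp_neg_renyi {p q : ℝ} (hq : 0 < q) (hp : 0 < p) :
    Real.exp (-(renyi p q / 2)) = √(p * q) + √((1 - p) * (1 - q)) := by
  unfold renyi
  rw [show -(-2 * Real.log (√(p * q) + √((1 - p) * (1 - q))) / 2)
    = Real.log (√(p * q) + √((1 - p) * (1 - q))) by ring, Real.exp_log (affinity_pos hq hp)]

/-- A neighbour outside the communities `a` and `b` is linked with probability `q` under both
hypotheses and carries no information. -/
lemma affinity_label {p q : ℝ} (hq : 0 < q) (hqp : q ≤ p) (hp : p < 1) {a b : Fin K} (hab : a ≠ b)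
    (c : Fin K) :
    √(labelMean p q a c * labelMean p q b c)
        + √((1 - labelMean p q a c) * (1 - labelMean p q b c))
      = if c = a ∨ c = b then Real.exp (-(renyi p q / 2)) else 1 := by
  have hp0 : 0 < p := lt_of_lt_of_le hq hqp
  rw [exp_neg_renyi hq hp0]
  unfold labelMean
  by_cases ha : a = c
  · subst ha
    simp [Ne.symm hab]
  · by_cases hb : b = c
    · subst hb
      simp [hab, mul_comm q p, mul_comm (1 - q)]
    · simp only [if_neg ha, if_neg hb, Ne.symm ha, Ne.symm hb, or_self, if_false]
      rw [Real.sqrt_mul_self hq.le, Real.sqrt_mul_self (by linarith)]; ring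

open Classical in
/-- The Hellinger affinity of the two labelings of `v`. -/
lemma sum_graphLik_mul_exp_idealGain {p q : ℝ} (hq : 0 < q) (hqp : q ≤ p) (hp : p < 1)
    (Zs : Labels n K) (v : Fin n) {b : Fin K} (hb : b ≠ Zs v) :
    ∑ G, graphLik p q Zs G * Real.exp (-(idealGain p q Zs G v b / 2))
      = Real.exp (-(renyi p q / 2)) ^
        ((Finset.univ.erase v).filter fun j => Zs j = Zs v ∨ Zs j = b).card := by
  set r : ℝ → Fin n → ℝ := fun t j => -((bernLog t (labelMean p q (Zs v) (Zs j))
    - bernLog t (labelMean p q b (Zs j))) / 2) with hr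
  -- The ideal gain only involves the pairs that contain `v`; this rewrites a sum over such pairs as
  -- a sum over the other nodes.
  have hpairs : ∀ f : Fin n → ℝ, ∑ x ∈ pairs n, (if x.1 = v then f x.2 else if x.2 = v then f x.1 else 0)
      = ∑ j ∈ Finset.univ.erase v, f j := by
    intro f
    have e := two_mul_sum_pairs (fun i j => if i = j then 0 else if i = v then f j
      else if j = v then f i else 0) (fun i j => by
        by_cases hij : i = j
        · simp [hij]
        · by_cases hi : i = v
          · have hj : j ≠ v := fun h => hij (hi.trans h.symm)
            simp [hi, hj, Ne.symm hj]
          · simp [hij, Ne.symm hij, hi]) (fun i => by simp)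
    have e1 : ∑ x ∈ pairs n, (if x.1 = x.2 then 0 else if x.1 = v then f x.2 else
        if x.2 = v then f x.1 else 0) = ∑ x ∈ pairs n, (if x.1 = v then f x.2 else
        if x.2 = v then f x.1 else 0) := Finset.sum_congr rfl fun x hx => by
      have hne : x.1 ≠ x.2 := ne_of_lt (by simpa [pairs] using hx)
      rw [if_neg hne]
    rw [e1] at e
    have e2 : ∑ i, ∑ j, (if i = j then 0 else if i = v then f j else if j = v then f i else 0)
        = ∑ i, ∑ j, ((if i = v then (if j = v then 0 else f j) else 0)
          + (if j = v then (if i = v then 0 else f i) else 0)) := by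
      refine Finset.sum_congr rfl fun i _ => Finset.sum_congr rfl fun j _ => ?_
      by_cases hi : i = v
      · by_cases hj : j = v
        · simp [hi, hj]
        · simp [hi, hj, Ne.symm hj]
      · by_cases hj : j = v
        · simp [hi, hj]
        · simp [hi, hj]
    have e3 : ∑ j ∈ Finset.univ.erase v, f j = ∑ j, if j = v then 0 else f j := by
      rw [← Finset.filter_ne', Finset.sum_filter]
      exact Finset.sum_congr rfl fun j _ => by by_cases h : j = v <;> simp [h]
    rw [e2] at e
    simp_rw [Finset.sum_add_distrib] at e
    rw [Finset.sum_comm (f := fun i j => if i = v then (if j = v then 0 else f j) else 0)] at e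
    simp only [Finset.sum_ite_eq', Finset.mem_univ, if_true] at e
    rw [e3]; linarith
  have hexp : ∀ G, -(idealGain p q Zs G v b / 2) = ∑ x ∈ pairs n,
      if G.Adj x.1 x.2 then (if x.1 = v then r 1 x.2 else if x.2 = v then r 1 x.1 else 0)
        else (if x.1 = v then r 0 x.2 else if x.2 = v then r 0 x.1 else 0) := by
    intro G
    have e : ∑ x ∈ pairs n, (if G.Adj x.1 x.2 then
        (if x.1 = v then r 1 x.2 else if x.2 = v then r 1 x.1 else 0)
        else (if x.1 = v then r 0 x.2 else if x.2 = v then r 0 x.1 else 0))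
        = ∑ x ∈ pairs n, (if x.1 = v then r (adj G v x.2) x.2 else
          if x.2 = v then r (adj G v x.1) x.1 else 0) := by
      refine Finset.sum_congr rfl fun x _ => ?_
      by_cases h1 : x.1 = v
      · simp only [h1, if_true, adj]; split_ifs <;> rfl
      · by_cases h2 : x.2 = v
        · simp only [h2, h1, if_true, if_false, adj, G.adj_comm v x.1]; split_ifs <;> rfl
        · simp [h1, h2]
    rw [e, hpairs (fun j => r (adj G v j) j), idealGain, Finset.sum_div, ← Finset.sum_neg_distrib]
  simp_rw [hexp]
  rw [sum_graphLik_mul_exp]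
  have hfac : ∀ x ∈ pairs n, labelMean p q (Zs x.1) (Zs x.2) * Real.exp
        (if x.1 = v then r 1 x.2 else if x.2 = v then r 1 x.1 else 0)
      + (1 - labelMean p q (Zs x.1) (Zs x.2)) * Real.exp
        (if x.1 = v then r 0 x.2 else if x.2 = v then r 0 x.1 else 0)
      = Real.exp (if x.1 = v then (if Zs x.2 = Zs v ∨ Zs x.2 = b then -(renyi p q / 2) else 0)
        else if x.2 = v then (if Zs x.1 = Zs v ∨ Zs x.1 = b then -(renyi p q / 2) else 0)
        else 0) := by
    have hone : ∀ j, labelMean p q (Zs v) (Zs j) * Real.exp (r 1 j)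
        + (1 - labelMean p q (Zs v) (Zs j)) * Real.exp (r 0 j)
        = Real.exp (if Zs j = Zs v ∨ Zs j = b then -(renyi p q / 2) else 0) := by
      intro j
      have m1 := labelMean_mem hq.le hqp (Zs v) (Zs j)
      have m2 := labelMean_mem hq.le hqp b (Zs j)
      rw [half_affinity (by linarith) (by linarith) (by linarith) (by linarith),
        affinity_label hq hqp hp (Ne.symm hb)]
      split_ifs <;> simp
    intro x _
    by_cases h1 : x.1 = v
    · simp only [h1, if_true]; exact hone x.2
    · by_cases h2 : x.2 = v
      · simp only [h2, h1, if_true, if_false]; rw [labelMean_comm]; exact hone x.1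
      · simp [h1, h2]
  rw [Finset.prod_congr rfl hfac, ← Real.exp_sum,
    hpairs (fun j => if Zs j = Zs v ∨ Zs j = b then -(renyi p q / 2) else 0),
    ← Finset.sum_filter, Finset.sum_const, nsmul_eq_mul, Real.exp_nat_mul]

end Ideal

end

end SBM

namespace SBM

noncomputable section

/-! ### Signal strength -/

/-- Sparse connection probabilities of the same order. -/
structure Regime (C₀ : ℝ) (p q : ℝ) : Prop where
  q_pos : 0 < q
  lt : q < p
  le : p ≤ 1 / 4
  ratio : p ≤ C₀ * q

/-- The signal-to-noise ratio of one node. -/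
def snr (n : ℕ) (p q : ℝ) : ℝ := n * (p - q) ^ 2 / p

/-- The order of the fluctuations of an estimated block density. -/
def fluct (n : ℕ) (p : ℝ) : ℝ := √(n * p) / n

lemma Regime.p_pos {C₀ p q : ℝ} (h : Regime C₀ p q) : 0 < p := h.q_pos.trans h.lt

lemma Regime.snr_le {C₀ p q : ℝ} (h : Regime C₀ p q) (n : ℕ) : snr n p q ≤ n * p := by
  unfold snr
  have hp := h.p_pos
  have hq := h.q_pos
  have hlt := h.lt
  rw [div_le_iff₀ hp]
  have : (p - q) ^ 2 ≤ p ^ 2 := by nlinarith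
  nlinarith [show (0 : ℝ) ≤ n by positivity]

lemma Regime.snr_le_nat {C₀ p q : ℝ} (h : Regime C₀ p q) (n : ℕ) : snr n p q ≤ n := by
  have h1 := h.snr_le n
  have h2 := h.le
  nlinarith [show (0 : ℝ) ≤ n by positivity]

lemma snr_nonneg {C₀ p q : ℝ} (h : Regime C₀ p q) (n : ℕ) : 0 ≤ snr n p q := by
  have := h.p_pos
  unfold snr; positivity

lemma fluct_nonneg (n : ℕ) (p : ℝ) : 0 ≤ fluct n p := by unfold fluct; positivity

/-- In units of the fluctuation of a block density, the gap `p - q` measures `√snr`. -/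
lemma fluct_mul_sqrt_snr {C₀ p q : ℝ} (h : Regime C₀ p q) {n : ℕ} (hn : 0 < n) :
    fluct n p * √(snr n p q) = p - q := by
  have hp := h.p_pos
  have hg : 0 ≤ p - q := by linarith [h.lt]
  have hn' : (0 : ℝ) < n := by exact_mod_cast hn
  unfold fluct snr
  rw [div_mul_eq_mul_div, ← Real.sqrt_mul (by positivity)]
  have : (n : ℝ) * p * (n * (p - q) ^ 2 / p) = (n * (p - q)) ^ 2 := by field_simp
  rw [this, Real.sqrt_sq (by positivity)]
  field_simp

lemma fluct_mul_sqrt {p : ℝ} (hp : 0 ≤ p) {n : ℕ} (hn : 0 < n) : fluct n p * √(n * p) = p := by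
  have hn' : (0 : ℝ) < n := by exact_mod_cast hn
  unfold fluct
  rw [div_mul_eq_mul_div, Real.mul_self_sqrt (by positivity)]
  field_simp

/-- With a large signal-to-noise ratio, fluctuations are small compared to `p - q`. -/
lemma fluct_le {C₀ p q : ℝ} (h : Regime C₀ p q) {n : ℕ} (hn : 0 < n) {δ : ℝ} (hδ : 0 < δ)
    (hsnr : (1 / δ) ^ 2 ≤ snr n p q) : fluct n p ≤ δ * (p - q) := by
  have h1 : 1 / δ ≤ √(snr n p q) := Real.le_sqrt_of_sq_le hsnr
  have h2 := fluct_mul_sqrt_snr h hn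
  have h3 := mul_le_mul_of_nonneg_left h1 (fluct_nonneg n p)
  rw [h2, mul_one_div, div_le_iff₀ hδ] at h3
  linarith

/-! ### Estimated block densities -/

section Blocks

variable {n K : ℕ}

/-- The posterior mean of the connectivity of the labels `a` and `c`, given all nodes but `v`. -/
def blockMean (κ₁ κ₂ : ℝ) (G : SimpleGraph (Fin n)) (Z : Labels n K) (v : Fin n)
    (a c : Fin K) : ℝ :=
  (κ₁ + offEdges G Z v s(a, c))
    / (κ₁ + κ₂ + offEdges G Z v s(a, c) + offNonEdges G Z v s(a, c))

/-- Number of ordered pairs of distinct nodes in `S × T`. -/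
def offDiag (S T : Finset (Fin n)) : ℝ := ∑ i ∈ S, ∑ j ∈ T, if i = j then 0 else 1

lemma le_offDiag (S T : Finset (Fin n)) :
    (S.card : ℝ) * (T.card - 1) ≤ offDiag S T := by
  unfold offDiag
  have : ∀ i ∈ S, (T.card : ℝ) - 1 ≤ ∑ j ∈ T, if i = j then (0 : ℝ) else 1 := by
    intro i _
    have e : ∑ j ∈ T, (if i = j then (0 : ℝ) else 1) = T.card - ∑ j ∈ T, if i = j then (1 : ℝ) else 0 := by
      rw [Finset.cast_card, ← Finset.sum_sub_distrib]
      exact Finset.sum_congr rfl fun j _ => by split_ifs <;> norm_num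
    rw [e, Finset.sum_ite_eq]
    split_ifs <;> linarith
  calc (S.card : ℝ) * (T.card - 1) = ∑ i ∈ S, ((T.card : ℝ) - 1) := by
        rw [Finset.sum_const, nsmul_eq_mul]
    _ ≤ _ := Finset.sum_le_sum this

open Classical in
lemma mult_mul_pairCount {Z : Labels n K} (a c : Fin K) (R : Fin n → Fin n → Prop)
    (hR : ∀ i j, R i j ↔ R j i) :
    mult a c * (pairCount (fun i j => s(Z i, Z j) = s(a, c) ∧ R i j) : ℝ)
      = ∑ i ∈ labelClass Z a, ∑ j ∈ labelClass Z c, if i ≠ j ∧ R i j then 1 else 0 := by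
  rw [← mult_mul_sum_pairs Z a c _ (fun i j => by rw [hR i j]; simp only [ne_comm]) (fun i => by simp),
    pairCount_eq_sum]
  congr 1
  refine Finset.sum_congr rfl fun x hx => ?_
  have : x.1 ≠ x.2 := ne_of_lt (by simpa [pairs] using hx)
  by_cases h : s(Z x.1, Z x.2) = s(a, c) <;> simp [h, this]

open Classical in
lemma mult_mul_offNode {Z : Labels n K} (v : Fin n) (a c : Fin K) (R : Fin n → Fin n → Prop)
    (hR : ∀ i j, R i j ↔ R j i) :
    mult a c * (pairCount (offNode v fun i j => s(Z i, Z j) = s(a, c) ∧ R i j) : ℝ)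
      = ∑ i ∈ (labelClass Z a).erase v, ∑ j ∈ (labelClass Z c).erase v,
        if i ≠ j ∧ R i j then 1 else 0 := by
  have e : (offNode v fun i j => s(Z i, Z j) = s(a, c) ∧ R i j)
      = fun i j => s(Z i, Z j) = s(a, c) ∧ (i ≠ v ∧ j ≠ v ∧ R i j) := by
    funext i j; unfold offNode; exact propext (by tauto)
  rw [e, mult_mul_pairCount a c _ (fun i j => by rw [hR i j]; tauto)]
  rw [← Finset.filter_ne', Finset.sum_filter]
  refine Finset.sum_congr rfl fun i _ => ?_
  rw [← Finset.filter_ne', Finset.sum_filter]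
  by_cases hi : i = v
  · simp [hi]
  · simp only [hi, ne_eq, not_false_eq_true, true_and, if_true]
    refine Finset.sum_congr rfl fun j _ => ?_
    by_cases hj : j = v <;> simp [hj]

lemma mult_mul_offEdges (p q : ℝ) (Zs : Labels n K) (G : SimpleGraph (Fin n)) (Z : Labels n K)
    (v : Fin n) (a c : Fin K) :
    mult a c * (offEdges G Z v s(a, c) : ℝ)
      = (∑ i ∈ (labelClass Z a).erase v, ∑ j ∈ (labelClass Z c).erase v, pairMean p q Zs i j)
        + noiseSum p q Zs G ((labelClass Z a).erase v) ((labelClass Z c).erase v) := by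
  classical
  have := mult_mul_offNode (Z := Z) v a c G.Adj G.adj_comm
  unfold offEdges edgeRel noiseSum noise
  rw [this, ← Finset.sum_add_distrib]
  refine Finset.sum_congr rfl fun i _ => ?_
  rw [← Finset.sum_add_distrib]
  refine Finset.sum_congr rfl fun j _ => ?_
  by_cases h : G.Adj i j
  · simp [adj, h, h.ne]
  · simp [adj, h]

lemma mult_mul_offPairs (G : SimpleGraph (Fin n)) (Z : Labels n K) (v : Fin n) (a c : Fin K) :
    mult a c * ((offEdges G Z v s(a, c) : ℝ) + offNonEdges G Z v s(a, c))
      = offDiag ((labelClass Z a).erase v) ((labelClass Z c).erase v) := by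
  classical
  have h1 := mult_mul_offNode (Z := Z) v a c G.Adj G.adj_comm
  have h2 := mult_mul_offNode (Z := Z) v a c (fun i j => ¬ G.Adj i j)
    (fun i j => by rw [G.adj_comm])
  unfold offEdges offNonEdges edgeRel nonEdgeRel offDiag
  rw [mul_add, h1, h2, ← Finset.sum_add_distrib]
  refine Finset.sum_congr rfl fun i _ => ?_
  rw [← Finset.sum_add_distrib]
  refine Finset.sum_congr rfl fun j _ => ?_
  by_cases hij : i = j
  · simp [hij]
  · by_cases h : G.Adj i j <;> simp [h, hij]

lemma card_labelClass_erase_ge {Z : Labels n K} {c₀ : ℝ} (c : Fin K) (v : Fin n)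
    (h : c₀ * n ≤ (labelClass Z c).card) : c₀ * n - 1 ≤ ((labelClass Z c).erase v).card := by
  have h1 : (labelClass Z c).card ≤ ((labelClass Z c).erase v).card + 1 := by
    have := Finset.pred_card_le_card_erase (s := labelClass Z c) (a := v)
    omega
  have : ((labelClass Z c).card : ℝ) ≤ ((labelClass Z c).erase v).card + 1 := by exact_mod_cast h1
  linarith

lemma le_offDiag_erase {Z : Labels n K} {c₀ : ℝ} (hn : 6 ≤ c₀ * n)
    (h : ∀ c, c₀ * n ≤ (labelClass Z c).card) (v : Fin n) (a c : Fin K) :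
    (c₀ * n) ^ 2 / 2 ≤ offDiag ((labelClass Z a).erase v) ((labelClass Z c).erase v) := by
  have ha := card_labelClass_erase_ge a v (h a)
  have hc := card_labelClass_erase_ge c v (h c)
  refine le_trans ?_ (le_offDiag _ _)
  nlinarith [mul_le_mul ha (show c₀ * n - 2 ≤ (((labelClass Z c).erase v).card : ℝ) - 1 by linarith)
    (by linarith) (by linarith)]

/-- The estimated density of a block is close to any number close to the average of the means. -/
lemma abs_blockMean_sub_le {κ₁ κ₂ : ℝ} (h₁ : 0 < κ₁) (h₂ : 0 < κ₂) (p q : ℝ) (Zs : Labels n K)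
    (G : SimpleGraph (Fin n)) (Z : Labels n K) (v : Fin n) (a c : Fin K) {B δ M : ℝ}
    (hB0 : 0 ≤ B) (hB1 : B ≤ 1) (hM : 0 < M)
    (hMle : M ≤ offDiag ((labelClass Z a).erase v) ((labelClass Z c).erase v))
    (hδ : |(∑ i ∈ (labelClass Z a).erase v, ∑ j ∈ (labelClass Z c).erase v, pairMean p q Zs i j)
      - B * offDiag ((labelClass Z a).erase v) ((labelClass Z c).erase v)| ≤ δ) :
    |blockMean κ₁ κ₂ G Z v a c - B| ≤ (2 * (κ₁ + κ₂)
      + |noiseSum p q Zs G ((labelClass Z a).erase v) ((labelClass Z c).erase v)| + δ) / M := by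
  have hE := mult_mul_offEdges p q Zs G Z v a c
  have hN := mult_mul_offPairs G Z v a c
  have hm1 := one_le_mult a c
  have hm2 := mult_le a c
  unfold blockMean
  set E : ℝ := (offEdges G Z v s(a, c) : ℝ)
  set F : ℝ := (offNonEdges G Z v s(a, c) : ℝ)
  have hE0 : 0 ≤ E := by positivity
  have hF0 : 0 ≤ F := by positivity
  set x := noiseSum p q Zs G ((labelClass Z a).erase v) ((labelClass Z c).erase v)
  set N := offDiag ((labelClass Z a).erase v) ((labelClass Z c).erase v)
  set y := ∑ i ∈ (labelClass Z a).erase v, ∑ j ∈ (labelClass Z c).erase v, pairMean p q Zs i j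
  set m := mult a c
  have hden : 0 < κ₁ + κ₂ + E + F := by positivity
  have e : (κ₁ + E) / (κ₁ + κ₂ + E + F) - B
      = (m * (κ₁ - B * (κ₁ + κ₂)) + x + (y - B * N)) / (m * (κ₁ + κ₂ + E + F)) := by
    have : m * (κ₁ - B * (κ₁ + κ₂)) + x + (y - B * N)
        = m * ((κ₁ + E) - B * (κ₁ + κ₂ + E + F)) := by linear_combination -hE + B * hN
    rw [this, mul_div_mul_left _ _ (by linarith : m ≠ 0)]
    field_simp
  rw [e, abs_div, abs_of_pos (show 0 < m * (κ₁ + κ₂ + E + F) by positivity)]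
  have hk : |m * (κ₁ - B * (κ₁ + κ₂))| ≤ 2 * (κ₁ + κ₂) := by
    rw [abs_mul, abs_of_pos (by linarith : 0 < m)]
    have : |κ₁ - B * (κ₁ + κ₂)| ≤ κ₁ + κ₂ := by
      rw [abs_le]; constructor <;> nlinarith
    exact mul_le_mul hm2 this (abs_nonneg _) (by norm_num)
  have hnum : |m * (κ₁ - B * (κ₁ + κ₂)) + x + (y - B * N)| ≤ 2 * (κ₁ + κ₂) + |x| + δ :=
    (abs_add_three _ _ _).trans (by linarith)
  have hMd : M ≤ m * (κ₁ + κ₂ + E + F) := by nlinarith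
  have hpos : 0 ≤ 2 * (κ₁ + κ₂) + |x| + δ := (abs_nonneg _).trans hnum
  calc _ ≤ (2 * (κ₁ + κ₂) + |x| + δ) / (m * (κ₁ + κ₂ + E + F)) := by gcongr
    _ ≤ _ := by gcongr

lemma sum_pairMean_mem {p q : ℝ} (hq : 0 ≤ q) (hqp : q ≤ p) (Zs : Labels n K)
    (S T : Finset (Fin n)) :
    q * offDiag S T ≤ ∑ i ∈ S, ∑ j ∈ T, pairMean p q Zs i j ∧
      ∑ i ∈ S, ∑ j ∈ T, pairMean p q Zs i j ≤ p * offDiag S T := by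
  unfold offDiag
  simp_rw [Finset.mul_sum]
  constructor
  all_goals
    refine Finset.sum_le_sum fun i _ => Finset.sum_le_sum fun j _ => ?_
    have := labelMean_mem hq hqp (Zs i) (Zs j)
    unfold pairMean
    split_ifs <;> linarith

/-- The bounds on the noise that hold for all sets of nodes, resp. for all nodes, at once. -/
structure NoiseBound (C₁ p q : ℝ) (Zs : Labels n K) (G : SimpleGraph (Fin n)) : Prop where
  rect : ∀ S T, |noiseSum p q Zs G S T| ≤ C₁ * (n * √(n * p))
  node : ∀ v c, |noiseSum p q Zs G {v} (labelClass Zs c)| ≤ C₁ * (n * (p - q))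

/-- All blocks of size of order `n`: fluctuations of the estimated densities. -/
theorem exists_blockMean_close (κ₁ κ₂ C₁ c₀ : ℝ) (h₁ : 0 < κ₁) (h₂ : 0 < κ₂) (hC₁ : 0 < C₁)
    (hc₀ : 0 < c₀) : ∃ C Λ : ℝ, 0 < C ∧ 0 < Λ ∧ ∀ {n K : ℕ} {C₀ p q : ℝ}, Regime C₀ p q →
      Λ ≤ snr n p q → ∀ (Zs Z : Labels n K) (G : SimpleGraph (Fin n)), NoiseBound C₁ p q Zs G →
      (∀ c, c₀ * n ≤ (labelClass Z c).card) → ∀ (v : Fin n) (a c : Fin K) (B δ : ℝ), 0 ≤ B → B ≤ 1 →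
      |(∑ i ∈ (labelClass Z a).erase v, ∑ j ∈ (labelClass Z c).erase v, pairMean p q Zs i j)
        - B * offDiag ((labelClass Z a).erase v) ((labelClass Z c).erase v)| ≤ δ * n ^ 2 →
      |blockMean κ₁ κ₂ G Z v a c - B| ≤ C * (fluct n p + δ) := by
  refine ⟨2 / c₀ ^ 2 * (2 * (κ₁ + κ₂) + C₁ + 1), max 1 (6 / c₀), by positivity, by positivity, ?_⟩
  intro n K C₀ p q hR hΛ Zs Z G hG hsize v a c B δ hB0 hB1 hδ
  have hnp : 1 ≤ n * p := ((le_max_left _ _).trans hΛ).trans (hR.snr_le n)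
  have hn1 : 6 / c₀ ≤ n := ((le_max_right _ _).trans hΛ).trans (hR.snr_le_nat n)
  have hn6 : 6 ≤ c₀ * n := by rwa [div_le_iff₀ hc₀, mul_comm] at hn1
  have hn0 : (0 : ℝ) < n := by
    have : 0 < 6 / c₀ := by positivity
    linarith
  have hn1' : (1 : ℝ) ≤ n := by
    have : 1 ≤ n := Nat.one_le_iff_ne_zero.mpr (by rintro rfl; simp at hn0)
    exact_mod_cast this
  have hM := le_offDiag_erase hn6 hsize v a c
  have key := abs_blockMean_sub_le h₁ h₂ p q Zs G Z v a c hB0 hB1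
    (show (0 : ℝ) < (c₀ * n) ^ 2 / 2 by positivity) hM hδ
  refine key.trans ?_
  have hsq : 1 ≤ √(n * p) := Real.one_le_sqrt.mpr hnp
  have h1 := hG.rect ((labelClass Z a).erase v) ((labelClass Z c).erase v)
  have hδ0 : 0 ≤ δ * n ^ 2 := (abs_nonneg _).trans hδ
  have hδ0' : 0 ≤ δ := nonneg_of_mul_nonneg_left hδ0 (by positivity)
  have hnum : 2 * (κ₁ + κ₂)
      + |noiseSum p q Zs G ((labelClass Z a).erase v) ((labelClass Z c).erase v)| + δ * n ^ 2
      ≤ (2 * (κ₁ + κ₂) + C₁) * (n * √(n * p)) + δ * n ^ 2 := by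
    have : 1 ≤ n * √(n * p) := by nlinarith
    nlinarith [add_pos h₁ h₂]
  calc _ ≤ ((2 * (κ₁ + κ₂) + C₁) * (n * √(n * p)) + δ * n ^ 2) / ((c₀ * n) ^ 2 / 2) := by gcongr
    _ = 2 / c₀ ^ 2 * ((2 * (κ₁ + κ₂) + C₁) * fluct n p + δ) := by
        unfold fluct; field_simp
    _ ≤ 2 / c₀ ^ 2 * ((2 * (κ₁ + κ₂) + C₁ + 1) * (fluct n p + δ)) := by
        have := fluct_nonneg n p
        gcongr
        nlinarith [add_pos h₁ h₂]
    _ = _ := by ring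

/-- All estimated densities are of order `p`. -/
theorem exists_blockMean_mem (κ₁ κ₂ C₀ C₁ c₀ : ℝ) (h₁ : 0 < κ₁) (h₂ : 0 < κ₂) (hC₀ : 0 < C₀)
    (hC₁ : 0 < C₁) (hc₀ : 0 < c₀) : ∃ Λ : ℝ, 0 < Λ ∧ ∀ {n K : ℕ} {p q : ℝ}, Regime C₀ p q →
      Λ ≤ snr n p q → ∀ (Zs Z : Labels n K) (G : SimpleGraph (Fin n)), NoiseBound C₁ p q Zs G →
      (∀ c, c₀ * n ≤ (labelClass Z c).card) → ∀ (v : Fin n) (a c : Fin K),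
      p / (2 * C₀) ≤ blockMean κ₁ κ₂ G Z v a c ∧ blockMean κ₁ κ₂ G Z v a c ≤ 2 * p := by
  obtain ⟨C, Λ, hC, hΛ0, hclose⟩ := exists_blockMean_close κ₁ κ₂ C₁ c₀ h₁ h₂ hC₁ hc₀
  refine ⟨max (max Λ (6 / c₀)) ((2 * C * C₀) ^ 2), by positivity, ?_⟩
  intro n K p q hR hΛ Zs Z G hG hsize v a c
  have hp := hR.p_pos
  have hq := hR.q_pos
  have hΛ1 := ((le_max_left _ _).trans (le_max_left _ _)).trans hΛ
  have hn1 : 6 / c₀ ≤ n :=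
    (((le_max_right _ _).trans (le_max_left _ _)).trans hΛ).trans (hR.snr_le_nat n)
  have hn6 : 6 ≤ c₀ * n := by rwa [div_le_iff₀ hc₀, mul_comm] at hn1
  have hn0 : 0 < n := by
    rcases Nat.eq_zero_or_pos n with h | h
    · subst h; simp at hn6; linarith
    · exact h
  have hnp := ((le_max_right _ _).trans hΛ).trans (hR.snr_le n)
  have hM := le_offDiag_erase hn6 hsize v a c
  have hMpos : 0 < offDiag ((labelClass Z a).erase v) ((labelClass Z c).erase v) :=
    lt_of_lt_of_le (by positivity) hM
  obtain ⟨hlo, hhi⟩ := sum_pairMean_mem hq.le hR.lt.le Zs ((labelClass Z a).erase v)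
    ((labelClass Z c).erase v)
  set y := ∑ i ∈ (labelClass Z a).erase v, ∑ j ∈ (labelClass Z c).erase v, pairMean p q Zs i j
  set N := offDiag ((labelClass Z a).erase v) ((labelClass Z c).erase v)
  -- The comparison value is the exact average of the means over the block, so only the fluctuation
  -- remains as an error.
  have hB0 : q ≤ y / N := by rwa [le_div_iff₀ hMpos]
  have hB1 : y / N ≤ p := by rwa [div_le_iff₀ hMpos]
  have h3 := hclose hR hΛ1 Zs Z G hG hsize v a c (y / N) 0 (by linarith) (by linarith [hR.le]) (by
    change |y - y / N * N| ≤ _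
    rw [div_mul_cancel₀ _ hMpos.ne']; simp)
  rw [add_zero] at h3
  have h4 : 2 * C * C₀ ≤ √(n * p) := Real.le_sqrt_of_sq_le hnp
  have h5 := fluct_mul_sqrt hp.le hn0
  have h6 : C * fluct n p ≤ p / (2 * C₀) := by
    rw [le_div_iff₀ (by positivity)]
    nlinarith [mul_le_mul_of_nonneg_left h4 (fluct_nonneg n p)]
  have h7 : p / (2 * C₀) = p / C₀ / 2 := by field_simp
  have h8 : p / C₀ ≤ q := by rw [div_le_iff₀ hC₀]; linarith [hR.ratio]
  have h9 : p / C₀ ≤ p := by linarith [hR.lt]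
  have h10 := abs_le.mp (h3.trans h6)
  constructor <;> linarith [h10.1, h10.2]

end Blocks

end

end SBM

namespace SBM

noncomputable section

/-! ### The gain of relabeling one node -/

section Flip

variable {n K : ℕ}

lemma sum_labelClass {M : Type*} [AddCommMonoid M] (Z : Labels n K) (f : Fin n → M) :
    ∑ c, ∑ j ∈ labelClass Z c, f j = ∑ j, f j :=
  Finset.sum_fiberwise Finset.univ Z f

lemma degTo_add_nonDegTo_le (G : SimpleGraph (Fin n)) (Z : Labels n K) (v : Fin n) (c : Fin K) :
    degTo G Z v c + nonDegTo G Z v c ≤ n := by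
  classical
  unfold degTo nonDegTo
  rw [← Finset.card_union_of_disjoint]
  · exact (Finset.card_le_univ _).trans (by simp)
  · rw [Finset.disjoint_left]
    intro j h h'
    exact (Finset.mem_filter.mp h').2.2.2 (Finset.mem_filter.mp h).2.2.2

lemma sum_bernLog_adj (G : SimpleGraph (Fin n)) (Z : Labels n K) (v : Fin n) (B : Fin K → ℝ) :
    ∑ j ∈ Finset.univ.erase v, bernLog (adj G v j) (B (Z j))
      = ∑ c, (degTo G Z v c * Real.log (B c) + nonDegTo G Z v c * Real.log (1 - B c)) := by
  classical
  rw [← Finset.sum_fiberwise (Finset.univ.erase v) Z]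
  refine Finset.sum_congr rfl fun c _ => ?_
  have e : ∑ j ∈ Finset.univ.erase v with Z j = c, bernLog (adj G v j) (B (Z j))
      = ∑ j ∈ Finset.univ.erase v with Z j = c,
        ((if G.Adj v j then Real.log (B c) else 0) + (if ¬ G.Adj v j then Real.log (1 - B c) else 0)) := by
    refine Finset.sum_congr rfl fun j hj => ?_
    rw [(Finset.mem_filter.mp hj).2]
    unfold bernLog adj
    by_cases h : G.Adj v j <;> simp [h]
  rw [e, Finset.sum_add_distrib, ← Finset.sum_filter, ← Finset.sum_filter, Finset.sum_const,
    Finset.sum_const, nsmul_eq_mul, nsmul_eq_mul, Finset.filter_filter, Finset.filter_filter]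
  have e1 : ((Finset.univ.erase v).filter fun j => Z j = c ∧ G.Adj v j)
      = Finset.univ.filter fun j => j ≠ v ∧ Z j = c ∧ G.Adj v j := by ext; simp
  have e2 : ((Finset.univ.erase v).filter fun j => Z j = c ∧ ¬ G.Adj v j)
      = Finset.univ.filter fun j => j ≠ v ∧ Z j = c ∧ ¬ G.Adj v j := by ext; simp
  rw [e1, e2]; rfl

lemma degTo_le {C₁ C₀ p q : ℝ} (hC₁ : 0 < C₁) (hR : Regime C₀ p q) {Zs : Labels n K}
    {G : SimpleGraph (Fin n)} (hG : NoiseBound C₁ p q Zs G) (Z : Labels n K) (v : Fin n)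
    (c : Fin K) : (degTo G Z v c : ℝ) ≤ (1 + K * C₁) * (n * p) := by
  classical
  have h1 : (degTo G Z v c : ℝ) ≤ ∑ j, adj G v j := by
    unfold degTo adj
    rw [Finset.card_filter]; push_cast
    refine Finset.sum_le_sum fun j _ => ?_
    by_cases h : G.Adj v j
    · simp only [h, if_true]; split_ifs <;> norm_num
    · simp [h]
  have h2 : ∑ j, adj G v j = ∑ j, pairMean p q Zs v j
      + ∑ c, noiseSum p q Zs G {v} (labelClass Zs c) := by
    unfold noiseSum
    simp only [Finset.sum_singleton]
    rw [sum_labelClass, ← Finset.sum_add_distrib]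
    exact Finset.sum_congr rfl fun j _ => by unfold noise; ring
  have h3 : ∑ j, pairMean p q Zs v j ≤ n * p := by
    calc _ ≤ ∑ j : Fin n, p := Finset.sum_le_sum fun j _ => by
          have := labelMean_mem hR.q_pos.le hR.lt.le (Zs v) (Zs j)
          unfold pairMean; split_ifs <;> linarith [hR.p_pos]
      _ = _ := by simp
  have h4 : ∑ c, noiseSum p q Zs G {v} (labelClass Zs c) ≤ K * (C₁ * (n * p)) := by
    calc _ ≤ ∑ c : Fin K, C₁ * (n * p) := Finset.sum_le_sum fun c _ =>
          ((le_abs_self _).trans (hG.node v c)).trans (by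
            gcongr; linarith [hR.q_pos])
      _ = _ := by simp
  calc _ ≤ _ := h1
    _ ≤ n * p + K * (C₁ * (n * p)) := by rw [h2]; linarith
    _ = _ := by ring

/-- Up to a bounded error, the gain of relabeling one node is a log-likelihood ratio at the estimated
block densities. -/
theorem exists_flip_expand (K : ℕ) (κ₁ κ₂ C₀ C₁ c₀ : ℝ) (h₁ : 0 < κ₁) (h₂ : 0 < κ₂) (hC₀ : 0 < C₀)
    (hC₁ : 0 < C₁) (hc₀ : 0 < c₀) : ∃ C Λ : ℝ, 0 < C ∧ 0 < Λ ∧ ∀ {n : ℕ} {p q : ℝ},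
      Regime C₀ p q → Λ ≤ snr n p q → ∀ (Zs Z : Labels n K) (G : SimpleGraph (Fin n)),
      NoiseBound C₁ p q Zs G → (∀ c, c₀ * n ≤ (labelClass Z c).card) →
      ∀ (v : Fin n) (a b : Fin K),
      |(Real.log (marginal κ₁ κ₂ G (Function.update Z v a))
          - Real.log (marginal κ₁ κ₂ G (Function.update Z v b)))
        - ∑ j ∈ Finset.univ.erase v, (bernLog (adj G v j) (blockMean κ₁ κ₂ G Z v a (Z j))
          - bernLog (adj G v j) (blockMean κ₁ κ₂ G Z v b (Z j)))| ≤ C := by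
  obtain ⟨Λ, hΛ0, hmem⟩ := exists_blockMean_mem κ₁ κ₂ C₀ C₁ c₀ h₁ h₂ hC₀ hC₁ hc₀
  -- The degree is `O(n p)` and a block contains of order `n ^ 2 * p` edges, so the square of the
  -- degree over the edge count is `O(p)`. The non-edges are `O(n)` against order `n ^ 2` and also
  -- give a bounded error.
  set Ce : ℝ := 8 * C₀ * (1 + K * C₁) ^ 2 / c₀ ^ 2 + 8 / c₀ ^ 2 with hCe
  have hCe0 : 0 < Ce := by positivity
  refine ⟨2 * ((K + 1) * Ce), max Λ (6 / c₀), by positivity, by positivity, ?_⟩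
  intro n p q hR hΛ Zs Z G hG hsize v a b
  have hp := hR.p_pos
  have hn1 : 6 / c₀ ≤ n := ((le_max_right _ _).trans hΛ).trans (hR.snr_le_nat n)
  have hn6 : 6 ≤ c₀ * n := by rwa [div_le_iff₀ hc₀, mul_comm] at hn1
  have hn0 : (0 : ℝ) < n := by
    have : 0 < 6 / c₀ := by positivity
    linarith
  -- The subtracted sum over all blocks does not involve the label of `v` and disappears from the
  -- difference of two labels.
  have one : ∀ a : Fin K, |Real.log (marginal κ₁ κ₂ G (Function.update Z v a))
      - (∑ e, Real.log (blockWeight κ₁ κ₂ (offEdges G Z v e) (offNonEdges G Z v e)))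
      - ∑ j ∈ Finset.univ.erase v, bernLog (adj G v j) (blockMean κ₁ κ₂ G Z v a (Z j))|
        ≤ K * Ce := by
    intro a
    rw [log_marginal_update h₁ h₂, add_sub_cancel_left, sum_bernLog_adj, ← Finset.sum_sub_distrib]
    refine (Finset.abs_sum_le_sum_abs _ _).trans ?_
    have hterm : ∀ c : Fin K, |Real.log (blockWeight κ₁ κ₂ (offEdges G Z v s(a, c) + degTo G Z v c)
          (offNonEdges G Z v s(a, c) + nonDegTo G Z v c))
        - Real.log (blockWeight κ₁ κ₂ (offEdges G Z v s(a, c)) (offNonEdges G Z v s(a, c)))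
        - (degTo G Z v c * Real.log (blockMean κ₁ κ₂ G Z v a c)
          + nonDegTo G Z v c * Real.log (1 - blockMean κ₁ κ₂ G Z v a c))| ≤ Ce := by
      intro c
      obtain ⟨hlo, hhi⟩ := hmem hR ((le_max_left _ _).trans hΛ) Zs Z G hG hsize v a c
      have hd := degTo_le hC₁ hR hG Z v c
      have hdm : (degTo G Z v c : ℝ) + nonDegTo G Z v c ≤ n := by
        exact_mod_cast degTo_add_nonDegTo_le G Z v c
      have hN := mult_mul_offPairs G Z v a c
      have hM := le_offDiag_erase hn6 hsize v a c
      have hm2 := mult_le a c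
      have up := log_blockWeight_add_le h₁ h₂ (offEdges G Z v s(a, c)) (offNonEdges G Z v s(a, c))
        (degTo G Z v c) (nonDegTo G Z v c)
      have lo := le_log_blockWeight_add h₁ h₂ (offEdges G Z v s(a, c)) (offNonEdges G Z v s(a, c))
        (degTo G Z v c) (nonDegTo G Z v c)
      set E : ℝ := (offEdges G Z v s(a, c) : ℝ) with hE
      set F : ℝ := (offNonEdges G Z v s(a, c) : ℝ) with hF
      have hE0 : 0 ≤ E := by positivity
      have hF0 : 0 ≤ F := by positivity
      have hs : 0 < κ₁ + κ₂ + E + F := by positivity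
      set B := blockMean κ₁ κ₂ G Z v a c with hB
      have hB1 : (κ₁ + E) / (κ₁ + κ₂ + E + F) = B := rfl
      have hB2 : (κ₂ + F) / (κ₁ + κ₂ + E + F) = 1 - B := by
        rw [← hB1]; field_simp; ring
      rw [hB1, hB2] at up lo
      set d : ℝ := (degTo G Z v c : ℝ)
      set m : ℝ := (nonDegTo G Z v c : ℝ)
      have hd0 : 0 ≤ d := by positivity
      have hm0 : 0 ≤ m := by positivity
      have hsn : (c₀ * n) ^ 2 / 4 ≤ κ₁ + κ₂ + E + F := by nlinarith
      have hx : κ₁ + E = B * (κ₁ + κ₂ + E + F) := by rw [← hB1]; field_simp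
      have hy : κ₂ + F = (1 - B) * (κ₁ + κ₂ + E + F) := by rw [← hB2]; field_simp
      have hBhalf : 1 / 2 ≤ 1 - B := by linarith [hR.le]
      have e1 : d ^ 2 / (κ₁ + E) ≤ 8 * C₀ * (1 + K * C₁) ^ 2 / c₀ ^ 2 := by
        have hx' : p / (2 * C₀) * ((c₀ * n) ^ 2 / 4) ≤ κ₁ + E := by
          rw [hx]; gcongr; exact (by positivity : 0 ≤ p / (2 * C₀)).trans hlo
        calc d ^ 2 / (κ₁ + E) ≤ ((1 + K * C₁) * (n * p)) ^ 2 / (p / (2 * C₀) * ((c₀ * n) ^ 2 / 4)) := by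
              gcongr
          _ = 8 * C₀ * (1 + K * C₁) ^ 2 / c₀ ^ 2 * p := by field_simp; ring
          _ ≤ 8 * C₀ * (1 + K * C₁) ^ 2 / c₀ ^ 2 * 1 := by
              gcongr; linarith [hR.le]
          _ = _ := mul_one _
      have e2 : m ^ 2 / (κ₂ + F) ≤ 8 / c₀ ^ 2 := by
        have hy' : 1 / 2 * ((c₀ * n) ^ 2 / 4) ≤ κ₂ + F := by
          rw [hy]; gcongr
        calc m ^ 2 / (κ₂ + F) ≤ (n : ℝ) ^ 2 / (1 / 2 * ((c₀ * n) ^ 2 / 4)) := by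
              gcongr; linarith
          _ = 8 / c₀ ^ 2 := by field_simp; norm_num
      have e3 : (d + m) ^ 2 / (κ₁ + κ₂ + E + F) ≤ 8 / c₀ ^ 2 := by
        calc (d + m) ^ 2 / (κ₁ + κ₂ + E + F) ≤ (n : ℝ) ^ 2 / ((c₀ * n) ^ 2 / 4) := by gcongr
          _ = 4 / c₀ ^ 2 := by field_simp
          _ ≤ _ := by gcongr; norm_num
      have e4 : 0 ≤ 8 * C₀ * (1 + K * C₁) ^ 2 / c₀ ^ 2 := by positivity
      rw [abs_le]
      constructor <;> linarith
    calc _ ≤ ∑ c : Fin K, Ce := Finset.sum_le_sum fun c _ => hterm c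
      _ = _ := by simp
  have ha := abs_le.mp (one a)
  have hb := abs_le.mp (one b)
  rw [Finset.sum_sub_distrib, abs_le]
  constructor <;> nlinarith [ha.1, ha.2, hb.1, hb.2]

end Flip

end

end SBM

namespace SBM

noncomputable section

/-! ### Assignments close to the truth: flips of single nodes -/

section Near

variable {n K : ℕ}

lemma abs_labelMean_sub_le {p q : ℝ} (hqp : q ≤ p) (a b c d : Fin K) :
    |labelMean p q a b - labelMean p q c d| ≤ p - q := by
  unfold labelMean
  split_ifs <;> simp [abs_of_nonneg (sub_nonneg.mpr hqp), abs_sub_comm q p, hqp]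

lemma card_misclassified (Z Zs : Labels n K) :
    (Finset.univ.filter fun j => Z j ≠ Zs j).card = hammingDist Z Zs := rfl

/-- A pair with two correctly labelled ends has the mean predicted by `Z`; any other pair errs by at
most `p - q`. At most `2 * n` ordered pairs involve a given misclassified node. -/
lemma abs_sum_pairMean_sub_le {p q : ℝ} (hqp : q ≤ p) (Zs Z : Labels n K) (v : Fin n)
    (a c : Fin K) :
    |(∑ i ∈ (labelClass Z a).erase v, ∑ j ∈ (labelClass Z c).erase v, pairMean p q Zs i j)
        - labelMean p q a c * offDiag ((labelClass Z a).erase v) ((labelClass Z c).erase v)|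
      ≤ 2 * hammingDist Z Zs * n * (p - q) := by
  classical
  have hg : 0 ≤ p - q := sub_nonneg.mpr hqp
  set m : Fin n → ℝ := fun i => if Z i ≠ Zs i then 1 else 0 with hm
  have hm0 : ∀ i, 0 ≤ m i := fun i => by simp only [hm]; split_ifs <;> norm_num
  have hms : ∑ i, m i = hammingDist Z Zs := by
    rw [← card_misclassified, Finset.card_filter]; push_cast; rfl
  unfold offDiag
  rw [Finset.mul_sum, ← Finset.sum_sub_distrib]
  have hterm : ∀ i ∈ labelClass Z a, ∀ j ∈ labelClass Z c,
      |pairMean p q Zs i j - labelMean p q a c * (if i = j then 0 else 1)|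
        ≤ (m i + m j) * (p - q) := by
    intro i hi j hj
    rw [mem_labelClass] at hi hj
    unfold pairMean
    by_cases hij : i = j
    · simp only [hij, if_true, mul_zero, sub_zero, abs_zero]
      exact mul_nonneg (add_nonneg (hm0 _) (hm0 _)) hg
    · simp only [hij, if_false, mul_one]
      by_cases h1 : Z i = Zs i
      · by_cases h2 : Z j = Zs j
        · rw [← h1, ← h2, hi, hj, sub_self, abs_zero]
          exact mul_nonneg (add_nonneg (hm0 _) (hm0 _)) hg
        · refine (abs_labelMean_sub_le hqp _ _ _ _).trans ?_
          have : m j = 1 := by simp [hm, h2]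
          nlinarith [hm0 i]
      · refine (abs_labelMean_sub_le hqp _ _ _ _).trans ?_
        have : m i = 1 := by simp [hm, h1]
        nlinarith [hm0 j]
  calc _ ≤ ∑ i ∈ (labelClass Z a).erase v, ∑ j ∈ (labelClass Z c).erase v,
        (m i + m j) * (p - q) := by
        refine (Finset.abs_sum_le_sum_abs _ _).trans (Finset.sum_le_sum fun i hi => ?_)
        rw [Finset.mul_sum, ← Finset.sum_sub_distrib]
        exact (Finset.abs_sum_le_sum_abs _ _).trans (Finset.sum_le_sum fun j hj =>
          hterm i (Finset.mem_of_mem_erase hi) j (Finset.mem_of_mem_erase hj))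
    _ ≤ ∑ i : Fin n, ∑ j : Fin n, (m i + m j) * (p - q) := by
        have hnn : ∀ i j, 0 ≤ (m i + m j) * (p - q) := fun i j =>
          mul_nonneg (add_nonneg (hm0 i) (hm0 j)) hg
        refine (Finset.sum_le_sum fun i _ => Finset.sum_le_sum_of_subset_of_nonneg
          (Finset.subset_univ _) fun j _ _ => hnn i j).trans
          (Finset.sum_le_sum_of_subset_of_nonneg (Finset.subset_univ _) fun i _ _ =>
            Finset.sum_nonneg fun j _ => hnn i j)
    _ = _ := by
        simp_rw [← Finset.sum_mul, Finset.sum_add_distrib]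
        simp only [Finset.sum_const, Finset.card_univ, Fintype.card_fin, nsmul_eq_mul, hms,
          ← Finset.mul_sum]
        ring

/-- Close to the truth, the estimated densities are close to the true ones. -/
theorem exists_blockMean_near (κ₁ κ₂ C₁ c₀ r : ℝ) (h₁ : 0 < κ₁) (h₂ : 0 < κ₂) (hC₁ : 0 < C₁)
    (hc₀ : 0 < c₀) (hr : 0 < r) : ∃ ρ Λ : ℝ, 0 < ρ ∧ 0 < Λ ∧ ∀ {n K : ℕ} {C₀ p q : ℝ},
      Regime C₀ p q → Λ ≤ snr n p q → ∀ (Zs Z : Labels n K) (G : SimpleGraph (Fin n)),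
      NoiseBound C₁ p q Zs G → (∀ c, c₀ * n ≤ (labelClass Z c).card) →
      (hammingDist Z Zs : ℝ) ≤ ρ * n → ∀ (v : Fin n) (a c : Fin K),
      |blockMean κ₁ κ₂ G Z v a c - labelMean p q a c| ≤ r * (p - q) := by
  obtain ⟨C, Λ, hC, hΛ0, hclose⟩ := exists_blockMean_close κ₁ κ₂ C₁ c₀ h₁ h₂ hC₁ hc₀
  -- Half of the tolerance `r` is spent on the misclassified nodes, half on the fluctuations.
  refine ⟨r / (4 * C), max Λ ((1 / (r / (2 * C))) ^ 2), by positivity, by positivity, ?_⟩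
  intro n K C₀ p q hR hΛ Zs Z G hG hsize hd v a c
  have hg : 0 ≤ p - q := by linarith [hR.lt]
  have hn : 0 < n := v.pos
  have hP := labelMean_mem hR.q_pos.le hR.lt.le a c
  have h1 := hclose hR ((le_max_left _ _).trans hΛ) Zs Z G hG hsize v a c (labelMean p q a c)
    (2 * (r / (4 * C)) * (p - q)) hP.2.2 (by linarith [hR.le]) (by
      refine (abs_sum_pairMean_sub_le hR.lt.le Zs Z v a c).trans ?_
      calc _ ≤ 2 * (r / (4 * C) * n) * n * (p - q) := by gcongr
        _ = _ := by ring)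
  have h2 := fluct_le hR hn (show 0 < r / (2 * C) by positivity) ((le_max_right _ _).trans hΛ)
  refine h1.trans ?_
  calc _ ≤ C * (r / (2 * C) * (p - q) + 2 * (r / (4 * C)) * (p - q)) := by gcongr
    _ = _ := by field_simp; ring

/-- The nodes with label `c` under `Z` and label `d` under `Zs`. -/
def confusion (Z Zs : Labels n K) (c d : Fin K) : Finset (Fin n) :=
  Finset.univ.filter fun j => Z j = c ∧ Zs j = d

lemma sum_confusion {M : Type*} [AddCommMonoid M] (Z Zs : Labels n K) (f : Fin n → M) :
    ∑ c, ∑ d, ∑ j ∈ confusion Z Zs c d, f j = ∑ j, f j := by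
  classical
  rw [← sum_labelClass Z f]
  refine Finset.sum_congr rfl fun c _ => ?_
  rw [← Finset.sum_fiberwise (labelClass Z c) Zs f]
  refine Finset.sum_congr rfl fun d _ => Finset.sum_congr ?_ fun _ _ => rfl
  ext j; simp [confusion]

lemma sum_confusion_left {M : Type*} [AddCommMonoid M] (Z Zs : Labels n K) (d : Fin K)
    (f : Fin n → M) :
    ∑ c, ∑ j ∈ confusion Z Zs c d, f j = ∑ j ∈ labelClass Zs d, f j := by
  classical
  rw [← Finset.sum_fiberwise (labelClass Zs d) Z f]
  refine Finset.sum_congr rfl fun c _ => Finset.sum_congr ?_ fun _ _ => rfl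
  ext j; simp [confusion, and_comm]

lemma Regime.labelMean_mem {C₀ p q : ℝ} (hR : Regime C₀ p q) (hC₀ : 0 < C₀) (x c : Fin K) :
    p / (2 * C₀) ≤ labelMean p q x c ∧ labelMean p q x c ≤ 3 / 4 := by
  have := SBM.labelMean_mem hR.q_pos.le hR.lt.le x c
  refine ⟨?_, by linarith [hR.le]⟩
  have h1 : p / (2 * C₀) ≤ q := by
    rw [div_le_iff₀ (by positivity)]; linarith [hR.ratio, mul_pos hC₀ hR.q_pos]
  linarith

variable {C₀ p q : ℝ} {Zs Z : Labels n K} {G : SimpleGraph (Fin n)} {v : Fin n} {x : Fin K}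
  {B : Fin K → ℝ} {r ρ C₁ c₁ : ℝ}

/-- Replaces estimated by true parameters. The coefficients of the noise depend only on the two
labels of a node, so the noise is grouped by the cells of the confusion matrix. -/
lemma sum_bernLog_sub_split (p q : ℝ) (Zs Z : Labels n K) (G : SimpleGraph (Fin n)) (v : Fin n)
    (x : Fin K) (B : Fin K → ℝ) :
    ∑ j ∈ Finset.univ.erase v,
      (bernLog (adj G v j) (B (Z j))
        - bernLog (adj G v j) (labelMean p q x (Zs j)))
      = (∑ j ∈ Finset.univ.erase v,
        (bernLog (labelMean p q (Zs v) (Zs j)) (B (Z j))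
          - bernLog (labelMean p q (Zs v) (Zs j)) (labelMean p q x (Zs j))))
        + ∑ c, ∑ d, (logOdds (B c) - logOdds (labelMean p q x d))
          * noiseSum p q Zs G {v} (confusion Z Zs c d) := by
  have e : ∑ c, ∑ d, (logOdds (B c) - logOdds (labelMean p q x d))
        * noiseSum p q Zs G {v} (confusion Z Zs c d)
      = ∑ j, (logOdds (B (Z j)) - logOdds (labelMean p q x (Zs j)))
        * noise p q Zs G v j := by
    rw [← sum_confusion Z Zs]
    refine Finset.sum_congr rfl fun c _ => Finset.sum_congr rfl fun d _ => ?_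
    unfold noiseSum
    rw [Finset.sum_singleton, Finset.mul_sum]
    refine Finset.sum_congr rfl fun j hj => ?_
    obtain ⟨h1, h2⟩ := (Finset.mem_filter.mp hj).2
    rw [h1, h2]
  rw [e, ← Finset.add_sum_erase _ _ (Finset.mem_univ v), noise_self, mul_zero, zero_add,
    ← Finset.sum_add_distrib]
  refine Finset.sum_congr rfl fun j hj => ?_
  have hjv : v ≠ j := (Finset.ne_of_mem_erase hj).symm
  have hm : noise p q Zs G v j = adj G v j - labelMean p q (Zs v) (Zs j) := by
    unfold noise pairMean; rw [if_neg hjv]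
  rw [hm, bernLog_eq (adj G v j) (labelMean p q (Zs v) (Zs j)) (B (Z j)),
    bernLog_eq (adj G v j) (labelMean p q (Zs v) (Zs j)) (labelMean p q x (Zs j))]
  ring

/-- Correctly labelled nodes contribute little because the densities are accurate to `r * (p - q)`;
the others contribute a full error of order `(p - q) ^ 2 / p` but are at most `ρ * n` in number. -/
lemma abs_sum_bernLog_drift_le (hC₀ : 0 < C₀) (hR : Regime C₀ p q) (hr : 0 ≤ r) (hr1 : r ≤ 1)
    (hBm : ∀ c, p / (2 * C₀) ≤ B c) (hBm' : ∀ c, B c ≤ 3 / 4)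
    (hBn : ∀ c, |B c - labelMean p q x c| ≤ r * (p - q))
    (hd : (hammingDist Z Zs : ℝ) ≤ ρ * n) :
    |∑ j ∈ Finset.univ.erase v,
        (bernLog (labelMean p q (Zs v) (Zs j)) (B (Z j))
          - bernLog (labelMean p q (Zs v) (Zs j)) (labelMean p q x (Zs j)))|
      ≤ r * (24 * C₀) * snr n p q + ρ * (96 * C₀) * snr n p q := by
  have hp := hR.p_pos
  have hg : 0 ≤ p - q := by linarith [hR.lt]
  set l := p / (2 * C₀) with hl
  have hl0 : 0 < l := by positivity
  have hl4 : 4 / l = 8 * C₀ / p := by rw [hl]; field_simp; norm_num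
  have hsnr : 1 / p * (p - q) * (n * (p - q)) = snr n p q := by unfold snr; field_simp
  have hPm := fun c => hR.labelMean_mem hC₀ x c
  have hdist : ∀ c d : Fin K, |B c - labelMean p q x d| ≤ 2 * (p - q) := fun c d => by
    calc _ ≤ |B c - labelMean p q x c| + |labelMean p q x c - labelMean p q x d| := abs_sub_le _ _ _
      _ ≤ r * (p - q) + (p - q) := add_le_add (hBn c) (abs_labelMean_sub_le hR.lt.le _ _ _ _)
      _ ≤ _ := by nlinarith
  have hterm : ∀ j, |bernLog (labelMean p q (Zs v) (Zs j)) (B (Z j))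
        - bernLog (labelMean p q (Zs v) (Zs j)) (labelMean p q x (Zs j))|
      ≤ 8 * C₀ / p * (p - q) * (3 * r * (p - q))
        + 8 * C₀ / p * (p - q) * (12 * (p - q)) * (if Z j ≠ Zs j then 1 else 0) := by
    intro j
    have hm := labelMean_mem hR.q_pos.le hR.lt.le (Zs v) (Zs j)
    have h1 := abs_bernLog_sub_le hm.2.2 (by linarith [hR.le]) hl0 (hBm (Z j))
      (hBm' (Z j)) (hPm (Zs j)).1 (hPm (Zs j)).2
    rw [hl4] at h1
    have h3 := abs_labelMean_sub_le hR.lt.le (Zs v) (Zs j) x (Zs j)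
    have h4 := hdist (Z j) (Zs j)
    have h5 : |labelMean p q (Zs v) (Zs j) - B (Z j)|
        ≤ (p - q) + |B (Z j) - labelMean p q x (Zs j)| := by
      refine (abs_sub_le _ (labelMean p q x (Zs j)) _).trans ?_
      rw [abs_sub_comm (labelMean p q x (Zs j))]; linarith
    set y := |B (Z j) - labelMean p q x (Zs j)|
    have hy0 : 0 ≤ y := abs_nonneg _
    have hc8 : 0 ≤ 8 * C₀ / p := by positivity
    by_cases hj : Z j = Zs j
    · simp only [hj, ne_eq, not_true_eq_false, if_false, mul_zero, add_zero]
      have hy : y ≤ r * (p - q) := by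
        have := hBn (Z j)
        simp only [y, ← hj]; exact this
      rw [hj] at h1 h5
      refine h1.trans ?_
      calc _ ≤ 8 * C₀ / p * (r * (p - q)) * (3 * (p - q)) := by
            have : y ≤ p - q := hy.trans (mul_le_of_le_one_left hg hr1)
            gcongr
            linarith
        _ = _ := by ring
    · simp only [hj, ne_eq, not_false_eq_true, if_true, mul_one]
      refine h1.trans ?_
      calc _ ≤ 8 * C₀ / p * (2 * (p - q)) * (4 * (p - q)) := by
            gcongr; linarith
        _ ≤ 8 * C₀ / p * (p - q) * (12 * (p - q)) := by
            have : 0 ≤ 8 * C₀ / p * (p - q) * (p - q) := by positivity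
            linarith
        _ ≤ _ := le_add_of_nonneg_left (by positivity)
  calc _ ≤ ∑ j ∈ Finset.univ.erase v, |bernLog (labelMean p q (Zs v) (Zs j))
          (B (Z j))
        - bernLog (labelMean p q (Zs v) (Zs j)) (labelMean p q x (Zs j))| :=
        Finset.abs_sum_le_sum_abs _ _
    _ ≤ ∑ j, |bernLog (labelMean p q (Zs v) (Zs j))
          (B (Z j))
        - bernLog (labelMean p q (Zs v) (Zs j)) (labelMean p q x (Zs j))| :=
        Finset.sum_le_sum_of_subset_of_nonneg (Finset.subset_univ _) fun _ _ _ => abs_nonneg _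
    _ ≤ ∑ j, (8 * C₀ / p * (p - q) * (3 * r * (p - q))
        + 8 * C₀ / p * (p - q) * (12 * (p - q)) * (if Z j ≠ Zs j then 1 else 0)) :=
        Finset.sum_le_sum fun j _ => hterm j
    _ = r * (24 * C₀) * snr n p q
        + 8 * C₀ / p * (p - q) * (12 * (p - q)) * hammingDist Z Zs := by
        rw [Finset.sum_add_distrib, ← Finset.mul_sum Finset.univ
          (fun j => if Z j ≠ Zs j then (1 : ℝ) else 0), Finset.sum_boole, card_misclassified]
        simp only [Finset.sum_const, Finset.card_univ, Fintype.card_fin, nsmul_eq_mul]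
        rw [← hsnr]; ring
    _ ≤ r * (24 * C₀) * snr n p q
        + 8 * C₀ / p * (p - q) * (12 * (p - q)) * (ρ * n) := by gcongr
    _ = r * (24 * C₀) * snr n p q + ρ * (96 * C₀) * snr n p q := by rw [← hsnr]; ring

/-- On diagonal cells the log-odds are accurate and the noise is of the generic order; off the
diagonal the log-odds may be wrong by order `(p - q) / p`, but there the noise is small by
assumption. -/
lemma abs_sum_logOdds_noise_le (hC₀ : 0 < C₀) (hR : Regime C₀ p q) (hr : 0 ≤ r) (hr1 : r ≤ 1)
    (hc₁0 : 0 < c₁) (hc₁1 : c₁ ≤ 1)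
    (hBm : ∀ c, p / (2 * C₀) ≤ B c) (hBm' : ∀ c, B c ≤ 3 / 4)
    (hBn : ∀ c, |B c - labelMean p q x c| ≤ r * (p - q))
    (hG : NoiseBound C₁ p q Zs G)
    (hv : ∀ c d, c ≠ d → |noiseSum p q Zs G {v} (confusion Z Zs c d)| ≤ c₁ * (n * (p - q))) :
    |∑ c, ∑ d, (logOdds (B c) - logOdds (labelMean p q x d))
          * noiseSum p q Zs G {v} (confusion Z Zs c d)|
      ≤ c₁ * (16 * C₀ * K ^ 2) * snr n p q + r * (8 * C₀ * K * (C₁ + K)) * snr n p q := by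
  have hp := hR.p_pos
  have hg : 0 ≤ p - q := by linarith [hR.lt]
  set l := p / (2 * C₀) with hl
  have hl0 : 0 < l := by positivity
  have hl4 : 4 / l = 8 * C₀ / p := by rw [hl]; field_simp; norm_num
  have hsnr : 1 / p * (p - q) * (n * (p - q)) = snr n p q := by unfold snr; field_simp
  have hPm := fun c => hR.labelMean_mem hC₀ x c
  have hdist : ∀ c d : Fin K, |B c - labelMean p q x d| ≤ 2 * (p - q) := fun c d => by
    calc _ ≤ |B c - labelMean p q x c| + |labelMean p q x c - labelMean p q x d| := abs_sub_le _ _ _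
      _ ≤ r * (p - q) + (p - q) := add_le_add (hBn c) (abs_labelMean_sub_le hR.lt.le _ _ _ _)
      _ ≤ _ := by nlinarith
  have hlog : ∀ c d : Fin K, |logOdds (B c) - logOdds (labelMean p q x d)|
      ≤ 8 * C₀ / p * |B c - labelMean p q x d| := fun c d => by
    rw [← hl4]
    exact abs_logOdds_sub_le hl0 (hBm c) (hBm' c) (hPm d).1 (hPm d).2
  have hc8 : 0 ≤ 8 * C₀ / p := by positivity
  -- Noise on an arbitrary cell is not controlled directly. The diagonal cell is a whole true
  -- community, for which there is a bound, minus off-diagonal cells.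
  have hdiag : ∀ c, |noiseSum p q Zs G {v} (confusion Z Zs c c)| ≤ (C₁ + K) * (n * (p - q)) := by
    intro c
    have e := sum_confusion_left Z Zs c (noise p q Zs G v)
    have e1 : noiseSum p q Zs G {v} (confusion Z Zs c c)
        = noiseSum p q Zs G {v} (labelClass Zs c)
          - ∑ d ∈ Finset.univ.erase c, noiseSum p q Zs G {v} (confusion Z Zs d c) := by
      unfold noiseSum
      simp only [Finset.sum_singleton]
      rw [← e, ← Finset.add_sum_erase _ _ (Finset.mem_univ c)]; ring
    rw [e1]
    calc _ ≤ |noiseSum p q Zs G {v} (labelClass Zs c)|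
          + |∑ d ∈ Finset.univ.erase c, noiseSum p q Zs G {v} (confusion Z Zs d c)| :=
          abs_sub _ _
      _ ≤ C₁ * (n * (p - q)) + ∑ d ∈ Finset.univ.erase c, (n * (p - q)) := by
          refine add_le_add (hG.node v c) ((Finset.abs_sum_le_sum_abs _ _).trans
            (Finset.sum_le_sum fun d hd => (hv d c (Finset.ne_of_mem_erase hd)).trans ?_))
          have : 0 ≤ n * (p - q) := by positivity
          nlinarith
      _ ≤ C₁ * (n * (p - q)) + K * (n * (p - q)) := by
          gcongr
          rw [Finset.sum_const, nsmul_eq_mul]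
          have : (Finset.univ.erase c).card ≤ K :=
            (Finset.card_erase_le).trans (by simp)
          gcongr
      _ = _ := by ring
  have hterm : ∀ c d : Fin K, |(logOdds (B c)
        - logOdds (labelMean p q x d)) * noiseSum p q Zs G {v} (confusion Z Zs c d)|
      ≤ c₁ * (16 * C₀) * snr n p q
        + (if c = d then r * (8 * C₀ * (C₁ + K)) * snr n p q else 0) := by
    intro c d
    rw [abs_mul]
    by_cases hcd : c = d
    · subst hcd
      rw [if_pos rfl]
      calc _ ≤ (8 * C₀ / p * (r * (p - q))) * ((C₁ + K) * (n * (p - q))) := by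
            refine mul_le_mul ((hlog c c).trans ?_) (hdiag c) (abs_nonneg _) (by positivity)
            gcongr; exact hBn c
        _ = r * (8 * C₀ * (C₁ + K)) * snr n p q := by rw [← hsnr]; ring
        _ ≤ _ := le_add_of_nonneg_left (mul_nonneg (by positivity) (snr_nonneg hR n))
    · rw [if_neg hcd, add_zero]
      calc _ ≤ (8 * C₀ / p * (2 * (p - q))) * (c₁ * (n * (p - q))) := by
            refine mul_le_mul ((hlog c d).trans ?_) (hv c d hcd) (abs_nonneg _) (by positivity)
            gcongr; exact hdist c d
        _ = _ := by rw [← hsnr]; ring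
  calc _ ≤ ∑ c : Fin K, ∑ d : Fin K, (c₁ * (16 * C₀) * snr n p q
        + (if c = d then r * (8 * C₀ * (C₁ + K)) * snr n p q else 0)) :=
        (Finset.abs_sum_le_sum_abs _ _).trans (Finset.sum_le_sum fun c _ =>
          (Finset.abs_sum_le_sum_abs _ _).trans (Finset.sum_le_sum fun d _ => hterm c d))
    _ = _ := by
        simp only [Finset.sum_add_distrib, Finset.sum_ite_eq, Finset.mem_univ, if_true,
          Finset.sum_const, Finset.card_univ, Fintype.card_fin, nsmul_eq_mul]
        ring

/-- Close to the truth, the gain of relabeling a node with little noise towards the misclassified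
nodes is close to the ideal one. -/
theorem exists_flip_near (K : ℕ) (κ₁ κ₂ C₀ C₁ c₀ r : ℝ) (h₁ : 0 < κ₁) (h₂ : 0 < κ₂) (hC₀ : 0 < C₀)
    (hC₁ : 0 < C₁) (hc₀ : 0 < c₀) (hr : 0 < r) : ∃ ρ c₁ Λ : ℝ, 0 < ρ ∧ 0 < c₁ ∧ 0 < Λ ∧
      ∀ {n : ℕ} {p q : ℝ}, Regime C₀ p q → Λ ≤ snr n p q →
      ∀ (Zs Z : Labels n K) (G : SimpleGraph (Fin n)),
      NoiseBound C₁ p q Zs G → (∀ c, c₀ * n ≤ (labelClass Z c).card) →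
      (hammingDist Z Zs : ℝ) ≤ ρ * n → ∀ v : Fin n,
      (∀ c d, c ≠ d → |noiseSum p q Zs G {v} (confusion Z Zs c d)| ≤ c₁ * (n * (p - q))) →
      ∀ b : Fin K,
      |(Real.log (marginal κ₁ κ₂ G (Function.update Z v (Zs v)))
          - Real.log (marginal κ₁ κ₂ G (Function.update Z v b))) - idealGain p q Zs G v b|
        ≤ r * snr n p q := by
  obtain ⟨CF, ΛF, hCF, hΛF, hflip⟩ := exists_flip_expand K κ₁ κ₂ C₀ C₁ c₀ h₁ h₂ hC₀ hC₁ hc₀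
  obtain ⟨ΛM, hΛM, hmem⟩ := exists_blockMean_mem κ₁ κ₂ C₀ C₁ c₀ h₁ h₂ hC₀ hC₁ hc₀
  -- Error budget: density errors, off-diagonal noise and misclassified nodes take `r / 16` each,
  -- for each of the two labels, and the bounded error of the expansion takes `r / 4`.
  set r' : ℝ := min 1 (r / (16 * (24 * C₀ + 8 * C₀ * K * (C₁ + K)))) with hr'
  have hden : 0 < 24 * C₀ + 8 * C₀ * K * (C₁ + K) := by positivity
  have hr'0 : 0 < r' := by positivity
  have hr'1 : r' ≤ 1 := min_le_left _ _
  have hr'2 : r' * (24 * C₀ + 8 * C₀ * K * (C₁ + K)) ≤ r / 16 := by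
    calc _ ≤ r / (16 * (24 * C₀ + 8 * C₀ * K * (C₁ + K))) * (24 * C₀ + 8 * C₀ * K * (C₁ + K)) := by
          gcongr; exact min_le_right _ _
      _ = r / 16 := by field_simp
  obtain ⟨ρ₁, Λ₁, hρ₁, hΛ₁, hnear⟩ := exists_blockMean_near κ₁ κ₂ C₁ c₀ r' h₁ h₂ hC₁ hc₀ hr'0
  set c₁ : ℝ := min 1 (r / (16 * (16 * C₀ * (K ^ 2 + 1)))) with hc₁
  have hc₁0 : 0 < c₁ := by positivity
  have hc₁1 : c₁ ≤ 1 := min_le_left _ _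
  have hc₁2 : c₁ * (16 * C₀ * K ^ 2) ≤ r / 16 := by
    calc _ ≤ r / (16 * (16 * C₀ * (K ^ 2 + 1))) * (16 * C₀ * (K ^ 2 + 1)) := by
          gcongr
          · exact min_le_right _ _
          · linarith
      _ = r / 16 := by field_simp
  set ρ : ℝ := min ρ₁ (r / (16 * (96 * C₀))) with hρ
  have hρ2 : ρ * (96 * C₀) ≤ r / 16 := by
    calc _ ≤ r / (16 * (96 * C₀)) * (96 * C₀) := by gcongr; exact min_le_right _ _
      _ = r / 16 := by field_simp
  refine ⟨ρ, c₁, max (max ΛF ΛM) (max Λ₁ (4 * CF / r)), by positivity, hc₁0, by positivity, ?_⟩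
  intro n p q hR hΛ Zs Z G hG hsize hd v hv b
  have hp := hR.p_pos
  have hg : 0 ≤ p - q := by linarith [hR.lt]
  have hn : 0 < n := v.pos
  have hn' : (0 : ℝ) < n := by exact_mod_cast hn
  have hΛ1 := ((le_max_left _ _).trans (le_max_left _ _)).trans hΛ
  have hΛ2 := ((le_max_right _ _).trans (le_max_left _ _)).trans hΛ
  have hΛ3 := ((le_max_left _ _).trans (le_max_right _ _)).trans hΛ
  have hΛ4 := ((le_max_right _ _).trans (le_max_right _ _)).trans hΛ
  have hsnr0 := snr_nonneg hR n
  have hCFsnr : CF ≤ r / 4 * snr n p q := by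
    rw [div_le_iff₀ hr] at hΛ4; linarith
  have hF := hflip hR hΛ1 Zs Z G hG hsize v (Zs v) b
  have hBm := fun x c => hmem hR hΛ2 Zs Z G hG hsize v x c
  have hBn := fun x c => hnear hR hΛ3 Zs Z G hG hsize
    (hd.trans (by gcongr; exact min_le_left _ _)) v x c
  have hBm' : ∀ x c : Fin K, blockMean κ₁ κ₂ G Z v x c ≤ 3 / 4 := fun x c => by
    linarith [(hBm x c).2, hR.le]
  have main : ∀ x : Fin K, |∑ j ∈ Finset.univ.erase v,
      (bernLog (adj G v j) (blockMean κ₁ κ₂ G Z v x (Z j))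
        - bernLog (adj G v j) (labelMean p q x (Zs j)))| ≤ 3 * r / 16 * snr n p q := by
    intro x
    rw [sum_bernLog_sub_split p q Zs Z G v x]
    refine (abs_add_le _ _).trans ((add_le_add
      (abs_sum_bernLog_drift_le hC₀ hR hr'0.le hr'1 (fun c => (hBm x c).1) (hBm' x) (hBn x) hd)
      (abs_sum_logOdds_noise_le hC₀ hR hr'0.le hr'1 hc₁0 hc₁1 (fun c => (hBm x c).1) (hBm' x)
        (hBn x) hG hv)).trans ?_)
    nlinarith [mul_le_mul_of_nonneg_right hr'2 hsnr0, mul_le_mul_of_nonneg_right hρ2 hsnr0, mul_le_mul_of_nonneg_right hc₁2 hsnr0]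
  have ma := abs_le.mp (main (Zs v))
  have mb := abs_le.mp (main b)
  have hF' := abs_le.mp hF
  unfold idealGain
  simp only [Finset.sum_sub_distrib] at ma mb hF' ⊢
  rw [abs_le]
  constructor <;> linarith [ma.1, ma.2, mb.1, mb.2, hF'.1, hF'.2]

end Near

end

end SBM

namespace SBM

noncomputable section

/-! ### Assignments close to the truth: drift and posterior mass -/

section NearMass

variable {n K : ℕ}

/-- Small sets of nodes receive little noise from every set that is not much smaller. -/
def SmallSetBound (ρ η c₁ p q : ℝ) (Zs : Labels n K) (G : SimpleGraph (Fin n)) : Prop :=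
  ∀ S T : Finset (Fin n), (S.card : ℝ) ≤ ρ * n → T.Nonempty → η * S.card ≤ T.card →
    |noiseSum p q Zs G T S| < T.card * (c₁ * (n * (p - q)))

/-- The total weight of the single flips away from the truth. -/
def flipMass (p q : ℝ) (Zs : Labels n K) (G : SimpleGraph (Fin n)) : ℝ :=
  ∑ v, ∑ b ∈ Finset.univ.erase (Zs v), Real.exp (-(idealGain p q Zs G v b / 2))

lemma noiseSum_eq_sum (p q : ℝ) (Zs : Labels n K) (G : SimpleGraph (Fin n))
    (S T : Finset (Fin n)) : noiseSum p q Zs G T S = ∑ v ∈ T, noiseSum p q Zs G {v} S := by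
  unfold noiseSum; simp only [Finset.sum_singleton]

/-- Nodes whose noise towards `S` is large with a common sign form a set with large total noise,
which is forbidden unless the set is much smaller than `S`. The two signs give the factor two. -/
lemma SmallSetBound.card_le {ρ η c₁ p q : ℝ} {Zs : Labels n K} {G : SimpleGraph (Fin n)}
    (h : SmallSetBound ρ η c₁ p q Zs G) (hη : 0 ≤ η) {S : Finset (Fin n)} (hS : (S.card : ℝ) ≤ ρ * n) :
    ((Finset.univ.filter fun v => c₁ * (n * (p - q)) < |noiseSum p q Zs G {v} S|).card : ℝ)
      ≤ 2 * η * S.card := by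
  classical
  have key : ∀ ε : ℝ, |ε| = 1 →
      ((Finset.univ.filter fun v => c₁ * (n * (p - q)) < ε * noiseSum p q Zs G {v} S).card : ℝ)
        ≤ η * S.card := by
    intro ε hε
    set T := Finset.univ.filter fun v => c₁ * (n * (p - q)) < ε * noiseSum p q Zs G {v} S
    by_contra hT
    push Not at hT
    have hne : T.Nonempty := by
      rw [← Finset.card_pos]
      have : (0 : ℝ) < T.card := lt_of_le_of_lt (by positivity) hT
      exact_mod_cast this
    have h1 := h S T hS hne hT.le
    have h2 : T.card * (c₁ * (n * (p - q))) ≤ ε * noiseSum p q Zs G T S := by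
      rw [noiseSum_eq_sum, Finset.mul_sum, ← nsmul_eq_mul, ← Finset.sum_const]
      exact Finset.sum_le_sum fun v hv => (Finset.mem_filter.mp hv).2.le
    have h3 : ε * noiseSum p q Zs G T S ≤ |noiseSum p q Zs G T S| := by
      refine (le_abs_self _).trans ?_
      rw [abs_mul, hε, one_mul]
    linarith
  have hsub : (Finset.univ.filter fun v => c₁ * (n * (p - q)) < |noiseSum p q Zs G {v} S|)
      ⊆ (Finset.univ.filter fun v => c₁ * (n * (p - q)) < 1 * noiseSum p q Zs G {v} S)
        ∪ Finset.univ.filter fun v => c₁ * (n * (p - q)) < -1 * noiseSum p q Zs G {v} S := by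
    intro v hv
    have := (Finset.mem_filter.mp hv).2
    rw [lt_abs] at this
    simpa using this
  have h1 := (Finset.card_le_card hsub).trans (Finset.card_union_le _ _)
  have h2 := key 1 (by simp)
  have h3 := key (-1) (by simp)
  have h1' : ((Finset.univ.filter fun v => c₁ * (n * (p - q)) < |noiseSum p q Zs G {v} S|).card : ℝ)
      ≤ (Finset.univ.filter fun v => c₁ * (n * (p - q)) < 1 * noiseSum p q Zs G {v} S).card
        + (Finset.univ.filter fun v => c₁ * (n * (p - q)) < -1 * noiseSum p q Zs G {v} S).card := by
    exact_mod_cast h1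
  linarith

lemma card_confusion_le {Z Zs : Labels n K} {c d : Fin K} (hcd : c ≠ d) :
    (confusion Z Zs c d).card ≤ hammingDist Z Zs := by
  rw [← card_misclassified]
  refine Finset.card_le_card fun j hj => ?_
  obtain ⟨h1, h2⟩ := (Finset.mem_filter.mp hj).2
  simp [h1, h2, hcd]

lemma abs_card_labelClass_sub_le (Z Zs : Labels n K) (c : Fin K) :
    |((labelClass Z c).card : ℝ) - (labelClass Zs c).card| ≤ hammingDist Z Zs := by
  classical
  have key : ∀ Z Zs : Labels n K, (labelClass Z c).card ≤ (labelClass Zs c).card + hammingDist Z Zs := by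
    intro Z Zs
    rw [← card_misclassified]
    refine (Finset.card_le_card fun j hj => ?_).trans (Finset.card_union_le _ _)
    rw [mem_labelClass] at hj
    by_cases h : Z j = Zs j
    · simp [← h, hj]
    · simp [h]
  have h1 : ((labelClass Z c).card : ℝ) ≤ (labelClass Zs c).card + hammingDist Z Zs := by
    exact_mod_cast key Z Zs
  have h2 : ((labelClass Zs c).card : ℝ) ≤ (labelClass Z c).card + hammingDist Z Zs := by
    rw [hammingDist_comm]; exact_mod_cast key Zs Z
  rw [abs_le]; constructor <;> linarith

/-- Assignments close to a balanced one are balanced, with a slightly larger constant. -/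
lemma isBalanced_of_near {α β ρ : ℝ} (hβ : 0 < β) (hα : β < α) (hK : 0 < K)
    (hρ₁ : ρ ≤ (1 / β - 1 / α) / K) (hρ₂ : ρ ≤ (α - β) / K) {Zs Z : Labels n K}
    (hZs : IsBalanced β Zs) (hd : (hammingDist Z Zs : ℝ) ≤ ρ * n) : IsBalanced α Z := by
  intro c
  have hK' : (0 : ℝ) < K := by exact_mod_cast hK
  have h1 := abs_le.mp (abs_card_labelClass_sub_le Z Zs c)
  have h2 := hZs c
  have hα0 : 0 < α := hβ.trans hα
  change (n : ℝ) / (α * K) ≤ ((labelClass Z c).card : ℝ) ∧ ((labelClass Z c).card : ℝ) ≤ α * n / K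
  change (n : ℝ) / (β * K) ≤ ((labelClass Zs c).card : ℝ) ∧ ((labelClass Zs c).card : ℝ) ≤ β * n / K at h2
  have h3 : (hammingDist Z Zs : ℝ) ≤ n / (β * K) - n / (α * K) := by
    calc _ ≤ (1 / β - 1 / α) / K * n := hd.trans (by gcongr)
      _ = _ := by field_simp
  have h4 : (hammingDist Z Zs : ℝ) ≤ α * n / K - β * n / K := by
    calc _ ≤ (α - β) / K * n := hd.trans (by gcongr)
      _ = _ := by field_simp
  constructor <;> linarith [h1.1, h1.2, h2.1, h2.2]

lemma IsBalanced.le_card {α : ℝ} {Z : Labels n K} (h : IsBalanced α Z) (c : Fin K) :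
    1 / (α * K) * n ≤ (labelClass Z c).card := by
  have := (h c).1
  change (n : ℝ) / (α * K) ≤ ((labelClass Z c).card : ℝ) at this
  calc _ = (n : ℝ) / (α * K) := by ring
    _ ≤ _ := this

/-- Close to the truth, all but a small proportion of the nodes have an almost ideal gain. -/
theorem exists_near_gain (K : ℕ) (hK : 2 ≤ K) (κ₁ κ₂ C₀ C₁ c₀ r : ℝ) (h₁ : 0 < κ₁) (h₂ : 0 < κ₂)
    (hC₀ : 0 < C₀) (hC₁ : 0 < C₁) (hc₀ : 0 < c₀) (hr : 0 < r) :
    ∃ ρ₁ c₁ Λ : ℝ, 0 < ρ₁ ∧ 0 < c₁ ∧ 0 < Λ ∧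
      ∀ {n : ℕ} {p q : ℝ}, Regime C₀ p q → Λ ≤ snr n p q →
      ∀ (Zs : Labels n K) (G : SimpleGraph (Fin n)) (ρ : ℝ),
      NoiseBound C₁ p q Zs G → ρ ≤ ρ₁ → SmallSetBound ρ (1 / (32 * K ^ 3)) c₁ p q Zs G →
      (∀ v b, b ≠ Zs v → r * snr n p q ≤ idealGain p q Zs G v b) →
      ∀ Z : Labels n K, (∀ c, c₀ * n ≤ (labelClass Z c).card) →
      (hammingDist Z Zs : ℝ) ≤ ρ * n → ∃ Bad : Finset (Fin n),
        (Bad.card : ℝ) ≤ hammingDist Z Zs / (16 * K) ∧ ∀ v, v ∉ Bad → ∀ b, b ≠ Zs v →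
          idealGain p q Zs G v b / 2 ≤ Real.log (marginal κ₁ κ₂ G (Function.update Z v (Zs v)))
            - Real.log (marginal κ₁ κ₂ G (Function.update Z v b)) := by
  classical
  -- Accuracy `r / 2` against an ideal gain of at least `r * snr` preserves half of the ideal gain.
  obtain ⟨ρ₁, c₁, Λ, hρ₁, hc₁, hΛ, hflip⟩ :=
    exists_flip_near K κ₁ κ₂ C₀ C₁ c₀ (r / 2) h₁ h₂ hC₀ hC₁ hc₀ (by positivity)
  refine ⟨ρ₁, c₁, Λ, hρ₁, hc₁, hΛ, ?_⟩
  intro n p q hR hsnr Zs G ρ hG hρ hS hideal Z hsize hd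
  have hK' : (0 : ℝ) < K := by exact_mod_cast (by omega : 0 < K)
  -- Nodes with large noise towards some off-diagonal cell. There are at most `K ^ 2` cells, each
  -- with `2 / (32 * K ^ 3)` exceptional nodes per misclassified node, which gives the proportion `1
  -- / (16 * K)`.
  set bad : Fin K × Fin K → Finset (Fin n) := fun x =>
    if x.1 = x.2 then ∅ else
      Finset.univ.filter fun v => c₁ * (n * (p - q)) < |noiseSum p q Zs G {v} (confusion Z Zs x.1 x.2)|
  have hbad : ∀ x, ((bad x).card : ℝ) ≤ 2 * (1 / (32 * K ^ 3)) * hammingDist Z Zs := by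
    intro x
    simp only [bad]
    split_ifs with h
    · simp; positivity
    · have hc : ((confusion Z Zs x.1 x.2).card : ℝ) ≤ hammingDist Z Zs := by
        exact_mod_cast card_confusion_le h
      refine (hS.card_le (by positivity) (hc.trans hd)).trans ?_
      gcongr
  refine ⟨Finset.univ.biUnion bad, ?_, ?_⟩
  · calc ((Finset.univ.biUnion bad).card : ℝ) ≤ ∑ x, ((bad x).card : ℝ) := by
          exact_mod_cast Finset.card_biUnion_le
      _ ≤ ∑ x : Fin K × Fin K, 2 * (1 / (32 * K ^ 3)) * (hammingDist Z Zs : ℝ) :=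
          Finset.sum_le_sum fun x _ => hbad x
      _ = _ := by
          simp only [Finset.sum_const, Finset.card_univ, Fintype.card_prod, Fintype.card_fin,
            nsmul_eq_mul]
          push_cast
          field_simp
          ring
  · intro v hv b hb
    have h := hflip hR hsnr Zs Z G hG hsize (hd.trans (by gcongr)) v (by
      intro c d hcd
      by_contra hlt
      push Not at hlt
      refine hv (Finset.mem_biUnion.mpr ⟨(c, d), Finset.mem_univ _, ?_⟩)
      simp [bad, hcd, hlt]) b
    have := hideal v b hb
    linarith [(abs_le.mp h).1]

/-- All but a few nodes of an assignment close to the truth have a gain of at least half the ideal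
one. -/
def NearGain (κ₁ κ₂ ρ p q : ℝ) (Zs : Labels n K) (G : SimpleGraph (Fin n)) : Prop :=
  ∀ Z : Labels n K, (hammingDist Z Zs : ℝ) ≤ ρ * n → ∃ Bad : Finset (Fin n),
    (Bad.card : ℝ) ≤ hammingDist Z Zs / (16 * K) ∧ ∀ v, v ∉ Bad → ∀ b, b ≠ Zs v →
      idealGain p q Zs G v b / 2 ≤ Real.log (marginal κ₁ κ₂ G (Function.update Z v (Zs v)))
        - Real.log (marginal κ₁ κ₂ G (Function.update Z v b))

variable {κ₁ κ₂ ρ p q : ℝ} {Zs : Labels n K} {G : SimpleGraph (Fin n)}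

lemma marginal_le_of_log {Z W : Labels n K} (h₁ : 0 < κ₁) (h₂ : 0 < κ₂) {x : ℝ}
    (h : x ≤ Real.log (marginal κ₁ κ₂ G W) - Real.log (marginal κ₁ κ₂ G Z)) :
    marginal κ₁ κ₂ G Z ≤ Real.exp (-x) * marginal κ₁ κ₂ G W := by
  have hZ := marginal_pos h₁ h₂ G Z
  have hW := marginal_pos h₁ h₂ G W
  calc marginal κ₁ κ₂ G Z = Real.exp (Real.log (marginal κ₁ κ₂ G Z)) := (Real.exp_log hZ).symm
    _ ≤ Real.exp (-x + Real.log (marginal κ₁ κ₂ G W)) := Real.exp_le_exp.mpr (by linarith)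
    _ = _ := by rw [Real.exp_add, Real.exp_log hW]

lemma flipMass_nonneg (p q : ℝ) (Zs : Labels n K) (G : SimpleGraph (Fin n)) :
    0 ≤ flipMass p q Zs G :=
  Finset.sum_nonneg fun _ _ => Finset.sum_nonneg fun _ _ => (Real.exp_pos _).le

/-- Rate of the flips away from the truth, given an exceptional set of nodes. -/
lemma outwardRate_le (h₁ : 0 < κ₁) (h₂ : 0 < κ₂) {Z : Labels n K} {Bad : Finset (Fin n)}
    {w : Fin n → Fin K → ℝ} (hw : ∀ v b, 0 ≤ w v b)
    (hgood : ∀ v, v ∉ Bad → Z v = Zs v → ∀ b, b ≠ Zs v →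
      marginal κ₁ κ₂ G (Function.update Z v b) ≤ w v b * marginal κ₁ κ₂ G Z) :
    outwardRate κ₁ κ₂ G Z Zs
      ≤ K * Bad.card + ∑ v, ∑ b ∈ Finset.univ.erase (Zs v), w v b := by
  classical
  unfold outwardRate
  rw [← Finset.univ_product_univ, Finset.sum_product]
  have hterm : ∀ v, (∑ b, if Z v = Zs v ∧ b ≠ Z v then
        min 1 (marginal κ₁ κ₂ G (Function.update Z v b) / marginal κ₁ κ₂ G Z) else 0)
      ≤ (if v ∈ Bad then (K : ℝ) else 0) + ∑ b ∈ Finset.univ.erase (Zs v), w v b := by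
    intro v
    have hs : 0 ≤ ∑ b ∈ Finset.univ.erase (Zs v), w v b := Finset.sum_nonneg fun _ _ => hw _ _
    by_cases hv : v ∈ Bad
    · rw [if_pos hv]
      calc _ ≤ ∑ b : Fin K, (1 : ℝ) := Finset.sum_le_sum fun b _ => by
            split_ifs
            · exact min_le_left _ _
            · norm_num
        _ = K := by simp
        _ ≤ _ := le_add_of_nonneg_right hs
    · rw [if_neg hv, zero_add]
      by_cases hZ : Z v = Zs v
      · rw [← Finset.filter_ne', Finset.sum_filter]
        refine Finset.sum_le_sum fun b _ => ?_
        by_cases hb : b = Zs v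
        · simp [hZ, hb]
        · simp only [hZ, hb, ne_eq, not_false_eq_true, and_self, if_true]
          refine (min_le_right _ _).trans ?_
          rw [div_le_iff₀ (marginal_pos h₁ h₂ G Z)]
          exact hgood v hv hZ b hb
      · simp only [hZ, false_and, if_false, Finset.sum_const_zero]
        exact hs
  calc _ ≤ ∑ v, ((if v ∈ Bad then (K : ℝ) else 0) + ∑ b ∈ Finset.univ.erase (Zs v), w v b) :=
        Finset.sum_le_sum fun v _ => hterm v
    _ = _ := by
        rw [Finset.sum_add_distrib, ← Finset.sum_filter, Finset.filter_mem_eq_inter,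
          Finset.univ_inter, Finset.sum_const, nsmul_eq_mul, mul_comm]

/-- Drift towards the truth for assignments close to it. -/
theorem NearGain.drift {α β : ℝ} (h₁ : 0 < κ₁) (h₂ : 0 < κ₂) (hK : 2 ≤ K)
    (hN : NearGain κ₁ κ₂ ρ p q Zs G) (hmass : flipMass p q Zs G ≤ 1 / 16)
    (hpos : ∀ v b, b ≠ Zs v → 0 ≤ idealGain p q Zs G v b)
    (hβ : 0 < β) (hα : β < α) (hρ₁ : ρ ≤ (1 / β - 1 / α) / K) (hρ₂ : ρ ≤ (α - β) / K)
    (hZs : IsBalanced β Zs) {Z : Labels n K} (hZ0 : hammingDist Z Zs ≠ 0)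
    (hd : (hammingDist Z Zs : ℝ) ≤ ρ * n) : ∃ S : Finset (Fin n),
      (∀ i ∈ S, Z i ≠ Zs i ∧ IsBalanced α (Function.update Z i (Zs i)) ∧
        marginal κ₁ κ₂ G Z ≤ marginal κ₁ κ₂ G (Function.update Z i (Zs i))) ∧
      1 / 2 * (hammingDist Z Zs : ℝ) ≤ S.card ∧ outwardRate κ₁ κ₂ G Z Zs ≤ (S.card : ℝ) / 2 := by
  classical
  obtain ⟨Bad, hBad, hgain⟩ := hN Z hd
  have hK' : (2 : ℝ) ≤ K := by exact_mod_cast hK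
  have hk1 : (1 : ℝ) ≤ hammingDist Z Zs := by exact_mod_cast Nat.one_le_iff_ne_zero.mpr hZ0
  refine ⟨(Finset.univ.filter fun j => Z j ≠ Zs j) \ Bad, ?_, ?_⟩
  · intro i hi
    obtain ⟨hi1, hi2⟩ := Finset.mem_sdiff.mp hi
    have hne : Z i ≠ Zs i := (Finset.mem_filter.mp hi1).2
    refine ⟨hne, isBalanced_of_near hβ hα (by omega) hρ₁ hρ₂ hZs
      (le_trans ?_ hd), ?_⟩
    · have h := hammingDist_update_of_eq (W := Zs) hne rfl
      exact_mod_cast (by omega : hammingDist (Function.update Z i (Zs i)) Zs ≤ hammingDist Z Zs)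
    · have h := hgain i hi2 (Z i) hne
      rw [Function.update_eq_self] at h
      refine (marginal_le_of_log h₁ h₂ h).trans ?_
      refine mul_le_of_le_one_left (marginal_pos h₁ h₂ G _).le (Real.exp_le_one_iff.mpr ?_)
      linarith [hpos i (Z i) hne]
  · have hcard : (hammingDist Z Zs : ℝ) - Bad.card
        ≤ (((Finset.univ.filter fun j => Z j ≠ Zs j) \ Bad).card : ℝ) := by
      have := Finset.le_card_sdiff Bad (Finset.univ.filter fun j => Z j ≠ Zs j)
      rw [card_misclassified] at this
      have h2 : hammingDist Z Zs ≤ ((Finset.univ.filter fun j => Z j ≠ Zs j) \ Bad).card + Bad.card := by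
        omega
      have h3 : (hammingDist Z Zs : ℝ)
        ≤ (((Finset.univ.filter fun j => Z j ≠ Zs j) \ Bad).card : ℝ) + Bad.card := by exact_mod_cast h2
      linarith
    have hB1 : K * (Bad.card : ℝ) ≤ hammingDist Z Zs / 16 := by
      rw [le_div_iff₀ (by positivity)] at hBad
      linarith
    have hB2 : (Bad.card : ℝ) ≤ hammingDist Z Zs / 32 := by nlinarith
    -- Exceptional nodes and the flip mass contribute at most `1 / 16` of the distance each, the
    -- latter because the distance is at least one; the set of corrections contains `31 / 32` of the
    -- misclassified nodes.
    have hout := outwardRate_le (Zs := Zs) (G := G) h₁ h₂ (Z := Z) (Bad := Bad)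
      (w := fun v b => Real.exp (-(idealGain p q Zs G v b / 2))) (fun _ _ => (Real.exp_pos _).le)
      (fun v hv hZ b hb => by
        have h := hgain v hv b hb
        rw [← hZ, Function.update_eq_self] at h
        exact marginal_le_of_log h₁ h₂ h)
    change _ ≤ _ + flipMass p q Zs G at hout
    constructor <;> linarith

/-- Close to the truth, the posterior decays at least like a product over the misclassified
nodes. -/
lemma NearGain.marginal_le (h₁ : 0 < κ₁) (h₂ : 0 < κ₂) (hK : 2 ≤ K)
    (hN : NearGain κ₁ κ₂ ρ p q Zs G) (Z : Labels n K) (hd : (hammingDist Z Zs : ℝ) ≤ ρ * n) :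
    marginal κ₁ κ₂ G Z
      ≤ (∏ i, if Z i = Zs i then 1 else Real.exp (-(idealGain p q Zs G i (Z i) / 2)))
        * marginal κ₁ κ₂ G Zs := by
  classical
  induction hk : hammingDist Z Zs generalizing Z with
  | zero =>
    rw [hammingDist_eq_zero.mp hk]; simp
  | succ k ih =>
    obtain ⟨Bad, hBad, hgain⟩ := hN Z hd
    have hK' : (2 : ℝ) ≤ K := by exact_mod_cast hK
    -- Some misclassified node is not exceptional. Correcting it gains its factor, and the induction
    -- continues from an assignment that is closer to the truth.
    have hlt : Bad.card < (Finset.univ.filter fun j => Z j ≠ Zs j).card := by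
      rw [card_misclassified]
      have h1 : (0 : ℝ) < hammingDist Z Zs := by rw [hk]; positivity
      have h2 : (Bad.card : ℝ) < hammingDist Z Zs := by
        refine hBad.trans_lt ?_
        rw [div_lt_iff₀ (by positivity)]; nlinarith
      exact_mod_cast h2
    obtain ⟨i, hi, hiB⟩ := Finset.exists_mem_notMem_of_card_lt_card hlt
    have hne : Z i ≠ Zs i := (Finset.mem_filter.mp hi).2
    have hup := hammingDist_update_of_eq (W := Zs) hne rfl
    have h := hgain i hiB (Z i) hne
    rw [Function.update_eq_self] at h
    have h3 := ih (Function.update Z i (Zs i)) (le_trans (by exact_mod_cast (by omega)) hd) (by omega)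
    refine (marginal_le_of_log h₁ h₂ h).trans ?_
    calc _ ≤ Real.exp (-(idealGain p q Zs G i (Z i) / 2)) * _ :=
          mul_le_mul_of_nonneg_left h3 (Real.exp_pos _).le
      _ = _ := by
          rw [← mul_assoc, ← Finset.mul_prod_erase _ _ (Finset.mem_univ i),
            ← Finset.mul_prod_erase Finset.univ _ (Finset.mem_univ i)]
          simp only [Function.update_self, if_true, one_mul, hne, if_false]
          congr 2
          refine Finset.prod_congr rfl fun j hj => ?_
          rw [Function.update_of_ne (Finset.ne_of_mem_erase hj)]

/-- Posterior mass close to the truth, relative to the truth. -/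
theorem NearGain.sum_le (h₁ : 0 < κ₁) (h₂ : 0 < κ₂) (hK : 2 ≤ K)
    (hN : NearGain κ₁ κ₂ ρ p q Zs G) (hmass : flipMass p q Zs G ≤ 1)
    (s : Finset (Labels n K)) (hs : ∀ Z ∈ s, Z ≠ Zs ∧ (hammingDist Z Zs : ℝ) ≤ ρ * n) :
    ∑ Z ∈ s, marginal κ₁ κ₂ G Z / marginal κ₁ κ₂ G Zs ≤ 2 * flipMass p q Zs G := by
  classical
  set w : Labels n K → ℝ := fun Z =>
    ∏ i, if Z i = Zs i then 1 else Real.exp (-(idealGain p q Zs G i (Z i) / 2)) with hw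
  have hw0 : ∀ Z, 0 ≤ w Z := fun Z => Finset.prod_nonneg fun i _ => by
    split_ifs
    · norm_num
    · exact (Real.exp_pos _).le
  have hwZs : w Zs = 1 := by simp [hw]
  -- The product weights form a partition function of independent labels, which factorises over the
  -- nodes and is at most `exp (flipMass)`; the truth accounts for the term one.
  have hsum : ∑ Z, w Z = ∏ i, (1 + ∑ b ∈ Finset.univ.erase (Zs i),
      Real.exp (-(idealGain p q Zs G i b / 2))) := by
    rw [hw, ← Fintype.piFinset_univ, ← Finset.prod_univ_sum (fun _ => Finset.univ)
      (fun i b => if b = Zs i then (1 : ℝ) else Real.exp (-(idealGain p q Zs G i b / 2)))]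
    refine Finset.prod_congr rfl fun i _ => ?_
    rw [← Finset.add_sum_erase _ _ (Finset.mem_univ (Zs i)), if_pos rfl]
    congr 1
    exact Finset.sum_congr rfl fun b hb => if_neg (Finset.ne_of_mem_erase hb)
  have hprod : ∑ Z, w Z ≤ Real.exp (flipMass p q Zs G) := by
    rw [hsum, flipMass, Real.exp_sum]
    refine Finset.prod_le_prod (fun i _ => ?_) fun i _ => ?_
    · exact add_nonneg zero_le_one (Finset.sum_nonneg fun b _ => (Real.exp_pos _).le)
    · rw [add_comm]; exact Real.add_one_le_exp _
  have hexp : Real.exp (flipMass p q Zs G) ≤ 1 + 2 * flipMass p q Zs G := by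
    have h0 := flipMass_nonneg p q Zs G
    -- Taylor's formula of order one on the unit interval: `exp x ≤ 1 + 2 * x`.
    have := Real.exp_bound' h0 hmass (n := 1) (by norm_num)
    norm_num [Finset.sum_range_succ] at this
    linarith
  calc _ ≤ ∑ Z ∈ s, w Z := Finset.sum_le_sum fun Z hZ => by
        rw [div_le_iff₀ (marginal_pos h₁ h₂ G Zs)]
        exact hN.marginal_le h₁ h₂ hK Z (hs Z hZ).2
    _ ≤ ∑ Z ∈ Finset.univ.erase Zs, w Z :=
        Finset.sum_le_sum_of_subset_of_nonneg
          (fun Z hZ => Finset.mem_erase.mpr ⟨(hs Z hZ).1, Finset.mem_univ _⟩) fun Z _ _ => hw0 Z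
    _ = ∑ Z, w Z - 1 := by
        rw [← Finset.add_sum_erase _ _ (Finset.mem_univ Zs), hwZs]; ring
    _ ≤ _ := by linarith

end NearMass

end

end SBM

namespace SBM

noncomputable section

/-! ### Assignments far from the truth -/

section Far

variable {n K : ℕ}

/-- The density of edges in a block. -/
def blockDensity (G : SimpleGraph (Fin n)) (Z : Labels n K) (e : Sym2 (Fin K)) : ℝ :=
  pairCount (edgeRel G Z e) / (pairCount (edgeRel G Z e) + pairCount (nonEdgeRel G Z e))

/-- The observed density maximises the likelihood of a block: `bernLog_sub_le` at `y = m`. -/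
lemma pow_mul_pow_le_of_density {O M : ℕ} {b x : ℝ} (hN : (O : ℝ) + M ≠ 0)
    (hb : b = O / (O + M)) (hb0 : 0 < b) (hb1 : b < 1) (hx0 : 0 < x) (hx1 : x < 1) :
    x ^ O * (1 - x) ^ M ≤ b ^ O * (1 - b) ^ M := by
  have hO : (O : ℝ) = (O + M) * b := by rw [hb]; field_simp
  have hM : (M : ℝ) = (O + M) * (1 - b) := by linarith
  have hkey : bernLog b x ≤ bernLog b b := by
    have := bernLog_sub_le hb0.le hb1.le hx0 hx1 hb0 hb1
    simp only [sub_self, mul_zero, zero_div] at this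
    linarith
  have hlog : ∀ y : ℝ, 0 < y → y < 1 →
      y ^ O * (1 - y) ^ M = Real.exp ((O + M) * bernLog b y) := by
    intro y hy0 hy1
    have : ((O : ℝ) + M) * bernLog b y = O * Real.log y + M * Real.log (1 - y) := by
      unfold bernLog
      linear_combination (-Real.log y) * hO - Real.log (1 - y) * hM
    rw [this, Real.exp_add, mul_comm (O : ℝ), mul_comm (M : ℝ), Real.exp_mul, Real.exp_mul,
      Real.exp_log hy0, Real.exp_log (sub_pos.mpr hy1), Real.rpow_natCast, Real.rpow_natCast]
  rw [hlog x hx0 hx1, hlog b hb0 hb1]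
  gcongr

/-- The marginal likelihood averages each block over its parameter and is at most the likelihood at
the maximisers. -/
lemma marginal_le_likelihood {κ₁ κ₂ : ℝ} (h₁ : 0 < κ₁) (h₂ : 0 < κ₂) (G : SimpleGraph (Fin n))
    (Z : Labels n K) (h : ∀ e, 0 < blockDensity G Z e ∧ blockDensity G Z e < 1) :
    marginal κ₁ κ₂ G Z ≤ likelihood G Z (blockDensity G Z) := by
  rw [marginal_eq_prod h₁ h₂, likelihood_eq_prod_blocks]
  refine Finset.prod_le_prod (fun e _ => (blockWeight_pos h₁ h₂ _ _).le) fun e _ => ?_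
  refine blockWeight_le_of_forall h₁ h₂ _ _ _ fun x hx0 hx1 => ?_
  refine pow_mul_pow_le_of_density (fun hN => ?_) rfl (h e).1 (h e).2 hx0 hx1
  have := (h e).1
  unfold blockDensity at this
  rw [hN, div_zero] at this
  exact lt_irrefl _ this

lemma pairCount_add_le (G : SimpleGraph (Fin n)) (Z : Labels n K) (e : Sym2 (Fin K)) :
    pairCount (edgeRel G Z e) + pairCount (nonEdgeRel G Z e) ≤ n ^ 2 := by
  classical
  unfold pairCount
  rw [← Finset.card_union_of_disjoint]
  · exact (Finset.card_le_univ _).trans (by simp [sq])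
  · rw [Finset.disjoint_left]
    intro x h h'
    exact (Finset.mem_filter.mp h').2.2 (Finset.mem_filter.mp h).2.2

/-- Up to an exponential factor, the marginal likelihood dominates the likelihood at any
connectivity. -/
theorem exists_likelihood_le (K : ℕ) (κ₁ κ₂ : ℝ) (h₁ : 0 < κ₁) (h₂ : 0 < κ₂) : ∃ C : ℝ, 0 < C ∧
    ∀ {n : ℕ}, 0 < n → ∀ (G : SimpleGraph (Fin n)) (Z : Labels n K) (B : Sym2 (Fin K) → ℝ),
      (∀ e, 0 ≤ B e ∧ B e ≤ 1) → likelihood G Z B ≤ Real.exp (C * n) * marginal κ₁ κ₂ G Z := by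
  set E := ⌈κ₁ + κ₂⌉₊ + 2
  set c := min κ₁ 1 * min κ₂ 1 with hc
  have hc0 : 0 < c := by positivity
  refine ⟨Fintype.card (Sym2 (Fin K)) * (2 * E + |Real.log c|) + 1, by positivity, ?_⟩
  intro n hn G Z B hB
  have hn' : (1 : ℝ) ≤ n := by exact_mod_cast hn
  rw [marginal_eq_prod h₁ h₂, likelihood_eq_prod_blocks]
  have hterm : ∀ e, B e ^ pairCount (edgeRel G Z e) * (1 - B e) ^ pairCount (nonEdgeRel G Z e)
      ≤ Real.exp ((2 * E + |Real.log c|) * n) * blockWeight κ₁ κ₂ (pairCount (edgeRel G Z e))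
        (pairCount (nonEdgeRel G Z e)) := by
    intro e
    have h := pow_mul_pow_le_blockWeight h₁ h₂ (pairCount (edgeRel G Z e))
      (pairCount (nonEdgeRel G Z e)) (hB e).1 (hB e).2
    have hW := blockWeight_pos h₁ h₂ (pairCount (edgeRel G Z e)) (pairCount (nonEdgeRel G Z e))
    have hN : (pairCount (edgeRel G Z e) : ℝ) + pairCount (nonEdgeRel G Z e) ≤ n ^ 2 := by
      exact_mod_cast pairCount_add_le G Z e
    -- The polynomial loss is bounded generously by an exponential in `n`; it is compared later with
    -- `exp (-c * n * snr)`, where `snr` is large.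
    have hN1 : (pairCount (edgeRel G Z e) : ℝ) + pairCount (nonEdgeRel G Z e) + 1
        ≤ Real.exp (2 * n) := by
      have h3 : (n : ℝ) + 1 ≤ Real.exp n := Real.add_one_le_exp _
      have h4 : Real.exp (2 * n) = Real.exp n * Real.exp n := by rw [← Real.exp_add]; ring_nf
      rw [h4]; nlinarith
    have hpow : ((pairCount (edgeRel G Z e) : ℝ) + pairCount (nonEdgeRel G Z e) + 1) ^ E
        ≤ Real.exp (2 * E * n) := by
      calc _ ≤ Real.exp (2 * n) ^ E := by gcongr
        _ = _ := by rw [← Real.exp_nat_mul]; ring_nf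
    have hcinv : 1 ≤ c * Real.exp (|Real.log c| * n) := by
      calc (1 : ℝ) = c * Real.exp (-Real.log c) := by
            rw [Real.exp_neg, Real.exp_log hc0]; field_simp
        _ ≤ _ := by
            gcongr
            nlinarith [neg_abs_le (Real.log c), abs_nonneg (Real.log c)]
    set L := B e ^ pairCount (edgeRel G Z e) * (1 - B e) ^ pairCount (nonEdgeRel G Z e)
    have hL : 0 ≤ L := mul_nonneg (pow_nonneg (hB e).1 _) (pow_nonneg (by linarith [(hB e).2]) _)
    calc L ≤ (c * Real.exp (|Real.log c| * n)) * L := le_mul_of_one_le_left hL hcinv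
      _ = Real.exp (|Real.log c| * n) * (c * L) := by ring
      _ ≤ Real.exp (|Real.log c| * n) * (blockWeight κ₁ κ₂ (pairCount (edgeRel G Z e))
          (pairCount (nonEdgeRel G Z e)) * Real.exp (2 * E * n)) := by
          refine mul_le_mul_of_nonneg_left (h.trans ?_) (Real.exp_pos _).le
          exact mul_le_mul_of_nonneg_left hpow hW.le
      _ = _ := by rw [add_mul, Real.exp_add]; ring
  calc _ ≤ ∏ e, Real.exp ((2 * E + |Real.log c|) * n) * blockWeight κ₁ κ₂
        (pairCount (edgeRel G Z e)) (pairCount (nonEdgeRel G Z e)) :=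
        Finset.prod_le_prod (fun e _ => mul_nonneg (pow_nonneg (hB e).1 _)
          (pow_nonneg (by linarith [(hB e).2]) _)) fun e _ => hterm e
    _ = Real.exp (Fintype.card (Sym2 (Fin K)) * ((2 * E + |Real.log c|) * n))
        * ∏ e, blockWeight κ₁ κ₂ (pairCount (edgeRel G Z e)) (pairCount (nonEdgeRel G Z e)) := by
        rw [Finset.prod_mul_distrib, Finset.prod_const, ← Real.exp_nat_mul, Finset.card_univ]
    _ ≤ _ := by
        refine mul_le_mul_of_nonneg_right (Real.exp_le_exp.mpr ?_)
          (Finset.prod_nonneg fun e _ => (blockWeight_pos h₁ h₂ _ _).le)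
        nlinarith

lemma log_likelihood (G : SimpleGraph (Fin n)) (Z : Labels n K) (B : Sym2 (Fin K) → ℝ)
    (hB : ∀ e, 0 < B e ∧ B e < 1) : 0 < likelihood G Z B ∧
      Real.log (likelihood G Z B)
        = ∑ x ∈ pairs n, bernLog (adj G x.1 x.2) (B s(Z x.1, Z x.2)) := by
  classical
  rw [likelihood_eq_prod_pairs]
  have hpos : ∀ x ∈ pairs n,
      0 < if G.Adj x.1 x.2 then B s(Z x.1, Z x.2) else 1 - B s(Z x.1, Z x.2) := fun x _ => by
    split_ifs
    · exact (hB _).1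
    · linarith [(hB s(Z x.1, Z x.2)).2]
  refine ⟨Finset.prod_pos hpos, ?_⟩
  rw [Real.log_prod fun x hx => (hpos x hx).ne']
  refine Finset.sum_congr rfl fun x _ => ?_
  unfold bernLog adj
  split_ifs <;> simp

/-- The fluctuations of the block densities. -/
lemma blockDensity_mem {C₀ C₁ c₀ p q : ℝ} (hR : Regime C₀ p q) (hC₁ : 0 < C₁) (hc₀ : 0 < c₀)
    {Zs Z : Labels n K} {G : SimpleGraph (Fin n)} (hG : NoiseBound C₁ p q Zs G) (hn : 2 ≤ c₀ * n)
    (hsize : ∀ c, c₀ * n ≤ (labelClass Z c).card) (a c : Fin K) :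
    q - 2 * C₁ / c₀ ^ 2 * fluct n p ≤ blockDensity G Z s(a, c) ∧
      blockDensity G Z s(a, c) ≤ p + 2 * C₁ / c₀ ^ 2 * fluct n p := by
  classical
  have hE : mult a c * (pairCount (edgeRel G Z s(a, c)) : ℝ)
      = (∑ i ∈ labelClass Z a, ∑ j ∈ labelClass Z c, pairMean p q Zs i j)
        + noiseSum p q Zs G (labelClass Z a) (labelClass Z c) := by
    have := mult_mul_pairCount (Z := Z) a c G.Adj G.adj_comm
    unfold edgeRel noiseSum noise
    rw [this, ← Finset.sum_add_distrib]
    refine Finset.sum_congr rfl fun i _ => ?_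
    rw [← Finset.sum_add_distrib]
    refine Finset.sum_congr rfl fun j _ => ?_
    by_cases h : G.Adj i j
    · simp [adj, h, h.ne]
    · simp [adj, h]
  have hN : mult a c * ((pairCount (edgeRel G Z s(a, c)) : ℝ) + pairCount (nonEdgeRel G Z s(a, c)))
      = offDiag (labelClass Z a) (labelClass Z c) := by
    have h1 := mult_mul_pairCount (Z := Z) a c G.Adj G.adj_comm
    have h2 := mult_mul_pairCount (Z := Z) a c (fun i j => ¬ G.Adj i j)
      (fun i j => by rw [G.adj_comm])
    unfold edgeRel nonEdgeRel offDiag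
    rw [mul_add, h1, h2, ← Finset.sum_add_distrib]
    refine Finset.sum_congr rfl fun i _ => ?_
    rw [← Finset.sum_add_distrib]
    refine Finset.sum_congr rfl fun j _ => ?_
    by_cases hij : i = j
    · simp [hij]
    · by_cases h : G.Adj i j <;> simp [h, hij]
  have hn0 : (0 : ℝ) < n := by
    by_contra h
    have : c₀ * n ≤ 0 := mul_nonpos_of_nonneg_of_nonpos hc₀.le (not_lt.mp h)
    linarith
  have hM : (c₀ * n) ^ 2 / 2 ≤ offDiag (labelClass Z a) (labelClass Z c) := by
    refine le_trans ?_ (le_offDiag _ _)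
    nlinarith [mul_le_mul (hsize a) (show c₀ * n - 1 ≤ ((labelClass Z c).card : ℝ) - 1 by
      linarith [hsize c]) (by linarith) (by positivity)]
  have hNpos : 0 < offDiag (labelClass Z a) (labelClass Z c) := lt_of_lt_of_le (by positivity) hM
  obtain ⟨hlo, hhi⟩ := sum_pairMean_mem hR.q_pos.le hR.lt.le Zs (labelClass Z a) (labelClass Z c)
  have hx := abs_le.mp (hG.rect (labelClass Z a) (labelClass Z c))
  have hb : blockDensity G Z s(a, c)
      = (mult a c * (pairCount (edgeRel G Z s(a, c)) : ℝ)) / offDiag (labelClass Z a) (labelClass Z c) := by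
    unfold blockDensity
    rw [← hN, mul_div_mul_left _ _ (mult_pos a c).ne']
  rw [hb, hE]
  have hfl : C₁ * (n * √(n * p))
      ≤ 2 * C₁ / c₀ ^ 2 * fluct n p * offDiag (labelClass Z a) (labelClass Z c) := by
    calc C₁ * (n * √(n * p)) = 2 * C₁ / c₀ ^ 2 * fluct n p * ((c₀ * n) ^ 2 / 2) := by
          unfold fluct; field_simp
      _ ≤ _ := by
          have := fluct_nonneg n p
          gcongr
  constructor
  · rw [le_div_iff₀ hNpos, sub_mul]; linarith [hx.1]
  · rw [div_le_iff₀ hNpos, add_mul]; linarith [hx.2]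

/-- The noise part of the comparison of two likelihoods. -/
lemma abs_sum_pairs_noise_le {C₁ p q H : ℝ} {Zs Z : Labels n K} {G : SimpleGraph (Fin n)}
    (hG : NoiseBound C₁ p q Zs G) (h : Fin K → Fin K → Fin K → Fin K → ℝ)
    (hs : ∀ a b c d, h a b c d = h b a d c) (hH : ∀ a b c d, |h a b c d| ≤ H) :
    |∑ x ∈ pairs n, noise p q Zs G x.1 x.2 * h (Z x.1) (Z x.2) (Zs x.1) (Zs x.2)|
      ≤ K ^ 4 * (H * (C₁ * (n * √(n * p)))) := by
  have h2 := two_mul_sum_pairs (fun i j => noise p q Zs G i j * h (Z i) (Z j) (Zs i) (Zs j))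
    (fun i j => by rw [noise_comm, hs]) (fun i => by rw [noise_self, zero_mul])
  have e : ∑ i, ∑ j, noise p q Zs G i j * h (Z i) (Z j) (Zs i) (Zs j)
      = ∑ a, ∑ c, ∑ b, ∑ d, h a b c d
        * noiseSum p q Zs G (confusion Z Zs a c) (confusion Z Zs b d) := by
    rw [← sum_confusion Z Zs]
    refine Finset.sum_congr rfl fun a _ => Finset.sum_congr rfl fun c _ => ?_
    have e1 : ∀ i ∈ confusion Z Zs a c, ∑ j, noise p q Zs G i j * h (Z i) (Z j) (Zs i) (Zs j)
        = ∑ b, ∑ d, ∑ j ∈ confusion Z Zs b d, noise p q Zs G i j * h a b c d := by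
      intro i hi
      obtain ⟨hi1, hi2⟩ := (Finset.mem_filter.mp hi).2
      rw [← sum_confusion Z Zs]
      refine Finset.sum_congr rfl fun b _ => Finset.sum_congr rfl fun d _ =>
        Finset.sum_congr rfl fun j hj => ?_
      obtain ⟨hj1, hj2⟩ := (Finset.mem_filter.mp hj).2
      rw [hi1, hi2, hj1, hj2]
    rw [Finset.sum_congr rfl e1, Finset.sum_comm]
    refine Finset.sum_congr rfl fun b _ => ?_
    rw [Finset.sum_comm]
    refine Finset.sum_congr rfl fun d _ => ?_
    unfold noiseSum
    simp_rw [← Finset.sum_mul]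
    ring
  have h3 : |∑ a, ∑ c, ∑ b, ∑ d, h a b c d
        * noiseSum p q Zs G (confusion Z Zs a c) (confusion Z Zs b d)|
      ≤ ∑ a : Fin K, ∑ c : Fin K, ∑ b : Fin K, ∑ d : Fin K, H * (C₁ * (n * √(n * p))) := by
    refine (Finset.abs_sum_le_sum_abs _ _).trans (Finset.sum_le_sum fun a _ => ?_)
    refine (Finset.abs_sum_le_sum_abs _ _).trans (Finset.sum_le_sum fun c _ => ?_)
    refine (Finset.abs_sum_le_sum_abs _ _).trans (Finset.sum_le_sum fun b _ => ?_)
    refine (Finset.abs_sum_le_sum_abs _ _).trans (Finset.sum_le_sum fun d _ => ?_)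
    rw [abs_mul]
    exact mul_le_mul (hH a b c d) (hG.rect _ _) (abs_nonneg _) ((abs_nonneg _).trans (hH a b c d))
  simp only [Finset.sum_const, Finset.card_univ, Fintype.card_fin, nsmul_eq_mul] at h3
  rw [← e, ← h2, abs_mul, abs_two] at h3
  have h0 := abs_nonneg (∑ x ∈ pairs n, noise p q Zs G x.1 x.2 * h (Z x.1) (Z x.2) (Zs x.1) (Zs x.2))
  calc _ ≤ 2 * |∑ x ∈ pairs n, noise p q Zs G x.1 x.2 * h (Z x.1) (Z x.2) (Zs x.1) (Zs x.2)| := by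
        linarith
    _ ≤ _ := h3
    _ = _ := by ring

/-- A community of `Z` that contains many nodes of two true communities cannot be fitted. -/
lemma le_sum_pairs_sq {p q : ℝ} {Zs Z : Labels n K} {a d d' : Fin K} (hd : d ≠ d') {m : ℝ}
    (hm : 2 ≤ m) (h1 : m ≤ (confusion Z Zs a d).card) (h2 : m ≤ (confusion Z Zs a d').card)
    (f : Sym2 (Fin K) → ℝ) :
    m ^ 2 * (p - q) ^ 2 / 8 ≤ ∑ x ∈ pairs n,
      (labelMean p q (Zs x.1) (Zs x.2) - f s(Z x.1, Z x.2)) ^ 2 := by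
  classical
  set y := f s(a, a)
  set F : Fin n → Fin n → ℝ := fun i j =>
    if i = j then 0 else (labelMean p q (Zs i) (Zs j) - f s(Z i, Z j)) ^ 2 with hF
  have hF0 : ∀ i j, 0 ≤ F i j := fun i j => by
    simp only [hF]; split_ifs <;> positivity
  have h := two_mul_sum_pairs F (fun i j => by
    simp only [hF, labelMean_comm p q (Zs i), Sym2.eq_swap (a := Z i), eq_comm (a := i)])
    (fun i => by simp [hF])
  have hpairs : ∑ x ∈ pairs n, F x.1 x.2 = ∑ x ∈ pairs n,
      (labelMean p q (Zs x.1) (Zs x.2) - f s(Z x.1, Z x.2)) ^ 2 := by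
    refine Finset.sum_congr rfl fun x hx => ?_
    have : x.1 ≠ x.2 := ne_of_lt (by simpa [pairs] using hx)
    simp [hF, this]
  have hdisj : Disjoint (confusion Z Zs a d) (confusion Z Zs a d') := by
    rw [Finset.disjoint_left]
    intro j hj hj'
    exact hd ((Finset.mem_filter.mp hj).2.2.symm.trans (Finset.mem_filter.mp hj').2.2)
  have e1 : ∑ i ∈ confusion Z Zs a d, ∑ j ∈ confusion Z Zs a d, F i j
      = (p - y) ^ 2 * offDiag (confusion Z Zs a d) (confusion Z Zs a d) := by
    unfold offDiag
    simp_rw [Finset.mul_sum]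
    refine Finset.sum_congr rfl fun i hi => Finset.sum_congr rfl fun j hj => ?_
    obtain ⟨hi1, hi2⟩ := (Finset.mem_filter.mp hi).2
    obtain ⟨hj1, hj2⟩ := (Finset.mem_filter.mp hj).2
    simp only [hF, hi1, hi2, hj1, hj2, labelMean, if_true]
    split_ifs <;> simp [y]
  have e2 : ∑ i ∈ confusion Z Zs a d, ∑ j ∈ confusion Z Zs a d', F i j
      = (confusion Z Zs a d).card * (confusion Z Zs a d').card * (q - y) ^ 2 := by
    have : ∀ i ∈ confusion Z Zs a d, ∀ j ∈ confusion Z Zs a d', F i j = (q - y) ^ 2 := by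
      intro i hi j hj
      have hij : i ≠ j := fun h => Finset.disjoint_left.mp hdisj hi (h ▸ hj)
      obtain ⟨hi1, hi2⟩ := (Finset.mem_filter.mp hi).2
      obtain ⟨hj1, hj2⟩ := (Finset.mem_filter.mp hj).2
      simp only [hF, hi1, hi2, hj1, hj2, labelMean, hij, hd, if_false]
      rfl
    rw [Finset.sum_congr rfl fun i hi => Finset.sum_congr rfl (this i hi)]
    simp; ring
  have hle : ∑ i ∈ confusion Z Zs a d, ∑ j ∈ confusion Z Zs a d, F i j
      + ∑ i ∈ confusion Z Zs a d, ∑ j ∈ confusion Z Zs a d', F i j ≤ ∑ i, ∑ j, F i j := by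
    rw [← Finset.sum_add_distrib]
    calc _ ≤ ∑ i ∈ confusion Z Zs a d, ∑ j, F i j := Finset.sum_le_sum fun i _ => by
          rw [← Finset.sum_union hdisj]
          exact Finset.sum_le_sum_of_subset_of_nonneg (Finset.subset_univ _) fun j _ _ => hF0 i j
      _ ≤ _ := Finset.sum_le_sum_of_subset_of_nonneg (Finset.subset_univ _) fun i _ _ =>
          Finset.sum_nonneg fun j _ => hF0 i j
  have hoff : m ^ 2 / 2 ≤ offDiag (confusion Z Zs a d) (confusion Z Zs a d) := by
    refine le_trans ?_ (le_offDiag _ _)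
    nlinarith
  have hprod : m ^ 2 / 2 ≤ (confusion Z Zs a d).card * ((confusion Z Zs a d').card : ℝ) := by
    nlinarith
  -- The pairs inside the first cell have mean `p`, the pairs between the two cells have mean `q`,
  -- and both are fitted by the same value `y`.
  have hsq : (p - q) ^ 2 / 2 ≤ (p - y) ^ 2 + (q - y) ^ 2 := by
    nlinarith [sq_nonneg (p + q - 2 * y)]
  rw [hpairs] at h
  rw [e1, e2, ← h] at hle
  have g1 := mul_le_mul_of_nonneg_left hoff (sq_nonneg (p - y))
  have g2 := mul_le_mul_of_nonneg_right hprod (sq_nonneg (q - y))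
  have g3 := mul_le_mul_of_nonneg_left hsq (show 0 ≤ m ^ 2 by positivity)
  linarith

end Far

end

end SBM

namespace SBM

noncomputable section

/-! ### Posterior mass of the assignments far from the truth -/

section FarMass

variable {n K : ℕ}

set_option maxHeartbeats 400000 in
/-- Posterior mass of an assignment with a mixed community. -/
theorem exists_marginal_far (K : ℕ) (κ₁ κ₂ C₀ C₁ c₀ ρ : ℝ) (h₁ : 0 < κ₁) (h₂ : 0 < κ₂)
    (hC₀ : 0 < C₀) (hC₁ : 0 < C₁) (hc₀ : 0 < c₀) (hρ : 0 < ρ) : ∃ c Λ : ℝ, 0 < c ∧ 0 < Λ ∧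
      ∀ {n : ℕ} {p q : ℝ}, Regime C₀ p q → Λ ≤ snr n p q →
      ∀ (Zs Z : Labels n K) (G : SimpleGraph (Fin n)), NoiseBound C₁ p q Zs G →
      (∀ c, c₀ * n ≤ (labelClass Z c).card) → ∀ a d d' : Fin K, d ≠ d' →
      ρ * n ≤ (confusion Z Zs a d).card → ρ * n ≤ (confusion Z Zs a d').card →
      marginal κ₁ κ₂ G Z ≤ Real.exp (-(c * (n * snr n p q))) * marginal κ₁ κ₂ G Zs := by
  obtain ⟨CL, hCL, hlik⟩ := exists_likelihood_le K κ₁ κ₂ h₁ h₂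
  set D := 2 * C₁ / c₀ ^ 2 with hD
  have hD0 : 0 < D := by positivity
  set Cn := K ^ 4 * (8 * C₀ * 2 * C₁) with hCn
  have hCn0 : 0 ≤ Cn := by positivity
  set c := ρ ^ 2 / 64 with hc
  have hc0 : 0 < c := by positivity
  refine ⟨c / 2, max (max ((2 * D * C₀) ^ 2) ((1 / (1 / D)) ^ 2)) (max (2 / c₀ + 2 / ρ)
    (max ((4 * Cn / c) ^ 2) (4 * CL / c))), by positivity, by positivity, ?_⟩
  intro n p q hR hΛ Zs Z G hG hsize a d d' hd hm1 hm2
  have hp := hR.p_pos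
  have hq := hR.q_pos
  have hg : 0 ≤ p - q := by linarith [hR.lt]
  have hΛ1 := ((le_max_left _ _).trans (le_max_left _ _)).trans hΛ
  have hΛ2 := ((le_max_right _ _).trans (le_max_left _ _)).trans hΛ
  have hΛ3 := (((le_max_left _ _).trans (le_max_right _ _)).trans hΛ).trans (hR.snr_le_nat n)
  have hΛ4 := (((le_max_left _ _).trans (le_max_right _ _)).trans (le_max_right _ _)).trans hΛ
  have hΛ5 := (((le_max_right _ _).trans (le_max_right _ _)).trans (le_max_right _ _)).trans hΛ
  have hn0 : (0 : ℝ) < n := lt_of_lt_of_le (by positivity) hΛ3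
  have hn : 0 < n := by exact_mod_cast hn0
  have hn1 : 2 ≤ c₀ * n := by
    have : 2 / c₀ ≤ n := by
      have : 0 < 2 / ρ := by positivity
      linarith
    rwa [div_le_iff₀ hc₀, mul_comm] at this
  have hn2 : 2 ≤ ρ * n := by
    have : 2 / ρ ≤ n := by
      have : 0 < 2 / c₀ := by positivity
      linarith
    rwa [div_le_iff₀ hρ, mul_comm] at this
  -- the block densities
  have hfl1 : D * fluct n p ≤ p - q := by
    have := fluct_le hR hn (show 0 < 1 / D by positivity) hΛ2
    rw [one_div, inv_mul_eq_div, le_div_iff₀ hD0] at this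
    linarith
  have hfl2 : D * fluct n p ≤ p / (2 * C₀) := by
    have h4 : 2 * D * C₀ ≤ √(n * p) := Real.le_sqrt_of_sq_le (hΛ1.trans (hR.snr_le n))
    have h5 := fluct_mul_sqrt hp.le hn
    rw [le_div_iff₀ (by positivity)]
    nlinarith [mul_le_mul_of_nonneg_left h4 (fluct_nonneg n p)]
  have hqC : p / C₀ ≤ q := by rw [div_le_iff₀ hC₀]; linarith [hR.ratio]
  have h2C : p / (2 * C₀) = p / C₀ / 2 := by field_simp
  have hdens : ∀ e, p / (2 * C₀) ≤ blockDensity G Z e ∧ blockDensity G Z e ≤ 2 * p ∧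
      q - (p - q) ≤ blockDensity G Z e ∧ blockDensity G Z e ≤ p + (p - q) := by
    intro e
    induction e using Sym2.ind with
    | _ x y =>
      obtain ⟨h1, h2⟩ := blockDensity_mem hR hC₁ hc₀ hG hn1 hsize x y
      refine ⟨?_, ?_, ?_, ?_⟩ <;> linarith [hR.lt]
  set b := blockDensity G Z with hb
  have hb01 : ∀ e, 0 < b e ∧ b e < 1 := fun e => by
    have h := hdens e
    have : 0 < p / (2 * C₀) := by positivity
    exact ⟨by linarith [h.1], by linarith [h.2.1, hR.le]⟩
  have hconn : ∀ e, 0 < connectivity K p q e ∧ connectivity K p q e < 1 := by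
    intro e
    unfold connectivity
    split_ifs
    · exact ⟨hp, by linarith [hR.le]⟩
    · exact ⟨hq, by linarith [hR.le, hR.lt]⟩
  obtain ⟨hLZ0, hLZ⟩ := log_likelihood G Z b hb01
  obtain ⟨hLs0, hLs⟩ := log_likelihood G Zs (connectivity K p q) hconn
  have hup := marginal_le_likelihood h₁ h₂ G Z hb01
  have hlow := hlik hn G Zs (connectivity K p q) fun e => ⟨(hconn e).1.le, (hconn e).2.le⟩
  set h : Fin K → Fin K → Fin K → Fin K → ℝ := fun a b' c d =>
    logOdds (b s(a, b')) - logOdds (labelMean p q c d) with hh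
  have hH : ∀ x y z w, |h x y z w| ≤ 8 * C₀ / p * (2 * (p - q)) := by
    intro x y z w
    have hP := hR.labelMean_mem hC₀ z w
    have hP' := labelMean_mem hq.le hR.lt.le z w
    have hbe := hdens s(x, y)
    have hl4 : 4 / (p / (2 * C₀)) = 8 * C₀ / p := by field_simp; norm_num
    have := abs_logOdds_sub_le (l := p / (2 * C₀)) (by positivity) hbe.1 (by linarith [hR.le]) hP.1 hP.2
    rw [hl4] at this
    refine this.trans ?_
    gcongr
    rw [abs_le]
    constructor <;> linarith [hbe.2.2.1, hbe.2.2.2, hP'.1, hP'.2.1]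
  have hnoise := abs_sum_pairs_noise_le (Z := Z) hG h (fun a b' c d => by
    simp only [hh]; rw [Sym2.eq_swap, labelMean_comm]) hH
  have hKL := le_sum_pairs_sq (p := p) (q := q) hd hn2 hm1 hm2 b
  -- Per pair, the comparison of `b` with the truth is a divergence term at the mean, quadratic over
  -- `8 * p` since all parameters are at most `2 * p`, plus a term linear in the noise.
  have hsum : Real.log (likelihood G Z b) - Real.log (likelihood G Zs (connectivity K p q))
      ≤ -(1 / (8 * p)) * (∑ x ∈ pairs n,
        (labelMean p q (Zs x.1) (Zs x.2) - b s(Z x.1, Z x.2)) ^ 2)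
        + ∑ x ∈ pairs n, noise p q Zs G x.1 x.2 * h (Z x.1) (Z x.2) (Zs x.1) (Zs x.2) := by
    rw [hLZ, hLs, ← Finset.sum_sub_distrib, Finset.mul_sum, ← Finset.sum_add_distrib]
    refine Finset.sum_le_sum fun x hx => ?_
    have hx12 : x.1 ≠ x.2 := ne_of_lt (by simpa [pairs] using hx)
    rw [connectivity_eq]
    set m := labelMean p q (Zs x.1) (Zs x.2) with hm
    have hm' := labelMean_mem hq.le hR.lt.le (Zs x.1) (Zs x.2)
    have hbe := hdens s(Z x.1, Z x.2)
    have hnz : noise p q Zs G x.1 x.2 = adj G x.1 x.2 - m := by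
      unfold noise pairMean; rw [if_neg hx12]
    rw [bernLog_eq _ m (b s(Z x.1, Z x.2)), bernLog_eq _ m m, hnz]
    have hk := le_bernLog_sub (m := m) (x := m) (y := b s(Z x.1, Z x.2)) (u := 2 * p)
      (by linarith) (by linarith [hR.le]) (by linarith) (by linarith [hR.le]) (hb01 _).1
      (by linarith [hR.le]) (by linarith) hbe.2.1 (by simp)
    have e1 : (m - b s(Z x.1, Z x.2)) * (2 * m - m - b s(Z x.1, Z x.2)) / (4 * (2 * p))
        = 1 / (8 * p) * (m - b s(Z x.1, Z x.2)) ^ 2 := by field_simp; ring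
    rw [e1] at hk
    simp only [hh, ← hm]
    linarith
  have hsq0 := Real.sqrt_nonneg (snr n p q)
  have hsqs : √(snr n p q) * √(snr n p q) = snr n p q := Real.mul_self_sqrt (snr_nonneg hR n)
  -- The noise is of order `n * √snr`, the misfit of order `n * snr`: a large `snr` makes the noise
  -- negligible.
  have hA : (K : ℝ) ^ 4 * (8 * C₀ / p * (2 * (p - q)) * (C₁ * (n * √(n * p))))
      = Cn * (n * √(snr n p q)) := by
    have : (p - q) / p * √(n * p) = √(snr n p q) := by
      have h5 := fluct_mul_sqrt hp.le hn
      have h6 := fluct_mul_sqrt_snr hR hn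
      have hfp : 0 < fluct n p := by
        unfold fluct; positivity
      rw [div_mul_eq_mul_div, div_eq_iff hp.ne']
      have : fluct n p * ((p - q) * √(n * p)) = fluct n p * (√(snr n p q) * p) := by
        linear_combination (p - q) * h5 - p * h6
      exact mul_left_cancel₀ hfp.ne' this
    rw [← this, hCn]; ring
  rw [hA] at hnoise
  have hKL' : 1 / (8 * p) * ((ρ * n) ^ 2 * (p - q) ^ 2 / 8) = c * (n * snr n p q) := by
    rw [hc]; unfold snr; field_simp; ring
  have hKL2 := mul_le_mul_of_nonneg_left hKL (show 0 ≤ 1 / (8 * p) by positivity)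
  rw [hKL'] at hKL2
  have hc1 : Cn * (n * √(snr n p q)) ≤ c / 4 * (n * snr n p q) := by
    have h4 : 4 * Cn / c ≤ √(snr n p q) := Real.le_sqrt_of_sq_le hΛ4
    rw [div_le_iff₀ hc0] at h4
    have := mul_le_mul_of_nonneg_left h4 (mul_nonneg hn0.le hsq0)
    have e : n * √(snr n p q) * (√(snr n p q) * c) = c * (n * snr n p q) := by
      linear_combination n * c * hsqs
    linarith
  have hc2 : CL * n ≤ c / 4 * (n * snr n p q) := by
    rw [div_le_iff₀ hc0] at hΛ5
    linarith [mul_le_mul_of_nonneg_left hΛ5 hn0.le]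
  have hfin : Real.log (likelihood G Z b) ≤ Real.log (likelihood G Zs (connectivity K p q))
      + (-(c / 2 * (n * snr n p q)) - CL * n) := by
    linarith [le_abs_self (∑ x ∈ pairs n, noise p q Zs G x.1 x.2
      * h (Z x.1) (Z x.2) (Zs x.1) (Zs x.2))]
  calc marginal κ₁ κ₂ G Z ≤ likelihood G Z b := hup
    _ = Real.exp (Real.log (likelihood G Z b)) := (Real.exp_log hLZ0).symm
    _ ≤ Real.exp (Real.log (likelihood G Zs (connectivity K p q))
        + (-(c / 2 * (n * snr n p q)) - CL * n)) := Real.exp_le_exp.mpr hfin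
    _ = likelihood G Zs (connectivity K p q) * Real.exp (-(c / 2 * (n * snr n p q)) - CL * n) := by
        rw [Real.exp_add, Real.exp_log hLs0]
    _ ≤ (Real.exp (CL * n) * marginal κ₁ κ₂ G Zs)
        * Real.exp (-(c / 2 * (n * snr n p q)) - CL * n) :=
        mul_le_mul_of_nonneg_right hlow (Real.exp_pos _).le
    _ = _ := by
        rw [show Real.exp (CL * n) * marginal κ₁ κ₂ G Zs
          * Real.exp (-(c / 2 * (n * snr n p q)) - CL * n)
          = (Real.exp (CL * n) * Real.exp (-(c / 2 * (n * snr n p q)) - CL * n))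
            * marginal κ₁ κ₂ G Zs by ring, ← Real.exp_add]
        congr 2; ring

/-- An assignment without mixed communities is close to the truth, up to a permutation of the
labels. -/
lemma exists_mixed {ρ : ℝ} {Zs Z : Labels n K} (hn : 0 < n)
    (hZs : ∀ d, K * (ρ * n) < (labelClass Zs d).card)
    (hdist : K ^ 2 * (ρ * n) ≤ (clusterDist (cluster Z) (cluster Zs) : ℝ)) (hK : 0 < K) (hρ : 0 < ρ) :
    ∃ a d d' : Fin K, d ≠ d' ∧ ρ * n ≤ (confusion Z Zs a d).card ∧
      ρ * n ≤ (confusion Z Zs a d').card := by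
  classical
  by_contra hcon
  push Not at hcon
  have hn' : (0 : ℝ) < n := by exact_mod_cast hn
  have hex : ∀ d, ∃ a, ρ * n ≤ (confusion Z Zs a d).card := by
    intro d
    by_contra h
    push Not at h
    have h1 : ∑ a, ((confusion Z Zs a d).card : ℝ) = (labelClass Zs d).card := by
      have := sum_confusion_left Z Zs d (fun _ => (1 : ℝ))
      simpa using this
    have h2 : ∑ a, ((confusion Z Zs a d).card : ℝ) ≤ ∑ a : Fin K, ρ * n :=
      Finset.sum_le_sum fun a _ => (h a).le
    simp only [Finset.sum_const, Finset.card_univ, Fintype.card_fin, nsmul_eq_mul] at h2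
    linarith [hZs d]
  -- Every true community has a large share in some community of `Z`, and without mixing these are
  -- distinct. The resulting permutation leaves only `K ^ 2` small cells as errors.
  choose g hg using hex
  have hinj : Function.Injective g := by
    intro d d' h
    by_contra hne
    exact absurd (hg d') (not_le.mpr (h ▸ hcon (g d) d d' hne (hg d)))
  set σ : Equiv.Perm (Fin K) := Equiv.ofBijective g (Finite.injective_iff_bijective.mp hinj)
  have hσ : ∀ d, σ d = g d := fun d => rfl
  have hle := clusterDist_le (mem_cluster.mpr ⟨σ⁻¹, rfl⟩ : (fun i => σ⁻¹ (Z i)) ∈ cluster Z)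
    (self_mem_cluster Zs)
  have hcard : (hammingDist (fun i => σ⁻¹ (Z i)) Zs : ℝ)
      = ∑ a, ∑ d, if σ⁻¹ a ≠ d then ((confusion Z Zs a d).card : ℝ) else 0 := by
    rw [← card_misclassified, Finset.card_filter]
    push_cast
    rw [← sum_confusion Z Zs]
    refine Finset.sum_congr rfl fun a _ => Finset.sum_congr rfl fun d _ => ?_
    rw [Finset.sum_congr rfl fun j hj => by
      obtain ⟨h1, h2⟩ := (Finset.mem_filter.mp hj).2
      rw [h1, h2]]
    split_ifs <;> simp
  have hlt : ∀ a d, (if σ⁻¹ a ≠ d then ((confusion Z Zs a d).card : ℝ) else 0) < ρ * n := by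
    intro a d
    split_ifs with h
    · have hga : g (σ⁻¹ a) = a := by rw [← hσ]; simp
      have := hcon (g (σ⁻¹ a)) (σ⁻¹ a) d h (hg _)
      rwa [hga] at this
    · positivity
  have hfin : (hammingDist (fun i => σ⁻¹ (Z i)) Zs : ℝ) < ∑ a : Fin K, ∑ d : Fin K, ρ * n := by
    rw [hcard]
    have hne : (Finset.univ : Finset (Fin K)).Nonempty := ⟨⟨0, hK⟩, Finset.mem_univ _⟩
    exact Finset.sum_lt_sum_of_nonempty hne fun a _ =>
      Finset.sum_lt_sum_of_nonempty hne fun d _ => hlt a d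
  simp only [Finset.sum_const, Finset.card_univ, Fintype.card_fin, nsmul_eq_mul] at hfin
  have : (clusterDist (cluster Z) (cluster Zs) : ℝ)
      ≤ hammingDist (fun i => σ⁻¹ (Z i)) Zs := by exact_mod_cast hle
  nlinarith

/-- Posterior mass far from the truth, relative to the truth. -/
theorem exists_sum_far_le (K : ℕ) (hK : 2 ≤ K) (κ₁ κ₂ C₀ C₁ α β ρ : ℝ) (h₁ : 0 < κ₁) (h₂ : 0 < κ₂)
    (hC₀ : 0 < C₀) (hC₁ : 0 < C₁) (hα : 0 < α) (hβ : 0 < β) (hρ : 0 < ρ) : ∃ Λ : ℝ, 0 < Λ ∧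
      ∀ {n : ℕ} {p q : ℝ}, Regime C₀ p q → Λ ≤ snr n p q →
      ∀ (Zs : Labels n K) (G : SimpleGraph (Fin n)), NoiseBound C₁ p q Zs G → IsBalanced β Zs →
      ∀ s : Finset (Labels n K), (∀ Z ∈ s, IsBalanced α Z ∧
        ρ * n ≤ (clusterDist (cluster Z) (cluster Zs) : ℝ)) →
      ∑ Z ∈ s, marginal κ₁ κ₂ G Z / marginal κ₁ κ₂ G Zs ≤ Real.exp (-(n : ℝ)) := by
  have hK0 : (0 : ℝ) < K := by exact_mod_cast (by omega : 0 < K)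
  -- `K ^ 2` cells below `ρ' * n` must not add up to the distance `ρ * n`, and `K` of them must not
  -- fill a true community.
  set ρ' := min (ρ / K ^ 2) (1 / (2 * (β * K * K))) with hρ'
  have hρ'0 : 0 < ρ' := by positivity
  have hρ'1 : K ^ 2 * ρ' ≤ ρ := by
    calc _ ≤ K ^ 2 * (ρ / K ^ 2) := by gcongr; exact min_le_left _ _
      _ = ρ := by field_simp
  have hρ'2 : K * ρ' < 1 / (β * K) := by
    calc _ ≤ K * (1 / (2 * (β * K * K))) := by gcongr; exact min_le_right _ _
      _ = 1 / (β * K) / 2 := by field_simp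
      _ < _ := half_lt_self (by positivity)
  obtain ⟨c, Λ, hc, hΛ0, hfar⟩ := exists_marginal_far K κ₁ κ₂ C₀ C₁ (1 / (α * K)) ρ' h₁ h₂ hC₀ hC₁
    (by positivity) hρ'0
  refine ⟨max Λ ((Real.log K + 1) / c), by positivity, ?_⟩
  intro n p q hR hΛ Zs G hG hZs s hs
  have hΛ2 := (le_max_right _ _).trans hΛ
  have hn0 : (0 : ℝ) < n := lt_of_lt_of_le (by positivity) (((le_max_left _ _).trans hΛ).trans
    (hR.snr_le_nat n))
  have hn : 0 < n := by exact_mod_cast hn0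
  have hterm : ∀ Z ∈ s, marginal κ₁ κ₂ G Z / marginal κ₁ κ₂ G Zs
      ≤ Real.exp (-(c * (n * snr n p q))) := by
    intro Z hZ
    obtain ⟨hbal, hd⟩ := hs Z hZ
    obtain ⟨a, d, d', hne, hd1, hd2⟩ := exists_mixed (ρ := ρ') (Zs := Zs) (Z := Z) hn (fun d => by
      refine lt_of_lt_of_le ?_ (hZs.le_card d)
      rw [← mul_assoc]; gcongr) (by
      refine le_trans ?_ hd
      rw [← mul_assoc]; gcongr) (by omega) hρ'0
    rw [div_le_iff₀ (marginal_pos h₁ h₂ G Zs)]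
    exact hfar hR ((le_max_left _ _).trans hΛ) Zs Z G hG hbal.le_card a d d' hne hd1 hd2
  -- The crude count `K ^ n` is affordable because the decay is `exp (-c * n * snr)` with `c * snr ≥
  -- log K + 1`.
  calc _ ≤ ∑ Z ∈ s, Real.exp (-(c * (n * snr n p q))) := Finset.sum_le_sum hterm
    _ ≤ ∑ Z : Labels n K, Real.exp (-(c * (n * snr n p q))) :=
        Finset.sum_le_sum_of_subset_of_nonneg (Finset.subset_univ _) fun _ _ _ => (Real.exp_pos _).le
    _ = (K : ℝ) ^ n * Real.exp (-(c * (n * snr n p q))) := by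
        simp [Finset.sum_const, Finset.card_univ]
    _ = Real.exp (n * Real.log K - c * (n * snr n p q)) := by
        rw [sub_eq_add_neg, Real.exp_add, mul_comm (n : ℝ) (Real.log K), Real.exp_mul,
          Real.exp_log hK0, Real.rpow_natCast]
    _ ≤ _ := by
        refine Real.exp_le_exp.mpr ?_
        rw [div_le_iff₀ hc] at hΛ2
        nlinarith

end FarMass

end

end SBM

namespace SBM

noncomputable section

/-! ### The Rényi divergence -/

/-- One minus the affinity is the squared Hellinger distance `((√p - √q) ^ 2 + (√(1 - p) - √(1 - q))
^ 2) / 2`; each square is compared with `(p - q) ^ 2 / p`. -/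
lemma Regime.one_sub_affinity {C₀ p q : ℝ} (h : Regime C₀ p q) :
    (√p - √q) ^ 2 / 2 ≤ 1 - Real.exp (-(renyi p q / 2)) ∧
      1 - Real.exp (-(renyi p q / 2)) ≤ (p - q) ^ 2 / p := by
  have hp := h.p_pos
  have hq := h.q_pos
  have hp1 : 0 < 1 - p := by linarith [h.le]
  have hq1 : 0 < 1 - q := by linarith [h.le, h.lt]
  rw [exp_neg_renyi hq hp, Real.sqrt_mul hp.le, Real.sqrt_mul hp1.le]
  have a1 := Real.mul_self_sqrt hp.le
  have a2 := Real.mul_self_sqrt hq.le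
  have a3 := Real.mul_self_sqrt hp1.le
  have a4 := Real.mul_self_sqrt hq1.le
  have e : 1 - (√p * √q + √(1 - p) * √(1 - q))
      = (√p - √q) ^ 2 / 2 + (√(1 - p) - √(1 - q)) ^ 2 / 2 := by nlinarith
  rw [e]
  refine ⟨by nlinarith [sq_nonneg (√(1 - p) - √(1 - q))], ?_⟩
  have b1 : (√p - √q) ^ 2 ≤ (p - q) ^ 2 / p := by
    rw [le_div_iff₀ hp]
    have : p - q = (√p - √q) * (√p + √q) := by nlinarith
    rw [this, mul_pow]
    refine mul_le_mul_of_nonneg_left ?_ (sq_nonneg _)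
    nlinarith [Real.sqrt_nonneg p, Real.sqrt_nonneg q]
  have b2 : (√(1 - p) - √(1 - q)) ^ 2 ≤ (p - q) ^ 2 / p := by
    have h1 : (p - q) ^ 2 = (√(1 - p) - √(1 - q)) ^ 2 * (√(1 - p) + √(1 - q)) ^ 2 := by
      have : p - q = -((√(1 - p) - √(1 - q)) * (√(1 - p) + √(1 - q))) := by nlinarith
      rw [this]; ring
    rw [le_div_iff₀ hp, h1]
    refine mul_le_mul_of_nonneg_left ?_ (sq_nonneg _)
    nlinarith [Real.sqrt_nonneg (1 - p), Real.sqrt_nonneg (1 - q), h.le]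
  linarith

lemma Regime.le_renyi {C₀ p q : ℝ} (h : Regime C₀ p q) : (p - q) ^ 2 / p / 4 ≤ renyi p q := by
  have hp := h.p_pos
  have hq := h.q_pos
  have h1 := h.one_sub_affinity.1
  have h2 := Real.add_one_le_exp (-(renyi p q / 2))
  have h3 : (p - q) ^ 2 / p / 4 ≤ (√p - √q) ^ 2 := by
    rw [div_le_iff₀ (by norm_num), div_le_iff₀ hp]
    have : p - q = (√p - √q) * (√p + √q) := by
      nlinarith [Real.mul_self_sqrt hp.le, Real.mul_self_sqrt hq.le]
    rw [this, mul_pow, mul_assoc]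
    refine mul_le_mul_of_nonneg_left ?_ (sq_nonneg _)
    have hle : √q ≤ √p := Real.sqrt_le_sqrt h.lt.le
    nlinarith [Real.sqrt_nonneg p, Real.sqrt_nonneg q, Real.mul_self_sqrt hp.le]
  linarith

lemma Regime.renyi_le {C₀ p q : ℝ} (h : Regime C₀ p q) : renyi p q ≤ 4 * ((p - q) ^ 2 / p) := by
  have hp := h.p_pos
  have hq := h.q_pos
  have h1 := h.one_sub_affinity.2
  set J := (p - q) ^ 2 / p
  have hJ : J ≤ 1 / 4 := by
    rw [div_le_iff₀ hp]; nlinarith [h.lt, h.le]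
  have hJ0 : 0 ≤ J := by positivity
  have h2 : Real.exp (-(2 * J)) ≤ 1 - J := by
    have h3 := Real.add_one_le_exp (2 * J)
    have h4 : Real.exp (-(2 * J)) * Real.exp (2 * J) = 1 := by rw [← Real.exp_add]; simp
    nlinarith [Real.exp_pos (-(2 * J)), mul_le_mul_of_nonneg_left h3 (show 0 ≤ 1 - J by linarith)]
  have h3 : Real.exp (-(2 * J)) ≤ Real.exp (-(renyi p q / 2)) := by linarith
  have := Real.exp_le_exp.mp h3
  linarith

/-- The price of the node itself, which is missing among its potential neighbours. -/
lemma Regime.exp_renyi_le {C₀ p q : ℝ} (h : Regime C₀ p q) : Real.exp (renyi p q / 2) ≤ 2 := by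
  have h1 := h.one_sub_affinity.2
  have hp := h.p_pos
  have hJ : (p - q) ^ 2 / p ≤ 1 / 4 := by
    rw [div_le_iff₀ hp]; nlinarith [h.lt, h.le, h.q_pos]
  have h4 : Real.exp (-(renyi p q / 2)) * Real.exp (renyi p q / 2) = 1 := by
    rw [← Real.exp_add]; simp
  nlinarith [Real.exp_pos (renyi p q / 2)]

/-! ### Probabilities of the exceptional events -/

section Events

variable {n K : ℕ}

lemma exp_two_le : Real.exp 2 ≤ 8 := by
  have h := Real.exp_one_lt_d9
  have : Real.exp 2 = Real.exp 1 * Real.exp 1 := by rw [← Real.exp_add]; norm_num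
  rw [this]
  nlinarith [Real.exp_pos 1]

/-- Chernoff bound with `θ = 1 / √(n p)`: the exponent is at most `16 * n - C₁ * n ≤ -4 * n`, enough
for a union over all `2 ^ n * 2 ^ n ≤ exp (2 * n)` rectangles. -/
lemma graphProb_rect_le {C₀ p q C₁ : ℝ} (hR : Regime C₀ p q) (hC₁ : 20 ≤ C₁) (hnp : 1 ≤ n * p)
    (Zs : Labels n K) :
    graphProb p q Zs (fun G => ¬ ∀ S T, |noiseSum p q Zs G S T| ≤ C₁ * (n * √(n * p)))
      ≤ 2 * Real.exp (-(n : ℝ)) := by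
  classical
  have hp := hR.p_pos
  have hp1 : p ≤ 1 := by linarith [hR.le]
  have hsq : 1 ≤ √(n * p) := Real.one_le_sqrt.mpr hnp
  have hsq2 : √(n * p) * √(n * p) = n * p := Real.mul_self_sqrt (by linarith)
  have hn0 : (0 : ℝ) < n := by
    by_contra h
    have : (n : ℝ) * p ≤ 0 := mul_nonpos_of_nonpos_of_nonneg (not_lt.mp h) hp.le
    linarith
  have one : ∀ S T : Finset (Fin n), graphProb p q Zs
      (fun G => C₁ * (n * √(n * p)) ≤ |noiseSum p q Zs G S T|) ≤ 2 * Real.exp (-(4 * n)) := by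
    intro S T
    refine (graphProb_noiseSum_le hR.q_pos.le hR.lt.le hp1 Zs S T
      (θ := 1 / √(n * p)) (by positivity) _).trans ?_
    gcongr
    have hθ : 1 / √(n * p) ≤ 1 := by rw [div_le_one (by linarith)]; exact hsq
    have hexp : Real.exp (2 * (1 / √(n * p))) ≤ 8 :=
      (Real.exp_le_exp.mpr (by linarith)).trans exp_two_le
    have hST : (S.card : ℝ) * T.card ≤ n * n := by
      gcongr
      · exact_mod_cast (Finset.card_le_univ S).trans_eq (by simp)
      · exact_mod_cast (Finset.card_le_univ T).trans_eq (by simp)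
    have e1 : 2 * p * (1 / √(n * p)) ^ 2 = 2 / n := by
      rw [div_pow, one_pow, sq, hsq2]; field_simp
    have e2 : 1 / √(n * p) * (C₁ * (n * √(n * p))) = C₁ * n := by field_simp
    rw [e1, e2]
    have : 2 / (n : ℝ) * Real.exp (2 * (1 / √(n * p))) * (S.card * T.card) ≤ 2 / n * 8 * (n * n) := by
      gcongr
    have e3 : 2 / (n : ℝ) * 8 * (n * n) = 16 * n := by field_simp; norm_num
    nlinarith
  have hu := graphProb_le_sum_of_exists hR.q_pos.le hR.lt.le hp1 Zs
    (Finset.univ : Finset (Finset (Fin n) × Finset (Fin n)))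
    (fun G => ¬ ∀ S T, |noiseSum p q Zs G S T| ≤ C₁ * (n * √(n * p)))
    (fun x G => C₁ * (n * √(n * p)) ≤ |noiseSum p q Zs G x.1 x.2|) (fun G hG => by
      push Not at hG
      obtain ⟨S, T, h⟩ := hG
      exact ⟨(S, T), Finset.mem_univ _, h.le⟩)
  refine hu.trans ((Finset.sum_le_sum fun x _ => one x.1 x.2).trans ?_)
  have h2 : (2 : ℝ) ≤ Real.exp 1 := by linarith [Real.add_one_le_exp (1 : ℝ)]
  have hcard : ((Finset.univ : Finset (Finset (Fin n) × Finset (Fin n))).card : ℝ)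
      ≤ Real.exp n * Real.exp n := by
    simp only [Finset.card_univ, Fintype.card_prod, Fintype.card_finset, Fintype.card_fin]
    push_cast
    have : (2 : ℝ) ^ n ≤ Real.exp n := by
      calc (2 : ℝ) ^ n ≤ Real.exp 1 ^ n := by gcongr
        _ = Real.exp n := by rw [← Real.exp_nat_mul, mul_one]
    gcongr
  rw [Finset.sum_const, nsmul_eq_mul]
  calc _ ≤ Real.exp n * Real.exp n * (2 * Real.exp (-(4 * n))) := by gcongr
    _ = 2 * Real.exp (-(2 * n)) := by
        rw [show Real.exp n * Real.exp n * (2 * Real.exp (-(4 * n)))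
          = 2 * (Real.exp n * Real.exp n * Real.exp (-(4 * n))) by ring, ← Real.exp_add,
          ← Real.exp_add]
        congr 2; ring
    _ ≤ _ := by gcongr; linarith

/-- Chernoff bound with `θ = (p - q) / p`: the exponent is at most `(16 - C₁) * snr ≤ -2 * log n`,
and only `n * K` events are united. -/
lemma graphProb_node_le {C₀ p q C₁ L : ℝ} (hR : Regime C₀ p q) (hC₁ : 16 + 2 * L ≤ C₁)
    (hn : 0 < n) (hlog : Real.log n ≤ L * snr n p q) (Zs : Labels n K) :
    graphProb p q Zs (fun G => ¬ ∀ v c, |noiseSum p q Zs G {v} (labelClass Zs c)|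
      ≤ C₁ * (n * (p - q))) ≤ 2 * K / n := by
  classical
  have hp := hR.p_pos
  have hp1 : p ≤ 1 := by linarith [hR.le]
  have hg : 0 ≤ p - q := by linarith [hR.lt]
  have hn0 : (0 : ℝ) < n := by exact_mod_cast hn
  have hs0 := snr_nonneg hR n
  have one : ∀ v c, graphProb p q Zs
      (fun G => C₁ * (n * (p - q)) ≤ |noiseSum p q Zs G {v} (labelClass Zs c)|)
        ≤ 2 * (1 / n ^ 2) := by
    intro v c
    refine (graphProb_noiseSum_le hR.q_pos.le hR.lt.le hp1 Zs {v} (labelClass Zs c)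
      (θ := (p - q) / p) (by positivity) _).trans ?_
    have hθ : (p - q) / p ≤ 1 := by rw [div_le_one hp]; linarith [hR.q_pos]
    have hexp : Real.exp (2 * ((p - q) / p)) ≤ 8 :=
      (Real.exp_le_exp.mpr (by linarith)).trans exp_two_le
    have hT : ((labelClass Zs c).card : ℝ) ≤ n := by
      exact_mod_cast (Finset.card_le_univ _).trans_eq (by simp)
    have e0 : (1 : ℝ) / n ^ 2 = Real.exp (-(2 * Real.log n)) := by
      rw [Real.exp_neg, mul_comm, Real.exp_mul, Real.exp_log hn0]
      norm_num
    rw [e0]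
    gcongr
    have h1 : 2 * p * ((p - q) / p) ^ 2 * Real.exp (2 * ((p - q) / p))
          * ((({v} : Finset (Fin n)).card : ℝ) * (labelClass Zs c).card)
        ≤ 2 * p * ((p - q) / p) ^ 2 * 8 * (1 * n) := by
      gcongr; simp
    have h2 : 2 * p * ((p - q) / p) ^ 2 * 8 * (1 * n) = 16 * snr n p q := by
      unfold snr; field_simp; ring
    have h3 : (p - q) / p * (C₁ * (n * (p - q))) = C₁ * snr n p q := by
      unfold snr; field_simp
    rw [h3]
    nlinarith
  have hu := graphProb_le_sum_of_exists hR.q_pos.le hR.lt.le hp1 Zs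
    (Finset.univ : Finset (Fin n × Fin K))
    (fun G => ¬ ∀ v c, |noiseSum p q Zs G {v} (labelClass Zs c)| ≤ C₁ * (n * (p - q)))
    (fun x G => C₁ * (n * (p - q)) ≤ |noiseSum p q Zs G {x.1} (labelClass Zs x.2)|) (fun G hG => by
      push Not at hG
      obtain ⟨v, c, h⟩ := hG
      exact ⟨(v, c), Finset.mem_univ _, h.le⟩)
  refine hu.trans ((Finset.sum_le_sum fun x _ => one x.1 x.2).trans_eq ?_)
  simp only [Finset.sum_const, Finset.card_univ, Fintype.card_prod, Fintype.card_fin, nsmul_eq_mul]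
  push_cast
  field_simp

/-- Bounds each tail by `n ^ (-|S|)`, and the union over all sets costs a constant. -/
lemma sum_pow_card_le {n : ℕ} (hn : 0 < n) :
    ∑ S : Finset (Fin n), (1 / (n : ℝ)) ^ S.card ≤ Real.exp 1 := by
  have h := Fintype.sum_pow_mul_eq_add_pow (Fin n) (1 / (n : ℝ)) 1
  simp only [one_pow, mul_one, Fintype.card_fin] at h
  have hn0 : (0 : ℝ) < n := by exact_mod_cast hn
  rw [h]
  calc _ ≤ Real.exp (1 / n) ^ n := by gcongr; exact Real.add_one_le_exp _
    _ = Real.exp 1 := by rw [← Real.exp_nat_mul]; congr 1; field_simp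

/-- Noise towards small sets. -/
theorem exists_graphProb_smallSet_le (η c₁ L : ℝ) (hη : 0 < η) (hc₁ : 0 < c₁) (hL : 0 < L) :
    ∃ ρ₀ : ℝ, 0 < ρ₀ ∧ ∀ {n K : ℕ} {C₀ p q ρ : ℝ}, Regime C₀ p q → 0 < n →
      Real.log n ≤ L * snr n p q → ρ ≤ ρ₀ → ∀ Zs : Labels n K,
      graphProb p q Zs (fun G => ¬ SmallSetBound ρ η c₁ p q Zs G) ≤ 18 / n := by
  classical
  -- The tilt `s * (p - q) / p` is a large multiple of the natural one, which is affordable because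
  -- the rectangle is thin: `ρ₀` makes the variance term half of the linear term. What remains beats
  -- `(1 + |S| + |T|) * log n`, since `|S| ≤ |T| / η`.
  set s := 4 * (1 + 1 / η) * L / c₁ with hs
  have hs0 : 0 < s := by positivity
  refine ⟨c₁ / (4 * s * Real.exp (2 * s)), by positivity, ?_⟩
  intro n K C₀ p q ρ hR hn hlog hρ Zs
  have hp := hR.p_pos
  have hp1 : p ≤ 1 := by linarith [hR.le]
  have hg : 0 ≤ p - q := by linarith [hR.lt]
  have hn0 : (0 : ℝ) < n := by exact_mod_cast hn
  have hn1 : (1 : ℝ) ≤ n := by exact_mod_cast hn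
  have hlog0 : 0 ≤ Real.log n := Real.log_nonneg hn1
  have hs' := snr_nonneg hR n
  have one : ∀ S T : Finset (Fin n), (S.card : ℝ) ≤ ρ * n → T.Nonempty → η * S.card ≤ T.card →
      graphProb p q Zs (fun G => T.card * (c₁ * (n * (p - q))) ≤ |noiseSum p q Zs G T S|)
        ≤ 2 / n * ((1 / (n : ℝ)) ^ S.card * (1 / (n : ℝ)) ^ T.card) := by
    intro S T hS hT hST
    refine (graphProb_noiseSum_le hR.q_pos.le hR.lt.le hp1 Zs T S
      (θ := s * ((p - q) / p)) (by positivity) _).trans ?_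
    have hθ : (p - q) / p ≤ 1 := by rw [div_le_one hp]; linarith [hR.q_pos]
    have hexp : Real.exp (2 * (s * ((p - q) / p))) ≤ Real.exp (2 * s) := by
      gcongr; exact mul_le_of_le_one_right hs0.le hθ
    have hT1 : (1 : ℝ) ≤ T.card := by exact_mod_cast hT.card_pos
    have e0 : ∀ m : ℕ, (1 / (n : ℝ)) ^ m = Real.exp (-(m * Real.log n)) := fun m => by
      rw [← Real.log_pow, Real.exp_neg, Real.exp_log (by positivity), one_div, inv_pow]
    have e1 : 2 / (n : ℝ) * ((1 / (n : ℝ)) ^ S.card * (1 / (n : ℝ)) ^ T.card)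
        = 2 * Real.exp (-((1 + S.card + T.card) * Real.log n)) := by
      rw [e0, e0, ← Real.exp_add, div_mul_eq_mul_div, mul_div_assoc]
      congr 1
      rw [show -((1 + (S.card : ℝ) + T.card) * Real.log n)
        = (-(S.card * Real.log n) + -(T.card * Real.log n)) - Real.log n by ring,
        Real.exp_sub _ (Real.log n), Real.exp_log hn0]
    rw [e1]
    gcongr
    have h1 : 2 * p * (s * ((p - q) / p)) ^ 2 * Real.exp (2 * (s * ((p - q) / p)))
          * ((T.card : ℝ) * S.card)
        ≤ 2 * p * (s * ((p - q) / p)) ^ 2 * Real.exp (2 * s)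
          * (T.card * (c₁ / (4 * s * Real.exp (2 * s)) * n)) := by
      gcongr
      exact hS.trans (by gcongr)
    have h2 : 2 * p * (s * ((p - q) / p)) ^ 2 * Real.exp (2 * s)
          * (T.card * (c₁ / (4 * s * Real.exp (2 * s)) * n)) = T.card * (s * c₁ / 2 * snr n p q) := by
      unfold snr
      have := Real.exp_pos (2 * s)
      field_simp
      ring
    have h3 : s * ((p - q) / p) * (T.card * (c₁ * (n * (p - q)))) = T.card * (s * c₁ * snr n p q) := by
      unfold snr; field_simp
    have h4 : 2 * (1 + 1 / η) * Real.log n ≤ s * c₁ / 2 * snr n p q := by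
      calc _ ≤ 2 * (1 + 1 / η) * (L * snr n p q) := by gcongr
        _ = _ := by rw [hs]; field_simp; ring
    have h5 : 1 + (S.card : ℝ) + T.card ≤ T.card * (2 * (1 + 1 / η)) := by
      have : (S.card : ℝ) ≤ T.card * (1 / η) := by
        rw [mul_one_div, le_div_iff₀ hη]; linarith
      have h6 : 0 ≤ (T.card : ℝ) * (1 / η) := by positivity
      linarith
    rw [h3]
    have h7 := mul_le_mul_of_nonneg_left h4 (show (0 : ℝ) ≤ T.card by positivity)
    have h8 := mul_le_mul_of_nonneg_right h5 hlog0
    linarith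
  set F : Finset (Finset (Fin n) × Finset (Fin n)) := Finset.univ.filter fun x =>
    (x.1.card : ℝ) ≤ ρ * n ∧ x.2.Nonempty ∧ η * x.1.card ≤ x.2.card
  have hu := graphProb_le_sum_of_exists hR.q_pos.le hR.lt.le hp1 Zs F
    (fun G => ¬ SmallSetBound ρ η c₁ p q Zs G)
    (fun x G => x.2.card * (c₁ * (n * (p - q))) ≤ |noiseSum p q Zs G x.2 x.1|) (fun G hG => by
      unfold SmallSetBound at hG
      push Not at hG
      obtain ⟨S, T, h1, h2, h3, h4⟩ := hG
      exact ⟨(S, T), by simp only [F, Finset.mem_filter, Finset.mem_univ, true_and]; exact ⟨h1, h2, h3⟩, h4⟩)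
  refine hu.trans ?_
  calc _ ≤ ∑ x ∈ F, 2 / n * ((1 / (n : ℝ)) ^ x.1.card * (1 / (n : ℝ)) ^ x.2.card) :=
        Finset.sum_le_sum fun x hx => by
          obtain ⟨h1, h2, h3⟩ := (Finset.mem_filter.mp hx).2
          exact one x.1 x.2 h1 h2 h3
    _ ≤ ∑ x : Finset (Fin n) × Finset (Fin n),
        2 / n * ((1 / (n : ℝ)) ^ x.1.card * (1 / (n : ℝ)) ^ x.2.card) :=
        Finset.sum_le_sum_of_subset_of_nonneg (Finset.subset_univ _) fun x _ _ => by positivity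
    _ = 2 / n * ((∑ S : Finset (Fin n), (1 / (n : ℝ)) ^ S.card)
        * ∑ S : Finset (Fin n), (1 / (n : ℝ)) ^ S.card) := by
        rw [Finset.sum_mul_sum, ← Finset.mul_sum, ← Finset.univ_product_univ, Finset.sum_product]
    _ ≤ 2 / n * (3 * 3) := by
        have h3 : ∑ S : Finset (Fin n), (1 / (n : ℝ)) ^ S.card ≤ 3 :=
          (sum_pow_card_le hn).trans (by linarith [Real.exp_one_lt_d9])
        gcongr
    _ = _ := by ring

/-- Where the effective sample size comes from: for `K = 2` the two communities exhaust all nodes,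
otherwise each has at least `n / (β K)`. The node `v` itself is lost. -/
lemma le_card_two_communities {β : ℝ} {Zs : Labels n K}
    (hZs : IsBalanced β Zs) (v : Fin n) {b : Fin K} (hb : b ≠ Zs v) :
    2 * effSize K β n - 1
      ≤ (((Finset.univ.erase v).filter fun j => Zs j = Zs v ∨ Zs j = b).card : ℝ) := by
  classical
  have h1 : ((Finset.univ.erase v).filter fun j => Zs j = Zs v ∨ Zs j = b)
      = (labelClass Zs (Zs v) ∪ labelClass Zs b).erase v := by
    ext j; simp
  have hdisj : Disjoint (labelClass Zs (Zs v)) (labelClass Zs b) := by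
    rw [Finset.disjoint_left]
    intro j hj hj'
    exact hb ((mem_labelClass.mp hj').symm.trans (mem_labelClass.mp hj))
  have h2 : ((labelClass Zs (Zs v) ∪ labelClass Zs b).erase v).card + 1
      = (labelClass Zs (Zs v)).card + (labelClass Zs b).card := by
    rw [← Finset.card_union_of_disjoint hdisj]
    exact Finset.card_erase_add_one (by simp)
  have h2' : (((labelClass Zs (Zs v) ∪ labelClass Zs b).erase v).card : ℝ) + 1
      = (labelClass Zs (Zs v)).card + (labelClass Zs b).card := by exact_mod_cast h2
  rw [h1]
  suffices h : 2 * effSize K β n ≤ (labelClass Zs (Zs v)).card + ((labelClass Zs b).card : ℝ) by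
    linarith
  unfold effSize
  split_ifs with h
  · subst h
    have hc : (labelClass Zs (Zs v)).card + (labelClass Zs b).card = n := by
      rw [← Finset.card_union_of_disjoint hdisj]
      have : labelClass Zs (Zs v) ∪ labelClass Zs b = Finset.univ := by
        ext j; simp only [Finset.mem_union, mem_labelClass, Finset.mem_univ, iff_true]
        omega
      rw [this]; simp
    have hc' : ((labelClass Zs (Zs v)).card : ℝ) + (labelClass Zs b).card = n := by exact_mod_cast hc
    linarith
  · have g1 := hZs.le_card (Zs v)
    have g2 := hZs.le_card b
    have e : (n : ℝ) / (K * β) = 1 / (β * K) * n := by rw [mul_comm (K : ℝ)]; ring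
    rw [e]; linarith

/-- The weight of the flips away from the truth. -/
lemma graphProb_flipMass_le {C₀ p q β e : ℝ} (hR : Regime C₀ p q)
    (hn : 0 < n) {Zs : Labels n K} (hZs : IsBalanced β Zs) (he : 0 < e) (he1 : e < 1)
    (hlog : Real.log n ≤ (1 - e) * (effSize K β n * renyi p q)) :
    graphProb p q Zs (fun G => ¬ flipMass p q Zs G
        ≤ Real.exp (-(e / 2 * (effSize K β n * renyi p q))))
      ≤ 2 * K * (n : ℝ) ^ (-(e / 2)) := by
  classical
  have hn0 : (0 : ℝ) < n := by exact_mod_cast hn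
  have hn1 : (1 : ℝ) ≤ n := by exact_mod_cast hn
  have hlog0 : 0 ≤ Real.log n := Real.log_nonneg hn1
  set X := effSize K β n * renyi p q with hX
  have hX0 : 0 ≤ X := by
    by_contra h
    push Not at h
    nlinarith
  have hXlog : Real.log n ≤ X := by nlinarith
  have hI0 : 0 ≤ renyi p q := (by have := hR.p_pos; positivity : 0 ≤ (p - q) ^ 2 / p / 4).trans hR.le_renyi
  -- At most `n * K` single errors, each with half-exponential moment at most `2 * exp (-X)`.
  have hmean : ∑ G, graphLik p q Zs G * flipMass p q Zs G ≤ n * (K * (2 * Real.exp (-X))) := by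
    unfold flipMass
    simp_rw [Finset.mul_sum]
    rw [Finset.sum_comm]
    have hv : ∀ v, ∑ G, ∑ b ∈ Finset.univ.erase (Zs v), graphLik p q Zs G
        * Real.exp (-(idealGain p q Zs G v b / 2)) ≤ K * (2 * Real.exp (-X)) := by
      intro v
      rw [Finset.sum_comm]
      have hb : ∀ b ∈ Finset.univ.erase (Zs v), ∑ G, graphLik p q Zs G
          * Real.exp (-(idealGain p q Zs G v b / 2)) ≤ 2 * Real.exp (-X) := by
        intro b hb
        rw [sum_graphLik_mul_exp_idealGain hR.q_pos hR.lt.le (by linarith [hR.le]) Zs v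
          (Finset.ne_of_mem_erase hb), ← Real.exp_nat_mul]
        have hc := le_card_two_communities hZs v (Finset.ne_of_mem_erase hb)
        calc _ ≤ Real.exp (renyi p q / 2 + -X) := by
              refine Real.exp_le_exp.mpr ?_
              have := mul_le_mul_of_nonneg_right hc hI0
              rw [hX]; linarith
          _ = Real.exp (renyi p q / 2) * Real.exp (-X) := Real.exp_add _ _
          _ ≤ _ := by
              have := hR.exp_renyi_le
              gcongr
      calc _ ≤ ∑ b ∈ Finset.univ.erase (Zs v), 2 * Real.exp (-X) := Finset.sum_le_sum hb
        _ ≤ ∑ b : Fin K, 2 * Real.exp (-X) :=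
            Finset.sum_le_sum_of_subset_of_nonneg (Finset.subset_univ _) fun _ _ _ => by positivity
        _ = _ := by simp
    calc _ ≤ ∑ v : Fin n, K * (2 * Real.exp (-X)) := Finset.sum_le_sum fun v _ => hv v
      _ = _ := by simp
  -- Markov's inequality at level `exp (-(e / 2) * X)`: as `log n ≤ (1 - e) * X`, the slack `e * X`
  -- is shared equally between the level and the probability.
  have hm := graphProb_le_sum hR.q_pos.le hR.lt.le (by linarith [hR.le]) Zs
    (fun G => ¬ flipMass p q Zs G ≤ Real.exp (-(e / 2 * X)))
    (fun G => flipMass p q Zs G * Real.exp (e / 2 * X))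
    (fun G => mul_nonneg (flipMass_nonneg _ _ _ _) (Real.exp_pos _).le) (fun G hG => by
      have h1 : Real.exp (-(e / 2 * X)) * Real.exp (e / 2 * X) = 1 := by rw [← Real.exp_add]; simp
      rw [← h1]
      exact mul_le_mul_of_nonneg_right (not_le.mp hG).le (Real.exp_pos _).le)
  refine hm.trans ?_
  simp_rw [← mul_assoc]
  rw [← Finset.sum_mul]
  calc _ ≤ n * (K * (2 * Real.exp (-X))) * Real.exp (e / 2 * X) :=
        mul_le_mul_of_nonneg_right hmean (Real.exp_pos _).le
    _ = 2 * K * Real.exp (Real.log n + -X + e / 2 * X) := by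
        rw [Real.exp_add, Real.exp_add, Real.exp_log hn0]; ring
    _ ≤ 2 * K * Real.exp (Real.log n * (-(e / 2))) := by
        gcongr
        nlinarith
    _ = _ := by rw [Real.exp_mul, Real.exp_log hn0]

/-- The event on which the chain mixes rapidly. -/
structure GoodNetwork (C₁ ρ η c₁ m p q : ℝ) (Zs : Labels n K) (G : SimpleGraph (Fin n)) : Prop where
  noise : NoiseBound C₁ p q Zs G
  small : SmallSetBound ρ η c₁ p q Zs G
  mass : flipMass p q Zs G ≤ Real.exp (-m)

/-- The good event has probability close to one. -/
theorem graphProb_not_good_le {C₀ p q β e C₁ η c₁ ρ : ℝ} (hR : Regime C₀ p q)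
    (hn : 0 < n) {Zs : Labels n K} (hZs : IsBalanced β Zs) (he : 0 < e) (he1 : e < 1)
    (hlog : Real.log n ≤ (1 - e) * (effSize K β n * renyi p q))
    (hlog' : Real.log n ≤ 4 * snr n p q) (hsnr : 1 ≤ snr n p q) (hC₁ : 24 ≤ C₁)
    (hsmall : graphProb p q Zs (fun G => ¬ SmallSetBound ρ η c₁ p q Zs G) ≤ 18 / n) :
    graphProb p q Zs (fun G => ¬ GoodNetwork C₁ ρ η c₁ (e / 2 * (effSize K β n * renyi p q)) p q Zs G)
      ≤ (20 + 4 * K) * (n : ℝ) ^ (-(e / 2)) := by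
  have hq := hR.q_pos.le
  have hqp := hR.lt.le
  have hp1 : p ≤ 1 := by linarith [hR.le]
  have hn0 : (0 : ℝ) < n := by exact_mod_cast hn
  have hn1 : (1 : ℝ) ≤ n := by exact_mod_cast hn
  have a1 := graphProb_rect_le (n := n) hR (by linarith : 20 ≤ C₁) (hsnr.trans (hR.snr_le n)) Zs
  have a2 := graphProb_node_le hR (by linarith : 16 + 2 * 4 ≤ C₁) hn hlog' Zs
  have a4 := graphProb_flipMass_le hR hn hZs he he1 hlog
  set E1 : SimpleGraph (Fin n) → Prop := fun G =>
    ¬ ∀ S T, |noiseSum p q Zs G S T| ≤ C₁ * (n * √(n * p))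
  set E2 : SimpleGraph (Fin n) → Prop := fun G =>
    ¬ ∀ v c, |noiseSum p q Zs G {v} (labelClass Zs c)| ≤ C₁ * (n * (p - q))
  set E3 : SimpleGraph (Fin n) → Prop := fun G => ¬ SmallSetBound ρ η c₁ p q Zs G
  set E4 : SimpleGraph (Fin n) → Prop := fun G => ¬ flipMass p q Zs G
        ≤ Real.exp (-(e / 2 * (effSize K β n * renyi p q)))
  have hsub := graphProb_mono hq hqp hp1 Zs (E := fun G => ¬ GoodNetwork C₁ ρ η c₁
      (e / 2 * (effSize K β n * renyi p q)) p q Zs G)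
    (F := fun G => (E1 G ∨ E2 G) ∨ (E3 G ∨ E4 G)) (fun G hG => by
      by_contra hcon
      simp only [E1, E2, E3, E4, not_or, not_not] at hcon
      exact hG ⟨⟨hcon.1.1, hcon.1.2⟩, hcon.2.1, hcon.2.2⟩)
  have b1 := graphProb_or_le hq hqp hp1 Zs (fun G => E1 G ∨ E2 G) (fun G => E3 G ∨ E4 G)
  have b2 := graphProb_or_le hq hqp hp1 Zs E1 E2
  have b3 := graphProb_or_le hq hqp hp1 Zs E3 E4
  have hinv : 1 / (n : ℝ) ≤ (n : ℝ) ^ (-(e / 2)) := by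
    rw [one_div, ← Real.rpow_neg_one]
    exact Real.rpow_le_rpow_of_exponent_le hn1 (by linarith)
  have hexp : Real.exp (-(n : ℝ)) ≤ 1 / n := by
    rw [Real.exp_neg, ← one_div]
    gcongr
    linarith [Real.add_one_le_exp (n : ℝ)]
  have c1 : 2 * Real.exp (-(n : ℝ)) ≤ 2 * (n : ℝ) ^ (-(e / 2)) := by linarith
  have c2 : 2 * (K : ℝ) / n ≤ 2 * K * (n : ℝ) ^ (-(e / 2)) := by
    rw [div_eq_mul_one_div]; gcongr
  have c3 : 18 / (n : ℝ) ≤ 18 * (n : ℝ) ^ (-(e / 2)) := by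
    rw [div_eq_mul_one_div]; gcongr
  linarith

end Events

end

end SBM

namespace SBM

noncomputable section

/-! ### The gain of relabeling one node in terms of the confusion matrix -/

section Share

variable {n K : ℕ}

/-- The share of the true community `d` in the community `a` of `Z`. -/
def share (Z Zs : Labels n K) (a d : Fin K) : ℝ := (confusion Z Zs a d).card / (labelClass Z a).card

lemma share_nonneg (Z Zs : Labels n K) (a d : Fin K) : 0 ≤ share Z Zs a d := by
  unfold share; positivity

lemma card_confusion_eq {Z Zs : Labels n K} {a : Fin K} (h : 0 < (labelClass Z a).card) (d : Fin K) :
    ((confusion Z Zs a d).card : ℝ) = share Z Zs a d * (labelClass Z a).card := by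
  have : ((labelClass Z a).card : ℝ) ≠ 0 := by exact_mod_cast h.ne'
  unfold share; field_simp

lemma sum_card_confusion (Z Zs : Labels n K) (a : Fin K) :
    ∑ d, ((confusion Z Zs a d).card : ℝ) = (labelClass Z a).card := by
  classical
  have h := Finset.sum_fiberwise (labelClass Z a) Zs (fun _ => (1 : ℝ))
  rw [Finset.sum_const, nsmul_eq_mul, mul_one] at h
  rw [← h]
  refine Finset.sum_congr rfl fun d _ => ?_
  rw [Finset.sum_const, nsmul_eq_mul, mul_one]
  congr 2
  ext j; simp [confusion]

lemma sum_share {Z Zs : Labels n K} {a : Fin K} (h : 0 < (labelClass Z a).card) :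
    ∑ d, share Z Zs a d = 1 := by
  have h' : ((labelClass Z a).card : ℝ) ≠ 0 := by exact_mod_cast h.ne'
  unfold share
  rw [← Finset.sum_div, sum_card_confusion, div_self h']

lemma share_le_one {Z Zs : Labels n K} {a : Fin K} (h : 0 < (labelClass Z a).card) (d : Fin K) :
    share Z Zs a d ≤ 1 := by
  rw [← sum_share (Zs := Zs) h]
  exact Finset.single_le_sum (f := share Z Zs a) (fun d _ => share_nonneg _ _ _ _) (Finset.mem_univ d)

/-- Removing a node and the diagonal changes a double sum by a term of order `n`. -/
lemma abs_sum_erase_sub_le (S T : Finset (Fin n)) (v : Fin n) (H : Fin n → Fin n → ℝ)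
    (hH : ∀ i j, |H i j| ≤ 1) :
    |∑ i ∈ S.erase v, ∑ j ∈ T.erase v, (if i = j then 0 else H i j) - ∑ i ∈ S, ∑ j ∈ T, H i j|
      ≤ 3 * n := by
  classical
  have e : ∑ i ∈ S.erase v, ∑ j ∈ T.erase v, (if i = j then 0 else H i j)
      = ∑ i ∈ S, ∑ j ∈ T, if i ≠ v ∧ j ≠ v ∧ i ≠ j then H i j else 0 := by
    rw [← Finset.filter_ne', Finset.sum_filter]
    refine Finset.sum_congr rfl fun i _ => ?_
    rw [← Finset.filter_ne', Finset.sum_filter]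
    by_cases hi : i = v
    · simp [hi]
    · simp only [hi, ne_eq, not_false_eq_true, true_and, if_true]
      refine Finset.sum_congr rfl fun j _ => ?_
      by_cases hj : j = v <;> by_cases hij : i = j <;> simp [hj, hij]
  rw [e, ← Finset.sum_sub_distrib]
  have hterm : ∀ i j, |(if i ≠ v ∧ j ≠ v ∧ i ≠ j then H i j else 0) - H i j|
      ≤ (if i = v then 1 else 0) + (if j = v then 1 else 0) + (if i = j then 1 else 0) := by
    intro i j
    have := hH i j
    by_cases hi : i = v
    · simp only [hi, ne_eq, not_true_eq_false, false_and, if_false, zero_sub, abs_neg, if_true]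
      have h1 : (0 : ℝ) ≤ if j = v then 1 else 0 := by split_ifs <;> norm_num
      have h2 : (0 : ℝ) ≤ if v = j then 1 else 0 := by split_ifs <;> norm_num
      rw [hi] at this
      linarith
    · by_cases hj : j = v
      · simp only [hj, ne_eq, not_true_eq_false, false_and, and_false, if_false, zero_sub, abs_neg,
          if_true, hi]
        rw [hj] at this
        linarith
      · by_cases hij : i = j
        · subst hij
          simp [hi, this]
        · simp [hi, hj, hij]
  calc _ ≤ ∑ i ∈ S, ∑ j ∈ T, ((if i = v then (1 : ℝ) else 0) + (if j = v then 1 else 0)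
        + (if i = j then 1 else 0)) := by
        refine (Finset.abs_sum_le_sum_abs _ _).trans (Finset.sum_le_sum fun i _ => ?_)
        rw [← Finset.sum_sub_distrib]
        exact (Finset.abs_sum_le_sum_abs _ _).trans (Finset.sum_le_sum fun j _ => hterm i j)
    _ ≤ ∑ i : Fin n, ∑ j : Fin n, ((if i = v then (1 : ℝ) else 0) + (if j = v then 1 else 0)
        + (if i = j then 1 else 0)) := by
        have hnn : ∀ i j, (0 : ℝ) ≤ (if i = v then (1 : ℝ) else 0) + (if j = v then 1 else 0)
          + (if i = j then 1 else 0) := fun i j => (abs_nonneg _).trans (hterm i j)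
        exact (Finset.sum_le_sum fun i _ => Finset.sum_le_sum_of_subset_of_nonneg
          (Finset.subset_univ _) fun j _ _ => hnn i j).trans
          (Finset.sum_le_sum_of_subset_of_nonneg (Finset.subset_univ _) fun i _ _ =>
            Finset.sum_nonneg fun j _ => hnn i j)
    _ = _ := by
        simp only [Finset.sum_add_distrib, Finset.sum_ite_eq, Finset.sum_ite_eq', Finset.mem_univ,
          if_true, Finset.sum_const, Finset.card_univ, Fintype.card_fin, nsmul_eq_mul, mul_one]
        simp
        ring

/-- The mean density of the block of two communities. -/
def meanDensity (p q : ℝ) (Z Zs : Labels n K) (a c : Fin K) : ℝ :=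
  q + (p - q) * ∑ d, share Z Zs a d * share Z Zs c d

lemma sum_same_label (Z Zs : Labels n K) (a c : Fin K) :
    ∑ i ∈ labelClass Z a, ∑ j ∈ labelClass Z c, (if Zs i = Zs j then (1 : ℝ) else 0)
      = ∑ d, ((confusion Z Zs a d).card : ℝ) * (confusion Z Zs c d).card := by
  classical
  rw [← Finset.sum_fiberwise (labelClass Z a) Zs]
  refine Finset.sum_congr rfl fun d _ => ?_
  have e1 : (labelClass Z a).filter (fun i => Zs i = d) = confusion Z Zs a d := by
    ext j; simp [confusion]
  have e2 : (labelClass Z c).filter (fun j => d = Zs j) = confusion Z Zs c d := by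
    ext j; simp [confusion, eq_comm]
  rw [e1, Finset.sum_congr rfl fun i hi => by
    rw [(Finset.mem_filter.mp hi).2.2, Finset.sum_boole, e2]]
  simp

lemma sum_share_mul_mem {Z Zs : Labels n K} {a c : Fin K} (ha : 0 < (labelClass Z a).card)
    (hc : 0 < (labelClass Z c).card) : 0 ≤ ∑ d, share Z Zs a d * share Z Zs c d ∧
      ∑ d, share Z Zs a d * share Z Zs c d ≤ 1 := by
  refine ⟨Finset.sum_nonneg fun d _ => mul_nonneg (share_nonneg _ _ _ _) (share_nonneg _ _ _ _), ?_⟩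
  rw [← sum_share (Zs := Zs) ha]
  exact Finset.sum_le_sum fun d _ => mul_le_of_le_one_right (share_nonneg _ _ _ _) (share_le_one hc d)

lemma meanDensity_mem {p q : ℝ} (hqp : q ≤ p) {Z Zs : Labels n K} {a c : Fin K}
    (ha : 0 < (labelClass Z a).card) (hc : 0 < (labelClass Z c).card) :
    q ≤ meanDensity p q Z Zs a c ∧ meanDensity p q Z Zs a c ≤ p := by
  obtain ⟨h0, h1⟩ := sum_share_mul_mem (Zs := Zs) ha hc
  unfold meanDensity
  constructor <;> nlinarith

/-- The estimated densities fluctuate around the mean densities. -/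
theorem exists_blockMean_mean (κ₁ κ₂ C₁ c₀ : ℝ) (h₁ : 0 < κ₁) (h₂ : 0 < κ₂) (hC₁ : 0 < C₁)
    (hc₀ : 0 < c₀) : ∃ C Λ : ℝ, 0 < C ∧ 0 < Λ ∧ ∀ {n K : ℕ} {C₀ p q : ℝ}, Regime C₀ p q →
      Λ ≤ snr n p q → ∀ (Zs Z : Labels n K) (G : SimpleGraph (Fin n)), NoiseBound C₁ p q Zs G →
      (∀ c, c₀ * n ≤ (labelClass Z c).card) → ∀ (v : Fin n) (a c : Fin K),
      |blockMean κ₁ κ₂ G Z v a c - meanDensity p q Z Zs a c| ≤ C * fluct n p := by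
  obtain ⟨C, Λ, hC, hΛ0, hclose⟩ := exists_blockMean_close κ₁ κ₂ C₁ c₀ h₁ h₂ hC₁ hc₀
  refine ⟨C * 4, Λ, by positivity, hΛ0, ?_⟩
  intro n K C₀ p q hR hΛ Zs Z G hG hsize v a c
  have hn : 0 < n := v.pos
  have hn0 : (0 : ℝ) < n := by exact_mod_cast hn
  have hp := hR.p_pos
  have hg : 0 ≤ p - q := by linarith [hR.lt]
  have hpos : ∀ c, 0 < (labelClass Z c).card := fun c => by
    have : (0 : ℝ) < (labelClass Z c).card := lt_of_lt_of_le (by positivity) (hsize c)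
    exact_mod_cast this
  obtain ⟨hm0, hm1⟩ := meanDensity_mem (Zs := Zs) hR.lt.le (hpos a) (hpos c)
  set W := ∑ d, share Z Zs a d * share Z Zs c d with hW
  obtain ⟨hW0, hW1⟩ := sum_share_mul_mem (Zs := Zs) (hpos a) (hpos c)
  -- `W` is the exact proportion of pairs with equal true labels in the full rectangle. Removing `v`
  -- and the diagonal leaves an error of order `n`, below the fluctuations after division by `n ^
  -- 2`.
  have hfull : ∑ i ∈ labelClass Z a, ∑ j ∈ labelClass Z c,
      ((if Zs i = Zs j then (1 : ℝ) else 0) - W) = 0 := by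
    simp only [Finset.sum_sub_distrib, Finset.sum_const, nsmul_eq_mul]
    rw [sum_same_label, hW, Finset.mul_sum, Finset.mul_sum, ← Finset.sum_sub_distrib]
    refine Finset.sum_eq_zero fun d _ => ?_
    rw [card_confusion_eq (hpos a), card_confusion_eq (hpos c)]; ring
  have herase := abs_sum_erase_sub_le (labelClass Z a) (labelClass Z c) v
    (fun i j => (if Zs i = Zs j then (1 : ℝ) else 0) - W) (fun i j => by
      rw [abs_le]; split_ifs <;> constructor <;> linarith)
  rw [hfull, sub_zero] at herase
  have e : (∑ i ∈ (labelClass Z a).erase v, ∑ j ∈ (labelClass Z c).erase v, pairMean p q Zs i j)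
        - meanDensity p q Z Zs a c * offDiag ((labelClass Z a).erase v) ((labelClass Z c).erase v)
      = (p - q) * ∑ i ∈ (labelClass Z a).erase v, ∑ j ∈ (labelClass Z c).erase v,
        (if i = j then 0 else (if Zs i = Zs j then (1 : ℝ) else 0) - W) := by
    unfold offDiag
    rw [Finset.mul_sum, Finset.mul_sum, ← Finset.sum_sub_distrib]
    refine Finset.sum_congr rfl fun i _ => ?_
    rw [Finset.mul_sum, Finset.mul_sum, ← Finset.sum_sub_distrib]
    refine Finset.sum_congr rfl fun j _ => ?_
    unfold pairMean labelMean meanDensity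
    rw [← hW]
    by_cases hij : i = j
    · simp [hij]
    · by_cases h : Zs i = Zs j
      · simp only [hij, h, if_true, if_false]; ring
      · simp only [hij, h, if_false]; ring
  have key := hclose hR hΛ Zs Z G hG hsize v a c (meanDensity p q Z Zs a c) (3 * (p - q) / n)
    (by linarith [hR.q_pos]) (by linarith [hR.le]) (by
      rw [e, abs_mul, abs_of_nonneg hg]
      calc _ ≤ (p - q) * (3 * n) := by gcongr
        _ = _ := by field_simp)
  refine key.trans ?_
  have hfl : (p - q) / n ≤ fluct n p := by
    unfold fluct
    gcongr
    have h1 : p - q ≤ p := by linarith [hR.q_pos]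
    refine h1.trans (Real.le_sqrt_of_sq_le ?_)
    have hn1 : (1 : ℝ) ≤ n := by exact_mod_cast hn
    nlinarith [hR.le]
  rw [mul_assoc]
  refine mul_le_mul_of_nonneg_left ?_ hC.le
  have : 3 * (p - q) / (n : ℝ) = 3 * ((p - q) / n) := by ring
  linarith

/-- Measured in units of the fluctuation `φ`, where `nn * φ ^ 2 = p`, signal and errors of one block
lose their dependence on `n` and `p`. The two identities that follow serve the same purpose. -/
lemma mul_drift_error_eq {C₀ p φ E V nn : ℝ} (hφ : 0 < φ) (hnn : 0 < nn) (hnφ : nn * φ ^ 2 = p) :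
    nn * (2 * (8 * C₀ / p * (E * φ) * (2 * V + E * φ))) = 16 * C₀ * E * (2 * (V / φ) + E) := by
  subst hnφ; field_simp; ring

lemma mul_noise_error_eq {C₀ p φ E V M nn : ℝ} (hφ : 0 < φ) (hnn : 0 < nn) (hnφ : nn * φ ^ 2 = p) :
    M * (nn * φ) * (8 * C₀ / p * (V + 2 * (E * φ))) = 8 * C₀ * M * (V / φ + 2 * E) := by
  subst hnφ; field_simp

lemma mul_signal_eq {p φ c₀ D s v nn : ℝ} (hφ : 0 < φ) (hnn : 0 < nn) (hnφ : nn * φ ^ 2 = p) :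
    c₀ / 8 * (D * s) * (v / φ) ^ 2 = c₀ * nn / 2 * (D * s * v ^ 2 / (4 * p)) := by
  subst hnφ; field_simp; ring

/-- The gain in one block: a quadratic signal and linear errors. -/
lemma le_block_gain {C₀ p φ E m x y x' y' v w D N Y M c₀ nn : ℝ} (hC₀ : 0 < C₀) (hp : 0 < p)
    (hφ : 0 < φ) (hnφ : nn * φ ^ 2 = p) (hE : 0 ≤ E) (hM : 0 ≤ M) (hc₀ : 0 ≤ c₀)
    (hm0 : 0 < m) (hm1 : m ≤ 3 / 4) (hx0 : p / (2 * C₀) ≤ x) (hx1 : x ≤ 3 / 4) (hxp : x ≤ p)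
    (hy0 : p / (2 * C₀) ≤ y) (hy1 : y ≤ 3 / 4) (hyp : y ≤ p)
    (hx0' : p / (2 * C₀) ≤ x') (hx1' : x' ≤ 3 / 4) (hy0' : p / (2 * C₀) ≤ y') (hy1' : y' ≤ 3 / 4)
    (hxy : x - y = D * v) (hmx : m - x = w * v) (hw : 0 ≤ w) (hD : 0 ≤ D) (hwD : w + D ≤ 1)
    (hxx : |x' - x| ≤ E * φ) (hyy : |y' - y| ≤ E * φ) (hN1 : c₀ * nn / 2 ≤ N) (hN2 : N ≤ nn)
    (hY : |Y| ≤ M * (nn * φ)) :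
    c₀ / 8 * (D * (2 * w + D)) * (v / φ) ^ 2
        - (16 * C₀ * E * (2 + E) + 8 * C₀ * M * (1 + 2 * E)) * (|v| / φ + 1)
      ≤ N * (bernLog m x' - bernLog m y') + Y * (logOdds x' - logOdds y') := by
  have hl0 : 0 < p / (2 * C₀) := by positivity
  have hl4 : 4 / (p / (2 * C₀)) = 8 * C₀ / p := by field_simp; norm_num
  have hnn : 0 < nn := by
    by_contra h
    have := mul_nonpos_of_nonpos_of_nonneg (not_lt.mp h) (sq_nonneg φ)
    linarith
  have hN0 : 0 ≤ N := le_trans (by positivity) hN1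
  have hv0 := abs_nonneg v
  have hmy : m - y = (w + D) * v := by linarith
  -- `m - x` and `x - y` are nonnegative multiples of the same `v`, so `x` lies between `y` and `m`.
  have main := le_bernLog_sub (m := m) (x := x) (y := y) (u := p) hm0 hm1 (by linarith) hx1
    (by linarith) hy1 hxp hyp (by
      rw [hmx, hxy, show w * v * (D * v) = w * D * v ^ 2 by ring]; positivity)
  have e1 : (x - y) * (2 * m - x - y) / (4 * p) = D * (2 * w + D) * v ^ 2 / (4 * p) := by
    rw [hxy, show 2 * m - x - y = (2 * w + D) * v by linarith]; ring
  rw [e1] at main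
  have hmx' : |m - x| ≤ |v| := by
    rw [hmx, abs_mul, abs_of_nonneg hw]; exact mul_le_of_le_one_left hv0 (by linarith)
  have hmy' : |m - y| ≤ |v| := by
    rw [hmy, abs_mul, abs_of_nonneg (by linarith)]; exact mul_le_of_le_one_left hv0 hwD
  have pert : ∀ z z' : ℝ, p / (2 * C₀) ≤ z → z ≤ 3 / 4 → p / (2 * C₀) ≤ z' → z' ≤ 3 / 4 →
      |z' - z| ≤ E * φ → |m - z| ≤ |v| →
      |bernLog m z' - bernLog m z| ≤ 8 * C₀ / p * (E * φ) * (2 * |v| + E * φ) := by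
    intro z z' hz0 hz1 hz0' hz1' hzz hmz
    have h := abs_bernLog_sub_le hm0.le (by linarith) hl0 hz0' hz1' hz0 hz1
    rw [hl4] at h
    have h2 : |m - z'| ≤ |v| + E * φ := by
      refine (abs_sub_le m z z').trans ?_
      rw [abs_sub_comm z z']; linarith
    refine h.trans (mul_le_mul (mul_le_mul_of_nonneg_left hzz (by positivity)) (by linarith)
      (by positivity) (by positivity))
  have px := abs_le.mp (pert x x' hx0 hx1 hx0' hx1' hxx hmx')
  have py := abs_le.mp (pert y y' hy0 hy1 hy0' hy1' hyy hmy')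
  set δ := 8 * C₀ / p * (E * φ) * (2 * |v| + E * φ) with hδ
  have hδ0 : 0 ≤ δ := by positivity
  have s1 : D * (2 * w + D) * v ^ 2 / (4 * p) - 2 * δ ≤ bernLog m x' - bernLog m y' := by
    linarith [px.1, py.2]
  have s2 : N * (D * (2 * w + D) * v ^ 2 / (4 * p)) - N * (2 * δ)
      ≤ N * (bernLog m x' - bernLog m y') := by
    rw [← mul_sub]; exact mul_le_mul_of_nonneg_left s1 hN0
  have q0 : 0 ≤ D * (2 * w + D) * v ^ 2 / (4 * p) := by positivity
  have s3 : c₀ / 8 * (D * (2 * w + D)) * (v / φ) ^ 2 ≤ N * (D * (2 * w + D) * v ^ 2 / (4 * p)) := by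
    calc _ = c₀ * nn / 2 * (D * (2 * w + D) * v ^ 2 / (4 * p)) := mul_signal_eq hφ hnn hnφ
      _ ≤ _ := mul_le_mul_of_nonneg_right hN1 q0
  have s4 : N * (2 * δ) ≤ 16 * C₀ * E * (2 + E) * (|v| / φ + 1) := by
    calc N * (2 * δ) ≤ nn * (2 * δ) := mul_le_mul_of_nonneg_right hN2 (by positivity)
      _ = 16 * C₀ * E * (2 * (|v| / φ) + E) := mul_drift_error_eq hφ hnn hnφ
      _ ≤ 16 * C₀ * E * ((2 + E) * (|v| / φ + 1)) := by
          have h0 : 0 ≤ |v| / φ := by positivity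
          refine mul_le_mul_of_nonneg_left ?_ (by positivity)
          linarith [mul_nonneg hE h0]
      _ = _ := by ring
  have s5 : |Y * (logOdds x' - logOdds y')| ≤ 8 * C₀ * M * (1 + 2 * E) * (|v| / φ + 1) := by
    have h := abs_logOdds_sub_le hl0 hx0' hx1' hy0' hy1'
    rw [hl4] at h
    have h2 : |x' - y'| ≤ |v| + 2 * (E * φ) := by
      have h3 : |x - y| ≤ |v| := by
        rw [hxy, abs_mul, abs_of_nonneg hD]; exact mul_le_of_le_one_left hv0 (by linarith)
      have h4 : x' - y' = (x' - x) + (x - y) + (y - y') := by ring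
      rw [h4]
      refine (abs_add_three _ _ _).trans ?_
      rw [abs_sub_comm y y']; linarith
    rw [abs_mul]
    calc _ ≤ M * (nn * φ) * (8 * C₀ / p * (|v| + 2 * (E * φ))) := by
          refine mul_le_mul hY (h.trans (mul_le_mul_of_nonneg_left h2 (by positivity)))
            (abs_nonneg _) (by positivity)
      _ = 8 * C₀ * M * (|v| / φ + 2 * E) := mul_noise_error_eq hφ hnn hnφ
      _ ≤ 8 * C₀ * M * ((1 + 2 * E) * (|v| / φ + 1)) := by
          have h0 : 0 ≤ |v| / φ := by positivity
          refine mul_le_mul_of_nonneg_left ?_ (by positivity)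
          linarith [mul_nonneg hE h0]
      _ = _ := by ring
  have s6 := (abs_le.mp s5).1
  linarith

end Share

end

end SBM

namespace SBM

noncomputable section

/-! ### Two communities: the gain under weak consistency -/

section TwoGain

variable {n K : ℕ}

lemma sum_fin_two_of_ne {a b : Fin 2} (h : b ≠ a) (f : Fin 2 → ℝ) : ∑ c, f c = f a + f b := by
  rw [Fin.sum_univ_two]
  fin_cases a <;> fin_cases b <;> first | exact absurd rfl h | simp [add_comm]

lemma card_large_noise_le {p q X t : ℝ} {Zs : Labels n K} {G : SimpleGraph (Fin n)}
    {S : Finset (Fin n)} (ht : 0 < t) (hX : ∀ T, |noiseSum p q Zs G T S| ≤ X) :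
    ((Finset.univ.filter fun v => t < |noiseSum p q Zs G {v} S|).card : ℝ) ≤ 2 * (X / t) := by
  classical
  have key : ∀ ε : ℝ, |ε| = 1 →
      ((Finset.univ.filter fun v => t < ε * noiseSum p q Zs G {v} S).card : ℝ) ≤ X / t := by
    intro ε hε
    set T := Finset.univ.filter fun v => t < ε * noiseSum p q Zs G {v} S
    rw [le_div_iff₀ ht]
    calc T.card * t ≤ ε * noiseSum p q Zs G T S := by
          rw [noiseSum_eq_sum, Finset.mul_sum, ← nsmul_eq_mul, ← Finset.sum_const]
          exact Finset.sum_le_sum fun v hv => (Finset.mem_filter.mp hv).2.le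
      _ ≤ |ε * noiseSum p q Zs G T S| := le_abs_self _
      _ ≤ X := by rw [abs_mul, hε, one_mul]; exact hX T
  have hsub : (Finset.univ.filter fun v => t < |noiseSum p q Zs G {v} S|)
      ⊆ (Finset.univ.filter fun v => t < 1 * noiseSum p q Zs G {v} S)
        ∪ Finset.univ.filter fun v => t < -1 * noiseSum p q Zs G {v} S := by
    intro v hv
    have := (Finset.mem_filter.mp hv).2
    rw [lt_abs] at this
    simpa using this
  have h1 := (Finset.card_le_card hsub).trans (Finset.card_union_le _ _)
  have h2 := key 1 (by simp)
  have h3 := key (-1) (by simp)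
  have h1' : ((Finset.univ.filter fun v => t < |noiseSum p q Zs G {v} S|).card : ℝ)
      ≤ (Finset.univ.filter fun v => t < 1 * noiseSum p q Zs G {v} S).card
        + (Finset.univ.filter fun v => t < -1 * noiseSum p q Zs G {v} S).card := by
    exact_mod_cast h1
  linarith

/-- Groups the nodes by their community in `Z` around arbitrary centres `m`; these will be the
expected densities of the links of `v`. -/
lemma sum_bernLog_blocks (G : SimpleGraph (Fin n)) (Z : Labels n K) (v : Fin n)
    (m B B' : Fin K → ℝ) :
    ∑ j ∈ Finset.univ.erase v, (bernLog (adj G v j) (B (Z j)) - bernLog (adj G v j) (B' (Z j)))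
      = ∑ c, ((((labelClass Z c).erase v).card : ℝ) * (bernLog (m c) (B c) - bernLog (m c) (B' c))
        + (∑ j ∈ (labelClass Z c).erase v, (adj G v j - m c)) * (logOdds (B c) - logOdds (B' c))) := by
  classical
  rw [← Finset.sum_fiberwise (Finset.univ.erase v) Z]
  refine Finset.sum_congr rfl fun c _ => ?_
  have e : (Finset.univ.erase v).filter (fun j => Z j = c) = (labelClass Z c).erase v := by
    ext j; simp
  rw [e, Finset.sum_mul, ← nsmul_eq_mul, ← Finset.sum_const, ← Finset.sum_add_distrib]
  refine Finset.sum_congr rfl fun j hj => ?_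
  rw [mem_labelClass.mp (Finset.mem_of_mem_erase hj), bernLog_eq (adj G v j) (m c) (B c),
    bernLog_eq (adj G v j) (m c) (B' c)]
  ring

/-- The centre is the mean link density of `v` to the community, exact on the full class; only the
missing pair of `v` with itself leaves the error `p - q`. -/
lemma abs_sum_adj_sub_le {p q : ℝ} (hqp : q ≤ p) (Zs Z : Labels n K) (G : SimpleGraph (Fin n))
    (v : Fin n) {c : Fin K} (hc : 0 < (labelClass Z c).card) :
    |∑ j ∈ (labelClass Z c).erase v, (adj G v j - (q + (p - q) * share Z Zs c (Zs v)))|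
      ≤ |noiseSum p q Zs G {v} (labelClass Z c)| + (p - q) := by
  classical
  set m := q + (p - q) * share Z Zs c (Zs v) with hm
  have hs0 := share_nonneg Z Zs c (Zs v)
  have hs1 := share_le_one (Zs := Zs) hc (Zs v)
  have e1 : ∑ j ∈ (labelClass Z c).erase v, (adj G v j - m)
      = ∑ j ∈ (labelClass Z c).erase v, noise p q Zs G v j
        + ∑ j ∈ (labelClass Z c).erase v, (labelMean p q (Zs v) (Zs j) - m) := by
    rw [← Finset.sum_add_distrib]
    refine Finset.sum_congr rfl fun j hj => ?_
    unfold noise pairMean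
    rw [if_neg (Finset.ne_of_mem_erase hj).symm]; ring
  have e2 : ∑ j ∈ (labelClass Z c).erase v, noise p q Zs G v j
      = noiseSum p q Zs G {v} (labelClass Z c) := by
    unfold noiseSum
    rw [Finset.sum_singleton]
    exact Finset.sum_erase _ (noise_self p q Zs G v)
  have e3 : ∑ j ∈ labelClass Z c, (labelMean p q (Zs v) (Zs j) - m) = 0 := by
    have : ∀ j, labelMean p q (Zs v) (Zs j) = q + (p - q) * (if Zs j = Zs v then 1 else 0) := by
      intro j
      unfold labelMean
      by_cases h : Zs j = Zs v
      · simp [h]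
      · simp [h, Ne.symm h]
    simp_rw [this]
    rw [Finset.sum_sub_distrib, Finset.sum_add_distrib, ← Finset.mul_sum, Finset.sum_boole]
    have e : (labelClass Z c).filter (fun j => Zs j = Zs v) = confusion Z Zs c (Zs v) := by
      ext j; simp [confusion]
    rw [e, card_confusion_eq hc]
    simp only [Finset.sum_const, nsmul_eq_mul, hm]
    ring
  have e4 : |∑ j ∈ (labelClass Z c).erase v, (labelMean p q (Zs v) (Zs j) - m)| ≤ p - q := by
    by_cases hv : v ∈ labelClass Z c
    · have h := Finset.add_sum_erase _ (fun j => labelMean p q (Zs v) (Zs j) - m) hv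
      rw [e3] at h
      have h' : ∑ j ∈ (labelClass Z c).erase v, (labelMean p q (Zs v) (Zs j) - m) = -(p - m) := by
        have : labelMean p q (Zs v) (Zs v) = p := by simp [labelMean]
        linarith
      rw [h', abs_neg, abs_le]
      constructor <;> nlinarith
    · rw [Finset.erase_eq_of_notMem hv, e3, abs_zero]; linarith
  rw [e1, e2]
  exact (abs_add_le _ _).trans (by linarith)

/-- The quadratic signal dominates the linear errors. -/
lemma le_signal_sub_error {c₀ D B L R saa sba Va Vb : ℝ} (hc₀ : 0 < c₀) (hD : 0 < D)
    (hB : 0 < B) (hR : 0 ≤ R) (hDs : D = saa - sba) (hsba : 0 ≤ sba) (hsaa : saa ≤ 1)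
    (hVa : Va = |2 * saa - 1| * R) (hVb : Vb = |2 * sba - 1| * R)
    (h1 : 64 * B / c₀ ≤ D ^ 2 * R) (h2 : 32 * (L + 2 * B) / c₀ ≤ (D ^ 2 * R) ^ 2) :
    L ≤ (c₀ / 8 * (D * (2 * (1 - saa) + D)) * Va ^ 2 - B * (Va + 1))
      + (c₀ / 8 * (D * (2 * (1 - saa) + D)) * Vb ^ 2 - B * (Vb + 1)) := by
  set s := 2 * (1 - saa) + D with hs
  have hsD : D ≤ s := by linarith
  have hD1 : D ≤ 1 := by linarith
  have hs0 : 0 < s := by linarith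
  have hVa0 : 0 ≤ Va := by rw [hVa]; positivity
  have hVb0 : 0 ≤ Vb := by rw [hVb]; positivity
  set V := max Va Vb with hV
  -- The signal of one community may vanish, when half of it is mixed in. Since `D` is the
  -- difference of the two shares, not both can be closer than `D / 2` to `1 / 2`.
  have hVm : D * R ≤ V := by
    have h3 : 2 * D ≤ |2 * saa - 1| + |2 * sba - 1| := by
      have := abs_sub (2 * saa - 1) (2 * sba - 1)
      have h4 := le_abs_self (2 * saa - 1 - (2 * sba - 1))
      linarith
    have h5 : 2 * (D * R) ≤ Va + Vb := by
      rw [hVa, hVb, ← add_mul]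
      calc _ = 2 * D * R := by ring
        _ ≤ _ := mul_le_mul_of_nonneg_right h3 hR
    linarith [le_max_left Va Vb, le_max_right Va Vb]
  -- If `s` is small, then `saa` is close to one and the signal of community `a` is of full order;
  -- if `s ≥ 1 / 2`, the previous bound suffices.
  have hsV : D * R / 2 ≤ s * V := by
    have hV0 : 0 ≤ V := hVa0.trans (le_max_left _ _)
    rcases le_total (1 / 2) s with h | h
    · nlinarith [mul_nonneg hD.le hR]
    · have h6 : R / 2 ≤ Va := by
        rw [hVa]
        have : 1 / 2 ≤ |2 * saa - 1| := le_trans (by linarith) (le_abs_self _)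
        nlinarith
      have h7 : R / 2 ≤ V := h6.trans (le_max_left _ _)
      calc D * R / 2 = D * (R / 2) := by ring
        _ ≤ s * V := mul_le_mul hsD h7 (by positivity) hs0.le
  set y := D ^ 2 * R with hy
  have hy0 : 0 ≤ y := by positivity
  have hyV : y ≤ V := by
    refine le_trans ?_ hVm
    rw [hy, sq, mul_assoc]
    exact mul_le_of_le_one_left (by positivity) hD1
  have hV0 : 0 ≤ V := hy0.trans hyV
  set A := c₀ / 8 * (D * s) with hA
  have hA0 : 0 < A := by positivity
  have hAV : c₀ / 16 * y ≤ A * V := by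
    calc c₀ / 16 * y = c₀ / 8 * D * (D * R / 2) := by rw [hy]; ring
      _ ≤ c₀ / 8 * D * (s * V) := mul_le_mul_of_nonneg_left hsV (by positivity)
      _ = _ := by rw [hA]; ring
  rw [div_le_iff₀ hc₀] at h1 h2
  have hAV4 : 4 * B ≤ A * V := by linarith
  have hAVV : 4 * B * V ≤ A * V * V := mul_le_mul_of_nonneg_right hAV4 hV0
  have hAyy : c₀ / 16 * y * y ≤ A * V * V := mul_le_mul hAV hyV hy0 (by positivity)
  have hmax : A * V ^ 2 ≤ A * Va ^ 2 + A * Vb ^ 2 := by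
    rcases max_choice Va Vb with h | h
    · rw [hV, h]; linarith [mul_nonneg hA0.le (sq_nonneg Vb)]
    · rw [hV, h]; linarith [mul_nonneg hA0.le (sq_nonneg Va)]
  have hBV : B * (Va + Vb) ≤ B * (2 * V) :=
    mul_le_mul_of_nonneg_left (by linarith [le_max_left Va Vb, le_max_right Va Vb]) hB.le
  nlinarith

set_option maxHeartbeats 400000 in
/-- Two communities: if `Z` is positively correlated with the truth, then all but a small proportion
of the nodes have a large gain. -/
theorem exists_gain_two (κ₁ κ₂ C₀ C₁ c₀ c₂ L : ℝ) (h₁ : 0 < κ₁) (h₂ : 0 < κ₂) (hC₀ : 0 < C₀)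
    (hC₁ : 0 < C₁) (hc₀ : 0 < c₀) (hc₂ : 0 < c₂) : ∃ Λ : ℝ, 0 < Λ ∧
      ∀ {n : ℕ} {p q : ℝ}, Regime C₀ p q → ∀ (Zs Z : Labels n 2) (G : SimpleGraph (Fin n)),
      NoiseBound C₁ p q Zs G → (∀ c, c₀ * n ≤ (labelClass Z c).card) → ∀ D : ℝ, 0 < D →
      D = share Z Zs 0 0 + share Z Zs 1 1 - 1 → Λ ≤ D ^ 4 * snr n p q →
      ∃ Bad : Finset (Fin n), (Bad.card : ℝ) ≤ c₂ * n ∧ ∀ v, v ∉ Bad → ∀ b, b ≠ Zs v →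
        L ≤ Real.log (marginal κ₁ κ₂ G (Function.update Z v (Zs v)))
            - Real.log (marginal κ₁ κ₂ G (Function.update Z v b)) := by
  classical
  obtain ⟨CF, ΛF, hCF, hΛF, hflip⟩ := exists_flip_expand 2 κ₁ κ₂ C₀ C₁ c₀ h₁ h₂ hC₀ hC₁ hc₀
  obtain ⟨ΛM, hΛM, hmem⟩ := exists_blockMean_mem κ₁ κ₂ C₀ C₁ c₀ h₁ h₂ hC₀ hC₁ hc₀
  obtain ⟨E, ΛE, hE, hΛE, hmean⟩ := exists_blockMean_mean κ₁ κ₂ C₁ c₀ h₁ h₂ hC₁ hc₀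
  -- At the threshold `4 * C₁ / c₂` at most `c₂ * n / 2` nodes are exceptional for each of the two
  -- communities. The summand one absorbs the error `p - q` of the centring.
  set M := 4 * C₁ / c₂ + 1 with hM
  have hM0 : 0 < M := by positivity
  set B := 16 * C₀ * E * (2 + E) + 8 * C₀ * M * (1 + 2 * E) with hB
  have hB0 : 0 < B := by positivity
  refine ⟨max (max (max ΛF ΛM) (max ΛE (2 / c₀)))
    (max ((64 * B / c₀) ^ 2) (32 * ((L + CF) + 2 * B) / c₀)),
      lt_max_of_lt_left (by positivity), ?_⟩
  intro n p q hR Zs Z G hG hsize D hD hDs hΛ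
  have hp := hR.p_pos
  have hg : 0 ≤ p - q := by linarith [hR.lt]
  have hsnr0 := snr_nonneg hR n
  have hpos' : 0 < D ^ 4 * snr n p q := lt_of_lt_of_le (lt_max_of_lt_left (by positivity)) hΛ
  have hn0 : (0 : ℝ) < n := by
    have h1 : 0 < snr n p q := by
      by_contra h
      have := mul_nonpos_of_nonneg_of_nonpos (show 0 ≤ D ^ 4 by positivity) (not_lt.mp h)
      linarith
    exact lt_of_lt_of_le h1 (hR.snr_le_nat n)
  have hn : 0 < n := by exact_mod_cast hn0
  have hpos : ∀ c, 0 < (labelClass Z c).card := fun c => by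
    have : (0 : ℝ) < (labelClass Z c).card := lt_of_lt_of_le (by positivity) (hsize c)
    exact_mod_cast this
  have hs2 : ∀ c, share Z Zs c 0 + share Z Zs c 1 = 1 := fun c => by
    have := sum_share (Zs := Zs) (hpos c)
    rwa [Fin.sum_univ_two] at this
  have hD1 : D ≤ 1 := by
    linarith [share_le_one (Zs := Zs) (hpos 0) 0, share_le_one (Zs := Zs) (hpos 1) 1]
  have hsnrΛ : D ^ 4 * snr n p q ≤ snr n p q :=
    mul_le_of_le_one_left hsnr0 (pow_le_one₀ hD.le hD1)
  have hΛ1 := ((((le_max_left _ _).trans (le_max_left _ _)).trans (le_max_left _ _)).trans hΛ).trans hsnrΛ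
  have hΛ2 := ((((le_max_right _ _).trans (le_max_left _ _)).trans (le_max_left _ _)).trans hΛ).trans hsnrΛ
  have hΛ3 := ((((le_max_left _ _).trans (le_max_right _ _)).trans (le_max_left _ _)).trans hΛ).trans hsnrΛ
  have hΛ4 := (((((le_max_right _ _).trans (le_max_right _ _)).trans (le_max_left _ _)).trans hΛ).trans
    hsnrΛ).trans (hR.snr_le_nat n)
  have hΛ5 := ((le_max_left _ _).trans (le_max_right _ _)).trans hΛ
  have hΛ6 := ((le_max_right _ _).trans (le_max_right _ _)).trans hΛ
  have hcn : 2 ≤ c₀ * n := by rwa [div_le_iff₀ hc₀, mul_comm] at hΛ4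
  set R := √(snr n p q) with hRdef
  have hR0 : 0 ≤ R := Real.sqrt_nonneg _
  have hRR : R ^ 2 = snr n p q := Real.sq_sqrt hsnr0
  have hy2 : (D ^ 2 * R) ^ 2 = D ^ 4 * snr n p q := by rw [← hRR]; ring
  have hy1 : 64 * B / c₀ ≤ D ^ 2 * R := by
    rw [← hy2] at hΛ5
    exact (pow_le_pow_iff_left₀ (by positivity) (by positivity) two_ne_zero).mp hΛ5
  rw [← hy2] at hΛ6
  set φ := fluct n p with hφ
  have hφ0 : 0 < φ := by rw [hφ]; unfold fluct; positivity
  have hnφ : n * φ ^ 2 = p := by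
    rw [hφ]; unfold fluct
    rw [div_pow, Real.sq_sqrt (by positivity)]; field_simp
  have hnφ1 : n * φ = √(n * p) := by rw [hφ]; unfold fluct; field_simp
  have hφR : φ * R = p - q := fluct_mul_sqrt_snr hR hn
  have hgsq : p - q ≤ n * φ := by
    rw [hnφ1]
    have h1 : p - q ≤ p := by linarith [hR.q_pos]
    refine h1.trans (Real.le_sqrt_of_sq_le ?_)
    have hn1 : (1 : ℝ) ≤ n := by exact_mod_cast hn
    nlinarith [hR.le]
  set t := 4 * C₁ / c₂ * (n * φ) with ht
  have ht0 : 0 < t := by positivity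
  refine ⟨Finset.univ.biUnion fun c =>
    Finset.univ.filter fun v => t < |noiseSum p q Zs G {v} (labelClass Z c)|, ?_, ?_⟩
  · have hone : ∀ c, ((Finset.univ.filter fun v =>
        t < |noiseSum p q Zs G {v} (labelClass Z c)|).card : ℝ) ≤ c₂ * n / 2 := by
      intro c
      refine (card_large_noise_le ht0 fun T => hG.rect T (labelClass Z c)).trans_eq ?_
      rw [ht, hnφ1]
      have : 0 < √(n * p) := by positivity
      field_simp
      norm_num
    calc _ ≤ ∑ c : Fin 2, ((Finset.univ.filter fun v =>
          t < |noiseSum p q Zs G {v} (labelClass Z c)|).card : ℝ) := by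
          exact_mod_cast Finset.card_biUnion_le
      _ ≤ ∑ c : Fin 2, c₂ * n / 2 := Finset.sum_le_sum fun c _ => hone c
      _ = _ := by simp; ring
  · intro v hv b hb
    have hnoise : ∀ c, |noiseSum p q Zs G {v} (labelClass Z c)| ≤ t := by
      intro c
      by_contra h
      exact hv (Finset.mem_biUnion.mpr ⟨c, Finset.mem_univ _, by simpa using h⟩)
    have hF := (abs_le.mp (hflip hR hΛ1 Zs Z G hG hsize v (Zs v) b)).1
    obtain ⟨a, ha⟩ : ∃ a, a = Zs v := ⟨_, rfl⟩
    rw [← ha] at hF hb ⊢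
    rw [sum_bernLog_blocks G Z v (fun c => q + (p - q) * share Z Zs c a)] at hF
    have hsum : ∀ f : Fin 2 → ℝ, ∑ c, f c = f a + f b := sum_fin_two_of_ne hb
    have hsab : ∀ c, share Z Zs c a + share Z Zs c b = 1 := fun c => by
      rw [← hsum, sum_share (hpos c)]
    have hDab : D = share Z Zs a a + share Z Zs b b - 1 := by
      rw [hDs, ← Fin.sum_univ_two fun c => share Z Zs c c, hsum]
    -- For two communities all densities are affine in one parameter: with `v = (p - q) * (2 * share
    -- c a - 1)` the densities under the labels `a` and `b` differ by `D * v`, and the links of the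
    -- node exceed the former by `share a b * v`.
    have hterm : ∀ c, c₀ / 8 * (D * (2 * share Z Zs a b + D))
          * ((p - q) * (2 * share Z Zs c a - 1) / φ) ^ 2
          - B * (|(p - q) * (2 * share Z Zs c a - 1)| / φ + 1)
        ≤ (((labelClass Z c).erase v).card : ℝ)
          * (bernLog (q + (p - q) * share Z Zs c a) (blockMean κ₁ κ₂ G Z v a c)
            - bernLog (q + (p - q) * share Z Zs c a) (blockMean κ₁ κ₂ G Z v b c))
        + (∑ j ∈ (labelClass Z c).erase v, (adj G v j - (q + (p - q) * share Z Zs c a)))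
          * (logOdds (blockMean κ₁ κ₂ G Z v a c) - logOdds (blockMean κ₁ κ₂ G Z v b c)) := by
      intro c
      have hq := hR.q_pos
      have hle := hR.le
      have hlq : p / (2 * C₀) ≤ q := by
        rw [div_le_iff₀ (by positivity)]; linarith [hR.ratio, mul_pos hC₀ hq]
      obtain ⟨x0, x1⟩ := meanDensity_mem (Zs := Zs) hR.lt.le (hpos a) (hpos c)
      obtain ⟨y0, y1⟩ := meanDensity_mem (Zs := Zs) hR.lt.le (hpos b) (hpos c)
      obtain ⟨x0', x1'⟩ := hmem hR hΛ2 Zs Z G hG hsize v a c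
      obtain ⟨y0', y1'⟩ := hmem hR hΛ2 Zs Z G hG hsize v b c
      have hca0 := share_nonneg Z Zs c a
      have hca1 := share_le_one (Zs := Zs) (hpos c) a
      have hm0 : 0 ≤ (p - q) * share Z Zs c a := mul_nonneg hg hca0
      have hm1 : (p - q) * share Z Zs c a ≤ p - q := mul_le_of_le_one_right hg hca1
      have hc1 := hsab c
      have ha1 := hsab a
      have hb1 := hsab b
      have hcard := card_labelClass_erase_ge c v (hsize c)
      refine le_block_gain (nn := n) hC₀ hp hφ0 hnφ hE.le hM0.le hc₀.le (by linarith) (by linarith)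
        (hlq.trans x0) (by linarith) x1 (hlq.trans y0) (by linarith) y1 x0' (by linarith) y0'
        (by linarith) ?_ ?_ (share_nonneg _ _ _ _) hD.le ?_
        (hmean hR hΛ3 Zs Z G hG hsize v a c) (hmean hR hΛ3 Zs Z G hG hsize v b c) ?_ ?_ ?_
      · unfold meanDensity
        rw [hsum, hsum, hDab]
        have e1 : share Z Zs a b = 1 - share Z Zs a a := by linarith
        have e2 : share Z Zs c b = 1 - share Z Zs c a := by linarith
        have e3 : share Z Zs b a = 1 - share Z Zs b b := by linarith
        rw [e1, e2, e3]; ring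
      · unfold meanDensity
        rw [hsum]
        have e1 : share Z Zs a b = 1 - share Z Zs a a := by linarith
        have e2 : share Z Zs c b = 1 - share Z Zs c a := by linarith
        rw [e1, e2]; ring
      · linarith [share_nonneg Z Zs b a]
      · linarith
      · have : ((labelClass Z c).erase v).card ≤ n :=
          (Finset.card_le_univ _).trans_eq (by simp)
        exact_mod_cast this
      · have h := abs_sum_adj_sub_le hR.lt.le Zs Z G v (hpos c)
        rw [← ha] at h
        refine h.trans ?_
        have := hnoise c
        rw [hM, add_mul, one_mul]
        linarith
    have hta := hterm a
    have htb := hterm b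
    rw [hsum] at hF
    have hV : ∀ c, |(p - q) * (2 * share Z Zs c a - 1)| / φ = |2 * share Z Zs c a - 1| * R := by
      intro c
      rw [abs_mul, abs_of_nonneg hg, ← hφR]; field_simp
    have hV2 : ∀ c, ((p - q) * (2 * share Z Zs c a - 1) / φ) ^ 2
        = (|2 * share Z Zs c a - 1| * R) ^ 2 := by
      intro c
      rw [← hV, div_pow, div_pow, sq_abs]
    have hab1 := hsab a
    have hbb1 := hsab b
    have e1 : share Z Zs a b = 1 - share Z Zs a a := by linarith
    rw [hV, hV2, e1] at hta htb
    have hfin := le_signal_sub_error (L := L + CF) hc₀ hD hB0 hR0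
      (by linarith : D = share Z Zs a a - share Z Zs b a) (share_nonneg _ _ _ _)
      (share_le_one (hpos a) a) rfl rfl hy1 hΛ6
    linarith

end TwoGain

end

end SBM

namespace SBM

noncomputable section

/-! ### Two communities: drift under weak consistency -/

section TwoDrift

variable {n : ℕ}

lemma card_labelClass_add (Z : Labels n 2) {a b : Fin 2} (h : b ≠ a) :
    ((labelClass Z a).card : ℝ) + (labelClass Z b).card = n := by
  have h1 := sum_labelClass Z (fun _ => (1 : ℝ))
  rw [sum_fin_two_of_ne h] at h1
  simpa using h1

lemma hammingDist_eq_confusion (Z Zs : Labels n 2) :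
    (hammingDist Z Zs : ℝ) = (confusion Z Zs 0 1).card + (confusion Z Zs 1 0).card := by
  classical
  have h := sum_confusion Z Zs (fun j => if Z j ≠ Zs j then (1 : ℝ) else 0)
  rw [Finset.sum_boole, card_misclassified] at h
  rw [← h]
  have hterm : ∀ c d, ∑ j ∈ confusion Z Zs c d, (if Z j ≠ Zs j then (1 : ℝ) else 0)
      = if c ≠ d then ((confusion Z Zs c d).card : ℝ) else 0 := by
    intro c d
    rw [Finset.sum_congr rfl fun j hj => by
      obtain ⟨h1, h2⟩ := (Finset.mem_filter.mp hj).2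
      rw [h1, h2]]
    split_ifs <;> simp
  simp_rw [hterm, Fin.sum_univ_two]
  simp

/-- The correlation of an assignment with the truth. -/
lemma le_share_add_share {α : ℝ} (hα : 1 ≤ α) (hn : 0 < n) {Z Zs : Labels n 2}
    (hZ : IsBalanced α Z) (hk : ∀ c, (hammingDist Z Zs : ℝ) ≤ (labelClass Zs c).card) :
    (1 - 2 * (hammingDist Z Zs / n)) / α ≤ share Z Zs 0 0 + share Z Zs 1 1 - 1 := by
  have hn0 : (0 : ℝ) < n := by exact_mod_cast hn
  have hα0 : 0 < α := by linarith
  have hz0 := hZ.le_card 0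
  have hz1 := hZ.le_card 1
  have hk0 := hk 0
  have hk1 := hk 1
  have hc : ∀ d, ((labelClass Zs d).card : ℝ) = (confusion Z Zs 0 d).card + (confusion Z Zs 1 d).card := by
    intro d
    have := sum_confusion_left Z Zs d (fun _ => (1 : ℝ))
    rw [Fin.sum_univ_two] at this
    simpa using this.symm
  have hr : ∀ a, ((labelClass Z a).card : ℝ) = (confusion Z Zs a 0).card + (confusion Z Zs a 1).card := by
    intro a
    rw [← sum_card_confusion Z Zs a, Fin.sum_univ_two]
  have hnn := card_labelClass_add Z (a := 0) (b := 1) (by decide)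
  rw [hammingDist_eq_confusion] at hk0 hk1 ⊢
  unfold share
  rw [hc] at hk0 hk1
  rw [hr] at hz0 hz1
  rw [hr, hr] at hnn ⊢
  set R00 : ℝ := ((confusion Z Zs 0 0).card : ℝ)
  set R01 : ℝ := ((confusion Z Zs 0 1).card : ℝ)
  set R10 : ℝ := ((confusion Z Zs 1 0).card : ℝ)
  set R11 : ℝ := ((confusion Z Zs 1 1).card : ℝ)
  have p00 : 0 ≤ R00 := by positivity
  have p01 : 0 ≤ R01 := by positivity
  have p10 : 0 ≤ R10 := by positivity
  have p11 : 0 ≤ R11 := by positivity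
  have hpos : 0 < 1 / (α * ((2 : ℕ) : ℝ)) * n := by positivity
  have h0 : 0 < R00 + R01 := lt_of_lt_of_le hpos hz0
  have h1 : 0 < R10 + R11 := lt_of_lt_of_le hpos hz1
  have e : R00 / (R00 + R01) + R11 / (R10 + R11) - 1
      = (R00 * R11 - R01 * R10) / ((R00 + R01) * (R10 + R11)) := by field_simp; ring
  rw [e]
  -- The correlation is the determinant of the confusion matrix over the product of the two
  -- community sizes, and that product is at most `n ^ 2 / 4`. Feasibility enters as `n ≤ 2 * α *
  -- size` for the community matching the smaller true one.
  have hdet : n * (n - 2 * (R01 + R10)) ≤ 4 * α * (R00 * R11 - R01 * R10) := by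
    have hz : ∀ z : ℝ, 1 / (α * ((2 : ℕ) : ℝ)) * n ≤ z → (n : ℝ) ≤ 2 * α * z := by
      intro z hz
      rw [div_mul_eq_mul_div, one_mul, div_le_iff₀ (by positivity)] at hz
      push_cast at hz
      linarith
    have g0 := hz _ hz0
    have g1 := hz _ hz1
    rcases le_total (R01 + R11) (R00 + R10) with h | h
    · have d1 := mul_le_mul_of_nonneg_right g1 (sub_nonneg.mpr h)
      have d2 : 0 ≤ (n : ℝ) * (α - 1) * (R11 - R10) :=
        mul_nonneg (mul_nonneg hn0.le (by linarith)) (by linarith)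
      rw [← hnn] at d1 d2 ⊢
      nlinarith
    · have d1 := mul_le_mul_of_nonneg_right g0 (sub_nonneg.mpr h)
      have d2 : 0 ≤ (n : ℝ) * (α - 1) * (R00 - R01) :=
        mul_nonneg (mul_nonneg hn0.le (by linarith)) (by linarith)
      rw [← hnn] at d1 d2 ⊢
      nlinarith
  have hk2 : 2 * (R01 + R10) ≤ n := by linarith
  have hprod : (R00 + R01) * (R10 + R11) ≤ n ^ 2 / 4 := by
    rw [← hnn]; nlinarith [sq_nonneg ((R00 + R01) - (R10 + R11))]
  rw [div_le_div_iff₀ hα0 (by positivity)]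
  have hd0 : 0 ≤ 1 - 2 * ((R01 + R10) / n) := by
    rw [sub_nonneg, ← mul_div_assoc, div_le_one hn0]; exact hk2
  calc (1 - 2 * ((R01 + R10) / n)) * ((R00 + R01) * (R10 + R11))
      ≤ (1 - 2 * ((R01 + R10) / n)) * (n ^ 2 / 4) := by gcongr
    _ = n * (n - 2 * (R01 + R10)) / 4 := by field_simp
    _ ≤ _ := by linarith

/-- With two communities the lower bound on the sizes implies the upper one, since `1 - 1 / (2 α) ≤
α / 2`. -/
lemma isBalanced_two {α : ℝ} (hα : 1 ≤ α) {W : Labels n 2}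
    (h : ∀ c, (n : ℝ) / (2 * α) ≤ (labelClass W c).card) : IsBalanced α W := by
  intro c
  have hα0 : 0 < α := by linarith
  change (n : ℝ) / (α * ((2 : ℕ) : ℝ)) ≤ ((labelClass W c).card : ℝ)
    ∧ ((labelClass W c).card : ℝ) ≤ α * n / ((2 : ℕ) : ℝ)
  push_cast
  refine ⟨by rw [mul_comm α]; exact h c, ?_⟩
  obtain ⟨b, hb⟩ : ∃ b : Fin 2, b ≠ c := exists_ne c
  have h1 := card_labelClass_add W hb
  have h2 := h b
  have h3 : (n : ℝ) - n / (2 * α) ≤ α * n / 2 := by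
    have hn0 : (0 : ℝ) ≤ n := by positivity
    have : 0 ≤ (n : ℝ) * (α - 1) ^ 2 / (2 * α) := by positivity
    have e : α * n / 2 - ((n : ℝ) - n / (2 * α)) = (n : ℝ) * (α - 1) ^ 2 / (2 * α) := by
      field_simp; ring
    linarith
  linarith

lemma isBalanced_update_two {α : ℝ} (hα : 1 ≤ α) {Z : Labels n 2} (hZ : IsBalanced α Z) (i : Fin n)
    (b : Fin 2) (h : (n : ℝ) / (2 * α) + 1 ≤ (labelClass Z (Z i)).card) :
    IsBalanced α (Function.update Z i b) := by
  classical
  refine isBalanced_two hα fun c => ?_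
  have hsub : (labelClass Z c).erase i ⊆ labelClass (Function.update Z i b) c := by
    intro j hj
    rw [mem_labelClass, Function.update_of_ne (Finset.ne_of_mem_erase hj)]
    exact mem_labelClass.mp (Finset.mem_of_mem_erase hj)
  have hcard : (((labelClass Z c).erase i).card : ℝ) ≤ (labelClass (Function.update Z i b) c).card := by
    exact_mod_cast Finset.card_le_card hsub
  by_cases hc : Z i = c
  · have h1 := Finset.card_erase_add_one (mem_labelClass.mpr hc)
    have h2 : (((labelClass Z c).erase i).card : ℝ) + 1 = (labelClass Z c).card := by exact_mod_cast h1
    rw [hc] at h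
    linarith
  · rw [Finset.erase_eq_of_notMem (by simpa using hc)] at hcard
    have := hZ.le_card c
    push_cast at this
    have e : (n : ℝ) / (2 * α) = 1 / (α * 2) * n := by ring
    linarith

/-- Many misclassified nodes can be corrected without leaving the feasible set. -/
lemma le_card_feasible {α β μ : ℝ} (hβ : 1 ≤ β) (hα : β < α) {Z Zs : Labels n 2}
    (hZ : IsBalanced α Z) (hZs : IsBalanced β Zs) (hμ : μ ≤ (1 / β - 1 / α) / 4)
    (hn : 1 ≤ (1 / β - 1 / α) / 4 * n) (hk : μ * n ≤ (hammingDist Z Zs : ℝ))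
    (F : Finset (Fin n)) (hF : ∀ i, Z i ≠ Zs i → IsBalanced α (Function.update Z i (Zs i)) → i ∈ F) :
    μ * n ≤ F.card := by
  classical
  have hα1 : 1 ≤ α := by linarith
  have hα0 : 0 < α := by linarith
  have hβ0 : 0 < β := by linarith
  -- Only a community at the lower limit blocks corrections. In that case the other one contains
  -- many nodes that truly belong to the small one, and moving these back is feasible.
  by_cases hall : ∀ a, (n : ℝ) / (2 * α) + 1 ≤ (labelClass Z a).card
  · refine hk.trans ?_
    rw [← card_misclassified]
    exact_mod_cast Finset.card_le_card fun i hi =>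
      hF i (Finset.mem_filter.mp hi).2 (isBalanced_update_two hα1 hZ i _ (hall _))
  · push Not at hall
    obtain ⟨a, ha⟩ := hall
    obtain ⟨b, hb⟩ : ∃ b : Fin 2, b ≠ a := exists_ne a
    have hnb := card_labelClass_add Z hb
    have e1 : (1 / β - 1 / α) / 4 * n = (n / (2 * β) - n / (2 * α)) / 2 := by field_simp; ring
    have hβn : (n : ℝ) / (2 * β) ≤ n / 2 := by gcongr; linarith
    have hbb : (n : ℝ) / (2 * α) + 1 ≤ (labelClass Z b).card := by linarith
    have hca : ((confusion Z Zs a a).card : ℝ) + (confusion Z Zs b a).card = (labelClass Zs a).card := by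
      have := sum_confusion_left Z Zs a (fun _ => (1 : ℝ))
      rw [sum_fin_two_of_ne hb] at this
      simpa using this
    have haa : ((confusion Z Zs a a).card : ℝ) ≤ (labelClass Z a).card := by
      have h : confusion Z Zs a a ⊆ labelClass Z a := fun j hj =>
        mem_labelClass.mpr (Finset.mem_filter.mp hj).2.1
      exact_mod_cast Finset.card_le_card h
    have hs := hZs.le_card a
    push_cast at hs
    have e2 : (n : ℝ) / (2 * β) = 1 / (β * 2) * n := by ring
    have hsub : ((confusion Z Zs b a).card : ℝ) ≤ F.card := by
      exact_mod_cast Finset.card_le_card fun i hi => by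
        obtain ⟨hi1, hi2⟩ := (Finset.mem_filter.mp hi).2
        exact hF i (by rw [hi1, hi2]; exact hb) (isBalanced_update_two hα1 hZ i _ (by rw [hi1]; exact hbb))
    have hn0 : (0 : ℝ) ≤ n := by positivity
    have hμn : μ * n ≤ (1 / β - 1 / α) / 4 * n := by gcongr
    linarith

/-- Drift towards the truth for two communities, away from the truth. -/
theorem exists_drift_two (κ₁ κ₂ C₀ C₁ α β ρ : ℝ) (h₁ : 0 < κ₁) (h₂ : 0 < κ₂) (hC₀ : 0 < C₀)
    (hC₁ : 0 < C₁) (hβ : 1 ≤ β) (hα : β < α) (hρ : 0 < ρ) : ∃ c Λ : ℝ, 0 < c ∧ c ≤ 1 ∧ 0 < Λ ∧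
      ∀ {n : ℕ} {p q : ℝ}, Regime C₀ p q → ∀ (Zs : Labels n 2) (G : SimpleGraph (Fin n)),
      NoiseBound C₁ p q Zs G → IsBalanced β Zs → ∀ Z : Labels n 2, IsBalanced α Z →
      ρ * n ≤ (hammingDist Z Zs : ℝ) → (hammingDist Z Zs : ℝ) < n / (2 * β) →
      Λ ≤ (1 - 2 * (hammingDist Z Zs / n)) ^ 4 * snr n p q → ∃ S : Finset (Fin n),
        (∀ i ∈ S, Z i ≠ Zs i ∧ IsBalanced α (Function.update Z i (Zs i)) ∧
          marginal κ₁ κ₂ G Z ≤ marginal κ₁ κ₂ G (Function.update Z i (Zs i))) ∧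
        c * (hammingDist Z Zs : ℝ) ≤ S.card ∧ outwardRate κ₁ κ₂ G Z Zs ≤ (S.card : ℝ) / 2 := by
  classical
  have hα0 : 0 < α := by linarith
  have hβ0 : 0 < β := by linarith
  set c₃ := (1 / β - 1 / α) / 4 with hc₃
  have hc₃0 : 0 < c₃ := by
    have := one_div_lt_one_div_of_lt hβ0 hα
    rw [hc₃]; linarith
  have hc₃1 : c₃ ≤ 1 := by
    have h1 : 1 / β ≤ 1 := by rw [div_le_one hβ0]; exact hβ
    have h2 : 0 < 1 / α := by positivity
    rw [hc₃]; linarith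
  set μ := min ρ c₃ with hμ
  have hμ0 : 0 < μ := lt_min hρ hc₃0
  have hμ1 : μ ≤ 1 := (min_le_right _ _).trans hc₃1
  -- The required gain makes regular erring flips cost at most `μ * n / 8` in total; the exceptional
  -- proportion `μ / 16`, with two labels, costs as much. Together this is below half of the
  -- remaining corrections.
  set L := Real.log (8 / μ) with hL
  have hL0 : 0 ≤ L := Real.log_nonneg (by rw [le_div_iff₀ hμ0]; linarith)
  have hexpL : Real.exp (-L) = μ / 8 := by
    rw [Real.exp_neg, hL, Real.exp_log (by positivity), inv_div]
  obtain ⟨Λ, hΛ0, hgain⟩ := exists_gain_two κ₁ κ₂ C₀ C₁ (1 / (α * (2 : ℕ))) (μ / 16) L h₁ h₂ hC₀ hC₁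
    (by positivity) (by positivity)
  refine ⟨μ / 2, max (Λ * α ^ 4) (1 / c₃), by positivity, by linarith, by positivity, ?_⟩
  intro n p q hR Zs G hG hZs Z hZ hk1 hk2 hΛ
  have hsnr0 := snr_nonneg hR n
  set δ := 1 - 2 * ((hammingDist Z Zs : ℝ) / n) with hδ
  have hkc : ∀ c, (hammingDist Z Zs : ℝ) ≤ (labelClass Zs c).card := fun c => by
    refine hk2.le.trans ((hZs.le_card c).trans' (le_of_eq ?_))
    push_cast; ring
  have hn0 : (0 : ℝ) < n := by
    by_contra h
    have h0 : (n : ℝ) = 0 := le_antisymm (not_lt.mp h) (by positivity)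
    rw [h0, zero_div] at hk2
    exact absurd hk2 (not_lt.mpr (by positivity))
  have hn : 0 < n := by exact_mod_cast hn0
  have hδ0 : 0 ≤ δ := by
    have : (n : ℝ) / (2 * β) ≤ n / 2 := by gcongr; linarith
    rw [hδ, sub_nonneg, ← mul_div_assoc, div_le_one hn0]; linarith
  have hδ1 : δ ≤ 1 := by
    have : 0 ≤ (hammingDist Z Zs : ℝ) / n := by positivity
    linarith
  have hcorr := le_share_add_share (by linarith) hn hZ hkc
  rw [← hδ] at hcorr
  set D := share Z Zs 0 0 + share Z Zs 1 1 - 1 with hD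
  have hΛ1 := (le_max_left _ _).trans hΛ
  have hΛ2 := (le_max_right _ _).trans hΛ
  have hδpos : 0 < δ := by
    rcases hδ0.lt_or_eq with h | h
    · exact h
    · rw [← h] at hΛ1
      have : 0 < Λ * α ^ 4 := by positivity
      norm_num at hΛ1
      linarith
  have hD0 : 0 < D := lt_of_lt_of_le (by positivity) hcorr
  have hDΛ : Λ ≤ D ^ 4 * snr n p q := by
    calc Λ = Λ * α ^ 4 / α ^ 4 := by field_simp
      _ ≤ δ ^ 4 * snr n p q / α ^ 4 := by gcongr
      _ = (δ / α) ^ 4 * snr n p q := by rw [div_pow]; ring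
      _ ≤ _ := by gcongr
  have hnc : 1 ≤ c₃ * n := by
    have h1 : 1 / c₃ ≤ n := hΛ2.trans ((mul_le_of_le_one_left hsnr0 (pow_le_one₀ hδ0 hδ1)).trans
      (hR.snr_le_nat n))
    rwa [div_le_iff₀ hc₃0, mul_comm] at h1
  obtain ⟨Bad, hBad, hg⟩ := hgain hR Zs Z G hG hZ.le_card D hD0 hD hDΛ
  set F := Finset.univ.filter fun i => Z i ≠ Zs i ∧ IsBalanced α (Function.update Z i (Zs i)) with hF
  have hFcard := le_card_feasible hβ hα hZ hZs (min_le_right ρ c₃) hnc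
    ((mul_le_mul_of_nonneg_right (min_le_left ρ c₃) hn0.le).trans hk1) F
    (fun i h1 h2 => Finset.mem_filter.mpr ⟨Finset.mem_univ _, h1, h2⟩)
  change μ * n ≤ F.card at hFcard
  have hScard : (F.card : ℝ) - Bad.card ≤ ((F \ Bad).card : ℝ) := by
    have h := Finset.le_card_sdiff Bad F
    have h2 : F.card ≤ (F \ Bad).card + Bad.card := by omega
    have h3 : (F.card : ℝ) ≤ ((F \ Bad).card : ℝ) + Bad.card := by exact_mod_cast h2
    linarith
  have hkn : (hammingDist Z Zs : ℝ) ≤ n := by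
    have : (n : ℝ) / (2 * β) ≤ n := div_le_self hn0.le (by linarith)
    linarith
  have hμn : 0 < μ * n := by positivity
  refine ⟨F \ Bad, ?_, ?_, ?_⟩
  · intro i hi
    obtain ⟨hi1, hi2⟩ := Finset.mem_sdiff.mp hi
    obtain ⟨hne, hbal⟩ := (Finset.mem_filter.mp hi1).2
    refine ⟨hne, hbal, ?_⟩
    have h := hg i hi2 (Z i) hne
    rw [Function.update_eq_self] at h
    refine (marginal_le_of_log h₁ h₂ h).trans ?_
    exact mul_le_of_le_one_left (marginal_pos h₁ h₂ G _).le (Real.exp_le_one_iff.mpr (by linarith))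
  · have : μ / 2 * (hammingDist Z Zs : ℝ) ≤ μ / 2 * n := by gcongr
    linarith
  · have hout := outwardRate_le (Zs := Zs) (G := G) h₁ h₂ (Z := Z) (Bad := Bad)
      (w := fun _ _ => Real.exp (-L)) (fun _ _ => (Real.exp_pos _).le)
      (fun v hv hZv b hb => by
        have h := hg v hv b hb
        rw [← hZv, Function.update_eq_self] at h
        exact marginal_le_of_log h₁ h₂ h)
    have hs : ∑ v, ∑ b ∈ Finset.univ.erase (Zs v), Real.exp (-L) = n * (μ / 8) := by
      simp [hexpL]
    rw [hs] at hout
    push_cast at hout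
    linarith

end TwoDrift

end

end SBM

namespace SBM

noncomputable section

/-! ### Mixing on a good network -/

/-- Every summand is bounded by the whole sum: a small flip mass also forces each ideal gain to be
large. -/
lemma idealGain_ge_of_flipMass {n K : ℕ} {p q m : ℝ} {Zs : Labels n K} {G : SimpleGraph (Fin n)}
    (h : flipMass p q Zs G ≤ Real.exp (-m)) (v : Fin n) {b : Fin K} (hb : b ≠ Zs v) :
    2 * m ≤ idealGain p q Zs G v b := by
  have h1 : Real.exp (-(idealGain p q Zs G v b / 2)) ≤ flipMass p q Zs G :=
    (Finset.single_le_sum (f := fun b => Real.exp (-(idealGain p q Zs G v b / 2)))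
      (fun _ _ => (Real.exp_pos _).le) (Finset.mem_erase.mpr ⟨hb, Finset.mem_univ b⟩)).trans
    (Finset.single_le_sum
      (f := fun v => ∑ b ∈ Finset.univ.erase (Zs v), Real.exp (-(idealGain p q Zs G v b / 2)))
      (fun _ _ => Finset.sum_nonneg fun _ _ => (Real.exp_pos _).le) (Finset.mem_univ v))
  have := Real.exp_le_exp.mp (h1.trans h)
  linarith

lemma le_effSize (K n : ℕ) {β : ℝ} (hβ : 1 ≤ β) : (n : ℝ) / (K * β) ≤ effSize K β n := by
  unfold effSize
  split_ifs with h
  · subst h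
    push_cast
    gcongr
    linarith
  · exact le_rfl

lemma effSize_le {K : ℕ} (hK : 2 ≤ K) (n : ℕ) {β : ℝ} (hβ : 1 ≤ β) :
    effSize K β n ≤ (n : ℝ) / 2 := by
  have hK' : (2 : ℝ) ≤ K := by exact_mod_cast hK
  unfold effSize
  split_ifs with h
  · exact le_rfl
  · gcongr
    nlinarith

lemma snr_eq (n : ℕ) (p q : ℝ) : snr n p q = n * ((p - q) ^ 2 / p) := by
  unfold snr; ring

lemma Regime.snr_le_effSize_mul {C₀ p q β : ℝ} (h : Regime C₀ p q) {K : ℕ} (hK : 2 ≤ K) (n : ℕ)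
    (hβ : 1 ≤ β) : 1 / (4 * (K * β)) * snr n p q ≤ effSize K β n * renyi p q := by
  have hK' : (2 : ℝ) ≤ K := by exact_mod_cast hK
  have hp := h.p_pos
  calc _ = (n : ℝ) / (K * β) * ((p - q) ^ 2 / p / 4) := by rw [snr_eq]; field_simp
    _ ≤ _ := by
      have h1 := le_effSize K n hβ
      have h2 := h.le_renyi
      have h3 : (0 : ℝ) ≤ n / (K * β) := by positivity
      gcongr
      linarith

lemma Regime.effSize_mul_le {C₀ p q β : ℝ} (h : Regime C₀ p q) {K : ℕ} (hK : 2 ≤ K) (n : ℕ)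
    (hβ : 1 ≤ β) : effSize K β n * renyi p q ≤ 2 * snr n p q := by
  have hp := h.p_pos
  have h0 : 0 ≤ renyi p q := (by positivity : 0 ≤ (p - q) ^ 2 / p / 4).trans h.le_renyi
  calc _ ≤ (n : ℝ) / 2 * (4 * ((p - q) ^ 2 / p)) :=
        mul_le_mul (effSize_le hK n hβ) h.renyi_le h0 (by positivity)
    _ = _ := by rw [snr_eq]; ring

/-- Convergence of the lazy chain on a good network, from an initial clustering within a radius `m`
up to which the chain drifts towards the truth. -/
theorem exists_tvToTarget_le (K : ℕ) (hK : 2 ≤ K) (κ₁ κ₂ C₀ α β e : ℝ) (h₁ : 0 < κ₁) (h₂ : 0 < κ₂)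
    (hC₀ : 0 < C₀) (hβ : 1 ≤ β) (hα : β < α) (he : 0 < e) :
    ∃ ρ c c₁ Λ : ℝ, 0 < ρ ∧ 0 < c ∧ c ≤ 1 ∧ 0 < Λ ∧
      (∀ {n : ℕ} {p q : ℝ}, Regime C₀ p q → 0 < n → Real.log n ≤ 4 * snr n p q →
        ∀ Zs : Labels n K, graphProb p q Zs
          (fun G => ¬ SmallSetBound ρ (1 / (32 * K ^ 3)) c₁ p q Zs G) ≤ 18 / n) ∧
      ∀ {n : ℕ} {p q ξ : ℝ}, Regime C₀ p q → Λ ≤ snr n p q → 1 ≤ ξ →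
      Real.exp (-(e / 2 * (effSize K β n * renyi p q))) ≤ 1 / 16 →
      ∀ {Zs : Labels n K} {G : SimpleGraph (Fin n)}, IsBalanced β Zs →
      GoodNetwork 24 ρ (1 / (32 * K ^ 3)) c₁ (e / 2 * (effSize K β n * renyi p q)) p q Zs G →
      ∀ m : ℕ, (∀ k : ℕ, k < m → ρ * n < k → K = 2 ∧ (k : ℝ) < n / (2 * β) ∧
        Λ ≤ (1 - 2 * ((k : ℝ) / n)) ^ 4 * snr n p q) →
      ∀ (Z₀ : Feasible n K α) (t : ℕ), tvToTarget κ₁ κ₂ ξ G Z₀ t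
        ≤ 2 * Real.exp (-(e / 2 * (effSize K β n * renyi p q))) + Real.exp (-(n : ℝ))
          + ((1 - c / (4 * (n * ((K : ℝ) - 1)))) ^ t * clusterDist (cluster Z₀.1) (cluster Zs)
            + 2 ^ clusterDist (cluster Z₀.1) (cluster Zs) / 2 ^ m) := by
  classical
  have hK' : (2 : ℝ) ≤ K := by exact_mod_cast hK
  have hβ0 : 0 < β := by linarith
  have hα0 : 0 < α := by linarith
  obtain ⟨ρ₁, c₁, Λ₁, hρ₁, hc₁, hΛ₁, hnear⟩ := exists_near_gain K hK κ₁ κ₂ C₀ 24 (1 / (α * K))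
    (e * (1 / (4 * (K * β)))) h₁ h₂ hC₀ (by norm_num) (by positivity) (by positivity)
  obtain ⟨ρ₀, hρ₀, hsmall⟩ := exists_graphProb_smallSet_le (1 / (32 * K ^ 3)) c₁ 4 (by positivity)
    hc₁ (by norm_num)
  have hgap1 : 0 < (1 / β - 1 / α) / K := by
    have := one_div_lt_one_div_of_lt hβ0 hα
    exact div_pos (by linarith) (by linarith)
  have hgap2 : 0 < (α - β) / K := div_pos (by linarith) (by linarith)
  -- The noise tolerance `c₁` is fixed by the gain near the truth; it determines how thin the
  -- rectangles must be (`ρ₀`), and `ρ` is chosen afterwards, small enough also for feasibility of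
  -- all assignments within `ρ * n`.
  obtain ⟨ρ, hρ, hρ1, hρ0, hρa, hρb⟩ : ∃ ρ : ℝ, 0 < ρ ∧ ρ ≤ ρ₁ ∧ ρ ≤ ρ₀ ∧
      ρ ≤ (1 / β - 1 / α) / K ∧ ρ ≤ (α - β) / K :=
    ⟨min (min ρ₁ ρ₀) (min ((1 / β - 1 / α) / K) ((α - β) / K)),
      lt_min (lt_min hρ₁ hρ₀) (lt_min hgap1 hgap2),
      (min_le_left _ _).trans (min_le_left _ _), (min_le_left _ _).trans (min_le_right _ _),
      (min_le_right _ _).trans (min_le_left _ _), (min_le_right _ _).trans (min_le_right _ _)⟩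
  obtain ⟨Λ₂, hΛ₂, hfar⟩ := exists_sum_far_le K hK κ₁ κ₂ C₀ 24 α β ρ h₁ h₂ hC₀ (by norm_num) hα0 hβ0 hρ
  obtain ⟨c₂, Λ₃, hc₂, hc₂1, hΛ₃, htwo⟩ :=
    exists_drift_two κ₁ κ₂ C₀ 24 α β ρ h₁ h₂ hC₀ (by norm_num) hβ hα hρ
  refine ⟨ρ, min (1 / 2) c₂, c₁, max (max Λ₁ Λ₂) (max Λ₃ (2 * (α * K) + 1)), hρ,
    lt_min (by norm_num) hc₂, (min_le_right _ _).trans hc₂1, hΛ₁.trans_le ((le_max_left _ _).trans (le_max_left _ _)),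
    fun hR hn hlog Zs => hsmall hR hn hlog hρ0 Zs, ?_⟩
  intro n p q ξ hR hsnr hξ hexp Zs G hZs hgood m hm Z₀ t
  have hs1 := ((le_max_left _ _).trans (le_max_left _ _)).trans hsnr
  have hs2 := ((le_max_right _ _).trans (le_max_left _ _)).trans hsnr
  have hs4 := ((le_max_right _ _).trans (le_max_right _ _)).trans hsnr
  have hnK : 2 * (α * K) + 1 ≤ (n : ℝ) := hs4.trans (hR.snr_le_nat n)
  have hn1 : (1 : ℝ) ≤ n := by
    have : 0 < α * K := by positivity
    linarith
  have hn : 0 < n := by exact_mod_cast (by linarith : (0 : ℝ) < n)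
  have hX := hR.snr_le_effSize_mul hK n hβ
  have hsnr0 := snr_nonneg hR n
  set X := effSize K β n * renyi p q
  have hideal : ∀ v b, b ≠ Zs v → e * X ≤ idealGain p q Zs G v b := fun v b hb => by
    have := idealGain_ge_of_flipMass hgood.mass v hb
    linarith
  have hX0 : 0 ≤ X := le_trans (by positivity) hX
  have hN : NearGain κ₁ κ₂ ρ p q Zs G := fun Z hd => hnear hR hs1 Zs G ρ hgood.noise hρ1 hgood.small
    (fun v b hb => (by rw [mul_assoc]; exact mul_le_mul_of_nonneg_left hX he.le :
      e * (1 / (4 * (K * β))) * snr n p q ≤ e * X).trans (hideal v b hb)) Z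
    (fun c => (isBalanced_of_near hβ0 hα (by omega) hρa hρb hZs hd).le_card c) hd
  have hmass : flipMass p q Zs G ≤ 1 / 16 := hgood.mass.trans hexp
  have hZsα : IsBalanced α Zs :=
    isBalanced_of_near hβ0 hα (by omega) hρa hρb hZs (by simp; positivity)
  have hexpn : Real.exp (-(n : ℝ)) ≤ 1 / 2 := by
    have h := Real.add_one_le_exp (n : ℝ)
    rw [Real.exp_neg, ← one_div]
    exact one_div_le_one_div_of_le (by norm_num) (by linarith)
  refine tvToTarget_le h₁ h₂ hα0 hn hK hξ ?_ hZsα m ((min_le_right _ _).trans hc₂1) ?_ (by linarith)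
    ?_ Z₀ t
  · rw [lt_div_iff₀ (by positivity)]
    linarith
  · intro Z hZ _ hZ0 hZm
    have hk0 : (0 : ℝ) ≤ hammingDist Z Zs := by positivity
    -- The same radius `ρ * n` separates the two sources of drift here and the near and far parts of
    -- the posterior mass below.
    rcases le_or_gt (hammingDist Z Zs : ℝ) (ρ * n) with hd | hd
    · obtain ⟨S, hS, hS1, hS2⟩ := hN.drift h₁ h₂ hK hmass
        (fun v b hb => (by positivity : 0 ≤ e * X).trans (hideal v b hb)) hβ0 hα hρa hρb hZs hZ0 hd
      exact ⟨S, hS, (mul_le_mul_of_nonneg_right (min_le_left _ _) hk0).trans hS1, hS2⟩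
    · obtain ⟨hK2, hlt, hΛ⟩ := hm _ hZm hd
      subst hK2
      obtain ⟨S, hS, hS1, hS2⟩ := htwo hR Zs G hgood.noise hZs Z hZ hd.le hlt
        (((le_max_left _ _).trans (le_max_right _ _)).trans hΛ)
      exact ⟨S, hS, (mul_le_mul_of_nonneg_right (min_le_right _ _) hk0).trans hS1, hS2⟩
  · set T : Finset (Labels n K) := Finset.univ.filter fun Z => IsBalanced α Z ∧ Z ≠ Zs ∧
      hammingDist Z Zs = clusterDist (cluster Z) (cluster Zs) with hT
    rw [← Finset.sum_filter_add_sum_filter_not T (fun Z => (hammingDist Z Zs : ℝ) ≤ ρ * n)]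
    refine add_le_add ((hN.sum_le h₁ h₂ hK (by linarith) _ fun Z hZ => ?_).trans ?_)
      (hfar hR hs2 Zs G hgood.noise hZs _ fun Z hZ => ?_)
    · rw [hT, Finset.mem_filter, Finset.mem_filter] at hZ
      exact ⟨hZ.1.2.2.1, hZ.2⟩
    · linarith [hgood.mass]
    · rw [hT, Finset.mem_filter, Finset.mem_filter] at hZ
      rw [← hZ.1.2.2.2]
      exact ⟨hZ.1.2.1, (not_le.mp hZ.2).le⟩

/-! ### Time scales -/

/-- The contraction rate per step is of order `1 / n`, so `n ^ (3 / 2)` steps give the exponent `n ^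
(1 / 2)`, which overwhelms the initial distance. -/
lemma one_sub_pow_mul_le {n K d t : ℕ} {c : ℝ} (hn : 0 < n) (hK : 2 ≤ K) (hc : 0 < c) (hc1 : c ≤ 1)
    (hd : d ≤ n) (ht : (n : ℝ) ^ (3 / 2 : ℝ) ≤ t) :
    (1 - c / (4 * (n * ((K : ℝ) - 1)))) ^ t * d
      ≤ n * Real.exp (-(c / (4 * K) * (n : ℝ) ^ (1 / 2 : ℝ))) := by
  have hK' : (2 : ℝ) ≤ K := by exact_mod_cast hK
  have hn0 : (0 : ℝ) < n := by exact_mod_cast hn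
  have hn1 : (1 : ℝ) ≤ n := by exact_mod_cast hn
  have hd' : (d : ℝ) ≤ n := by exact_mod_cast hd
  have hK1 : 0 < (K : ℝ) - 1 := by linarith
  have hx : c / (4 * (n * ((K : ℝ) - 1))) ≤ 1 := by
    rw [div_le_one (by positivity)]
    nlinarith
  have hle : c / (4 * K) / n ≤ c / (4 * (n * ((K : ℝ) - 1))) := by
    rw [div_div]
    apply div_le_div_of_nonneg_left hc.le (by positivity)
    nlinarith
  have hpow : (n : ℝ) ^ (3 / 2 : ℝ) = n * (n : ℝ) ^ (1 / 2 : ℝ) := by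
    rw [← Real.rpow_one_add' hn0.le (by norm_num)]
    norm_num
  have hexp := Real.one_sub_le_exp_neg (c / (4 * (n * ((K : ℝ) - 1))))
  rw [mul_comm]
  refine mul_le_mul hd' ?_ (pow_nonneg (by linarith) _) hn0.le
  calc _ ≤ Real.exp (-(c / (4 * (n * ((K : ℝ) - 1))))) ^ t :=
        pow_le_pow_left₀ (by linarith) hexp _
    _ = Real.exp (-(t * (c / (4 * (n * ((K : ℝ) - 1)))))) := by
        rw [← Real.exp_nat_mul]; ring_nf
    _ ≤ _ := by
        apply Real.exp_le_exp.mpr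
        apply neg_le_neg
        calc _ = (n : ℝ) ^ (3 / 2 : ℝ) * (c / (4 * K) / n) := by rw [hpow]; field_simp
          _ ≤ _ := mul_le_mul ht hle (by positivity) (by positivity)

lemma tendsto_mul_exp_neg_sqrt {a : ℝ} (ha : 0 < a) :
    Tendsto (fun n : ℕ => (n : ℝ) * Real.exp (-(a * (n : ℝ) ^ (1 / 2 : ℝ)))) atTop (𝓝 0) := by
  have h1 : Tendsto (fun n : ℕ => a * (n : ℝ) ^ (1 / 2 : ℝ)) atTop atTop :=
    ((tendsto_rpow_atTop (by norm_num)).comp tendsto_natCast_atTop_atTop).const_mul_atTop ha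
  have h2 := ((Real.tendsto_pow_mul_exp_neg_atTop_nhds_zero 2).comp h1).const_mul (1 / a ^ 2)
  rw [mul_zero] at h2
  refine h2.congr fun n => ?_
  have h3 : ((n : ℝ) ^ (1 / 2 : ℝ)) ^ 2 = n := by
    rw [← Real.rpow_natCast, ← Real.rpow_mul (by positivity)]
    norm_num
  simp only [Function.comp]
  rw [mul_pow, h3]
  field_simp

/-- The claimed time has order at least `n ^ (2 - τ) ≥ n ^ (3 / 2)`; the logarithmic factor is
bounded below through `π ≤ 1 / 2`. -/
lemma ceil_rpow_le {n K : ℕ} {τ γ ξ ε π : ℝ} (hn : 0 < n) (hK : 2 ≤ K) (hτ : τ ≤ 1 / 2)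
    (hξ : 1 ≤ ξ) (hε : 0 < ε) (hε1 : ε < 1) (hπ : 0 < π) (hπ2 : π ≤ 1 / 2) :
    (⌈(n : ℝ) ^ (3 / 2 : ℝ)⌉₊ : ℝ) ≤ 4 * K * (n : ℝ) ^ 2 * max γ ((n : ℝ) ^ (-τ)) *
      (ξ * Real.log π⁻¹ + Real.log ε⁻¹) := by
  have hK' : (2 : ℝ) ≤ K := by exact_mod_cast hK
  have hn0 : (0 : ℝ) < n := by exact_mod_cast hn
  have hn1 : (1 : ℝ) ≤ n := by exact_mod_cast hn
  have h1 : (1 : ℝ) ≤ (n : ℝ) ^ (3 / 2 : ℝ) := Real.one_le_rpow hn1 (by norm_num)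
  have h2 : (⌈(n : ℝ) ^ (3 / 2 : ℝ)⌉₊ : ℝ) ≤ 2 * (n : ℝ) ^ (3 / 2 : ℝ) := by
    linarith [Nat.ceil_lt_add_one (by positivity : 0 ≤ (n : ℝ) ^ (3 / 2 : ℝ))]
  have h3 : 1 / 2 ≤ Real.log π⁻¹ := by
    have : Real.log 2 ≤ Real.log π⁻¹ := by
      apply Real.log_le_log (by norm_num)
      rw [le_inv_comm₀ (by norm_num) hπ]
      linarith
    linarith [Real.log_two_gt_d9]
  have h4 : 0 ≤ Real.log ε⁻¹ := Real.log_nonneg ((one_le_inv₀ hε).mpr hε1.le)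
  have h5 : 1 / 2 ≤ ξ * Real.log π⁻¹ + Real.log ε⁻¹ := by nlinarith
  have h6 : (n : ℝ) ^ (3 / 2 : ℝ) ≤ (n : ℝ) ^ 2 * max γ ((n : ℝ) ^ (-τ)) := by
    calc _ ≤ (n : ℝ) ^ (2 + -τ) := Real.rpow_le_rpow_of_exponent_le hn1 (by linarith)
      _ = (n : ℝ) ^ 2 * (n : ℝ) ^ (-τ) := by rw [Real.rpow_add hn0]; norm_num
      _ ≤ _ := by gcongr; exact le_max_right _ _
  calc _ ≤ 2 * (n : ℝ) ^ (3 / 2 : ℝ) := h2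
    _ ≤ 4 * K * ((n : ℝ) ^ 2 * max γ ((n : ℝ) ^ (-τ))) * (1 / 2) := by
        have : 0 ≤ (n : ℝ) ^ (3 / 2 : ℝ) := by linarith
        nlinarith [mul_le_mul hK' h6 this (by linarith)]
    _ ≤ 4 * K * ((n : ℝ) ^ 2 * max γ ((n : ℝ) ^ (-τ))) * (ξ * Real.log π⁻¹ + Real.log ε⁻¹) := by
        gcongr
    _ = _ := by ring

lemma mixingTime_le {n K : ℕ} {α κ₁ κ₂ ξ ε x : ℝ} {G : SimpleGraph (Fin n)} {Z₀ : Feasible n K α}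
    {t₁ : ℕ} (h : ∀ t ≥ t₁, tvToTarget κ₁ κ₂ ξ G Z₀ t ≤ ε) (hx : (t₁ : ℝ) ≤ x) :
    (mixingTime κ₁ κ₂ ξ G Z₀ ε : ENNReal) ≤ ENNReal.ofReal x := by
  have h1 : mixingTime κ₁ κ₂ ξ G Z₀ ε ≤ (t₁ : ℕ∞) := sInf_le ⟨t₁, h, rfl⟩
  calc (mixingTime κ₁ κ₂ ξ G Z₀ ε : ENNReal) ≤ ((t₁ : ℕ∞) : ENNReal) := ENat.toENNReal_mono h1
    _ = ENNReal.ofReal t₁ := by simp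
    _ ≤ _ := ENNReal.ofReal_le_ofReal hx

/-! ### Eventual consequences of the conditions -/

lemma eventually_regime {p q : ℕ → ℝ} (hpq : ∀ n, 0 ≤ q n ∧ q n < p n ∧ p n ≤ 1)
    (hp : Tendsto p atTop (𝓝 0)) (h : Asymptotics.IsTheta atTop p q) :
    ∃ C₀ : ℝ, 0 < C₀ ∧ ∀ᶠ n in atTop, Regime C₀ (p n) (q n) := by
  obtain ⟨C₀, hC₀, hb⟩ := h.1.exists_pos
  refine ⟨C₀, hC₀, ?_⟩
  filter_upwards [hb.bound, hp.eventually_le_const (show (0 : ℝ) < 1 / 4 by norm_num)] with n hn hn4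
  obtain ⟨h1, h2, -⟩ := hpq n
  rw [Real.norm_of_nonneg (h1.trans h2.le), Real.norm_of_nonneg h1] at hn
  refine ⟨lt_of_le_of_ne h1 fun h0 => ?_, h2, hn4, hn⟩
  rw [← h0] at hn h2
  linarith

/-- The limsup is strictly below `1 - e` for an `e` smaller than `ε₀`; the cap `1 / 2` keeps `e`
below one. -/
lemma SignalCondition.eventually_log_le {K : ℕ} (hK : 2 ≤ K) {β ε₀ C₀ : ℝ} (hβ : 1 ≤ β)
    {p q : ℕ → ℝ} (hε₀ : 0 < ε₀) (hR : ∀ᶠ n in atTop, Regime C₀ (p n) (q n))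
    (h : SignalCondition K β p q ε₀) : ∃ e : ℝ, 0 < e ∧ e < 1 ∧ ∀ᶠ n : ℕ in atTop,
      Real.log n ≤ (1 - e) * (effSize K β n * renyi (p n) (q n)) := by
  refine ⟨min (ε₀ / 2) (1 / 2), by positivity, (min_le_right _ _).trans_lt (by norm_num), ?_⟩
  have hlt : limsup (fun n : ℕ =>
      ((Real.log n / (effSize K β n * renyi (p n) (q n)) : ℝ) : EReal)) atTop
      < ((1 - min (ε₀ / 2) (1 / 2) : ℝ) : EReal) := by
    rw [h]
    exact EReal.coe_lt_coe_iff.mpr (by linarith [min_le_left (ε₀ / 2) (1 / 2)])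
  filter_upwards [eventually_lt_of_limsup_lt hlt, hR, eventually_gt_atTop 0] with n hn hR hn0
  have hn0' : (0 : ℝ) < n := by exact_mod_cast hn0
  have hK0 : (0 : ℝ) < K := by exact_mod_cast (by omega : 0 < K)
  have hp := hR.p_pos
  have hpq : 0 < p n - q n := sub_pos.mpr hR.lt
  have hX : 0 < effSize K β n * renyi (p n) (q n) := by
    refine lt_of_lt_of_le ?_ (hR.snr_le_effSize_mul hK n hβ)
    rw [snr_eq]
    positivity
  exact ((div_lt_iff₀ hX).mp (EReal.coe_lt_coe_iff.mp hn)).le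

/-- The initial clustering lies well within the radius of drift. -/
lemma eventually_exists_radius {K : ℕ} {α β ε₀ C₀ : ℝ} (hβ : 1 ≤ β) {p q γ₀ ξ : ℕ → ℝ}
    (hγ₀ : ∀ n, 0 < γ₀ n) (hR : ∀ᶠ n in atTop, Regime C₀ (p n) (q n))
    (hcond : (InitCondition K β p q γ₀ ∧ TemperatureCondition K α ε₀ γ₀ ξ) ∨
      ConsistentInitCondition ε₀ γ₀ ξ) {ρ Λ : ℝ} (hρ : 0 < ρ) (D : ℕ) :
    ∀ᶠ n : ℕ in atTop, ∃ m : ℕ, (∀ k : ℕ, k < m → ρ * n < k → K = 2 ∧ (k : ℝ) < n / (2 * β) ∧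
      Λ ≤ (1 - 2 * ((k : ℝ) / n)) ^ 4 * snr n (p n) (q n)) ∧ γ₀ n * n + D ≤ m := by
  have hβ0 : 0 < β := by linarith
  have hzero : Tendsto γ₀ atTop (𝓝 0) → ∀ᶠ n : ℕ in atTop, ∃ m : ℕ, (∀ k : ℕ, k < m → ρ * n < k →
      K = 2 ∧ (k : ℝ) < n / (2 * β) ∧ Λ ≤ (1 - 2 * ((k : ℝ) / n)) ^ 4 * snr n (p n) (q n)) ∧
      γ₀ n * n + D ≤ m := by
    intro hγ
    have h1 : Tendsto (fun n : ℕ => ρ / 2 * (n : ℝ)) atTop atTop :=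
      tendsto_natCast_atTop_atTop.const_mul_atTop (by positivity)
    filter_upwards [hγ.eventually_le_const (show (0 : ℝ) < ρ / 2 by positivity),
      h1.eventually_ge_atTop (D + 1)] with n hn hn'
    -- Up to this radius only the drift near the truth is needed: no `k` satisfies `ρ * n < k < m`.
    refine ⟨⌊ρ * n⌋₊, fun k hk hk' => ?_, ?_⟩
    · have h2 : (k : ℝ) ≤ ⌊ρ * n⌋₊ := by exact_mod_cast hk.le
      have h3 := Nat.floor_le (by positivity : 0 ≤ ρ * n)
      linarith
    · have h2 := Nat.lt_floor_add_one (ρ * n)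
      have h3 : γ₀ n * n ≤ ρ / 2 * n := by gcongr
      linarith
  rcases hcond with ⟨h | h, -⟩ | h
  · obtain ⟨hK, hlt, hI, hgap⟩ := h
    subst hK
    filter_upwards [hlt, hI.eventually_ge_atTop (64 * Λ), hgap.eventually_ge_atTop (4 * β * D), hR,
      eventually_gt_atTop 0] with n hlt hI hgap hR hn
    push_cast at hlt hI hgap
    have hn0 : (0 : ℝ) < n := by exact_mod_cast hn
    have hγ := hγ₀ n
    set γ := γ₀ n
    have hβ1 : 1 / β ≤ 1 := by rw [div_le_one hβ0]; exact hβ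
    have hγβ : γ < 1 / (2 * β) := by rw [lt_div_iff₀ (by positivity)]; linarith
    have e1 : 1 / (2 * β) = 1 / β / 2 := by field_simp
    have hγ2 : 2 * γ < 1 := by linarith
    -- Midway between the initial error and the smallest true community. Since `1 / (2 * β) ≤ 1 /
    -- 2`, this keeps half of `1 - 2 * γ` as correlation, while the distance to the start, `(1 - 2 *
    -- β * γ) * n / (4 * β)`, tends to infinity.
    refine ⟨⌈(γ + 1 / (2 * β)) / 2 * n⌉₊, fun k hk _ => ⟨rfl, ?_, ?_⟩, ?_⟩
    · calc (k : ℝ) < (γ + 1 / (2 * β)) / 2 * n := Nat.lt_ceil.mp hk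
        _ ≤ 1 / (2 * β) * n := mul_le_mul_of_nonneg_right (by linarith) hn0.le
        _ = _ := by ring
    · have hk1 : (k : ℝ) / n < (γ + 1 / (2 * β)) / 2 := by
        rw [div_lt_iff₀ hn0]; exact Nat.lt_ceil.mp hk
      have hb : (1 - 2 * γ) / 2 ≤ 1 - 2 * ((k : ℝ) / n) := by linarith
      have hpow := pow_le_pow_left₀ (by linarith) hb 4
      have hs : n * renyi (p n) (q n) / 4 ≤ snr n (p n) (q n) := by
        rw [snr_eq]
        have := mul_le_mul_of_nonneg_left hR.renyi_le hn0.le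
        linarith
      have hs0 := snr_nonneg hR n
      have hp := hR.p_pos
      have hI0 : 0 ≤ renyi (p n) (q n) :=
        (by positivity : 0 ≤ (p n - q n) ^ 2 / p n / 4).trans hR.le_renyi
      calc Λ ≤ (1 - 2 * γ) ^ 4 * (n * renyi (p n) (q n)) / 64 := by linarith
        _ = ((1 - 2 * γ) / 2) ^ 4 * (n * renyi (p n) (q n) / 4) := by ring
        _ ≤ _ := mul_le_mul hpow hs (by positivity) (by positivity)
    · refine le_trans ?_ (Nat.le_ceil _)
      have h1 : (1 - 2 * γ) * ((1 - 2 * β * γ) * n) ≤ (1 - 2 * β * γ) * n :=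
        mul_le_of_le_one_left (mul_nonneg (by linarith) hn0.le) (by linarith)
      have h2 : 4 * β * D ≤ (1 - 2 * β * γ) * n := by linarith
      have h3 : (D : ℝ) ≤ (1 - 2 * β * γ) * n / (4 * β) := by
        rw [le_div_iff₀ (by positivity)]; linarith
      have h4 : (1 - 2 * β * γ) * n / (4 * β) = (γ + 1 / (2 * β)) / 2 * n - γ * n := by
        field_simp; ring
      linarith
  · exact hzero h.2
  · exact hzero h.1

end

end SBM
/-- With high probability the mixing time is bounded, for all large networks. -/
theorem SBM.eventually_mixingTime_le (K : ℕ) (hK : 2 ≤ K) (α β κ₁ κ₂ ε₀ : ℝ) (hβ : 1 ≤ β) (hα : β < α)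
    (hκ₁ : 0 < κ₁) (hκ₂ : 0 < κ₂) (hε₀ : 0 < ε₀) (p q γ₀ ξ : ℕ → ℝ)
    (hpq : ∀ n, 0 ≤ q n ∧ q n < p n ∧ p n ≤ 1) (hp : Tendsto p atTop (𝓝 0))
    (hpq_order : Asymptotics.IsTheta atTop p q) (hγ₀ : ∀ n, 0 < γ₀ n) (hξ : ∀ n, 1 ≤ ξ n)
    (hsignal : SBM.SignalCondition K β p q ε₀)
    (hcond : (SBM.InitCondition K β p q γ₀ ∧ SBM.TemperatureCondition K α ε₀ γ₀ ξ) ∨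
      SBM.ConsistentInitCondition ε₀ γ₀ ξ) :
    ∃ e : ℝ, 0 < e ∧ ∀ τ ε : ℝ, τ < 1 / 2 → 0 < ε → ε < 1 → ∀ᶠ n : ℕ in atTop,
      ∀ Zstar : SBM.Labels n K, SBM.IsBalanced β Zstar →
      ∃ E : SimpleGraph (Fin n) → Prop,
        SBM.graphProb (p n) (q n) Zstar (fun G => ¬ E G) ≤ (20 + 4 * K) * (n : ℝ) ^ (-(e / 2)) ∧
        ∀ G, E G → ∀ Z₀ : SBM.Feasible n K α, SBM.loss Z₀.1 Zstar ≤ γ₀ n →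
          (SBM.mixingTime κ₁ κ₂ (ξ n) G Z₀ ε : ENNReal) ≤
            ENNReal.ofReal (4 * K * (n : ℝ) ^ 2 * max (γ₀ n) ((n : ℝ) ^ (-τ)) *
              (ξ n * Real.log (SBM.posterior α κ₁ κ₂ G Z₀.1)⁻¹ + Real.log ε⁻¹)) := by
  have hα0 : 0 < α := by linarith
  obtain ⟨C₀, hC₀, hR⟩ := SBM.eventually_regime hpq hp hpq_order
  obtain ⟨e, he, he1, hlog⟩ := hsignal.eventually_log_le hK hβ hε₀ hR
  refine ⟨e, he, fun τ ε hτ hε hε1 => ?_⟩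
  obtain ⟨ρ, c, c₁, Λ, hρ, hc, hc1, hΛ, hsmall, htv⟩ :=
    SBM.exists_tvToTarget_le K hK κ₁ κ₂ C₀ α β e hκ₁ hκ₂ hC₀ hβ hα he
  -- A start `D` steps inside the radius makes the escape term at most `ε / 4`.
  obtain ⟨D, hD⟩ : ∃ D : ℕ, (1 / 2 : ℝ) ^ D < ε / 4 :=
    exists_pow_lt_of_lt_one (by positivity) (by norm_num)
  have hlogn : Tendsto (fun n : ℕ => Real.log n) atTop atTop :=
    Real.tendsto_log_atTop.comp tendsto_natCast_atTop_atTop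
  have hexp : Tendsto (fun n : ℕ => Real.exp (-(e / 2 * Real.log n))) atTop (𝓝 0) :=
    Real.tendsto_exp_neg_atTop_nhds_zero.comp (hlogn.const_mul_atTop (by positivity))
  have hexpn : Tendsto (fun n : ℕ => Real.exp (-(n : ℝ))) atTop (𝓝 0) :=
    Real.tendsto_exp_neg_atTop_nhds_zero.comp tendsto_natCast_atTop_atTop
  have hK' : (2 : ℝ) ≤ K := by exact_mod_cast hK
  have hpow := SBM.tendsto_mul_exp_neg_sqrt (show 0 < c / (4 * K) by positivity)
  filter_upwards [hR, hlog, hlogn.eventually_ge_atTop (2 * max 1 Λ),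
    hexp.eventually_le_const (show (0 : ℝ) < min (1 / 16) (ε / 8) by positivity),
    hexpn.eventually_le_const (show (0 : ℝ) < ε / 4 by positivity),
    hpow.eventually_le_const (show (0 : ℝ) < ε / 4 by positivity),
    SBM.eventually_exists_radius hβ hγ₀ hR hcond hρ D (Λ := Λ), eventually_gt_atTop 0]
    with n hR hlog hlarge hexp hexpn hpow hrad hn Zs hZs
  obtain ⟨m, hm, hmγ⟩ := hrad
  have hn0 : (0 : ℝ) < n := by exact_mod_cast hn
  have hXle := hR.effSize_mul_le hK n hβ
  have hsnr0 := SBM.snr_nonneg hR n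
  have hlog0 : 0 ≤ Real.log n := Real.log_nonneg (by exact_mod_cast hn)
  have hX0 : 0 ≤ SBM.effSize K β n * SBM.renyi (p n) (q n) := by
    refine le_trans ?_ (hR.snr_le_effSize_mul hK n hβ)
    positivity
  have hlogX : Real.log n ≤ SBM.effSize K β n * SBM.renyi (p n) (q n) :=
    hlog.trans (mul_le_of_le_one_left hX0 (by linarith))
  set X := SBM.effSize K β n * SBM.renyi (p n) (q n) with hX
  have hsnr : max 1 Λ ≤ SBM.snr n (p n) (q n) := by linarith
  have hlog4 : Real.log n ≤ 4 * SBM.snr n (p n) (q n) := by linarith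
  have hmass : Real.exp (-(e / 2 * X)) ≤ min (1 / 16) (ε / 8) := by
    refine le_trans (Real.exp_le_exp.mpr ?_) hexp
    have := mul_le_mul_of_nonneg_left hlogX (by positivity : 0 ≤ e / 2)
    linarith
  refine ⟨SBM.GoodNetwork 24 ρ (1 / (32 * K ^ 3)) c₁ (e / 2 * X) (p n) (q n) Zs,
    SBM.graphProb_not_good_le hR hn hZs he he1 hlog hlog4 ((le_max_left _ _).trans hsnr) le_rfl
      (hsmall hR hn hlog4 Zs), fun G hG Z₀ hZ₀ => ?_⟩
  refine SBM.mixingTime_le (t₁ := ⌈(n : ℝ) ^ (3 / 2 : ℝ)⌉₊) (fun t ht => ?_)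
    (SBM.ceil_rpow_le hn hK hτ.le (hξ n) hε hε1 (SBM.posterior_pos hκ₁ hκ₂ Z₀.2)
      (SBM.posterior_le_half hκ₁ hκ₂ hα0 hn hK Z₀.2))
  have h1 := htv hR ((le_max_right _ _).trans hsnr) (hξ n) (hmass.trans (min_le_left _ _)) hZs hG m hm
    Z₀ t
  set d := SBM.clusterDist (SBM.cluster Z₀.1) (SBM.cluster Zs) with hd
  have hdn : d ≤ n := by
    refine (SBM.clusterDist_le (SBM.self_mem_cluster Z₀.1) (SBM.self_mem_cluster Zs)).trans ?_
    exact (hammingDist_le_card_fintype).trans_eq (Fintype.card_fin n)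
  have h2 := SBM.one_sub_pow_mul_le hn hK hc hc1 hdn (Nat.ceil_le.mp ht)
  have hdγ : (d : ℝ) ≤ γ₀ n * n := by
    unfold SBM.loss at hZ₀
    rwa [div_le_iff₀ hn0] at hZ₀
  have hdm : d + D ≤ m := by exact_mod_cast (by linarith : (d : ℝ) + D ≤ m)
  have h3 : (2 : ℝ) ^ d / 2 ^ m ≤ (1 / 2) ^ D := by
    rw [div_le_iff₀ (by positivity), one_div, inv_pow, ← div_eq_inv_mul, le_div_iff₀ (by positivity),
      ← pow_add]
    exact pow_le_pow_right₀ (by norm_num) hdm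
  -- The mass near the truth contributes `2 * (ε / 8)`; the far mass, the contraction term and the
  -- escape term contribute `ε / 4` each.
  have h4 := hmass.trans (min_le_right _ _)
  linarith

theorem theorem2 (K : ℕ) (hK : 2 ≤ K) (α β κ₁ κ₂ ε₀ : ℝ) (hβ : 1 ≤ β) (hα : β < α)
    (hκ₁ : 0 < κ₁) (hκ₂ : 0 < κ₂) (hε₀ : 0 < ε₀) (p q γ₀ ξ : ℕ → ℝ)
    (hpq : ∀ n, 0 ≤ q n ∧ q n < p n ∧ p n ≤ 1)
    (hp : Tendsto p atTop (𝓝 0)) (hq : Tendsto q atTop (𝓝 0))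
    (hpq_order : Asymptotics.IsTheta atTop p q)
    (hγ₀ : ∀ n, 0 < γ₀ n) (hξ : ∀ n, 1 ≤ ξ n)
    (hsignal : SBM.SignalCondition K β p q ε₀)
    (hcond : (SBM.InitCondition K β p q γ₀ ∧ SBM.TemperatureCondition K α ε₀ γ₀ ξ) ∨
      SBM.ConsistentInitCondition ε₀ γ₀ ξ) :
    ∃ τ₀ : ℝ, 0 < τ₀ ∧ ∀ τ : ℝ, 0 < τ → τ < τ₀ →
      ∃ C₂ : ℝ, 0 < C₂ ∧ ∀ ε : ℝ, 0 < ε → ε < 1 →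
        ∃ C₁ : ℝ, 0 < C₁ ∧
          ∀ (n : ℕ), 1 ≤ n →
          ∀ (Zstar : SBM.Labels n K), SBM.IsBalanced β Zstar →
          ∀ (Ω : Type*) [MeasurableSpace Ω] (μ : Measure Ω) [IsProbabilityMeasure μ]
            (A : Ω → SimpleGraph (Fin n)) (Z₀ : Ω → SBM.Feasible n K α) (η : ℝ),
            SBM.IsSample μ (p n) (q n) Zstar A →
            (∀ Z, MeasurableSet (Z₀ ⁻¹' {Z})) →
            1 - η ≤ μ.real {ω | SBM.loss (Z₀ ω).1 Zstar ≤ γ₀ n} →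
            1 - C₁ * (n : ℝ) ^ (-C₂) - η ≤
              μ.real {ω | (SBM.mixingTime κ₁ κ₂ (ξ n) (A ω) (Z₀ ω) ε : ENNReal) ≤
                ENNReal.ofReal (4 * K * (n : ℝ) ^ 2 * max (γ₀ n) ((n : ℝ) ^ (-τ)) *
                  (ξ n * Real.log (SBM.posterior α κ₁ κ₂ (A ω) (Z₀ ω).1)⁻¹ +
                    Real.log ε⁻¹))} := by
  obtain ⟨e, he, hev⟩ := SBM.eventually_mixingTime_le K hK α β κ₁ κ₂ ε₀ hβ hα hκ₁ hκ₂ hε₀ p q γ₀ ξ hpq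
    hp hpq_order hγ₀ hξ hsignal hcond
  refine ⟨1 / 2, by norm_num, fun τ _ hτ => ⟨e / 2, by positivity, fun ε hε hε1 => ?_⟩⟩
  obtain ⟨N, hN⟩ := eventually_atTop.mp (hev τ ε hτ hε hε1)
  have hNe : (0 : ℝ) ≤ (N : ℝ) ^ (e / 2) := by positivity
  -- The last summand makes the claimed lower bound nonpositive for the finitely many `n < N`.
  refine ⟨20 + 4 * K + (N : ℝ) ^ (e / 2), by positivity, ?_⟩
  intro n hn Zs hZs Ω _ μ _ A Z₀ η hA _ hη
  have hn0 : (0 : ℝ) < n := by exact_mod_cast hn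
  have hpow : 0 < (n : ℝ) ^ (-(e / 2)) := by positivity
  rcases le_or_gt N n with hNn | hNn
  · obtain ⟨E, hE, hmix⟩ := hN n hNn Zs hZs
    obtain ⟨hq0, hqp, hp1⟩ := hpq n
    have hprob := (hA.measureReal_le hq0 hqp.le hp1 (fun G => ¬ E G)).2
    set T := {ω | (SBM.mixingTime κ₁ κ₂ (ξ n) (A ω) (Z₀ ω) ε : ENNReal) ≤
      ENNReal.ofReal (4 * K * (n : ℝ) ^ 2 * max (γ₀ n) ((n : ℝ) ^ (-τ)) *
        (ξ n * Real.log (SBM.posterior α κ₁ κ₂ (A ω) (Z₀ ω).1)⁻¹ + Real.log ε⁻¹))}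
    -- On `E` the bound holds for every start within the radius, so no independence of `Z₀` and `A`
    -- is needed. Monotonicity and subadditivity of the outer measure spare the measurability of
    -- `T`.
    have hsub : {ω | SBM.loss (Z₀ ω).1 Zs ≤ γ₀ n} ⊆ T ∪ {ω | ¬ E (A ω)} := fun ω hω => by
      by_cases h : E (A ω)
      · exact Or.inl (hmix _ h (Z₀ ω) hω)
      · exact Or.inr h
    have h1 := (measureReal_mono hsub).trans (measureReal_union_le (μ := μ) _ _)
    rw [hprob] at h1
    nlinarith [mul_nonneg hNe hpow.le]
  · have h1 : (1 : ℝ) ≤ (N : ℝ) ^ (e / 2) * (n : ℝ) ^ (-(e / 2)) := by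
      rw [Real.rpow_neg hn0.le, ← div_eq_mul_inv, one_le_div (by positivity)]
      exact Real.rpow_le_rpow hn0.le (by exact_mod_cast hNn.le) (by positivity)
    have h2 : (0 : ℝ) ≤ (20 + 4 * K) * (n : ℝ) ^ (-(e / 2)) := by positivity
    -- Nonnegativity of `η` is not assumed but follows from `1 - η` being at most a probability.
    have h3 : 0 ≤ η := by linarith [measureReal_le_one (μ := μ) (s := {ω | SBM.loss (Z₀ ω).1 Zs ≤ γ₀ n})]
    refine le_trans ?_ measureReal_nonneg
    linarith
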